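/- Let $c,r,D,\eta_\infty>0$ and, for $0\le\eta<\eta_\infty$, let $e(\eta)=\frac{\eta_\infty}{\eta_\infty-\eta}$. Points of $\mathbb S^2$ are written $(\cos\theta,\sin\theta\cos\varphi,\sin\theta\sin\varphi)$ with $0\le\theta\le\pi$. Consider the diffusion equation on the expanding sphere $$\Big(\frac{e}{D}+\frac{e'}{c^2e}\Big)\frac{\partial u}{\partial\eta}+\frac1{c^2}\frac{\partial^2u}{\partial\eta^2}-\frac1{r^2}\Delta u=0,\qquad u|_{\eta=0}=T,\qquad \frac{\partial u}{\partial\eta}\Big|_{\eta=0}=0,\qquad(1)$$ where $\Delta=\frac{\partial^2}{\partial\theta^2}+\cot\theta\frac{\partial}{\partial\theta}+\frac1{\sin^2\theta}\frac{\partial^2}{\partial\varphi^2}$ and $T$ is a real-valued, centered, isotropic (finite-dimensional distributions invariant under rotations) Gaussian random field on $\mathbb S^2$, defined on a probability space $(\Omega,\mathfrak F,P)$, with almost surely twice continuously differentiable realizations. A solution of (1) is a random field $u$ on $[0,\eta_\infty)\times\mathbb S^2$ such that almost every realization is continuous, equals the realization of $T$ at $\eta=0$, and satisfies the equation and the condition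 on the derivative weakly on the sphere: for each $\psi\in C^\infty(\mathbb S^2)$, the function $g(\eta)=\int_{\mathbb S^2}u(\eta,\cdot)\psi$ is $C^2$ on $[0,\eta_\infty)$, $g'(0)=0$, and $\big(\frac{e}{D}+\frac{e'}{c^2e}\big)g'+\frac1{c^2}g''-\frac1{r^2}\int_{\mathbb S^2}u(\eta,\cdot)\Delta\psi=0$. A classical solution is a random field almost every realization of which is $C^2$ on $[0,\eta_\infty)\times\mathbb S^2$ and satisfies (1) pointwise. Let $P_l$ be the Legendre polynomials and $$Y_{lm}(\theta,\varphi)=(-1)^m\sqrt{\tfrac{2l+1}{4\pi}\tfrac{(l-m)!}{(l+m)!}}\,e^{im\varphi}P_l^m(\cos\theta),\qquad P_l^m(x)=(-1)^m(1-x^2)^{m/2}\frac{d^m}{dx^m}P_l(x)\quad(m\ge0),$$ with $P_l^{-m}=(-1)^m\frac{(l-m)!}{(l+m)!}P_l^m$. Put $a_{lm}=\int_{\mathbb S^2}T\,Y_{lm}^*$ and $C_l=E|a_{lm}|^2$ (which does not depend on $m$). With $z_l=\frac{c\sqrt{l(l+1)}}{r}$, $\nu=\frac{c^2\eta_\infty}{2D}+1$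 and the Bessel functions $J_\mu,Y_\mu$ of the first and second kind, let $F_0=1$ and, for $l\ge1$, $$F_l(\eta)=\frac{\pi z_l(\eta_\infty-\eta)^\nu}{2\eta_\infty^{\nu-1}}\Big(Y_{\nu-1}(z_l\eta_\infty)J_\nu(z_l(\eta_\infty-\eta))-J_{\nu-1}(z_l\eta_\infty)Y_\nu(z_l(\eta_\infty-\eta))\Big).$$ Then (1) has a solution, and every solution $u$ is given by $$u(\eta,\theta,\varphi)=\sum_{l=0}^\infty F_l(\eta)\sum_{m=-l}^l a_{lm}Y_{lm}(\theta,\varphi),$$ where the series converges in $L^2(\Omega\times\mathbb S^2)$ for each $\eta\in[0,\eta_\infty)$ and also, almost surely, at all $\eta\in[0,\eta_\infty)$, $\theta\in[0,\pi]$, $\varphi\in\mathbb R$. The random variables $u(\eta,\theta,\varphi)$ are square integrable, and $$\mathrm{Cov}\big(u(\eta,\theta,\varphi),u(\eta',\theta',\varphi')\big)=(4\pi)^{-1}\sum_{l=0}^\infty C_l(2l+1)F_l(\eta)F_l(\eta')P_l(\cos\Theta)$$ for all $\eta,\eta'\in[0,\eta_\infty)$ and all points $(\theta,\varphi),(\theta',\varphi')$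 of $\mathbb S^2$, where $\Theta$ is the angular distance between them and the series converges. Moreover, every classical solution is a solution, and if $\sum_l C_l\,l^{10}(2l+1)<\infty$, then every solution is classical. -/

import Mathlib

open MeasureTheory ProbabilityTheory Set Filter Topology
open scoped Manifold ComplexConjugate

noncomputable section

namespace ExpandingSphere

/-! ### The sphere and its angular coordinates -/

/-- Euclidean three-space. -/
abbrev E3 : Type := EuclideanSpace ℝ (Fin 3)

/-- The unit sphere in Euclidean three-space. -/
abbrev S2 : Type := Metric.sphere (0 : E3) 1

/-- The point of the sphere with colatitude `θ` and longitude `φ`. -/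
def sph (θ φ : ℝ) : S2 :=
  ⟨!₂[Real.cos θ, Real.sin θ * Real.cos φ, Real.sin θ * Real.sin φ], by
    rw [mem_sphere_zero_iff_norm, EuclideanSpace.norm_eq, Real.sqrt_eq_one]
    simp only [Fin.sum_univ_three, Real.norm_eq_abs, sq_abs]
    simp
    nlinarith [Real.sin_sq_add_cos_sq θ, Real.sin_sq_add_cos_sq φ]⟩

/-- The measure `sin θ dθ dφ` on `[0, π] × [0, 2π)`: the surface measure of the sphere in
angular coordinates. -/
def angMeasure : Measure (ℝ × ℝ) :=
  (volume.restrict (Icc 0 Real.pi ×ˢ Ico 0 (2 * Real.pi))).withDensity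
    (fun p => ENNReal.ofReal (Real.sin p.1))

/-- The Laplace-Beltrami operator of the unit sphere, in angular coordinates
(meaningful away from the poles, that is for `0 < θ < π`):
`∂²f/∂θ² + cot θ ∂f/∂θ + (1 / sin² θ) ∂²f/∂φ²`. -/
def sphLap (f : S2 → ℝ) (θ φ : ℝ) : ℝ :=
  deriv (deriv (fun t => f (sph t φ))) θ
    + Real.cos θ / Real.sin θ * deriv (fun t => f (sph t φ)) θ
    + 1 / Real.sin θ ^ 2 * deriv (deriv (fun s => f (sph θ s))) φ

/-! ### Spherical harmonics -/

/-- The `l`-th Legendre polynomial, `P_l(x) = (1 / (2^l l!)) d^l/dx^l (x² - 1)^l`. -/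
def legendreP (l : ℕ) : Polynomial ℝ :=
  Polynomial.C (1 / (2 ^ l * (l.factorial : ℝ))) *
    Polynomial.derivative^[l] ((Polynomial.X ^ 2 - 1) ^ l)

/-- The associated Legendre function of nonnegative order,
`P_l^m(x) = (-1)^m (1 - x²)^{m/2} d^m/dx^m P_l(x)`. -/
def assocLegendreNat (l m : ℕ) (x : ℝ) : ℝ :=
  (-1) ^ m * Real.sqrt (1 - x ^ 2) ^ m * (Polynomial.derivative^[m] (legendreP l)).eval x

/-- The associated Legendre function `P_l^m` for `-l ≤ m ≤ l`; for negative order by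
`P_l^{-m} = (-1)^m ((l - m)! / (l + m)!) P_l^m`. -/
def assocLegendre (l : ℕ) : ℤ → ℝ → ℝ
  | Int.ofNat m, x => assocLegendreNat l m x
  | Int.negSucc k, x =>
      (-1) ^ (k + 1) * (((l - (k + 1)).factorial : ℝ) / ((l + (k + 1)).factorial : ℝ)) *
        assocLegendreNat l (k + 1) x

/-- The normalizing constant `(-1)^m √((2l+1)/(4π) · (l-m)!/(l+m)!)`. -/
def harmonicConst (l : ℕ) (m : ℤ) : ℝ :=
  (-1) ^ m * Real.sqrt ((2 * l + 1) / (4 * Real.pi) *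
    ((((l : ℤ) - m).toNat.factorial : ℝ) / (((l : ℤ) + m).toNat.factorial : ℝ)))

/-- The spherical harmonic `Y_{lm}(θ, φ)`. -/
def sphY (l : ℕ) (m : ℤ) (θ φ : ℝ) : ℂ :=
  (harmonicConst l m : ℂ) * Complex.exp (Complex.I * m * φ) *
    (assocLegendre l m (Real.cos θ) : ℂ)

/-! ### Bessel functions -/

/-- The Bessel function of the first kind, for `x > 0` (at the poles of `Γ`, the reciprocal
`1 / Γ` is `0`). -/
def besselJ (ν x : ℝ) : ℝ :=
  (x / 2) ^ ν * ∑' k : ℕ, (-(x ^ 2) / 4) ^ k / ((k.factorial : ℝ) * Real.Gamma (ν + k + 1))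

/-- The quotient defining the Bessel function of the second kind at noninteger orders. -/
def besselYAux (ν x : ℝ) : ℝ :=
  (besselJ ν x * Real.cos (ν * Real.pi) - besselJ (-ν) x) / Real.sin (ν * Real.pi)

open Classical in
/-- The Bessel function of the second kind, for `x > 0`; at integer order it is the limit
of its values at noninteger orders. -/
def besselY (ν x : ℝ) : ℝ :=
  if ∃ n : ℤ, ν = n then limUnder (𝓝[≠] ν) (fun μ => besselYAux μ x) else besselYAux ν x

/-! ### The expanding sphere -/

/-- The expansion factor in conformal time, `e(η) = η∞ / (η∞ - η)`. -/
def expansion (ηinf η : ℝ) : ℝ := ηinf / (ηinf - η)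

/-- The coefficient `e(η)/D + e'(η)/(c² e(η))` of the first time derivative. -/
def damping (c D ηinf η : ℝ) : ℝ :=
  expansion ηinf η / D + deriv (expansion ηinf) η / (c ^ 2 * expansion ηinf η)

/-- `z_l = c √(l(l+1)) / r`. -/
def zfreq (c r : ℝ) (l : ℕ) : ℝ := c * Real.sqrt (l * (l + 1)) / r

/-- `ν = c² η∞ / (2D) + 1`. -/
def nuIndex (c D ηinf : ℝ) : ℝ := c ^ 2 * ηinf / (2 * D) + 1

/-- `K₁^{(l)} = π z_l Y_{ν-1}(z_l η∞) / (2 η∞^{ν-1})`. -/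
def K1 (c r D ηinf : ℝ) (l : ℕ) : ℝ :=
  Real.pi * zfreq c r l * besselY (nuIndex c D ηinf - 1) (zfreq c r l * ηinf) /
    (2 * ηinf ^ (nuIndex c D ηinf - 1))

/-- `K₂^{(l)} = -π z_l J_{ν-1}(z_l η∞) / (2 η∞^{ν-1})`. -/
def K2 (c r D ηinf : ℝ) (l : ℕ) : ℝ :=
  -(Real.pi * zfreq c r l * besselJ (nuIndex c D ηinf - 1) (zfreq c r l * ηinf) /
    (2 * ηinf ^ (nuIndex c D ηinf - 1)))

/-- The time factor `F_l(η)`. -/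
def timeF (c r D ηinf : ℝ) (l : ℕ) (η : ℝ) : ℝ :=
  if l = 0 then 1
  else (ηinf - η) ^ nuIndex c D ηinf *
    (K1 c r D ηinf l * besselJ (nuIndex c D ηinf) (zfreq c r l * (ηinf - η))
      + K2 c r D ηinf l * besselY (nuIndex c D ηinf) (zfreq c r l * (ηinf - η)))

/-- `v` is a classical solution on `[0, η∞) × S²` of
`(e/D + e'/(c² e)) ∂v/∂η + (1/c²) ∂²v/∂η² - (1/r²) Δ v = 0`, `v(0, ·) = f`, `∂v/∂η(0, ·) = 0`:
it is `C²` up to time `0`, and the equation holds pointwise in angular coordinates. -/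
structure IsClassicalSolution (c r D ηinf : ℝ) (f : S2 → ℝ) (v : ℝ → S2 → ℝ) : Prop where
  contMDiffOn : ContMDiffOn (𝓘(ℝ, ℝ).prod (𝓡 2)) 𝓘(ℝ, ℝ) 2
    (fun p : ℝ × S2 => v p.1 p.2) (Ico 0 ηinf ×ˢ univ)
  equation : ∀ η ∈ Ico 0 ηinf, ∀ θ ∈ Ioo 0 Real.pi, ∀ φ : ℝ,
    damping c D ηinf η * derivWithin (fun s => v s (sph θ φ)) (Ico 0 ηinf) η
      + 1 / c ^ 2 *
        derivWithin (derivWithin (fun s => v s (sph θ φ)) (Ico 0 ηinf)) (Ico 0 ηinf) η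
      - 1 / r ^ 2 * sphLap (v η) θ φ = 0
  initial : ∀ x, v 0 x = f x
  initial_deriv : ∀ x, derivWithin (fun s => v s x) (Ico 0 ηinf) 0 = 0

/-- The pairing `∫_{S²} v(η, x) ψ(x) dx`, as a function of `η`. -/
def pairing (v : ℝ → S2 → ℝ) (ψ : S2 → ℝ) (η : ℝ) : ℝ :=
  ∫ p, v η (sph p.1 p.2) * ψ (sph p.1 p.2) ∂angMeasure

/-- `v` is a (continuous) weak solution on `[0, η∞) × S²` of the same initial value problem:
the equation is integrated against the smooth functions `ψ` on the sphere. -/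
structure IsWeakSolution (c r D ηinf : ℝ) (f : S2 → ℝ) (v : ℝ → S2 → ℝ) : Prop where
  continuousOn : ContinuousOn (fun p : ℝ × S2 => v p.1 p.2) (Ico 0 ηinf ×ˢ univ)
  contDiffOn : ∀ ψ : S2 → ℝ, ContMDiff (𝓡 2) 𝓘(ℝ, ℝ) ((⊤ : ℕ∞) : WithTop ℕ∞) ψ →
    ContDiffOn ℝ 2 (pairing v ψ) (Ico 0 ηinf)
  equation : ∀ ψ : S2 → ℝ, ContMDiff (𝓡 2) 𝓘(ℝ, ℝ) ((⊤ : ℕ∞) : WithTop ℕ∞) ψ → ∀ η ∈ Ico 0 ηinf,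
    damping c D ηinf η * derivWithin (pairing v ψ) (Ico 0 ηinf) η
      + 1 / c ^ 2 *
        derivWithin (derivWithin (pairing v ψ) (Ico 0 ηinf)) (Ico 0 ηinf) η
      - 1 / r ^ 2 * ∫ p, v η (sph p.1 p.2) * sphLap ψ p.1 p.2 ∂angMeasure = 0
  initial : ∀ x, v 0 x = f x
  initial_deriv : ∀ ψ : S2 → ℝ, ContMDiff (𝓡 2) 𝓘(ℝ, ℝ) ((⊤ : ℕ∞) : WithTop ℕ∞) ψ →
    derivWithin (pairing v ψ) (Ico 0 ηinf) 0 = 0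

/-! ### Spherical random fields -/

section RandomFields

variable {Ω : Type*} [MeasurableSpace Ω]

/-- The random field `T` on the sphere is isotropic: its finite-dimensional distributions are
invariant under rotations. -/
def IsIsotropic (T : S2 → Ω → ℝ) (P : Measure Ω) : Prop :=
  ∀ R : E3 ≃ₗᵢ[ℝ] E3, LinearMap.det (R.toLinearEquiv : E3 →ₗ[ℝ] E3) = 1 →
    ∀ (k : ℕ) (x y : Fin k → S2), (∀ i, (y i : E3) = R (x i : E3)) →
      IdentDistrib (fun ω i => T (x i) ω) (fun ω i => T (y i) ω) P P

/-- The random Laplace coefficient `a_{lm} = ∫_{S²} T Y_{lm}^*`. -/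
def coeff (T : S2 → Ω → ℝ) (l : ℕ) (m : ℤ) (ω : Ω) : ℂ :=
  ∫ p, (T (sph p.1 p.2) ω : ℂ) * conj (sphY l m p.1 p.2) ∂angMeasure

/-- The angular power spectrum of an isotropic field, `C_l = E |a_{lm}|²`; this does not depend
on `m`, and `m = 0` is taken here. -/
def powerSpectrum (T : S2 → Ω → ℝ) (P : Measure Ω) (l : ℕ) : ℝ :=
  ∫ ω, ‖coeff T l 0 ω‖ ^ 2 ∂P

/-- The partial sum `∑_{l ≤ L} F_l(η) ∑_{|m| ≤ l} a_{lm} Y_{lm}(θ, φ)`. -/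
def partialSum (c r D ηinf : ℝ) (T : S2 → Ω → ℝ) (L : ℕ) (η θ φ : ℝ) (ω : Ω) : ℂ :=
  ∑ l ∈ Finset.range (L + 1), (timeF c r D ηinf l η : ℂ) *
    ∑ m ∈ Finset.Icc (-(l : ℤ)) (l : ℤ), coeff T l m ω * sphY l m θ φ

/-- `u` is a random field on `[0, η∞) × S²` almost all of whose realizations are weak solutions
with initial value the realization of `T`. -/
def IsWeakRandomSolution (c r D ηinf : ℝ) (P : Measure Ω) (T : S2 → Ω → ℝ)
    (u : ℝ → S2 → Ω → ℝ) : Prop :=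
  (∀ η ∈ Ico 0 ηinf, ∀ x, AEMeasurable (u η x) P) ∧
    ∀ᵐ ω ∂P, IsWeakSolution c r D ηinf (fun x => T x ω) (fun η x => u η x ω)

/-- `u` is a random field on `[0, η∞) × S²` almost all of whose realizations are classical
solutions with initial value the realization of `T`. -/
def IsClassicalRandomSolution (c r D ηinf : ℝ) (P : Measure Ω) (T : S2 → Ω → ℝ)
    (u : ℝ → S2 → Ω → ℝ) : Prop :=
  (∀ η ∈ Ico 0 ηinf, ∀ x, AEMeasurable (u η x) P) ∧
    ∀ᵐ ω ∂P, IsClassicalSolution c r D ηinf (fun x => T x ω) (fun η x => u η x ω)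

end RandomFields

end ExpandingSphere

end

open MeasureTheory ProbabilityTheory Set Filter Topology
open scoped Manifold ComplexConjugate

noncomputable section

namespace ExpandingSphere

/-! The proof is separation of variables, made rigorous in both directions.

Time. Test the equation against the zonal function `y ↦ P_l(⟨x, y⟩)`, an eigenfunction of the
Laplacian with eigenvalue `-l(l+1)`. The projection of a weak solution to degree `l` then satisfies
`g'' + (2ν-1)/(η∞-η) g' + z_l² g = 0`, `g'(0) = 0`. The recurrences common to `J` and `Y` show that
`F_l` solves this equation with `F_l'(0) = 0`, and the Wronskian of `J` and `Y` gives `F_l(0) = 1`.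
Since the damping is nonnegative, the energy `g'² + z_l² g²` does not increase. For a difference of
solutions this is uniqueness (`eq_timeF_mul_of_ode`); for `F_l` itself it is the bound `|F_l| ≤ 1`.
So every solution has the projections `F_l(η) T_l`, where `T_l` is the projection of `T`.

Space. The harmonics are complete by Stone-Weierstrass, so a continuous function is determined by
its projections. If `f` is `C²`, Bessel's inequality for its Laplacian gives `∑ (l+1)⁴ ‖f_l‖² < ∞`,
and the addition theorem gives `sup |f_l|² ≤ (2l+1)/(4π) ‖f_l‖²`; hence `∑ sup |f_l| < ∞`. The
series therefore converges uniformly on the sphere and equals every solution. Conversely its sum is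
a weak solution: `(l+1)² |⟨f_l, ψ⟩|` is summable, which allows two time derivatives of the pairing
with `ψ`.

Probability. By isotropy `E[T_l(x) T_k(z)]` depends only on `⟨x, z⟩`; it is an eigenfunction of
degree `l` in `x` and of degree `k` in `z`, hence a multiple of both `P_l` and `P_k`. It vanishes
for `l ≠ k` and equals `(2l+1)/(4π) C_l P_l(⟨x, z⟩)` for `l = k`. Orthogonality and summable
variances yield convergence in `L²` and the covariance. Gaussianity enters only through
measurability and finite second moments.

Regularity. Green's identity turns classical solutions into weak ones. In the other direction, two
space derivatives of `f_l` cost `(l+1)⁴ ‖f_l‖` and each time derivative of `F_l` costs a factor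
`l+1`, so `∑ (l+1)⁴ ‖T_l‖ < ∞` suffices. By a weighted arithmetic-geometric inequality this follows
from `∑ (l+1)^10 ‖T_l‖² < ∞`, whose expectation is `∑ (l+1)^10 (2l+1) C_l`. -/

/-! ### The reciprocal Gamma function -/

/-- The reciprocal Gamma function on the real line. -/
def recGamma (s : ℝ) : ℝ := (Real.Gamma s)⁻¹

lemma recGamma_eq_re (s : ℝ) : recGamma s = ((Complex.Gamma (s : ℂ))⁻¹).re := by
  rw [recGamma, Complex.Gamma_ofReal, ← Complex.ofReal_inv, Complex.ofReal_re]

lemma recGamma_eq (s : ℝ) : recGamma s = s * recGamma (s + 1) := by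
  have h := Complex.one_div_Gamma_eq_self_mul_one_div_Gamma_add_one (s : ℂ)
  rw [recGamma_eq_re, recGamma_eq_re, h]
  push_cast
  simp

lemma hasDerivAt_recGamma (s : ℝ) :
    HasDerivAt recGamma (deriv (fun z : ℂ => (Complex.Gamma z)⁻¹) (s : ℂ)).re s := by
  have h := (Complex.differentiable_one_div_Gamma (s : ℂ)).hasDerivAt.real_of_complex
  exact h.congr_of_eventuallyEq (Eventually.of_forall fun x => recGamma_eq_re x)

lemma differentiable_recGamma : Differentiable ℝ recGamma :=
  fun s => (hasDerivAt_recGamma s).differentiableAt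

/-- For the finitely many `k ≤ N`, where `N ≥ M`, compactness of the disc gives a bound. Beyond `N`
the relation `1/Γ(w) = w/Γ(w+1)` with `w = z+k+1`, `|w| ≥ k+1-|z| ≥ 1`, shows that the moduli do not
increase with `k`. -/
lemma exists_norm_inv_Gamma_le (M : ℝ) :
    ∃ C : ℝ, ∀ k : ℕ, ∀ z : ℂ, ‖z‖ ≤ M → ‖(Complex.Gamma (z + k + 1))⁻¹‖ ≤ C := by
  have hk : ∀ k : ℕ, ∃ C : ℝ, ∀ z : ℂ, ‖z‖ ≤ M → ‖(Complex.Gamma (z + k + 1))⁻¹‖ ≤ C := by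
    intro k
    obtain ⟨C, hC⟩ := (isCompact_closedBall (0 : ℂ) M).exists_bound_of_continuousOn
      (f := fun z : ℂ => (Complex.Gamma (z + k + 1))⁻¹)
      ((Complex.differentiable_one_div_Gamma.comp
        (by fun_prop : Differentiable ℂ fun z : ℂ => z + k + 1)).continuous.continuousOn)
    exact ⟨C, fun z hz => hC z (by simpa using hz)⟩
  choose C hC using hk
  obtain ⟨N, hN⟩ := exists_nat_ge M
  refine ⟨∑ k ∈ Finset.range (N + 1), |C k|, fun k z hz => ?_⟩
  have hle : ∀ j ≤ N, C j ≤ ∑ k ∈ Finset.range (N + 1), |C k| := fun j hj =>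
    (le_abs_self _).trans (Finset.single_le_sum (f := fun k => |C k|) (fun _ _ => abs_nonneg _)
      (Finset.mem_range.2 (by omega)))
  rcases le_total k N with h | h
  · exact (hC k z hz).trans (hle k h)
  · induction k, h using Nat.le_induction with
    | base => exact (hC N z hz).trans (hle N le_rfl)
    | succ k hNk ih =>
      refine le_trans ?_ ih
      rw [Complex.one_div_Gamma_eq_self_mul_one_div_Gamma_add_one (z + k + 1), norm_mul]
      push_cast
      have h1 : 1 ≤ ‖z + k + 1‖ := by
        have h3 : ‖((k : ℂ) + 1)‖ ≤ ‖z + k + 1‖ + ‖z‖ := by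
          calc ‖((k : ℂ) + 1)‖ = ‖(z + k + 1) - z‖ := by congr 1; ring
            _ ≤ _ := norm_sub_le _ _
        have h4 : ‖((k : ℂ) + 1)‖ = k + 1 := by
          rw [show ((k : ℂ) + 1) = ((k + 1 : ℕ) : ℂ) by push_cast; rfl, Complex.norm_natCast]
          push_cast; rfl
        have : (N : ℝ) ≤ k := by exact_mod_cast hNk
        linarith
      have h2 : z + (k + 1) + 1 = z + k + 1 + 1 := by ring
      rw [h2]
      nlinarith [norm_nonneg (Complex.Gamma (z + k + 1 + 1))⁻¹]

lemma exists_abs_recGamma_le (M : ℝ) :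
    ∃ C : ℝ, ∀ k : ℕ, ∀ μ : ℝ, |μ| ≤ M →
      |recGamma (μ + k + 1)| ≤ C ∧ |deriv recGamma (μ + k + 1)| ≤ C := by
  -- The radius `M + 1` leaves room for unit circles around the points of the disc, on which
  -- Cauchy's estimate bounds the derivative.
  obtain ⟨C, hC⟩ := exists_norm_inv_Gamma_le (M + 1)
  refine ⟨C, fun k μ hμ => ⟨?_, ?_⟩⟩
  · rw [recGamma_eq_re]
    refine (Complex.abs_re_le_norm _).trans ?_
    push_cast
    exact hC k μ (by rw [Complex.norm_real, Real.norm_eq_abs]; linarith)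
  · rw [(hasDerivAt_recGamma _).deriv]
    refine (Complex.abs_re_le_norm _).trans ?_
    have := Complex.norm_deriv_le_of_forall_mem_sphere_norm_le (R := 1) (C := C)
      (c := ((μ + k + 1 : ℝ) : ℂ)) (f := fun z : ℂ => (Complex.Gamma z)⁻¹) one_pos
      Complex.differentiable_one_div_Gamma.diffContOnCl ?_
    · simpa using this
    · intro z hz
      have h := hC k (z - k - 1) ?_
      · rwa [show z - k - 1 + k + 1 = z by ring] at h
      · rw [mem_sphere_iff_norm] at hz
        calc ‖z - k - 1‖ = ‖(z - ((μ + k + 1 : ℝ) : ℂ)) + (μ : ℂ)‖ := by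
              congr 1; push_cast; ring
          _ ≤ _ := norm_add_le _ _
          _ ≤ M + 1 := by rw [hz, Complex.norm_real, Real.norm_eq_abs]; linarith

/-! ### Exponential-type power series -/

lemma summable_expSeries {a : ℕ → ℝ} {C : ℝ} (ha : ∀ k, |a k| ≤ C) (t : ℝ) :
    Summable fun k : ℕ => a k * (t ^ k / k.factorial) := by
  refine Summable.of_norm_bounded ((Real.summable_pow_div_factorial |t|).mul_left C) fun k => ?_
  rw [norm_mul, norm_div, norm_pow, Real.norm_eq_abs, Real.norm_eq_abs, Real.norm_natCast]
  exact mul_le_mul_of_nonneg_right (ha k) (by positivity)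

lemma tsum_nat_mul_expSeries {a : ℕ → ℝ} {C : ℝ} (ha : ∀ k, |a k| ≤ C) (t : ℝ) :
    HasSum (fun k : ℕ => a k * (k * t ^ (k - 1) / k.factorial))
      (∑' k : ℕ, a (k + 1) * (t ^ k / k.factorial)) := by
  have h := (summable_expSeries (a := fun k => a (k + 1)) (fun k => ha (k + 1)) t).hasSum
  rw [← hasSum_nat_add_iff' 1]
  have h0 : ∑ i ∈ Finset.range 1, a i * ((i : ℝ) * t ^ (i - 1) / i.factorial) = 0 := by simp
  rw [h0, sub_zero]
  convert! h using 2 with k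
  rw [Nat.factorial_succ]
  push_cast
  have : ((k : ℝ) + 1) ≠ 0 := by positivity
  have h2 : ((k.factorial : ℕ) : ℝ) ≠ 0 := by positivity
  field_simp

/-- Differentiation shifts the coefficient sequence by one. For the coefficients `1/Γ(μ+k+1)` this
is the passage from order `μ` to `μ+1`. -/
lemma hasDerivAt_expSeries {a : ℕ → ℝ} {C : ℝ} (ha : ∀ k, |a k| ≤ C) (t : ℝ) :
    HasDerivAt (fun t => ∑' k : ℕ, a k * (t ^ k / k.factorial))
      (∑' k : ℕ, a (k + 1) * (t ^ k / k.factorial)) t := by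
  rw [← (tsum_nat_mul_expSeries ha t).tsum_eq]
  set R : ℝ := |t| + 1
  have hR : 0 < R := by positivity
  have hu := (tsum_nat_mul_expSeries (a := fun _ => C) (C := |C|) (fun _ => le_rfl) R).summable
  refine hasDerivAt_tsum_of_isPreconnected (t := Metric.ball 0 R) (y₀ := 0) hu
    Metric.isOpen_ball (convex_ball _ _).isPreconnected
    (g' := fun k y => a k * (k * y ^ (k - 1) / k.factorial)) ?_ ?_ ?_ ?_ ?_
  · intro k y _
    exact ((hasDerivAt_pow k y).div_const _).const_mul _
  · intro k y hy
    rw [Metric.mem_ball, dist_zero_right] at hy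
    rw [norm_mul, norm_div, norm_mul, norm_pow, Real.norm_natCast, Real.norm_natCast]
    have : ‖y‖ ^ (k - 1) ≤ R ^ (k - 1) := pow_le_pow_left₀ (norm_nonneg _) hy.le _
    refine mul_le_mul (ha k) ?_ (by positivity) ((abs_nonneg _).trans (ha k))
    gcongr
  · simpa using hR
  · exact summable_expSeries ha 0
  · simp [R]

/-- The entire function `∑ t^k / (k! Γ(μ + k + 1))`. -/
def besselPhi (μ t : ℝ) : ℝ := ∑' k : ℕ, recGamma (μ + k + 1) * (t ^ k / k.factorial)

/-- The derivative of `besselPhi` in the order. -/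
def besselPhiD (μ t : ℝ) : ℝ := ∑' k : ℕ, deriv recGamma (μ + k + 1) * (t ^ k / k.factorial)

lemma hasDerivAt_besselPhi (μ t : ℝ) : HasDerivAt (besselPhi μ) (besselPhi (μ + 1) t) t := by
  obtain ⟨C, hC⟩ := exists_abs_recGamma_le |μ|
  convert! hasDerivAt_expSeries (a := fun k => recGamma (μ + k + 1)) (fun k => (hC k μ le_rfl).1) t
    using 1
  refine tsum_congr fun k => ?_
  push_cast
  ring_nf

lemma hasDerivAt_besselPhiD (μ t : ℝ) : HasDerivAt (besselPhiD μ) (besselPhiD (μ + 1) t) t := by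
  obtain ⟨C, hC⟩ := exists_abs_recGamma_le |μ|
  convert! hasDerivAt_expSeries (a := fun k => deriv recGamma (μ + k + 1))
    (fun k => (hC k μ le_rfl).2) t using 1
  refine tsum_congr fun k => ?_
  push_cast
  ring_nf

lemma hasDerivAt_besselPhi_order (μ t : ℝ) :
    HasDerivAt (fun μ => besselPhi μ t) (besselPhiD μ t) μ := by
  obtain ⟨C, hC⟩ := exists_abs_recGamma_le (|μ| + 1)
  have hsub : ∀ y ∈ Metric.ball μ 1, |y| ≤ |μ| + 1 := by
    intro y hy
    rw [Metric.mem_ball, Real.dist_eq] at hy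
    have := abs_sub_abs_le_abs_sub y μ
    linarith
  refine hasDerivAt_tsum_of_isPreconnected (t := Metric.ball μ 1) (y₀ := μ)
    ((Real.summable_pow_div_factorial |t|).mul_left C)
    Metric.isOpen_ball (convex_ball _ _).isPreconnected
    (g' := fun (k : ℕ) y => deriv recGamma (y + k + 1) * (t ^ k / k.factorial)) ?_ ?_ ?_ ?_ ?_
  · intro k y _
    refine HasDerivAt.mul_const ?_ _
    have := (differentiable_recGamma (y + (k + 1))).hasDerivAt.comp_add_const y (k + 1 : ℝ)
    simpa only [add_assoc] using this
  · intro k y hy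
    rw [norm_mul, norm_div, norm_pow, Real.norm_eq_abs, Real.norm_eq_abs, Real.norm_natCast]
    exact mul_le_mul_of_nonneg_right (hC k y (hsub y hy)).2 (by positivity)
  · simp
  · exact summable_expSeries (fun k => (hC k μ (by linarith [abs_nonneg μ])).1) t
  · simp

/-- Coefficientwise this is `1/Γ(μ+k) = (μ+k)/Γ(μ+k+1)`; the part with the factor `k` is `t` times
the derivative of the series in `t`. -/
lemma besselPhi_sub_one (μ t : ℝ) :
    besselPhi (μ - 1) t = μ * besselPhi μ t + t * besselPhi (μ + 1) t := by
  obtain ⟨C, hC⟩ := exists_abs_recGamma_le |μ|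
  have hC' := fun k => (hC k μ le_rfl).1
  have h1 := (summable_expSeries hC' t).hasSum.mul_left μ
  have h2 := (tsum_nat_mul_expSeries hC' t).mul_left t
  have h3 := h1.add h2
  have h4 : besselPhi (μ - 1) t = ∑' k : ℕ, (μ * (recGamma (μ + k + 1) * (t ^ k / k.factorial))
      + t * (recGamma (μ + k + 1) * (k * t ^ (k - 1) / k.factorial))) := by
    refine tsum_congr fun k => ?_
    rw [show μ - 1 + k + 1 = μ + k by ring, recGamma_eq (μ + k)]
    rcases k with _ | k
    · simp
    · simp only [Nat.add_sub_cancel, pow_succ]; push_cast; ring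
  rw [h4, h3.tsum_eq, besselPhi, besselPhi]
  congr 2
  refine tsum_congr fun k => ?_
  push_cast
  ring_nf

/-- The previous recurrence differentiated in `μ`; the extra term comes from the factor `μ`. It is
needed for the Bessel functions of the second kind at integer order. -/
lemma besselPhiD_sub_one (μ t : ℝ) :
    besselPhiD (μ - 1) t = besselPhi μ t + μ * besselPhiD μ t + t * besselPhiD (μ + 1) t := by
  have h1 : HasDerivAt (fun μ => besselPhi (μ - 1) t) (besselPhiD (μ - 1) t) μ :=
    (hasDerivAt_besselPhi_order (μ - 1) t).comp_sub_const μ 1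
  have h2 : HasDerivAt (fun μ => μ * besselPhi μ t + t * besselPhi (μ + 1) t)
      (1 * besselPhi μ t + μ * besselPhiD μ t + t * besselPhiD (μ + 1) t) μ :=
    ((hasDerivAt_id μ).mul (hasDerivAt_besselPhi_order μ t)).add
      (((hasDerivAt_besselPhi_order (μ + 1) t).comp_add_const μ 1).const_mul t)
  rw [funext fun μ => besselPhi_sub_one μ t] at h1
  rw [h1.unique h2, one_mul]

/-- By the recurrences at `μ` and `1-μ` the left side has derivative `0` in `t`; at `t = 0` it is
`1/(Γ(μ)Γ(1-μ))`, which the reflection formula evaluates. -/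
lemma besselPhi_wronskian (μ t : ℝ) :
    besselPhi (-μ) t * besselPhi (μ - 1) t - t * besselPhi μ t * besselPhi (1 - μ) t
      = Real.sin (Real.pi * μ) / Real.pi := by
  have hd : ∀ t, HasDerivAt (fun t => besselPhi (-μ) t * besselPhi (μ - 1) t
      - t * besselPhi μ t * besselPhi (1 - μ) t) 0 t := by
    intro t
    have a1 := hasDerivAt_besselPhi (-μ) t
    have a2 := hasDerivAt_besselPhi (μ - 1) t
    have a3 := hasDerivAt_besselPhi μ t
    have a4 := hasDerivAt_besselPhi (1 - μ) t
    have h := (a1.mul a2).sub (((hasDerivAt_id t).mul a3).mul a4)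
    refine h.congr_deriv ?_
    have e1 := besselPhi_sub_one μ t
    have e2 := besselPhi_sub_one (1 - μ) t
    rw [show 1 - μ - 1 = -μ by ring] at e2
    rw [show -μ + 1 = 1 - μ by ring, show μ - 1 + 1 = μ by ring]
    simp only [Pi.mul_apply, id]
    rw [e1, e2]
    ring
  have hc := is_const_of_deriv_eq_zero (fun t => (hd t).differentiableAt) (fun t => (hd t).deriv) t 0
  rw [hc]
  have h0 : ∀ μ, besselPhi μ 0 = recGamma (μ + 1) := by
    intro μ
    rw [besselPhi, tsum_eq_single 0]
    · simp
    · intro k hk; simp [hk]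
  rw [h0, h0]
  rw [show μ - 1 + 1 = μ by ring, show -μ + 1 = 1 - μ by ring, recGamma, recGamma, ← mul_inv,
    mul_comm, Real.Gamma_mul_Gamma_one_sub]
  simp

/-! ### Bessel functions of real order -/

lemma besselJ_eq (μ x : ℝ) : besselJ μ x = (x / 2) ^ μ * besselPhi μ (-(x ^ 2) / 4) := by
  rw [besselJ, besselPhi]
  congr 1
  refine tsum_congr fun k => ?_
  rw [recGamma, div_eq_mul_inv, div_eq_mul_inv, mul_inv]
  ring

/-- The derivative of the Bessel function of the first kind in the order. -/
def besselJOrder (μ x : ℝ) : ℝ :=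
  Real.log (x / 2) * besselJ μ x + (x / 2) ^ μ * besselPhiD μ (-(x ^ 2) / 4)

lemma hasDerivAt_besselJ_order (μ : ℝ) {x : ℝ} (hx : 0 < x) :
    HasDerivAt (fun μ => besselJ μ x) (besselJOrder μ x) μ := by
  have h1 : HasDerivAt (fun μ => (x / 2) ^ μ) (Real.log (x / 2) * (x / 2) ^ μ) μ := by
    have := (hasDerivAt_id μ).const_rpow (a := x / 2) (by positivity)
    simpa [mul_comm] using this
  have h2 := h1.mul (hasDerivAt_besselPhi_order μ (-(x ^ 2) / 4))
  rw [funext fun μ => besselJ_eq μ x]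
  refine h2.congr_deriv ?_
  rw [besselJOrder, besselJ_eq]
  ring

lemma half_rpow_add_one (μ : ℝ) {x : ℝ} (hx : 0 < x) :
    (x / 2) ^ (μ + 1) = (x / 2) ^ μ * (x / 2) := by
  rw [Real.rpow_add (by positivity), Real.rpow_one]

lemma half_rpow_sub_one (μ : ℝ) {x : ℝ} (hx : 0 < x) :
    (x / 2) ^ (μ - 1) = (x / 2) ^ μ * (2 / x) := by
  rw [Real.rpow_sub (by positivity), Real.rpow_one]
  field_simp

lemma hasDerivAt_half_rpow (μ : ℝ) {x : ℝ} (hx : 0 < x) :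
    HasDerivAt (fun x : ℝ => (x / 2) ^ μ) (μ / x * (x / 2) ^ μ) x := by
  have := ((hasDerivAt_id x).div_const 2).rpow_const (p := μ) (Or.inl (by simp; positivity))
  refine this.congr_deriv ?_
  simp only [id]
  rw [half_rpow_sub_one μ hx]
  field_simp

lemma hasDerivAt_neg_sq_div (x : ℝ) : HasDerivAt (fun x : ℝ => -(x ^ 2) / 4) (-(x / 2)) x := by
  refine ((hasDerivAt_pow 2 x).neg.div_const 4).congr_deriv ?_
  simp; ring

lemma hasDerivAt_besselJ (μ : ℝ) {x : ℝ} (hx : 0 < x) :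
    HasDerivAt (besselJ μ) (μ / x * besselJ μ x - besselJ (μ + 1) x) x := by
  have h := (hasDerivAt_half_rpow μ hx).mul
    ((hasDerivAt_besselPhi μ (-(x ^ 2) / 4)).comp x (hasDerivAt_neg_sq_div x))
  rw [show besselJ μ = fun x => (x / 2) ^ μ * besselPhi μ (-(x ^ 2) / 4) from
    funext fun x => besselJ_eq μ x]
  refine h.congr_deriv ?_
  rw [besselJ_eq, half_rpow_add_one μ hx]
  simp only [Function.comp]
  ring

lemma hasDerivAt_besselJOrder (μ : ℝ) {x : ℝ} (hx : 0 < x) :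
    HasDerivAt (besselJOrder μ)
      (μ / x * besselJOrder μ x - besselJOrder (μ + 1) x + besselJ μ x / x) x := by
  have hlog : HasDerivAt (fun x : ℝ => Real.log (x / 2)) (1 / x) x := by
    refine (((hasDerivAt_id x).div_const 2).log (by simp; positivity)).congr_deriv ?_
    simp only [id]
    field_simp
  have h := (hlog.mul (hasDerivAt_besselJ μ hx)).add ((hasDerivAt_half_rpow μ hx).mul
    ((hasDerivAt_besselPhiD μ (-(x ^ 2) / 4)).comp x (hasDerivAt_neg_sq_div x)))
  refine h.congr_deriv ?_
  rw [besselJOrder, besselJOrder, half_rpow_add_one μ hx]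
  simp only [Function.comp]
  ring

lemma besselJ_sub_one (μ : ℝ) {x : ℝ} (hx : 0 < x) :
    besselJ (μ - 1) x = 2 * μ / x * besselJ μ x - besselJ (μ + 1) x := by
  rw [besselJ_eq, besselJ_eq, besselJ_eq, half_rpow_sub_one μ hx, half_rpow_add_one μ hx,
    besselPhi_sub_one]
  field_simp
  ring

lemma besselJOrder_sub_one (μ : ℝ) {x : ℝ} (hx : 0 < x) :
    besselJOrder (μ - 1) x
      = 2 * μ / x * besselJOrder μ x - besselJOrder (μ + 1) x + 2 / x * besselJ μ x := by
  rw [besselJOrder, besselJOrder, besselJOrder, besselJ_sub_one μ hx, half_rpow_sub_one μ hx,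
    half_rpow_add_one μ hx, besselPhiD_sub_one, besselJ_eq μ]
  field_simp
  ring

lemma besselJ_wronskian (μ : ℝ) {x : ℝ} (hx : 0 < x) :
    besselJ μ x * besselJ (1 - μ) x + besselJ (-μ) x * besselJ (μ - 1) x
      = 2 * Real.sin (μ * Real.pi) / (Real.pi * x) := by
  have h := besselPhi_wronskian μ (-(x ^ 2) / 4)
  have h1 : (x / 2) ^ (1 - μ) = (x / 2) * ((x / 2) ^ μ)⁻¹ := by
    rw [Real.rpow_sub (by positivity), Real.rpow_one, div_eq_mul_inv]
  have h2 : (x / 2) ^ (-μ) = ((x / 2) ^ μ)⁻¹ := Real.rpow_neg (by positivity) μ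
  have h3 : (x / 2) ^ μ ≠ 0 := (Real.rpow_pos_of_pos (by positivity) μ).ne'
  rw [besselJ_eq, besselJ_eq, besselJ_eq, besselJ_eq, h1, h2, half_rpow_sub_one μ hx]
  rw [mul_comm μ Real.pi]
  have h4 : Real.sin (Real.pi * μ) = Real.pi * (besselPhi (-μ) (-(x ^ 2) / 4)
      * besselPhi (μ - 1) (-(x ^ 2) / 4) - (-(x ^ 2) / 4) * besselPhi μ (-(x ^ 2) / 4)
      * besselPhi (1 - μ) (-(x ^ 2) / 4)) := by
    rw [h]; field_simp
  rw [h4]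
  field_simp
  ring

lemma besselJ_neg_nat (n : ℕ) {x : ℝ} (hx : 0 < x) :
    besselJ (-(n : ℝ)) x = (-1) ^ n * besselJ n x := by
  -- The three-term recurrence needs two consecutive orders in the induction. At order `0` it reads
  -- `J_{-1} = -J_1`, which starts it.
  have key : ∀ n : ℕ, besselJ (-(n : ℝ)) x = (-1) ^ n * besselJ n x ∧
      besselJ (-((n + 1 : ℕ) : ℝ)) x = (-1) ^ (n + 1) * besselJ ((n + 1 : ℕ) : ℝ) x := by
    intro n
    induction n with
    | zero =>
      have h := besselJ_sub_one 0 hx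
      simp at h ⊢
      exact h
    | succ n ih =>
      refine ⟨ih.2, ?_⟩
      have h1 := besselJ_sub_one (-((n + 1 : ℕ) : ℝ)) hx
      have h2 := besselJ_sub_one ((n + 1 : ℕ) : ℝ) hx
      rw [show -((n + 1 : ℕ) : ℝ) + 1 = -(n : ℝ) by push_cast; ring, ih.1, ih.2] at h1
      rw [show ((n + 1 : ℕ) : ℝ) - 1 = (n : ℝ) by push_cast; ring] at h2
      rw [show -((n + 1 + 1 : ℕ) : ℝ) = -((n + 1 : ℕ) : ℝ) - 1 by push_cast; ring,
        show ((n + 1 + 1 : ℕ) : ℝ) = ((n + 1 : ℕ) : ℝ) + 1 by push_cast; ring, h1, h2]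
      ring
  exact (key n).1

lemma cos_int_mul_pi_sq (n : ℤ) : Real.cos (n * Real.pi) * Real.cos (n * Real.pi) = 1 := by
  have h := Real.sin_sq_add_cos_sq (n * Real.pi)
  rw [Real.sin_int_mul_pi] at h
  nlinarith

lemma besselJ_neg_int (n : ℤ) {x : ℝ} (hx : 0 < x) :
    besselJ (-(n : ℝ)) x = Real.cos (n * Real.pi) * besselJ n x := by
  obtain ⟨k, rfl | rfl⟩ := n.eq_nat_or_neg
  · have h : Real.cos ((k : ℤ) * Real.pi) = (-1) ^ k := by
      simpa using Real.cos_nat_mul_pi k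
    rw [h]
    exact_mod_cast besselJ_neg_nat k hx
  · have h : Real.cos ((-(k : ℤ) : ℤ) * Real.pi) = (-1) ^ k := by
      push_cast
      rw [neg_mul, Real.cos_neg]
      simpa using Real.cos_nat_mul_pi k
    rw [h]
    push_cast
    rw [neg_neg, besselJ_neg_nat k hx, ← mul_assoc, ← mul_pow]
    simp

/-- L'Hôpital in the order: numerator and denominator both vanish at `n`, since `J_{-n} = cos(nπ)
J_n`, so the quotient is a quotient of slopes. The limit expresses `Y_n` by order derivatives of
`J`, from which its recurrences can be read off. -/
lemma tendsto_besselYAux (n : ℤ) {x : ℝ} (hx : 0 < x) :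
    Tendsto (fun μ => besselYAux μ x) (𝓝[≠] (n : ℝ))
      (𝓝 ((besselJOrder n x + Real.cos (n * Real.pi) * besselJOrder (-n) x) / Real.pi)) := by
  have hlin : HasDerivAt (fun μ : ℝ => μ * Real.pi) Real.pi (n : ℝ) := by
    simpa using (hasDerivAt_id (n : ℝ)).mul_const Real.pi
  have h1 : HasDerivAt (fun μ => besselJ μ x * Real.cos (μ * Real.pi) - besselJ (-μ) x)
      (besselJOrder n x * Real.cos (n * Real.pi) + besselJOrder (-n) x) (n : ℝ) := by
    have hJ := hasDerivAt_besselJ_order (n : ℝ) hx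
    have hJ' := (hasDerivAt_besselJ_order (-(n : ℝ)) hx).scomp (n : ℝ) (hasDerivAt_neg (n : ℝ))
    refine ((hJ.mul hlin.cos).sub hJ').congr_deriv ?_
    rw [Real.sin_int_mul_pi]
    simp
  have h2 : HasDerivAt (fun μ : ℝ => Real.sin (μ * Real.pi))
      (Real.cos (n * Real.pi) * Real.pi) (n : ℝ) := hlin.sin
  have hc := cos_int_mul_pi_sq n
  have hc0 : Real.cos (n * Real.pi) ≠ 0 := fun h => by simp [h] at hc
  have h3 := (hasDerivAt_iff_tendsto_slope.1 h1).div (hasDerivAt_iff_tendsto_slope.1 h2)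
    (mul_ne_zero hc0 Real.pi_ne_zero)
  have h4 : (besselJOrder n x * Real.cos (n * Real.pi) + besselJOrder (-n) x)
      / (Real.cos (n * Real.pi) * Real.pi)
      = (besselJOrder n x + Real.cos (n * Real.pi) * besselJOrder (-n) x) / Real.pi := by
    rw [div_eq_div_iff (mul_ne_zero hc0 Real.pi_ne_zero) Real.pi_ne_zero]
    linear_combination (-Real.pi * besselJOrder (-n) x) * hc
  rw [h4] at h3
  refine h3.congr' ?_
  filter_upwards [self_mem_nhdsWithin] with μ hμ
  have hμ' : μ - n ≠ 0 := sub_ne_zero.2 hμ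
  rw [Pi.div_apply, slope_def_field, slope_def_field, Real.sin_int_mul_pi, besselJ_neg_int n hx,
    besselYAux, div_div_div_cancel_right₀ hμ']
  congr 1 <;> ring

lemma besselY_int (n : ℤ) {x : ℝ} (hx : 0 < x) :
    besselY n x = (besselJOrder n x + Real.cos (n * Real.pi) * besselJOrder (-n) x) / Real.pi := by
  rw [besselY, if_pos ⟨n, rfl⟩]
  exact (tendsto_besselYAux n hx).limUnder_eq

lemma besselY_of_not_int {μ : ℝ} (h : ¬ ∃ n : ℤ, μ = n) (x : ℝ) :
    besselY μ x = besselYAux μ x := by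
  rw [besselY, if_neg h]

lemma sin_mul_pi_ne_zero {μ : ℝ} (h : ¬ ∃ n : ℤ, μ = n) : Real.sin (μ * Real.pi) ≠ 0 := by
  intro h0
  obtain ⟨n, hn⟩ := Real.sin_eq_zero_iff.1 h0
  exact h ⟨n, (mul_right_cancel₀ Real.pi_ne_zero hn).symm⟩

lemma not_int_add_one {μ : ℝ} (h : ¬ ∃ n : ℤ, μ = n) : ¬ ∃ n : ℤ, μ + 1 = n := by
  rintro ⟨n, hn⟩
  exact h ⟨n - 1, by push_cast; linarith⟩

lemma not_int_sub_one {μ : ℝ} (h : ¬ ∃ n : ℤ, μ = n) : ¬ ∃ n : ℤ, μ - 1 = n := by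
  rintro ⟨n, hn⟩
  exact h ⟨n + 1, by push_cast; linarith⟩

/-- At noninteger order the recurrences of `J_μ` and `J_{-μ}` combine, as `cos` and `sin` change
sign under a shift by `π`. At integer order the order derivatives satisfy inhomogeneous recurrences;
their extra terms cancel because `J_{-n} = cos(nπ) J_n` and `cos²(nπ) = 1`. -/
lemma besselY_sub_one (μ : ℝ) {x : ℝ} (hx : 0 < x) :
    besselY (μ - 1) x = 2 * μ / x * besselY μ x - besselY (μ + 1) x := by
  by_cases h : ∃ n : ℤ, μ = n
  · obtain ⟨n, rfl⟩ := h
    have e1 : (n : ℝ) - 1 = ((n - 1 : ℤ) : ℝ) := by push_cast; ring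
    have e2 : (n : ℝ) + 1 = ((n + 1 : ℤ) : ℝ) := by push_cast; ring
    rw [e1, e2, besselY_int _ hx, besselY_int _ hx, besselY_int _ hx, ← e1, ← e2]
    have c1 : Real.cos (((n : ℝ) - 1) * Real.pi) = - Real.cos (n * Real.pi) := by
      rw [sub_mul, one_mul, Real.cos_sub_pi]
    have c2 : Real.cos (((n : ℝ) + 1) * Real.pi) = - Real.cos (n * Real.pi) := by
      rw [add_mul, one_mul, Real.cos_add_pi]
    have r1 := besselJOrder_sub_one (n : ℝ) hx
    have r2 := besselJOrder_sub_one (-(n : ℝ)) hx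
    rw [besselJ_neg_int n hx] at r2
    rw [c1, c2, r1, show -((n : ℝ) + 1) = -(n : ℝ) - 1 by ring, r2,
      show -((n : ℝ) - 1) = -(n : ℝ) + 1 by ring]
    have hc := cos_int_mul_pi_sq n
    field_simp
    linear_combination (-2 * besselJ n x) * hc
  · rw [besselY_of_not_int h, besselY_of_not_int (not_int_sub_one h),
      besselY_of_not_int (not_int_add_one h), besselYAux, besselYAux, besselYAux]
    have c1 : Real.cos ((μ - 1) * Real.pi) = - Real.cos (μ * Real.pi) := by
      rw [sub_mul, one_mul, Real.cos_sub_pi]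
    have c2 : Real.cos ((μ + 1) * Real.pi) = - Real.cos (μ * Real.pi) := by
      rw [add_mul, one_mul, Real.cos_add_pi]
    have s1 : Real.sin ((μ - 1) * Real.pi) = - Real.sin (μ * Real.pi) := by
      rw [sub_mul, one_mul, Real.sin_sub_pi]
    have s2 : Real.sin ((μ + 1) * Real.pi) = - Real.sin (μ * Real.pi) := by
      rw [add_mul, one_mul, Real.sin_add_pi]
    have hs := sin_mul_pi_ne_zero h
    have r2 := besselJ_sub_one (-μ) hx
    rw [c1, c2, s1, s2, besselJ_sub_one μ hx, show -(μ + 1) = -μ - 1 by ring, r2,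
      show -(μ - 1) = -μ + 1 by ring]
    field_simp
    ring

/-- At integer order the extra terms `J/x` cancel in the same way as in the three-term recurrence.
-/
lemma hasDerivAt_besselY (μ : ℝ) {x : ℝ} (hx : 0 < x) :
    HasDerivAt (besselY μ) (μ / x * besselY μ x - besselY (μ + 1) x) x := by
  by_cases h : ∃ n : ℤ, μ = n
  · obtain ⟨n, rfl⟩ := h
    have e2 : (n : ℝ) + 1 = ((n + 1 : ℤ) : ℝ) := by push_cast; ring
    have h0 := ((hasDerivAt_besselJOrder (n : ℝ) hx).add
      ((hasDerivAt_besselJOrder (-(n : ℝ)) hx).const_mul (Real.cos (n * Real.pi)))).div_const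
        Real.pi
    have h1 : HasDerivAt (besselY n) _ x := h0.congr_of_eventuallyEq (by
      filter_upwards [lt_mem_nhds hx] with y hy
      rw [besselY_int n hy]; rfl)
    refine h1.congr_deriv ?_
    rw [e2, besselY_int _ hx, besselY_int _ hx, ← e2]
    have c2 : Real.cos (((n : ℝ) + 1) * Real.pi) = - Real.cos (n * Real.pi) := by
      rw [add_mul, one_mul, Real.cos_add_pi]
    have r2 := besselJOrder_sub_one (-(n : ℝ)) hx
    rw [besselJ_neg_int n hx] at r2 ⊢
    rw [c2, show -((n : ℝ) + 1) = -(n : ℝ) - 1 by ring, r2]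
    have hc := cos_int_mul_pi_sq n
    field_simp
    linear_combination (-besselJ n x) * hc
  · have h0 := (((hasDerivAt_besselJ μ hx).mul_const (Real.cos (μ * Real.pi))).sub
      (hasDerivAt_besselJ (-μ) hx)).div_const (Real.sin (μ * Real.pi))
    have h1 : HasDerivAt (besselY μ) _ x := h0.congr_of_eventuallyEq (by
      filter_upwards with y
      rw [besselY_of_not_int h, besselYAux]; rfl)
    refine h1.congr_deriv ?_
    rw [besselY_of_not_int h, besselY_of_not_int (not_int_add_one h), besselYAux, besselYAux]
    have c2 : Real.cos ((μ + 1) * Real.pi) = - Real.cos (μ * Real.pi) := by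
      rw [add_mul, one_mul, Real.cos_add_pi]
    have s2 : Real.sin ((μ + 1) * Real.pi) = - Real.sin (μ * Real.pi) := by
      rw [add_mul, one_mul, Real.sin_add_pi]
    have r2 := besselJ_sub_one (-μ) hx
    have hs := sin_mul_pi_ne_zero h
    rw [c2, s2, show -(μ + 1) = -μ - 1 by ring, r2]
    field_simp
    ring

lemma besselYAux_wronskian {μ : ℝ} (h : ¬ ∃ n : ℤ, μ = n) {x : ℝ} (hx : 0 < x) :
    besselJ μ x * besselYAux (μ - 1) x - besselJ (μ - 1) x * besselYAux μ x
      = 2 / (Real.pi * x) := by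
  have hW := besselJ_wronskian μ hx
  have hs := sin_mul_pi_ne_zero h
  have c1 : Real.cos ((μ - 1) * Real.pi) = - Real.cos (μ * Real.pi) := by
    rw [sub_mul, one_mul, Real.cos_sub_pi]
  have s1 : Real.sin ((μ - 1) * Real.pi) = - Real.sin (μ * Real.pi) := by
    rw [sub_mul, one_mul, Real.sin_sub_pi]
  rw [besselYAux, besselYAux, c1, s1, show -(μ - 1) = 1 - μ by ring]
  have hπ := Real.pi_ne_zero
  field_simp at hW ⊢
  linear_combination hW

/-- Integer orders are limits of noninteger ones, where the identity is the Wronskian of `J_μ` and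
`J_{-μ}` divided by `sin(μπ)`. -/
lemma bessel_wronskian (μ : ℝ) {x : ℝ} (hx : 0 < x) :
    besselJ μ x * besselY (μ - 1) x - besselJ (μ - 1) x * besselY μ x = 2 / (Real.pi * x) := by
  by_cases h : ∃ n : ℤ, μ = n
  · obtain ⟨n, rfl⟩ := h
    have hY : Tendsto (fun μ => besselYAux μ x) (𝓝[≠] (n : ℝ)) (𝓝 (besselY n x)) := by
      rw [besselY_int n hx]; exact tendsto_besselYAux n hx
    have hsub : Tendsto (fun μ : ℝ => μ - 1) (𝓝[≠] (n : ℝ)) (𝓝[≠] ((n - 1 : ℤ) : ℝ)) := by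
      refine tendsto_nhdsWithin_iff.2 ⟨?_, ?_⟩
      · have : Tendsto (fun μ : ℝ => μ - 1) (𝓝 (n : ℝ)) (𝓝 ((n : ℝ) - 1)) :=
          (continuous_id.sub continuous_const).tendsto _
        push_cast
        exact this.mono_left nhdsWithin_le_nhds
      · filter_upwards [self_mem_nhdsWithin] with μ hμ h'
        push_cast at h'
        exact hμ (by simpa using h')
    have hY1 : Tendsto (fun μ => besselYAux (μ - 1) x) (𝓝[≠] (n : ℝ))
        (𝓝 (besselY (n - 1) x)) := by
      have h2 : besselY ((n : ℝ) - 1) x = besselY ((n - 1 : ℤ) : ℝ) x := by push_cast; rfl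
      rw [h2, besselY_int (n - 1) hx]
      exact (tendsto_besselYAux (n - 1) hx).comp hsub
    have hJ : Tendsto (fun μ => besselJ μ x) (𝓝[≠] (n : ℝ)) (𝓝 (besselJ n x)) :=
      (hasDerivAt_besselJ_order (n : ℝ) hx).continuousAt.tendsto.mono_left nhdsWithin_le_nhds
    have hJ1 : Tendsto (fun μ => besselJ (μ - 1) x) (𝓝[≠] (n : ℝ)) (𝓝 (besselJ (n - 1) x)) := by
      have h2 : besselJ ((n : ℝ) - 1) x = besselJ ((n - 1 : ℤ) : ℝ) x := by push_cast; rfl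
      rw [h2]
      exact ((hasDerivAt_besselJ_order ((n - 1 : ℤ) : ℝ) hx).continuousAt.tendsto.mono_left
        nhdsWithin_le_nhds).comp hsub
    refine tendsto_nhds_unique ((hJ.mul hY1).sub (hJ1.mul hY)) ?_
    refine tendsto_const_nhds.congr' ?_
    have hev : ∀ᶠ μ : ℝ in 𝓝[≠] (n : ℝ), μ ∈ Ioo ((n : ℝ) - 1) (n + 1) :=
      mem_nhdsWithin_of_mem_nhds (Ioo_mem_nhds (by linarith) (by linarith))
    filter_upwards [hev, self_mem_nhdsWithin] with μ hμ hne
    refine (besselYAux_wronskian ?_ hx).symm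
    rintro ⟨m, rfl⟩
    apply hne
    have h1 : (n : ℝ) - 1 < m := hμ.1
    have h2 : (m : ℝ) < n + 1 := hμ.2
    have h3 : n - 1 < m := by exact_mod_cast h1
    have h4 : m < n + 1 := by exact_mod_cast h2
    have : m = n := by omega
    simp [this]
  · rw [besselY_of_not_int h, besselY_of_not_int (not_int_sub_one h)]
    exact besselYAux_wronskian h hx

/-! ### The time factors -/

/-- Only the two recurrences are used, so that `J` and `Y` are treated alike. The second derivative
is the time equation in the variable `s = η∞ - η`, up to the sign of its first order term. -/
lemma hasDerivAt_rpow_mul_cylinder {Z : ℝ → ℝ → ℝ} {z s ν : ℝ} (hz : 0 < z) (hs : 0 < s)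
    (h1 : ∀ μ x, 0 < x → HasDerivAt (Z μ) (μ / x * Z μ x - Z (μ + 1) x) x)
    (h2 : ∀ μ x, 0 < x → Z (μ - 1) x = 2 * μ / x * Z μ x - Z (μ + 1) x) :
    HasDerivAt (fun s => s ^ ν * Z ν (z * s)) (z * (s ^ ν * Z (ν - 1) (z * s))) s ∧
    HasDerivAt (fun s => z * (s ^ ν * Z (ν - 1) (z * s)))
      ((2 * ν - 1) / s * (z * (s ^ ν * Z (ν - 1) (z * s))) - z ^ 2 * (s ^ ν * Z ν (z * s))) s := by
  have hzs : 0 < z * s := mul_pos hz hs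
  have hp : HasDerivAt (fun s : ℝ => s ^ ν) (ν / s * s ^ ν) s := by
    refine ((hasDerivAt_id s).rpow_const (p := ν) (Or.inl hs.ne')).congr_deriv ?_
    simp only [id]
    rw [Real.rpow_sub hs, Real.rpow_one]
    field_simp
  have hl : HasDerivAt (fun s => z * s) z s := by simpa using (hasDerivAt_id s).const_mul z
  have hc1 := (h1 ν _ hzs).comp s hl
  have hc2 := (h1 (ν - 1) _ hzs).comp s hl
  have hr := h2 ν _ hzs
  rw [show ν - 1 + 1 = ν by ring] at hc2
  refine ⟨(hp.mul hc1).congr_deriv ?_, ((hp.mul hc2).const_mul z).congr_deriv ?_⟩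
  · rw [hr]
    simp only [Function.comp]
    field_simp
    ring
  · simp only [Function.comp]
    field_simp
    ring

lemma zfreq_pos {c r : ℝ} (hc : 0 < c) (hr : 0 < r) {l : ℕ} (hl : l ≠ 0) : 0 < zfreq c r l := by
  have : (0 : ℝ) < l := by exact_mod_cast Nat.pos_of_ne_zero hl
  rw [zfreq]; positivity

lemma zfreq_nonneg {c r : ℝ} (hc : 0 < c) (hr : 0 < r) (l : ℕ) : 0 ≤ zfreq c r l := by
  rw [zfreq]; positivity

lemma zfreq_sq (c r : ℝ) (l : ℕ) : zfreq c r l ^ 2 = c ^ 2 / r ^ 2 * (l * (l + 1)) := by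
  rw [zfreq, div_pow, mul_pow, Real.sq_sqrt (by positivity)]
  ring

lemma one_lt_nuIndex {c D ηinf : ℝ} (hc : 0 < c) (hD : 0 < D) (hη : 0 < ηinf) :
    1 < nuIndex c D ηinf := by
  rw [nuIndex]
  have : 0 < c ^ 2 * ηinf / (2 * D) := by positivity
  linarith

/-- The derivative of `timeF` on `(-∞, η∞)`. -/
def timeFD (c r D ηinf : ℝ) (l : ℕ) (η : ℝ) : ℝ :=
  if l = 0 then 0
  else -(zfreq c r l * ((ηinf - η) ^ nuIndex c D ηinf *
    (K1 c r D ηinf l * besselJ (nuIndex c D ηinf - 1) (zfreq c r l * (ηinf - η))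
      + K2 c r D ηinf l * besselY (nuIndex c D ηinf - 1) (zfreq c r l * (ηinf - η)))))

section
variable {c r D ηinf : ℝ}

lemma hasDerivAt_timeF (hc : 0 < c) (hr : 0 < r) (l : ℕ) {η : ℝ} (h : η < ηinf) :
    HasDerivAt (timeF c r D ηinf l) (timeFD c r D ηinf l η) η ∧
    HasDerivAt (timeFD c r D ηinf l)
      (-((2 * nuIndex c D ηinf - 1) / (ηinf - η)) * timeFD c r D ηinf l η
        - zfreq c r l ^ 2 * timeF c r D ηinf l η) η := by
  by_cases hl : l = 0
  · subst hl
    have e1 : timeF c r D ηinf 0 = fun _ => 1 := by funext; simp [timeF]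
    have e2 : timeFD c r D ηinf 0 = fun _ => 0 := by funext; simp [timeFD]
    rw [e1, e2]
    refine ⟨hasDerivAt_const _ _, (hasDerivAt_const _ _).congr_deriv ?_⟩
    simp [zfreq]
  · have hz := zfreq_pos hc hr hl
    have hs : 0 < ηinf - η := sub_pos.2 h
    set ν := nuIndex c D ηinf
    set z := zfreq c r l
    have hsub : HasDerivAt (fun η => ηinf - η) (-1) η := by
      simpa using (hasDerivAt_id η).const_sub ηinf
    obtain ⟨j1, j2⟩ := hasDerivAt_rpow_mul_cylinder (ν := ν) hz hs
      (fun μ x hx => hasDerivAt_besselJ μ hx) (fun μ x hx => besselJ_sub_one μ hx)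
    obtain ⟨y1, y2⟩ := hasDerivAt_rpow_mul_cylinder (ν := ν) hz hs
      (fun μ x hx => hasDerivAt_besselY μ hx) (fun μ x hx => besselY_sub_one μ hx)
    have a1 := ((j1.comp η hsub).const_mul (K1 c r D ηinf l)).add
      ((y1.comp η hsub).const_mul (K2 c r D ηinf l))
    have a2 := (((j2.comp η hsub).const_mul (K1 c r D ηinf l)).add
      ((y2.comp η hsub).const_mul (K2 c r D ηinf l))).neg
    have e1 : timeF c r D ηinf l = fun η => K1 c r D ηinf l * ((ηinf - η) ^ ν *
        besselJ ν (z * (ηinf - η))) + K2 c r D ηinf l * ((ηinf - η) ^ ν *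
        besselY ν (z * (ηinf - η))) := by
      funext η; rw [timeF, if_neg hl]; ring
    have e2 : timeFD c r D ηinf l = fun η => -(K1 c r D ηinf l * (z * ((ηinf - η) ^ ν *
        besselJ (ν - 1) (z * (ηinf - η)))) + K2 c r D ηinf l * (z * ((ηinf - η) ^ ν *
        besselY (ν - 1) (z * (ηinf - η))))) := by
      funext η; rw [timeFD, if_neg hl]; ring
    rw [e1, e2]
    refine ⟨a1.congr_deriv (by ring), a2.congr_deriv (by ring)⟩

/-- At `η = 0` the bracket of Bessel functions is their Wronskian at `z_l η∞`; the normalization of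
`K1` and `K2` cancels its value `2/(π z_l η∞)`. -/
lemma timeF_zero (hc : 0 < c) (hr : 0 < r) (hη : 0 < ηinf) (l : ℕ) :
    timeF c r D ηinf l 0 = 1 := by
  rw [timeF]
  split_ifs with hl
  · rfl
  · have hz := zfreq_pos hc hr hl
    have hW := bessel_wronskian (nuIndex c D ηinf) (mul_pos hz hη)
    rw [K1, K2, sub_zero]
    have h1 : ηinf ^ (nuIndex c D ηinf - 1) = ηinf ^ nuIndex c D ηinf / ηinf := by
      rw [Real.rpow_sub hη, Real.rpow_one]
    have h2 : ηinf ^ nuIndex c D ηinf ≠ 0 := (Real.rpow_pos_of_pos hη _).ne'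
    rw [h1]
    have hπ := Real.pi_ne_zero
    have : Real.pi * (zfreq c r l * ηinf) ≠ 0 := by positivity
    field_simp at hW ⊢
    linear_combination hW

/-- Differentiation lowers the order to `ν-1`, and at `η = 0` the bracket becomes `Y J - J Y` with
equal orders and arguments. -/
lemma timeFD_zero (l : ℕ) : timeFD c r D ηinf l 0 = 0 := by
  rw [timeFD]
  split_ifs with hl
  · rfl
  · rw [K1, K2, sub_zero]
    ring

end

/-! ### The energy estimate -/

section Energy
variable {ηinf κ z : ℝ} {F G : ℝ → ℝ}

/-- The energy has derivative `-2κ/(η∞-η) G²`, the dissipation by the damping term. -/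
lemma energy_le (hκ : 0 ≤ κ) (hF : ContinuousOn F (Ico 0 ηinf)) (hG : ContinuousOn G (Ico 0 ηinf))
    (h1 : ∀ η ∈ Ioo 0 ηinf, HasDerivAt F (G η) η)
    (h2 : ∀ η ∈ Ioo 0 ηinf, HasDerivAt G (-(κ / (ηinf - η)) * G η - z ^ 2 * F η) η)
    {η : ℝ} (hη : η ∈ Ico 0 ηinf) : G η ^ 2 + z ^ 2 * F η ^ 2 ≤ G 0 ^ 2 + z ^ 2 * F 0 ^ 2 := by
  have hd : ∀ η ∈ Ioo 0 ηinf, HasDerivAt (fun η => G η ^ 2 + z ^ 2 * F η ^ 2)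
      (-(2 * (κ / (ηinf - η)) * G η ^ 2)) η := by
    intro η hη
    have := ((h2 η hη).pow 2).add (((h1 η hη).pow 2).const_mul (z ^ 2))
    refine this.congr_deriv ?_
    simp
    ring
  have hanti : AntitoneOn (fun η => G η ^ 2 + z ^ 2 * F η ^ 2) (Ico 0 ηinf) := by
    refine antitoneOn_of_deriv_nonpos (convex_Ico _ _) ?_ ?_ ?_
    · exact (hG.pow 2).add (continuousOn_const.mul (hF.pow 2))
    · rw [interior_Ico]
      exact fun η hη => (hd η hη).differentiableAt.differentiableWithinAt
    · rw [interior_Ico]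
      intro η hη
      rw [(hd η hη).deriv]
      have : 0 ≤ κ / (ηinf - η) := div_nonneg hκ (sub_nonneg.2 hη.2.le)
      have := mul_nonneg this (sq_nonneg (G η))
      linarith
  exact hanti ⟨le_rfl, hη.1.trans_lt hη.2⟩ hη hη.1

/-- Backwards in time the energy may grow, but at rate at most `2κ/η∞`, because `κ/(η∞-η) ≤ κ/η∞`
for `η ≤ 0`. Negative times are admitted so that `η = 0` becomes an interior point for termwise
differentiation. -/
lemma energy_le_of_nonpos (hη0 : 0 < ηinf) (hκ : 0 ≤ κ)
    (h1 : ∀ η < ηinf, HasDerivAt F (G η) η)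
    (h2 : ∀ η < ηinf, HasDerivAt G (-(κ / (ηinf - η)) * G η - z ^ 2 * F η) η)
    {η : ℝ} (hη : η ≤ 0) :
    G η ^ 2 + z ^ 2 * F η ^ 2 ≤ Real.exp (-(2 * (κ / ηinf) * η)) * (G 0 ^ 2 + z ^ 2 * F 0 ^ 2) := by
  set A := 2 * (κ / ηinf) with hA
  have hd : ∀ η < ηinf, HasDerivAt (fun η => Real.exp (A * η) * (G η ^ 2 + z ^ 2 * F η ^ 2))
      (Real.exp (A * η) * (A * (G η ^ 2 + z ^ 2 * F η ^ 2)
        - 2 * (κ / (ηinf - η)) * G η ^ 2)) η := by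
    intro η hη
    have e1 := ((h2 η hη).pow 2).add (((h1 η hη).pow 2).const_mul (z ^ 2))
    have e2 : HasDerivAt (fun η => Real.exp (A * η)) (Real.exp (A * η) * A) η := by
      simpa using ((hasDerivAt_id η).const_mul A).exp
    refine (e2.mul e1).congr_deriv ?_
    simp
    ring
  have hmono : MonotoneOn (fun η => Real.exp (A * η) * (G η ^ 2 + z ^ 2 * F η ^ 2)) (Iic 0) := by
    have hlt : ∀ η ∈ Iic (0 : ℝ), η < ηinf := fun η hη => lt_of_le_of_lt hη hη0
    refine monotoneOn_of_deriv_nonneg (convex_Iic _) ?_ ?_ ?_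
    · exact fun η hη => (hd η (hlt η hη)).continuousAt.continuousWithinAt
    · exact fun η hη => (hd η (hlt η (interior_subset hη))).differentiableAt.differentiableWithinAt
    · intro η hη
      have hη' : η ≤ 0 := mem_Iic.1 (interior_subset hη)
      rw [(hd η (hlt η hη')).deriv]
      refine mul_nonneg (Real.exp_pos _).le ?_
      have : κ / (ηinf - η) ≤ κ / ηinf := div_le_div_of_nonneg_left hκ hη0 (by linarith)
      have h3 : 0 ≤ κ / ηinf := by positivity
      have h4 := mul_le_mul_of_nonneg_right this (sq_nonneg (G η))
      have h5 : 0 ≤ κ / ηinf * (z ^ 2 * F η ^ 2) := by positivity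
      rw [hA]
      nlinarith
  have h := hmono (mem_Iic.2 hη) (mem_Iic.2 le_rfl) hη
  simp only [mul_zero, Real.exp_zero, one_mul] at h
  rw [Real.exp_neg]
  rw [inv_mul_eq_div, le_div_iff₀ (Real.exp_pos _), mul_comm]
  exact h

end Energy

/-! ### Bounds for the time factors and uniqueness for the time equation -/

section
variable {c r D ηinf : ℝ}

lemma timeF_energy_le (hc : 0 < c) (hr : 0 < r) (hD : 0 < D) (hη : 0 < ηinf) (l : ℕ) {η : ℝ}
    (h : η ∈ Ico 0 ηinf) :
    timeFD c r D ηinf l η ^ 2 + zfreq c r l ^ 2 * timeF c r D ηinf l η ^ 2 ≤ zfreq c r l ^ 2 := by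
  have hν := one_lt_nuIndex hc hD hη
  have hd := fun η (hη : η < ηinf) => hasDerivAt_timeF (D := D) hc hr l hη
  have := energy_le (F := timeF c r D ηinf l) (G := timeFD c r D ηinf l) (z := zfreq c r l)
    (κ := 2 * nuIndex c D ηinf - 1) (by linarith)
    (fun η hη => (hd η hη.2).1.continuousAt.continuousWithinAt)
    (fun η hη => (hd η hη.2).2.continuousAt.continuousWithinAt)
    (fun η hη => (hd η hη.2).1) (fun η hη => (hd η hη.2).2) h
  rw [timeF_zero hc hr hη, timeFD_zero] at this
  simpa using this

lemma abs_timeF_le_one (hc : 0 < c) (hr : 0 < r) (hD : 0 < D) (hη : 0 < ηinf) (l : ℕ) {η : ℝ}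
    (h : η ∈ Ico 0 ηinf) : |timeF c r D ηinf l η| ≤ 1 := by
  by_cases hl : l = 0
  · subst hl; simp [timeF]
  have h1 := timeF_energy_le hc hr hD hη l h
  have hz := zfreq_pos hc hr hl
  rw [← sq_le_one_iff_abs_le_one]
  have : zfreq c r l ^ 2 * timeF c r D ηinf l η ^ 2 ≤ zfreq c r l ^ 2 * 1 := by
    nlinarith [sq_nonneg (timeFD c r D ηinf l η)]
  exact le_of_mul_le_mul_left this (by positivity)

/-- On `(-1, η∞ - δ)` the time factors and their first two derivatives are bounded by a multiple
of the corresponding powers of `l + 1`. -/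
lemma exists_timeF_bound (hc : 0 < c) (hr : 0 < r) (hD : 0 < D) (hη : 0 < ηinf) {b : ℝ}
    (hb : b < ηinf) : ∃ M : ℝ, 0 ≤ M ∧ ∀ (l : ℕ), ∀ η ∈ Ioo (-1) b,
      |timeF c r D ηinf l η| ≤ M ∧ |timeFD c r D ηinf l η| ≤ M * (l + 1) ∧
      |-((2 * nuIndex c D ηinf - 1) / (ηinf - η)) * timeFD c r D ηinf l η
        - zfreq c r l ^ 2 * timeF c r D ηinf l η| ≤ M * (l + 1) ^ 2 := by
  have hν := one_lt_nuIndex hc hD hη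
  set κ := 2 * nuIndex c D ηinf - 1 with hκdef
  have hκ : 0 ≤ κ := by rw [hκdef]; linarith
  -- `B²` is the largest value of `exp(-2(κ/η∞)η)` on `[-1, 0]`, the growth factor of the energy at
  -- negative times.
  set B := Real.exp (κ / ηinf) with hB
  have hB1 : 1 ≤ B := Real.one_le_exp (by positivity)
  have hzl : ∀ l : ℕ, zfreq c r l ≤ c / r * (l + 1) := by
    intro l
    rw [zfreq, mul_div_right_comm]
    refine mul_le_mul_of_nonneg_left ?_ (by positivity)
    rw [Real.sqrt_le_left (by positivity)]
    nlinarith [(Nat.cast_nonneg l : (0 : ℝ) ≤ l)]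
  have hE : ∀ (l : ℕ), ∀ η ∈ Ioo (-1) b,
      timeFD c r D ηinf l η ^ 2 + zfreq c r l ^ 2 * timeF c r D ηinf l η ^ 2
        ≤ (B * zfreq c r l) ^ 2 := by
    intro l η h
    rcases le_total 0 η with h0 | h0
    · refine (timeF_energy_le hc hr hD hη l ⟨h0, h.2.trans hb⟩).trans ?_
      rw [mul_pow]
      exact le_mul_of_one_le_left (sq_nonneg _) (one_le_pow₀ hB1)
    · have := energy_le_of_nonpos (F := timeF c r D ηinf l) (G := timeFD c r D ηinf l)
        (z := zfreq c r l) (κ := κ) hη hκ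
        (fun η hη => (hasDerivAt_timeF (D := D) hc hr l hη).1)
        (fun η hη => (hasDerivAt_timeF (D := D) hc hr l hη).2) h0
      rw [timeF_zero hc hr hη, timeFD_zero] at this
      refine this.trans ?_
      simp only [ne_eq, OfNat.ofNat_ne_zero, not_false_eq_true, zero_pow, one_pow, mul_one, zero_add]
      rw [mul_pow]
      refine mul_le_mul_of_nonneg_right ?_ (sq_nonneg _)
      rw [hB, ← Real.exp_nat_mul]
      refine Real.exp_le_exp.2 ?_
      have : 0 ≤ κ / ηinf := by positivity
      push_cast
      nlinarith [h.1]
  have hF : ∀ (l : ℕ), ∀ η ∈ Ioo (-1) b, |timeF c r D ηinf l η| ≤ B := by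
    intro l η h
    by_cases hl : l = 0
    · subst hl; simpa [timeF] using hB1
    have hz := zfreq_pos hc hr hl
    refine abs_le_of_sq_le_sq ?_ (by positivity)
    have h1 := hE l η h
    have : zfreq c r l ^ 2 * timeF c r D ηinf l η ^ 2 ≤ zfreq c r l ^ 2 * B ^ 2 := by
      nlinarith [sq_nonneg (timeFD c r D ηinf l η)]
    exact le_of_mul_le_mul_left this (by positivity)
  have hFD : ∀ (l : ℕ), ∀ η ∈ Ioo (-1) b, |timeFD c r D ηinf l η| ≤ B * (c / r) * (l + 1) := by
    intro l η h
    have h0 := zfreq_nonneg hc hr l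
    have : |timeFD c r D ηinf l η| ≤ B * zfreq c r l := by
      refine abs_le_of_sq_le_sq ?_ (by positivity)
      nlinarith [hE l η h, sq_nonneg (zfreq c r l * timeF c r D ηinf l η)]
    refine this.trans ?_
    rw [mul_assoc]
    exact mul_le_mul_of_nonneg_left (hzl l) (by positivity)
  set q := κ / (ηinf - b) with hq
  have hq0 : 0 ≤ q := div_nonneg hκ (by linarith)
  refine ⟨B + B * (c / r) + q * (B * (c / r)) + (c / r) ^ 2 * B, by positivity,
    fun l η h => ⟨?_, ?_, ?_⟩⟩
  · refine (hF l η h).trans ?_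
    have : 0 ≤ B * (c / r) + q * (B * (c / r)) + (c / r) ^ 2 * B := by positivity
    linarith
  · refine (hFD l η h).trans (mul_le_mul_of_nonneg_right ?_ (by positivity))
    have : 0 ≤ B + q * (B * (c / r)) + (c / r) ^ 2 * B := by positivity
    linarith
  · have h1 : κ / (ηinf - η) ≤ q :=
      div_le_div_of_nonneg_left hκ (by linarith) (by linarith [h.2])
    have h1' : 0 ≤ κ / (ηinf - η) := div_nonneg hκ (by linarith [h.2])
    have h2 : |-(κ / (ηinf - η)) * timeFD c r D ηinf l η| ≤ q * (B * (c / r) * (l + 1)) := by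
      rw [abs_mul, abs_neg, abs_of_nonneg h1']
      exact mul_le_mul h1 (hFD l η h) (abs_nonneg _) hq0
    have h3 : |zfreq c r l ^ 2 * timeF c r D ηinf l η| ≤ (c / r * (l + 1)) ^ 2 * B := by
      rw [abs_mul, abs_of_nonneg (sq_nonneg _)]
      exact mul_le_mul (pow_le_pow_left₀ (zfreq_nonneg hc hr l) (hzl l) 2) (hF l η h)
        (abs_nonneg _) (by positivity)
    refine (abs_sub _ _).trans ((add_le_add h2 h3).trans ?_)
    have hl1 : (1 : ℝ) ≤ l + 1 := by linarith [(Nat.cast_nonneg l : (0 : ℝ) ≤ l)]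
    have h4 : q * (B * (c / r) * (l + 1)) ≤ q * (B * (c / r)) * (l + 1) ^ 2 := by
      have : 0 ≤ q * (B * (c / r)) * (l + 1) := by positivity
      nlinarith
    have h5 : 0 ≤ (B + B * (c / r)) * ((l : ℝ) + 1) ^ 2 := by positivity
    nlinarith

/-- Uniqueness for the time equation. -/
lemma eq_timeF_mul_of_ode (hc : 0 < c) (hr : 0 < r) (hD : 0 < D) (hη : 0 < ηinf) (l : ℕ)
    {g g' : ℝ → ℝ} {a : ℝ} (hg : ContinuousOn g (Ico 0 ηinf)) (hg' : ContinuousOn g' (Ico 0 ηinf))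
    (h1 : ∀ η ∈ Ioo 0 ηinf, HasDerivAt g (g' η) η)
    (h2 : ∀ η ∈ Ioo 0 ηinf, HasDerivAt g' (-((2 * nuIndex c D ηinf - 1) / (ηinf - η)) * g' η
      - zfreq c r l ^ 2 * g η) η)
    (h0 : g 0 = a) (h0' : g' 0 = 0) {η : ℝ} (h : η ∈ Ico 0 ηinf) :
    g η = timeF c r D ηinf l η * a := by
  have hν := one_lt_nuIndex hc hD hη
  have hd := fun η (hη : η < ηinf) => hasDerivAt_timeF (D := D) hc hr l hη
  have hcF : ContinuousOn (timeF c r D ηinf l) (Ico 0 ηinf) :=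
    fun η hη => (hd η hη.2).1.continuousAt.continuousWithinAt
  have hcG : ContinuousOn (timeFD c r D ηinf l) (Ico 0 ηinf) :=
    fun η hη => (hd η hη.2).2.continuousAt.continuousWithinAt
  -- The difference has zero initial energy, hence zero energy. Only the derivative part is read
  -- off, because `z_0 = 0` hides the values for `l = 0`; equality of the values then follows from
  -- constancy.
  have key : ∀ η ∈ Ico 0 ηinf, g' η - timeFD c r D ηinf l η * a = 0 := by
    intro η hη'
    have := energy_le (F := fun η => g η - timeF c r D ηinf l η * a)
      (G := fun η => g' η - timeFD c r D ηinf l η * a) (z := zfreq c r l)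
      (κ := 2 * nuIndex c D ηinf - 1) (ηinf := ηinf) (by linarith)
      (hg.sub (hcF.mul continuousOn_const)) (hg'.sub (hcG.mul continuousOn_const))
      (fun η hη => (h1 η hη).sub ((hd η hη.2).1.mul_const a))
      (fun η hη => ((h2 η hη).sub ((hd η hη.2).2.mul_const a)).congr_deriv (by ring)) hη'
    simp only [h0, h0', timeF_zero hc hr hη, timeFD_zero] at this
    simp only [one_mul, sub_self, zero_mul, ne_eq, OfNat.ofNat_ne_zero, not_false_eq_true, zero_pow,
      mul_zero, add_zero] at this
    have h3 : 0 ≤ zfreq c r l ^ 2 * (g η - timeF c r D ηinf l η * a) ^ 2 := by positivity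
    have h4 : (g' η - timeFD c r D ηinf l η * a) ^ 2 = 0 :=
      le_antisymm (by linarith) (sq_nonneg _)
    exact pow_eq_zero_iff (two_ne_zero) |>.1 h4
  have hconst : ∀ x ∈ Ico 0 ηinf, ∀ y ∈ Ico 0 ηinf, g x - timeF c r D ηinf l x * a
      = g y - timeF c r D ηinf l y * a := by
    intro x hx y hy
    have hcd : ContinuousOn (fun x => g x - timeF c r D ηinf l x * a) (Ico 0 ηinf) :=
      hg.sub (hcF.mul continuousOn_const)
    have hdd : ∀ x ∈ Ioo 0 ηinf, HasDerivAt (fun x => g x - timeF c r D ηinf l x * a) 0 x :=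
      fun x hx => ((h1 x hx).sub ((hd x hx.2).1.mul_const a)).congr_deriv
        (key x ⟨hx.1.le, hx.2⟩)
    have hm : MonotoneOn (fun x => g x - timeF c r D ηinf l x * a) (Ico 0 ηinf) := by
      refine monotoneOn_of_deriv_nonneg (convex_Ico _ _) hcd ?_ ?_ <;> rw [interior_Ico]
      · exact fun x hx => (hdd x hx).differentiableAt.differentiableWithinAt
      · exact fun x hx => (hdd x hx).deriv.ge
    have ha : AntitoneOn (fun x => g x - timeF c r D ηinf l x * a) (Ico 0 ηinf) := by
      refine antitoneOn_of_deriv_nonpos (convex_Ico _ _) hcd ?_ ?_ <;> rw [interior_Ico]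
      · exact fun x hx => (hdd x hx).differentiableAt.differentiableWithinAt
      · exact fun x hx => (hdd x hx).deriv.le
    rcases le_total x y with h | h
    · exact le_antisymm (hm hx hy h) (ha hx hy h)
    · exact le_antisymm (ha hy hx h) (hm hy hx h)
  have := hconst η h 0 ⟨le_rfl, hη⟩
  rw [h0, timeF_zero hc hr hη] at this
  linarith

/-- Here `e'/e = 1/(η∞-η)` and `2ν-1 = c²η∞/D + 1`, which is where the index `ν` comes from. -/
lemma damping_eq (hη : 0 < ηinf) {η : ℝ} (h : η < ηinf) (hc : 0 < c) (hD : 0 < D) :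
    damping c D ηinf η = 1 / c ^ 2 * ((2 * nuIndex c D ηinf - 1) / (ηinf - η)) := by
  have hs : ηinf - η ≠ 0 := (sub_pos.2 h).ne'
  have hd : HasDerivAt (expansion ηinf) (ηinf / (ηinf - η) ^ 2) η := by
    have h1 : HasDerivAt (fun η => ηinf - η) (-1) η := by
      simpa using (hasDerivAt_id η).const_sub ηinf
    have := (hasDerivAt_const η ηinf).div h1 hs
    refine this.congr_deriv ?_
    simp
  rw [damping, hd.deriv, expansion, nuIndex]
  field_simp
  ring

end

/-! ### Smooth maps to and from the sphere -/

lemma contMDiff_coe_S2 {n : WithTop ℕ∞} :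
    ContMDiff (𝓡 2) 𝓘(ℝ, E3) n fun x : S2 => (x : E3) := by
  have : Fact (Module.finrank ℝ E3 = 2 + 1) := ⟨finrank_euclideanSpace_fin⟩
  exact contMDiff_coe_sphere

lemma contMDiff_codRestrict_S2 {E : Type*} [NormedAddCommGroup E] [NormedSpace ℝ E]
    {n : WithTop ℕ∞} {f : E → E3} (hf : ContDiff ℝ n f)
    (h : ∀ x, f x ∈ Metric.sphere (0 : E3) 1) :
    ContMDiff 𝓘(ℝ, E) (𝓡 2) n fun x => (⟨f x, h x⟩ : S2) := by
  have : Fact (Module.finrank ℝ E3 = 2 + 1) := ⟨finrank_euclideanSpace_fin⟩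
  exact hf.contMDiff.codRestrict_sphere h

/-! ### Angular coordinates -/

/-- The unit vector `(1, 0, 0)`. -/
def ePole : E3 := EuclideanSpace.single 0 1

/-- The equatorial unit vector of longitude `φ`. -/
def eEq (φ : ℝ) : E3 := Real.cos φ • EuclideanSpace.single 1 1 + Real.sin φ • EuclideanSpace.single 2 1

/-- The derivative of `eEq`. -/
def eLon (φ : ℝ) : E3 :=
  -Real.sin φ • EuclideanSpace.single 1 1 + Real.cos φ • EuclideanSpace.single 2 1

/-- The unit tangent vector in the direction of increasing colatitude. -/
def eCol (θ φ : ℝ) : E3 := -Real.sin θ • ePole + Real.cos θ • eEq φ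

lemma coe_sph (θ φ : ℝ) : (sph θ φ : E3) = Real.cos θ • ePole + Real.sin θ • eEq φ := by
  ext i
  fin_cases i <;> simp [sph, ePole, eEq]

lemma sph_apply_zero (θ φ : ℝ) : (sph θ φ : E3) 0 = Real.cos θ := by simp [sph]
lemma sph_apply_one (θ φ : ℝ) : (sph θ φ : E3) 1 = Real.sin θ * Real.cos φ := by simp [sph]
lemma sph_apply_two (θ φ : ℝ) : (sph θ φ : E3) 2 = Real.sin θ * Real.sin φ := by simp [sph]

lemma hasDerivAt_eEq (φ : ℝ) : HasDerivAt eEq (eLon φ) φ :=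
  ((Real.hasDerivAt_cos φ).smul_const _).add ((Real.hasDerivAt_sin φ).smul_const _)

lemma hasDerivAt_eLon (φ : ℝ) : HasDerivAt eLon (-eEq φ) φ := by
  refine (((Real.hasDerivAt_sin φ).neg.smul_const _).add
    ((Real.hasDerivAt_cos φ).smul_const _)).congr_deriv ?_
  rw [eEq, neg_add, neg_smul, neg_smul]

lemma hasDerivAt_sph_col (θ φ : ℝ) : HasDerivAt (fun t => (sph t φ : E3)) (eCol θ φ) θ := by
  simp_rw [coe_sph]
  exact ((Real.hasDerivAt_cos θ).smul_const _).add ((Real.hasDerivAt_sin θ).smul_const _)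

lemma hasDerivAt_eCol (θ φ : ℝ) : HasDerivAt (fun t => eCol t φ) (-(sph θ φ : E3)) θ := by
  refine (((Real.hasDerivAt_sin θ).neg.smul_const _).add
    ((Real.hasDerivAt_cos θ).smul_const _)).congr_deriv ?_
  rw [coe_sph, neg_add, neg_smul, neg_smul]

lemma hasDerivAt_sph_lon (θ φ : ℝ) :
    HasDerivAt (fun s => (sph θ s : E3)) (Real.sin θ • eLon φ) φ := by
  simp_rw [coe_sph]
  exact ((hasDerivAt_eEq φ).const_smul (Real.sin θ)).const_add _

lemma continuous_eEq : Continuous eEq := by unfold eEq; fun_prop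
lemma continuous_eLon : Continuous eLon := by unfold eLon; fun_prop
lemma continuous_eCol : Continuous fun p : ℝ × ℝ => eCol p.1 p.2 := by
  have := continuous_eEq
  unfold eCol; fun_prop

lemma contDiff_coe_sph {n : WithTop ℕ∞} : ContDiff ℝ n fun p : ℝ × ℝ => (sph p.1 p.2 : E3) := by
  simp_rw [coe_sph, eEq]
  fun_prop

lemma contMDiff_sph {n : WithTop ℕ∞} :
    ContMDiff 𝓘(ℝ, ℝ × ℝ) (𝓡 2) n fun p : ℝ × ℝ => sph p.1 p.2 :=
  contMDiff_codRestrict_S2 contDiff_coe_sph fun p => (sph p.1 p.2).2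

lemma continuous_sph : Continuous fun p : ℝ × ℝ => sph p.1 p.2 :=
  (contMDiff_sph (n := 0)).continuous

lemma sph_surj (x : S2) : ∃ θ ∈ Icc 0 Real.pi, ∃ φ ∈ Ico 0 (2 * Real.pi), sph θ φ = x := by
  obtain ⟨x, hx⟩ := x
  have hx1 : x 0 ^ 2 + (x 1 ^ 2 + x 2 ^ 2) = 1 := by
    rw [mem_sphere_zero_iff_norm, EuclideanSpace.norm_eq, Real.sqrt_eq_one] at hx
    simp only [Fin.sum_univ_three, Real.norm_eq_abs, sq_abs] at hx
    linarith
  have h0 : x 0 ∈ Icc (-1) 1 := by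
    constructor <;> nlinarith [sq_nonneg (x 1), sq_nonneg (x 2)]
  set θ := Real.arccos (x 0)
  have hc : Real.cos θ = x 0 := Real.cos_arccos h0.1 h0.2
  have hs : Real.sin θ = Real.sqrt (x 1 ^ 2 + x 2 ^ 2) := by
    rw [Real.sin_arccos]; congr 1; linarith
  set z : ℂ := ⟨x 1, x 2⟩ with hz
  have hzn : ‖z‖ = Real.sqrt (x 1 ^ 2 + x 2 ^ 2) := by
    rw [Complex.norm_eq_sqrt_sq_add_sq]
  set φ := toIcoMod Real.two_pi_pos 0 z.arg with hφ
  have hφm : φ ∈ Ico 0 (2 * Real.pi) := by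
    have := toIcoMod_mem_Ico Real.two_pi_pos 0 z.arg
    simpa using this
  have harg : (z.arg : ℝ) = φ + toIcoDiv Real.two_pi_pos 0 z.arg * (2 * Real.pi) := by
    have := toIcoMod_add_toIcoDiv_zsmul Real.two_pi_pos 0 z.arg
    rw [zsmul_eq_mul] at this
    exact this.symm
  have hcos : Real.cos z.arg = Real.cos φ := by rw [harg, Real.cos_add_int_mul_two_pi]
  have hsin : Real.sin z.arg = Real.sin φ := by rw [harg, Real.sin_add_int_mul_two_pi]
  refine ⟨θ, ⟨Real.arccos_nonneg _, Real.arccos_le_pi _⟩, φ, hφm, Subtype.ext ?_⟩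
  have e1 : ‖z‖ * Real.cos z.arg = x 1 := Complex.norm_mul_cos_arg z
  have e2 : ‖z‖ * Real.sin z.arg = x 2 := Complex.norm_mul_sin_arg z
  ext i
  fin_cases i
  · simp [sph, hc]
  · simp [sph, hs, ← hzn, ← hcos, e1]
  · simp [sph, hs, ← hzn, ← hsin, e2]

/-! ### The radial projection and homogeneous extensions -/

/-- The north pole `(1, 0, 0)`. -/
def northPole : S2 := sph 0 0

lemma coe_northPole : (northPole : E3) = ePole := by
  rw [northPole, coe_sph]; simp

open Classical in
/-- The radial projection onto the sphere. -/
def radial (x : E3) : S2 :=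
  if h : x ≠ 0 then ⟨‖x‖⁻¹ • x, by
    rw [mem_sphere_zero_iff_norm, norm_smul, norm_inv, norm_norm,
      inv_mul_cancel₀ (norm_ne_zero_iff.2 h)]⟩
  else northPole

lemma coe_radial {x : E3} (h : x ≠ 0) : (radial x : E3) = ‖x‖⁻¹ • x := by
  rw [radial, dif_pos h]

lemma S2_ne_zero (x : S2) : (x : E3) ≠ 0 := by
  have := ne_zero_of_mem_unit_sphere x
  exact this

lemma S2_norm (x : S2) : ‖(x : E3)‖ = 1 := mem_sphere_zero_iff_norm.1 x.2

lemma radial_coe (x : S2) : radial (x : E3) = x :=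
  Subtype.ext (by rw [coe_radial (S2_ne_zero x), S2_norm]; simp)

lemma radial_smul {t : ℝ} (ht : 0 < t) (x : E3) : radial (t • x) = radial x := by
  by_cases hx : x = 0
  · simp [hx]
  · refine Subtype.ext ?_
    rw [coe_radial hx, coe_radial (smul_ne_zero ht.ne' hx), norm_smul, Real.norm_of_nonneg ht.le,
      smul_smul]
    congr 1
    field_simp

/-- Corestriction to the sphere is applied to globally smooth maps, so the identity is first
modified to `ρ(y) = x + χ(y)(y-x)`. The cut-off lives in the ball of radius `‖x‖/2`, hence `ρ` never
vanishes, and `ρ(y) = y` near `x`. -/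
lemma contMDiffAt_radial {n : WithTop ℕ∞} (hn : n ≤ (⊤ : ℕ∞)) {x : E3} (hx : x ≠ 0) :
    ContMDiffAt 𝓘(ℝ, E3) (𝓡 2) n radial x := by
  have hxn : 0 < ‖x‖ := norm_pos_iff.2 hx
  let χ : ContDiffBump x := ⟨‖x‖ / 4, ‖x‖ / 2, by positivity, by linarith⟩
  let ρ : E3 → E3 := fun y => x + χ y • (y - x)
  have hρ0 : ∀ y, ρ y ≠ 0 := by
    intro y h
    have h1 : ‖χ y • (y - x)‖ < ‖x‖ := by
      by_cases hy : y ∈ Metric.ball x (‖x‖ / 2)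
      · rw [norm_smul, Real.norm_of_nonneg χ.nonneg]
        have := χ.le_one (x := y)
        rw [mem_ball_iff_norm] at hy
        nlinarith [norm_nonneg (y - x), χ.nonneg (x := y)]
      · have : χ y = 0 := by
          refine χ.zero_of_le_dist ?_
          simpa using hy
        rw [this, zero_smul, norm_zero]; exact hxn
    have h2 : ‖x‖ = ‖χ y • (y - x)‖ := by
      rw [← norm_neg (χ y • (y - x)), ← eq_neg_of_add_eq_zero_left h]
    exact h1.ne h2.symm
  have hρ : ContDiff ℝ n ρ := by
    have : ContDiff ℝ n χ := χ.contDiff.of_le hn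
    fun_prop
  have hcd : ContDiff ℝ n fun y => ‖ρ y‖⁻¹ • ρ y :=
    ((hρ.norm ℝ hρ0).inv fun y => (norm_ne_zero_iff.2 (hρ0 y))).smul hρ
  have hm : ContMDiff 𝓘(ℝ, E3) (𝓡 2) n fun y => radial (ρ y) := by
    have h3 : ∀ y, ‖ρ y‖⁻¹ • ρ y ∈ Metric.sphere (0 : E3) 1 := fun y => by
      rw [← coe_radial (hρ0 y)]; exact (radial (ρ y)).2
    have := contMDiff_codRestrict_S2 hcd h3
    refine this.congr fun y => Subtype.ext ?_
    rw [coe_radial (hρ0 y)]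
  refine (hm x).congr_of_eventuallyEq ?_
  have : ∀ᶠ y in 𝓝 x, χ y = 1 := by
    filter_upwards [Metric.closedBall_mem_nhds x (ε := ‖x‖ / 4) (by positivity)] with y hy
    exact χ.one_of_mem_closedBall hy
  filter_upwards [this] with y hy
  simp [ρ, hy]

/-- The extension of a function on the sphere to a function homogeneous of degree `0`. -/
def homExt (f : S2 → ℝ) (x : E3) : ℝ := f (radial x)

/-- A twice continuously differentiable function on the sphere. -/
abbrev IsC2 (f : S2 → ℝ) : Prop := ContMDiff (𝓡 2) 𝓘(ℝ, ℝ) 2 f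

lemma homExt_coe (f : S2 → ℝ) (x : S2) : homExt f x = f x := by rw [homExt, radial_coe]

lemma homExt_smul (f : S2 → ℝ) {t : ℝ} (ht : 0 < t) (x : E3) : homExt f (t • x) = homExt f x := by
  rw [homExt, homExt, radial_smul ht]

lemma contDiffAt_homExt {f : S2 → ℝ} {n : WithTop ℕ∞} (hn : n ≤ (⊤ : ℕ∞))
    (hf : ContMDiff (𝓡 2) 𝓘(ℝ, ℝ) n f) {x : E3} (hx : x ≠ 0) : ContDiffAt ℝ n (homExt f) x :=
  contMDiffAt_iff_contDiffAt.1 ((hf (radial x)).comp x (contMDiffAt_radial hn hx))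

lemma contMDiff_of_contDiffAt {g : E3 → ℝ} {n : WithTop ℕ∞}
    (hg : ∀ x : S2, ContDiffAt ℝ n g x) : ContMDiff (𝓡 2) 𝓘(ℝ, ℝ) n fun x : S2 => g x :=
  fun x => (hg x).contMDiffAt.comp x (contMDiff_coe_S2 x)

/-! ### Second derivatives along curves -/

lemma contDiffAt_two_fderiv {g : E3 → ℝ} {x : E3} (hg : ContDiffAt ℝ 2 g x) :
    DifferentiableAt ℝ (fderiv ℝ g) x :=
  (hg.fderiv_right (m := 1) (by norm_num)).differentiableAt (by norm_num)

lemma hasDerivAt_fderiv_curve {g : E3 → ℝ} {γ γ' : ℝ → E3} {a : E3} {t : ℝ}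
    (hg : ContDiffAt ℝ 2 g (γ t)) (h1 : HasDerivAt γ (γ' t) t) (h2 : HasDerivAt γ' a t) :
    HasDerivAt (fun s => fderiv ℝ g (γ s) (γ' s))
      (fderiv ℝ (fderiv ℝ g) (γ t) (γ' t) (γ' t) + fderiv ℝ g (γ t) a) t :=
  HasDerivAt.clm_apply
    ((contDiffAt_two_fderiv hg).hasFDerivAt.comp_hasDerivAt t h1) h2

lemma hasDerivAt_comp_curve {g : E3 → ℝ} {γ : ℝ → E3} {v : E3} {t : ℝ}
    (hg : ContDiffAt ℝ 2 g (γ t)) (h1 : HasDerivAt γ v t) :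
    HasDerivAt (fun s => g (γ s)) (fderiv ℝ g (γ t) v) t :=
  (hg.differentiableAt (by norm_num)).hasFDerivAt.comp_hasDerivAt t h1

lemma fderiv_homExt_self {f : S2 → ℝ} (hf : IsC2 f) (x : S2) :
    fderiv ℝ (homExt f) x x = 0 := by
  have hl : HasDerivAt (fun t : ℝ => t • (x : E3)) (x : E3) 1 := by
    simpa using (hasDerivAt_id (1 : ℝ)).smul_const (x : E3)
  have h1 : HasDerivAt (fun t : ℝ => homExt f (t • (x : E3))) _ 1 :=
    hasDerivAt_comp_curve (g := homExt f) (γ := fun t : ℝ => t • (x : E3))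
    (by simpa using contDiffAt_homExt (by exact WithTop.coe_le_coe.2 le_top) hf (S2_ne_zero x)) hl
  have h2 : HasDerivAt (fun t : ℝ => homExt f (t • (x : E3))) 0 1 := by
    refine (hasDerivAt_const (1 : ℝ) (homExt f x)).congr_of_eventuallyEq ?_
    filter_upwards [lt_mem_nhds (zero_lt_one (α := ℝ))] with t ht
    exact homExt_smul f ht x
  simpa using h1.unique h2

lemma fderiv_fderiv_homExt_self {f : S2 → ℝ} (hf : IsC2 f) (x : S2) :
    fderiv ℝ (fderiv ℝ (homExt f)) x x x = 0 := by
  have hl : ∀ t : ℝ, HasDerivAt (fun t : ℝ => t • (x : E3)) (x : E3) t := fun t => by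
    simpa using (hasDerivAt_id t).smul_const (x : E3)
  have hg : ∀ t : ℝ, 0 < t → ContDiffAt ℝ 2 (homExt f) (t • (x : E3)) := fun t ht =>
    contDiffAt_homExt (by exact WithTop.coe_le_coe.2 le_top) hf (smul_ne_zero ht.ne' (S2_ne_zero x))
  have h1 := hasDerivAt_fderiv_curve (γ := fun t : ℝ => t • (x : E3)) (γ' := fun _ => (x : E3))
    (hg 1 one_pos) (hl 1) (hasDerivAt_const (1 : ℝ) (x : E3))
  have h0 : ∀ t : ℝ, 0 < t → fderiv ℝ (homExt f) (t • (x : E3)) x = 0 := by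
    intro t ht
    have a1 := hasDerivAt_comp_curve (g := homExt f) (hg t ht) (hl t)
    have a2 : HasDerivAt (fun t : ℝ => homExt f (t • (x : E3))) 0 t := by
      refine (hasDerivAt_const t (homExt f x)).congr_of_eventuallyEq ?_
      filter_upwards [lt_mem_nhds ht] with t ht
      exact homExt_smul f ht x
    exact a1.unique a2
  have h2 : HasDerivAt (fun s : ℝ => fderiv ℝ (homExt f) (s • (x : E3)) x) 0 1 := by
    refine (hasDerivAt_const (1 : ℝ) (0 : ℝ)).congr_of_eventuallyEq ?_
    filter_upwards [lt_mem_nhds (zero_lt_one (α := ℝ))] with t ht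
    exact h0 t ht
  simpa using h1.unique h2

/-! ### The Laplace-Beltrami operator -/

/-- The Laplace-Beltrami operator of the sphere: the Euclidean Laplacian of the extension
homogeneous of degree `0`. -/
def lap (f : S2 → ℝ) (x : S2) : ℝ := Laplacian.laplacian (homExt f) (x : E3)

lemma lap_eq_sum {ι : Type*} [Fintype ι] (b : OrthonormalBasis ι ℝ E3) (f : S2 → ℝ) (x : S2) :
    lap f x = ∑ i, fderiv ℝ (fderiv ℝ (homExt f)) x (b i) (b i) := by
  rw [lap, InnerProductSpace.laplacian_eq_iteratedFDeriv_orthonormalBasis _ b]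
  simp only [iteratedFDeriv_two_apply]
  rfl

lemma two_le_top : (2 : WithTop ℕ∞) ≤ ((⊤ : ℕ∞) : WithTop ℕ∞) := by
  exact WithTop.coe_le_coe.2 le_top

lemma continuousAt_fderiv_fderiv_homExt {f : S2 → ℝ} (hf : IsC2 f) {x : E3} (hx : x ≠ 0) :
    ContinuousAt (fderiv ℝ (fderiv ℝ (homExt f))) x := by
  have h1 := (contDiffAt_homExt two_le_top hf hx).fderiv_right (m := 1) (by norm_num)
  exact (h1.fderiv_right (m := 0) (by norm_num)).continuousAt

lemma continuousAt_fderiv_homExt {f : S2 → ℝ} (hf : IsC2 f) {x : E3} (hx : x ≠ 0) :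
    ContinuousAt (fderiv ℝ (homExt f)) x :=
  ((contDiffAt_homExt two_le_top hf hx).fderiv_right (m := 1) (by norm_num)).continuousAt

lemma continuous_lap {f : S2 → ℝ} (hf : IsC2 f) : Continuous (lap f) := by
  rw [funext (lap_eq_sum (stdOrthonormalBasis ℝ E3) f)]
  refine continuous_finsetSum _ fun i _ => ?_
  have : Continuous fun x : S2 => fderiv ℝ (fderiv ℝ (homExt f)) (x : E3) :=
    continuous_iff_continuousAt.2 fun x =>
      ContinuousAt.comp (f := fun x : S2 => (x : E3))
        (continuousAt_fderiv_fderiv_homExt hf (S2_ne_zero x)) continuous_subtype_val.continuousAt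
  fun_prop

/-- The orthonormal basis at a point of the sphere given by angular coordinates. -/
def angFrame (θ φ : ℝ) : Fin 3 → E3 := ![(sph θ φ : E3), eCol θ φ, eLon φ]

lemma orthonormal_angFrame (θ φ : ℝ) : Orthonormal ℝ (angFrame θ φ) := by
  have hφ := Real.sin_sq_add_cos_sq φ
  have hθ := Real.sin_sq_add_cos_sq θ
  have h : ∀ x y : E3, inner ℝ x y = x 0 * y 0 + x 1 * y 1 + x 2 * y 2 := fun x y => by
    simp only [PiLp.inner_apply, Fin.sum_univ_three, RCLike.inner_apply, conj_trivial]
    ring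
  rw [orthonormal_iff_ite]
  intro i j
  fin_cases i <;> fin_cases j <;> rw [h] <;>
    simp [angFrame, sph, eCol, ePole, eEq, eLon] <;> grind

lemma exists_angBasis (θ φ : ℝ) : ∃ b : OrthonormalBasis (Fin 3) ℝ E3, ⇑b = angFrame θ φ := by
  have ho := orthonormal_angFrame θ φ
  have hs : ⊤ ≤ Submodule.span ℝ (Set.range (angFrame θ φ)) := by
    rw [LinearIndependent.span_eq_top_of_card_eq_finrank ho.linearIndependent (by simp)]
  exact ⟨OrthonormalBasis.mk ho hs, OrthonormalBasis.coe_mk ho hs⟩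

lemma deriv_sph_col {f : S2 → ℝ} (hf : IsC2 f) (θ φ : ℝ) :
    HasDerivAt (fun t => f (sph t φ)) (fderiv ℝ (homExt f) (sph θ φ) (eCol θ φ)) θ := by
  have := hasDerivAt_comp_curve (contDiffAt_homExt two_le_top hf (S2_ne_zero (sph θ φ)))
    (hasDerivAt_sph_col θ φ)
  simpa only [homExt_coe] using this

lemma deriv_sph_lon {f : S2 → ℝ} (hf : IsC2 f) (θ φ : ℝ) :
    HasDerivAt (fun s => f (sph θ s))
      (Real.sin θ * fderiv ℝ (homExt f) (sph θ φ) (eLon φ)) φ := by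
  have := hasDerivAt_comp_curve (contDiffAt_homExt two_le_top hf (S2_ne_zero (sph θ φ)))
    (hasDerivAt_sph_lon θ φ)
  simpa only [homExt_coe, map_smul, smul_eq_mul] using this

/-- Meridians are great circles: their acceleration is radial and is annihilated by the derivative
of a function homogeneous of degree `0`. -/
lemma deriv_deriv_sph_col {f : S2 → ℝ} (hf : IsC2 f) (θ φ : ℝ) :
    HasDerivAt (fun t => fderiv ℝ (homExt f) (sph t φ) (eCol t φ))
      (fderiv ℝ (fderiv ℝ (homExt f)) (sph θ φ) (eCol θ φ) (eCol θ φ)) θ := by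
  refine (hasDerivAt_fderiv_curve (contDiffAt_homExt two_le_top hf (S2_ne_zero (sph θ φ)))
    (hasDerivAt_sph_col θ φ) (hasDerivAt_eCol θ φ)).congr_deriv ?_
  rw [map_neg, fderiv_homExt_self hf, neg_zero, add_zero]

/-- A parallel is not a geodesic. Its acceleration `-sin θ • eEq φ` has a radial part, which is
annihilated, and a part `-sin θ cos θ • eCol θ φ`, which is not. -/
lemma deriv_deriv_sph_lon {f : S2 → ℝ} (hf : IsC2 f) (θ φ : ℝ) :
    HasDerivAt (fun s => Real.sin θ * fderiv ℝ (homExt f) (sph θ s) (eLon s))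
      (Real.sin θ ^ 2 * fderiv ℝ (fderiv ℝ (homExt f)) (sph θ φ) (eLon φ) (eLon φ)
        - Real.sin θ * Real.cos θ * fderiv ℝ (homExt f) (sph θ φ) (eCol θ φ)) φ := by
  have h := hasDerivAt_fderiv_curve (γ' := fun s => Real.sin θ • eLon s)
    (contDiffAt_homExt two_le_top hf (S2_ne_zero (sph θ φ)))
    (hasDerivAt_sph_lon θ φ) ((hasDerivAt_eLon φ).const_smul (Real.sin θ))
  simp only [map_smul, smul_eq_mul] at h
  refine h.congr_deriv ?_
  have e1 : eEq φ = Real.sin θ • (sph θ φ : E3) + Real.cos θ • eCol θ φ := by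
    rw [coe_sph, eCol, smul_add, smul_add, smul_smul, smul_smul, smul_smul, smul_smul]
    rw [add_add_add_comm, ← add_smul, ← add_smul]
    rw [show Real.sin θ * Real.cos θ + Real.cos θ * -Real.sin θ = 0 by ring,
      show Real.sin θ * Real.sin θ + Real.cos θ * Real.cos θ = 1 by
        nlinarith [Real.sin_sq_add_cos_sq θ], zero_smul, one_smul, zero_add]
  rw [e1, map_neg, map_add, map_smul, map_smul, fderiv_homExt_self hf]
  simp
  ring

/-- The Euclidean Laplacian is computed in the frame of the radial, colatitude and longitude
directions. The radial second derivative is zero, and the first order term from the acceleration of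
the parallel cancels `cot θ ∂/∂θ`. The advantage of `lap` is that it makes sense at the poles as
well. -/
lemma sphLap_eq_lap {f : S2 → ℝ} (hf : IsC2 f) {θ : ℝ} (hθ : Real.sin θ ≠ 0) (φ : ℝ) :
    sphLap f θ φ = lap f (sph θ φ) := by
  obtain ⟨b, hb⟩ := exists_angBasis θ φ
  rw [lap_eq_sum b, hb, Fin.sum_univ_three]
  simp only [angFrame, Matrix.cons_val_zero, Matrix.cons_val_one, Matrix.cons_val]
  rw [fderiv_fderiv_homExt_self hf, sphLap, (funext fun t => (deriv_sph_col hf t φ).deriv :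
    deriv (fun t => f (sph t φ)) = _), (deriv_deriv_sph_col hf θ φ).deriv,
    (funext fun s => (deriv_sph_lon hf θ s).deriv : deriv (fun s => f (sph θ s)) = _),
    (deriv_deriv_sph_lon hf θ φ).deriv]
  field_simp
  ring

/-! ### Surface measure -/

instance : IsFiniteMeasure angMeasure := by
  rw [angMeasure]
  have : IsFiniteMeasure ((volume : Measure (ℝ × ℝ)).restrict
      (Icc 0 Real.pi ×ˢ Ico 0 (2 * Real.pi))) := by
    refine ⟨?_⟩
    rw [Measure.restrict_apply_univ, Measure.volume_eq_prod, Measure.prod_prod]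
    exact ENNReal.mul_lt_top (by simp) (by rw [Real.volume_Ico]; exact ENNReal.ofReal_lt_top)
  refine isFiniteMeasure_withDensity_ofReal ?_
  refine (Integrable.mono' (integrable_const (1 : ℝ)) (by fun_prop) ?_).2
  exact Eventually.of_forall fun p => Real.abs_sin_le_one _

/-- The surface measure of the sphere. -/
def sphMeasure : Measure S2 := angMeasure.map fun p => sph p.1 p.2

lemma measurable_sph : Measurable fun p : ℝ × ℝ => sph p.1 p.2 := continuous_sph.measurable

instance : IsFiniteMeasure sphMeasure := by
  rw [sphMeasure]; infer_instance

lemma integral_sphMeasure {E : Type*} [NormedAddCommGroup E] [NormedSpace ℝ E] {h : S2 → E}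
    (hh : AEStronglyMeasurable h sphMeasure) :
    ∫ x, h x ∂sphMeasure = ∫ p, h (sph p.1 p.2) ∂angMeasure :=
  integral_map measurable_sph.aemeasurable hh

lemma ae_angMeasure : ∀ᵐ p ∂angMeasure, p.1 ∈ Ioo 0 Real.pi ∧ p.2 ∈ Ico 0 (2 * Real.pi) := by
  have hS : MeasurableSet (Icc 0 Real.pi ×ˢ Ico 0 (2 * Real.pi) : Set (ℝ × ℝ)) :=
    measurableSet_Icc.prod measurableSet_Ico
  rw [angMeasure, ae_withDensity_iff (by fun_prop), ae_restrict_iff' hS]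
  refine Eventually.of_forall fun p hp h => ?_
  have hs : 0 < Real.sin p.1 := by
    by_contra hc
    exact h (ENNReal.ofReal_eq_zero.2 (not_lt.1 hc))
  refine ⟨⟨lt_of_le_of_ne hp.1.1 fun h0 => ?_, lt_of_le_of_ne hp.1.2 fun h0 => ?_⟩, hp.2⟩
  · rw [← h0, Real.sin_zero] at hs; exact lt_irrefl _ hs
  · rw [h0, Real.sin_pi] at hs; exact lt_irrefl _ hs

lemma integral_angMeasure {E : Type*} [NormedAddCommGroup E] [NormedSpace ℝ E]
    [CompleteSpace E] {h : ℝ × ℝ → E} (hh : Continuous h) :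
    ∫ p, h p ∂angMeasure
      = ∫ θ in (0 : ℝ)..Real.pi, ∫ φ in (0 : ℝ)..2 * Real.pi, Real.sin θ • h (θ, φ) := by
  have hS : MeasurableSet (Icc 0 Real.pi ×ˢ Ico 0 (2 * Real.pi) : Set (ℝ × ℝ)) :=
    measurableSet_Icc.prod measurableSet_Ico
  rw [angMeasure, integral_withDensity_eq_integral_toReal_smul (by fun_prop) (by simp)]
  have h1 : ∫ p in Icc 0 Real.pi ×ˢ Ico 0 (2 * Real.pi), (ENNReal.ofReal (Real.sin p.1)).toReal • h p
      = ∫ p in Icc 0 Real.pi ×ˢ Ico 0 (2 * Real.pi), Real.sin p.1 • h p := by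
    refine setIntegral_congr_fun hS fun p hp => ?_
    rw [ENNReal.toReal_ofReal (Real.sin_nonneg_of_mem_Icc hp.1)]
  rw [h1, Measure.volume_eq_prod, setIntegral_prod]
  · rw [intervalIntegral.integral_of_le Real.pi_pos.le, ← integral_Icc_eq_integral_Ioc]
    refine setIntegral_congr_fun measurableSet_Icc fun θ _ => ?_
    rw [intervalIntegral.integral_of_le Real.two_pi_pos.le, ← integral_Ico_eq_integral_Ioc]
  · refine (ContinuousOn.integrableOn_compact (K := Icc 0 Real.pi ×ˢ Icc 0 (2 * Real.pi))
      (isCompact_Icc.prod isCompact_Icc) ?_).mono_set (prod_mono le_rfl Ico_subset_Icc_self)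
    exact ((Real.continuous_sin.comp continuous_fst).smul hh).continuousOn

lemma integral_sphMeasure_eq {E : Type*} [NormedAddCommGroup E] [NormedSpace ℝ E]
    [CompleteSpace E] {h : S2 → E} (hh : Continuous h) :
    ∫ x, h x ∂sphMeasure
      = ∫ θ in (0 : ℝ)..Real.pi, ∫ φ in (0 : ℝ)..2 * Real.pi, Real.sin θ • h (sph θ φ) := by
  have : SecondCountableTopologyEither S2 E := inferInstance
  rw [integral_sphMeasure hh.aestronglyMeasurable]
  exact integral_angMeasure (hh.comp continuous_sph)

lemma sphMeasure_real_univ : sphMeasure.real univ = 4 * Real.pi := by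
  have h1 : ∫ _ : S2, (1 : ℝ) ∂sphMeasure = sphMeasure.real univ := by simp
  rw [← h1, integral_sphMeasure_eq continuous_const]
  simp only [smul_eq_mul, mul_one, intervalIntegral.integral_const, sub_zero]
  rw [intervalIntegral.integral_const_mul, integral_sin]
  simp
  ring

lemma mem_closure_angles (p : ℝ × ℝ) (hp : p ∈ Icc 0 Real.pi ×ˢ Ico 0 (2 * Real.pi)) :
    p ∈ closure (Ioo 0 Real.pi ×ˢ Ioo 0 (2 * Real.pi)) := by
  rw [closure_prod_eq, closure_Ioo Real.pi_pos.ne, closure_Ioo Real.two_pi_pos.ne]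
  exact ⟨hp.1, Ico_subset_Icc_self hp.2⟩

/-- Lets almost everywhere equality of continuous functions on the sphere be upgraded to equality.
The density `sin θ` is positive on the open rectangle of angles, which is dense in the full one. -/
instance : Measure.IsOpenPosMeasure sphMeasure := by
  refine ⟨fun U hU hne h0 => ?_⟩
  obtain ⟨x, hx⟩ := hne
  obtain ⟨θ, hθ, φ, hφ, rfl⟩ := sph_surj x
  rw [sphMeasure, Measure.map_apply measurable_sph hU.measurableSet, angMeasure,
    withDensity_apply_eq_zero (by fun_prop),
    Measure.restrict_apply₀' (measurableSet_Icc.prod measurableSet_Ico).nullMeasurableSet] at h0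
  set V : Set (ℝ × ℝ) := (fun p : ℝ × ℝ => sph p.1 p.2) ⁻¹' U
  have hV : IsOpen V := hU.preimage continuous_sph
  have hO : IsOpen (V ∩ Ioo 0 Real.pi ×ˢ Ioo 0 (2 * Real.pi)) :=
    hV.inter (isOpen_Ioo.prod isOpen_Ioo)
  have hne : (V ∩ Ioo 0 Real.pi ×ˢ Ioo 0 (2 * Real.pi)).Nonempty :=
    mem_closure_iff.1 (mem_closure_angles (θ, φ) ⟨hθ, hφ⟩) V hV hx
  refine (hO.measure_pos volume hne).ne' (measure_mono_null ?_ h0)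
  rintro p ⟨hpV, hp1, hp2⟩
  refine ⟨⟨?_, hpV⟩, Ioo_subset_Icc_self hp1, Ioo_subset_Ico_self hp2⟩
  simp only [mem_ofPred_eq, ne_eq, ENNReal.ofReal_eq_zero, not_le]
  exact Real.sin_pos_of_mem_Ioo hp1

lemma integrable_sphMeasure {E : Type*} [NormedAddCommGroup E] {h : S2 → E} (hh : Continuous h) :
    Integrable h sphMeasure := by
  have : SecondCountableTopologyEither S2 E := inferInstance
  obtain ⟨C, hC⟩ := isCompact_univ.exists_bound_of_continuousOn hh.continuousOn
  exact Integrable.mono' (integrable_const C) hh.aestronglyMeasurable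
    (Eventually.of_forall fun x => hC x (mem_univ x))

lemma eq_zero_of_integral_sq_eq_zero {f : S2 → ℝ} (hf : Continuous f)
    (h : ∫ x, f x * f x ∂sphMeasure = 0) : f = 0 := by
  have h1 : (fun x => f x * f x) =ᵐ[sphMeasure] 0 :=
    (integral_eq_zero_iff_of_nonneg (fun x => mul_self_nonneg _)
      (integrable_sphMeasure (hf.mul hf))).1 h
  have h2 : (fun x => f x * f x) = 0 :=
    (hf.mul hf).ae_eq_iff_eq sphMeasure continuous_zero |>.1 h1
  funext x
  exact mul_self_eq_zero.1 (congrFun h2 x)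

/-! ### Green's identity -/

lemma intervalIntegral_integral_swap_cont {X : ℝ × ℝ → ℝ} (hX : Continuous X) {a b c d : ℝ}
    (hab : a ≤ b) (hcd : c ≤ d) :
    ∫ x in a..b, ∫ y in c..d, X (x, y) = ∫ y in c..d, ∫ x in a..b, X (x, y) := by
  simp only [intervalIntegral.integral_of_le hab, intervalIntegral.integral_of_le hcd]
  refine integral_integral_swap (f := fun x y => X (x, y)) ?_
  rw [Measure.prod_restrict]
  refine (ContinuousOn.integrableOn_compact (K := Icc a b ×ˢ Icc c d)
    (isCompact_Icc.prod isCompact_Icc) ?_).mono_set (prod_mono Ioc_subset_Icc_self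
      Ioc_subset_Icc_self)
  exact hX.continuousOn

lemma continuous_fderiv_homExt_sph {f : S2 → ℝ} (hf : IsC2 f) :
    Continuous fun p : ℝ × ℝ => fderiv ℝ (homExt f) (sph p.1 p.2 : E3) :=
  continuous_iff_continuousAt.2 fun _ =>
    ContinuousAt.comp (f := fun p : ℝ × ℝ => (sph p.1 p.2 : E3))
      (continuousAt_fderiv_homExt hf (S2_ne_zero _)) 
      (contDiff_coe_sph (n := 0)).continuous.continuousAt

lemma continuous_fderiv_fderiv_homExt_sph {f : S2 → ℝ} (hf : IsC2 f) :
    Continuous fun p : ℝ × ℝ => fderiv ℝ (fderiv ℝ (homExt f)) (sph p.1 p.2 : E3) :=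
  continuous_iff_continuousAt.2 fun _ =>
    ContinuousAt.comp (f := fun p : ℝ × ℝ => (sph p.1 p.2 : E3))
      (continuousAt_fderiv_fderiv_homExt hf (S2_ne_zero _))
      (contDiff_coe_sph (n := 0)).continuous.continuousAt

/-- In angular coordinates `sin θ (f Δg - g Δf)` is the `θ`-derivative of `sin θ (f ∂_θ g - g ∂_θ
f)` plus `1/sin θ` times the `φ`-derivative of `f ∂_φ g - g ∂_φ f`. The first integrates to zero
because `sin` vanishes at `0` and `π`, the second by periodicity. -/
theorem green {f g : S2 → ℝ} (hf : IsC2 f) (hg : IsC2 g) :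
    ∫ x, f x * lap g x ∂sphMeasure = ∫ x, g x * lap f x ∂sphMeasure := by
  have hfc := hf.continuous
  have hgc := hg.continuous
  have hlf := continuous_lap hf
  have hlg := continuous_lap hg
  have h0 := integral_sub (integrable_sphMeasure (hfc.mul hlg))
    (integrable_sphMeasure (hgc.mul hlf))
  simp only [Pi.mul_apply] at h0
  rw [← sub_eq_zero, ← h0, integral_sphMeasure_eq (h := fun x => f x * lap g x - g x * lap f x)
    ((hfc.mul hlg).sub (hgc.mul hlf))]
  simp only [smul_eq_mul]
  set A : (S2 → ℝ) → ℝ → ℝ → ℝ := fun f θ φ => fderiv ℝ (homExt f) (sph θ φ) (eCol θ φ) with hA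
  set A2 : (S2 → ℝ) → ℝ → ℝ → ℝ := fun f θ φ =>
    fderiv ℝ (fderiv ℝ (homExt f)) (sph θ φ) (eCol θ φ) (eCol θ φ) with hA2
  set B : (S2 → ℝ) → ℝ → ℝ → ℝ := fun f θ φ =>
    Real.sin θ * fderiv ℝ (homExt f) (sph θ φ) (eLon φ) with hB
  set B2 : (S2 → ℝ) → ℝ → ℝ → ℝ := fun f θ φ => Real.sin θ ^ 2 *
    fderiv ℝ (fderiv ℝ (homExt f)) (sph θ φ) (eLon φ) (eLon φ)
      - Real.sin θ * Real.cos θ * A f θ φ with hB2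
  have hAc : ∀ {f}, IsC2 f → Continuous fun p : ℝ × ℝ => A f p.1 p.2 := fun hf =>
    (continuous_fderiv_homExt_sph hf).clm_apply continuous_eCol
  have hA2c : ∀ {f}, IsC2 f → Continuous fun p : ℝ × ℝ => A2 f p.1 p.2 := fun hf =>
    ((continuous_fderiv_fderiv_homExt_sph hf).clm_apply continuous_eCol).clm_apply continuous_eCol
  have hB2c : ∀ {f}, IsC2 f → Continuous fun p : ℝ × ℝ => B2 f p.1 p.2 := fun hf => by
    have h1 := continuous_fderiv_fderiv_homExt_sph hf
    have h2 := hAc hf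
    have h3 := continuous_eLon
    simp only [hB2]
    fun_prop
  have hlap : ∀ {f}, IsC2 f → ∀ θ φ, Real.sin θ ≠ 0 → lap f (sph θ φ)
      = A2 f θ φ + Real.cos θ / Real.sin θ * A f θ φ + 1 / Real.sin θ ^ 2 * B2 f θ φ := by
    intro f hf θ φ hs
    rw [← sphLap_eq_lap hf hs, sphLap, (funext fun t => (deriv_sph_col hf t φ).deriv :
      deriv (fun t => f (sph t φ)) = _), (deriv_deriv_sph_col hf θ φ).deriv,
      (funext fun s => (deriv_sph_lon hf θ s).deriv : deriv (fun s => f (sph θ s)) = _),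
      (deriv_deriv_sph_lon hf θ φ).deriv]
  have hdA : ∀ {f}, IsC2 f → ∀ θ φ, HasDerivAt (fun t => A f t φ) (A2 f θ φ) θ :=
    fun hf θ φ => deriv_deriv_sph_col hf θ φ
  have hdB : ∀ {f}, IsC2 f → ∀ θ φ, HasDerivAt (fun s => B f θ s) (B2 f θ φ) φ :=
    fun hf θ φ => deriv_deriv_sph_lon hf θ φ
  set X' : ℝ → ℝ → ℝ := fun θ φ =>
    Real.cos θ * (f (sph θ φ) * A g θ φ - g (sph θ φ) * A f θ φ)
      + Real.sin θ * (f (sph θ φ) * A2 g θ φ - g (sph θ φ) * A2 f θ φ) with hX'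
  have hX'c : Continuous fun p : ℝ × ℝ => X' p.1 p.2 := by
    have h1 := hAc hf
    have h2 := hAc hg
    have h3 := hA2c hf
    have h4 := hA2c hg
    have h5 := hfc.comp continuous_sph
    have h6 := hgc.comp continuous_sph
    simp only [Function.comp_def] at h5 h6
    exact ((Real.continuous_cos.comp continuous_fst).mul ((h5.mul h2).sub (h6.mul h1))).add
      ((Real.continuous_sin.comp continuous_fst).mul ((h5.mul h4).sub (h6.mul h3)))
  have hdX : ∀ θ φ, HasDerivAt (fun t => Real.sin t * (f (sph t φ) * A g t φ
      - g (sph t φ) * A f t φ)) (X' θ φ) θ := by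
    intro θ φ
    refine ((Real.hasDerivAt_sin θ).mul (((deriv_sph_col hf θ φ).mul (hdA hg θ φ)).sub
      ((deriv_sph_col hg θ φ).mul (hdA hf θ φ)))).congr_deriv ?_
    simp only [hX', hA, Pi.mul_apply, Pi.sub_apply]
    ring
  -- The integrand is a `φ`-derivative of a function of period `2π`.
  have hYzero : ∀ θ, ∫ φ in (0 : ℝ)..2 * Real.pi,
      (f (sph θ φ) * B2 g θ φ - g (sph θ φ) * B2 f θ φ) = 0 := by
    intro θ
    rw [intervalIntegral.integral_eq_sub_of_hasDerivAt
      (f := fun φ => f (sph θ φ) * B g θ φ - g (sph θ φ) * B f θ φ)]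
    · have e1 : sph θ (2 * Real.pi) = sph θ 0 := Subtype.ext (by simp [coe_sph, eEq])
      have e2 : eLon (2 * Real.pi) = eLon 0 := by simp [eLon]
      simp only [hB, e1, e2, sub_self]
    · intro φ _
      refine (((deriv_sph_lon hf θ φ).mul (hdB hg θ φ)).sub
        ((deriv_sph_lon hg θ φ).mul (hdB hf θ φ))).congr_deriv ?_
      simp only [hB]
      ring
    · have h3 := (hB2c hf).comp (by fun_prop : Continuous fun φ : ℝ => (θ, φ))
      have h4 := (hB2c hg).comp (by fun_prop : Continuous fun φ : ℝ => (θ, φ))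
      have h5 := (hfc.comp continuous_sph).comp (by fun_prop : Continuous fun φ : ℝ => (θ, φ))
      have h6 := (hgc.comp continuous_sph).comp (by fun_prop : Continuous fun φ : ℝ => (θ, φ))
      exact ((h5.mul h4).sub (h6.mul h3)).intervalIntegrable _ _
  -- For fixed `θ` the factor `1/sin θ` is constant in `φ`, so the singular term disappears before
  -- the integration in `θ`.
  have hsplit : ∀ θ ∈ Ioo 0 Real.pi, ∫ φ in (0 : ℝ)..2 * Real.pi,
      Real.sin θ * (f (sph θ φ) * lap g (sph θ φ) - g (sph θ φ) * lap f (sph θ φ))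
      = ∫ φ in (0 : ℝ)..2 * Real.pi, X' θ φ := by
    intro θ hθ
    have hs : Real.sin θ ≠ 0 := (Real.sin_pos_of_mem_Ioo hθ).ne'
    rw [← sub_eq_zero, ← intervalIntegral.integral_sub]
    · have hz := congrArg (1 / Real.sin θ * ·) (hYzero θ)
      simp only [mul_zero, ← intervalIntegral.integral_const_mul] at hz
      refine Eq.trans (intervalIntegral.integral_congr fun φ _ => ?_) hz
      simp only [hlap hf θ φ hs, hlap hg θ φ hs, hX']
      field_simp
      ring
    · have h3 := (hlf.comp continuous_sph).comp (by fun_prop : Continuous fun φ : ℝ => (θ, φ))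
      have h4 := (hlg.comp continuous_sph).comp (by fun_prop : Continuous fun φ : ℝ => (θ, φ))
      have h5 := (hfc.comp continuous_sph).comp (by fun_prop : Continuous fun φ : ℝ => (θ, φ))
      have h6 := (hgc.comp continuous_sph).comp (by fun_prop : Continuous fun φ : ℝ => (θ, φ))
      exact (continuous_const.mul ((h5.mul h4).sub (h6.mul h3))).intervalIntegrable _ _
    · exact (hX'c.comp (by fun_prop : Continuous fun φ : ℝ => (θ, φ))).intervalIntegrable _ _
  have hstep : ∫ θ in (0 : ℝ)..Real.pi, ∫ φ in (0 : ℝ)..2 * Real.pi,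
      Real.sin θ * (f (sph θ φ) * lap g (sph θ φ) - g (sph θ φ) * lap f (sph θ φ))
      = ∫ θ in (0 : ℝ)..Real.pi, ∫ φ in (0 : ℝ)..2 * Real.pi, X' θ φ := by
    refine intervalIntegral.integral_congr_ae ?_
    filter_upwards [compl_mem_ae_iff.2 (measure_singleton Real.pi)] with θ hθ hm
    rw [uIoc_of_le Real.pi_pos.le] at hm
    exact hsplit θ ⟨hm.1, lt_of_le_of_ne hm.2 hθ⟩
  rw [hstep, intervalIntegral_integral_swap_cont hX'c Real.pi_pos.le Real.two_pi_pos.le]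
  refine Eq.trans (intervalIntegral.integral_congr fun φ _ => ?_)
    (intervalIntegral.integral_zero (a := 0) (b := 2 * Real.pi))
  simp only
  rw [intervalIntegral.integral_eq_sub_of_hasDerivAt (fun θ _ => hdX θ φ)]
  · simp
  · exact (hX'c.comp (by fun_prop : Continuous fun θ : ℝ => (θ, φ))).intervalIntegrable _ _

/-! ### Rotations -/

/-- The action of a linear isometry on the sphere. -/
def rot (R : E3 ≃ₗᵢ[ℝ] E3) (x : S2) : S2 :=
  ⟨R x, by rw [mem_sphere_zero_iff_norm, R.norm_map, S2_norm]⟩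

lemma coe_rot (R : E3 ≃ₗᵢ[ℝ] E3) (x : S2) : (rot R x : E3) = R x := rfl

lemma continuous_rot (R : E3 ≃ₗᵢ[ℝ] E3) : Continuous (rot R) :=
  (R.continuous.comp continuous_subtype_val).subtype_mk _

lemma radial_map (R : E3 ≃ₗᵢ[ℝ] E3) {x : E3} (hx : x ≠ 0) : rot R (radial x) = radial (R x) := by
  refine Subtype.ext ?_
  rw [coe_rot, coe_radial hx, coe_radial (by simpa using hx), map_smul, R.norm_map]

lemma homExt_rot (R : E3 ≃ₗᵢ[ℝ] E3) (f : S2 → ℝ) {x : E3} (hx : x ≠ 0) :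
    homExt (fun x => f (rot R x)) x = homExt f (R x) := by
  rw [homExt, homExt, radial_map R hx]

lemma contMDiff_rot (R : E3 ≃ₗᵢ[ℝ] E3) {f : S2 → ℝ} {n : WithTop ℕ∞} (hn : n ≤ (⊤ : ℕ∞))
    (hf : ContMDiff (𝓡 2) 𝓘(ℝ, ℝ) n f) : ContMDiff (𝓡 2) 𝓘(ℝ, ℝ) n fun x => f (rot R x) := by
  have := contMDiff_of_contDiffAt (g := fun x => homExt f (R x)) (n := n) fun x =>
    ContDiffAt.comp (g := homExt f) (f := R) (x : E3)
      (contDiffAt_homExt hn hf (by simpa using S2_ne_zero x)) R.contDiff.contDiffAt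
  refine this.congr fun x => ?_
  rw [← homExt_rot R f (S2_ne_zero x), homExt_coe]

/-- The Laplacian may be computed in any orthonormal basis: a fixed one is used on the left, its
image under `R` on the right. -/
lemma lap_rot (R : E3 ≃ₗᵢ[ℝ] E3) (f : S2 → ℝ) (x : S2) :
    lap (fun x => f (rot R x)) x = lap f (rot R x) := by
  have h1 : homExt (fun x => f (rot R x)) =ᶠ[𝓝 (x : E3)] (homExt f ∘ R) := by
    filter_upwards [isOpen_ne.mem_nhds (S2_ne_zero x)] with y hy
    exact homExt_rot R f hy
  rw [lap, lap, InnerProductSpace.laplacian_eq_iteratedFDeriv_orthonormalBasis _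
    (stdOrthonormalBasis ℝ E3), InnerProductSpace.laplacian_eq_iteratedFDeriv_orthonormalBasis _
    ((stdOrthonormalBasis ℝ E3).map R)]
  simp only
  rw [(h1.iteratedFDeriv ℝ 2).eq_of_nhds]
  refine Finset.sum_congr rfl fun i _ => ?_
  have h2 := R.toContinuousLinearEquiv.iteratedFDerivWithin_comp_right (𝕜 := ℝ) (homExt f)
    uniqueDiffOn_univ (x := (x : E3)) (mem_univ _) 2
  rw [preimage_univ, iteratedFDerivWithin_univ, iteratedFDerivWithin_univ] at h2
  have e : (homExt f ∘ R) = homExt f ∘ R.toContinuousLinearEquiv := rfl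
  rw [e, h2, ContinuousMultilinearMap.compContinuousLinearMap_apply]
  congr 1
  funext j
  fin_cases j <;> simp

/-! ### Legendre polynomials -/

section Legendre
open Polynomial

/-- The `(k+1)`-st derivative of `(x²-1) w' = 2l x w`, where `w = (x²-1)^l`. Taking `k = l + m`
gives Legendre's equation differentiated `m` times. -/
lemma iterate_derivative_rodrigues (l k : ℕ) :
    (X ^ 2 - 1) * derivative^[k + 2] ((X ^ 2 - 1 : ℝ[X]) ^ l)
      + C (2 * ((k : ℝ) + 1) - 2 * l) * X * derivative^[k + 1] ((X ^ 2 - 1 : ℝ[X]) ^ l)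
      + C (((k : ℝ) + 1) * k - 2 * l * (k + 1)) * derivative^[k] ((X ^ 2 - 1 : ℝ[X]) ^ l) = 0 := by
  have h0 : (X ^ 2 - 1) * derivative ((X ^ 2 - 1 : ℝ[X]) ^ l)
      = C (2 * (l : ℝ)) * X * (X ^ 2 - 1 : ℝ[X]) ^ l := by
    rcases l with _ | l
    · simp
    · rw [derivative_pow]
      simp only [derivative_sub, derivative_X_pow, derivative_one, Nat.add_sub_cancel]
      simp only [pow_succ]
      simp only [map_mul, map_natCast, C_ofNat]
      push_cast
      ring
  set w : ℝ[X] := (X ^ 2 - 1) ^ l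
  induction k with
  | zero =>
    have h1 := congrArg derivative h0
    simp only [derivative_mul, derivative_sub, derivative_X_pow, derivative_one, derivative_C,
      derivative_X] at h1
    simp only [Function.iterate_succ, Function.iterate_zero, Function.comp, id]
    simp only [map_mul, map_sub, map_add, map_natCast, C_ofNat, map_one, map_zero, Nat.cast_zero] at h1 ⊢
    linear_combination h1
  | succ k ih =>
    have h1 := congrArg derivative ih
    simp only [derivative_mul, derivative_sub, derivative_add, derivative_X_pow, derivative_one,
      derivative_C, derivative_X, ← Function.iterate_succ_apply' derivative, derivative_zero] at h1
    simp only [map_mul, map_sub, map_add, map_natCast, C_ofNat, map_one, Nat.cast_succ] at h1 ⊢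
    linear_combination h1

/-- The differential equation of the derivatives of the Legendre polynomials. -/
lemma legendreP_ode (l m : ℕ) :
    (1 - X ^ 2) * derivative^[m + 2] (legendreP l)
      - C (2 * ((m : ℝ) + 1)) * X * derivative^[m + 1] (legendreP l)
      + C ((l : ℝ) * (l + 1) - m * (m + 1)) * derivative^[m] (legendreP l) = 0 := by
  have hp : ∀ k, derivative^[k] (legendreP l) = C (1 / (2 ^ l * (l.factorial : ℝ))) *
      derivative^[l + k] ((X ^ 2 - 1 : ℝ[X]) ^ l) := by
    intro k
    rw [legendreP, iterate_derivative_C_mul, ← Function.iterate_add_apply, add_comm k l]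
  have h := iterate_derivative_rodrigues l (l + m)
  rw [hp, hp, hp, ← add_assoc, ← add_assoc]
  simp only [map_mul, map_sub, map_add, map_natCast, C_ofNat, map_one, Nat.cast_add] at h ⊢
  linear_combination (-C (1 / (2 ^ l * (l.factorial : ℝ)))) * h

lemma legendreP_ode_eval (l m : ℕ) (x : ℝ) :
    (1 - x ^ 2) * (derivative^[m + 2] (legendreP l)).eval x
      - 2 * (m + 1) * x * (derivative^[m + 1] (legendreP l)).eval x
      + ((l : ℝ) * (l + 1) - m * (m + 1)) * (derivative^[m] (legendreP l)).eval x = 0 := by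
  have := congrArg (eval x) (legendreP_ode l m)
  simpa using this

lemma natDegree_legendreP (l : ℕ) : (legendreP l).natDegree ≤ l := by
  rw [legendreP]
  refine (natDegree_C_mul_le _ _).trans ((natDegree_iterate_derivative _ _).trans ?_)
  have : ((X ^ 2 - 1 : ℝ[X]) ^ l).natDegree ≤ l * 2 := by
    refine natDegree_pow_le.trans (Nat.mul_le_mul_left _ ?_)
    have : (X ^ 2 - 1 : ℝ[X]) = X ^ 2 - C 1 := by simp
    rw [this, natDegree_X_pow_sub_C]
  omega

lemma coeff_legendreP (l : ℕ) : (legendreP l).coeff l ≠ 0 := by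
  rw [legendreP, coeff_C_mul, coeff_iterate_derivative]
  have hm : (X ^ 2 - 1 : ℝ[X]).Monic := by
    have : (X ^ 2 - 1 : ℝ[X]) = X ^ 2 - C 1 := by simp
    rw [this]; exact monic_X_pow_sub_C 1 two_ne_zero
  have hd : ((X ^ 2 - 1 : ℝ[X]) ^ l).natDegree = l + l := by
    rw [hm.natDegree_pow]
    have : (X ^ 2 - 1 : ℝ[X]) = X ^ 2 - C 1 := by simp
    rw [this, natDegree_X_pow_sub_C]; ring
  have hc : ((X ^ 2 - 1 : ℝ[X]) ^ l).coeff (l + l) = 1 := by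
    rw [← hd]; exact (hm.pow l)
  rw [hc, nsmul_eq_mul, mul_one]
  have : ((l + l).descFactorial l) ≠ 0 := by
    rw [Ne, Nat.descFactorial_eq_zero_iff_lt]; omega
  positivity

lemma natDegree_derivative_legendreP (l m : ℕ) :
    (derivative^[m] (legendreP l)).natDegree ≤ l - m :=
  (natDegree_iterate_derivative _ _).trans (Nat.sub_le_sub_right (natDegree_legendreP l) m)

lemma coeff_derivative_legendreP {l m : ℕ} (h : m ≤ l) :
    (derivative^[m] (legendreP l)).coeff (l - m) ≠ 0 := by
  rw [coeff_iterate_derivative, Nat.sub_add_cancel h, nsmul_eq_mul]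
  refine mul_ne_zero ?_ (coeff_legendreP l)
  rw [Nat.cast_ne_zero, Ne, Nat.descFactorial_eq_zero_iff_lt]
  omega

/-- Polynomials `p k` of exact degree `k` form a triangular basis: subtracting a multiple of `p n`
removes the coefficient of degree `n`. The target is a general module because the lemma serves both
for integrals and for a quotient map. -/
lemma linearMap_eq_zero_of_degree {p : ℕ → ℝ[X]} {V : Type*} [AddCommGroup V] [Module ℝ V]
    (Λ : ℝ[X] →ₗ[ℝ] V) (n : ℕ) (hd : ∀ k, (p k).natDegree ≤ k) (hc : ∀ k, (p k).coeff k ≠ 0)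
    (h : ∀ k < n, Λ (p k) = 0) {g : ℝ[X]} (hg : g.degree < n) : Λ g = 0 := by
  induction n generalizing g with
  | zero =>
    have : g = 0 := by
      rw [← degree_eq_bot]; exact Nat.WithBot.lt_zero_iff.1 (by simpa using hg)
    rw [this, map_zero]
  | succ n ih =>
    set a := g.coeff n / (p n).coeff n
    have h1 : (g - C a * p n).degree < n := by
      rw [degree_lt_iff_coeff_zero]
      intro m hm
      rw [coeff_sub, coeff_C_mul]
      rcases hm.eq_or_lt with rfl | hm
      · rw [div_mul_cancel₀ _ (hc n), sub_self]
      · rw [coeff_eq_zero_of_natDegree_lt ((hd n).trans_lt hm),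
          coeff_eq_zero_of_degree_lt (hg.trans_le (by exact_mod_cast hm))]
        simp
    have h2 := ih (fun k hk => h k (hk.trans (Nat.lt_succ_self n))) h1
    rw [map_sub, ← smul_eq_C_mul, map_smul, h n (Nat.lt_succ_self n), smul_zero, sub_zero] at h2
    exact h2

/-- Up to `l!`, the `l`-th derivative at `a` is the `l`-th Taylor coefficient there, and the Taylor
shift turns `(X-a)^l` into `X^l`. -/
lemma eval_iterate_derivative_pow_mul (a : ℝ) (l : ℕ) (q : ℝ[X]) :
    (derivative^[l] ((X - C a) ^ l * q)).eval a = l.factorial * q.eval a := by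
  have h1 : derivative^[l] ((X - C a) ^ l * q) = l.factorial • hasseDeriv l ((X - C a) ^ l * q) := by
    rw [← factorial_smul_hasseDeriv]; rfl
  have h2 : (hasseDeriv l ((X - C a) ^ l * q)).eval a = q.eval a := by
    rw [← taylor_coeff, taylor_mul, taylor_pow]
    simp only [map_sub, taylor_X, taylor_C, add_sub_cancel_right]
    rw [coeff_X_pow_mul', if_pos le_rfl, Nat.sub_self, taylor_coeff_zero]
  rw [h1, eval_smul, h2, nsmul_eq_mul]

lemma legendreP_eval_one (l : ℕ) : (legendreP l).eval 1 = 1 := by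
  have h : (X ^ 2 - 1 : ℝ[X]) ^ l = (X - C 1) ^ l * (X + 1) ^ l := by
    rw [← mul_pow]; congr 1; simp; ring
  rw [legendreP, eval_mul, eval_C, h, eval_iterate_derivative_pow_mul]
  simp only [eval_pow, eval_add, eval_X, eval_one]
  have : (l.factorial : ℝ) ≠ 0 := by positivity
  norm_num
  field_simp

lemma legendreP_eval_neg_one (l : ℕ) : (legendreP l).eval (-1) = (-1) ^ l := by
  have h : (X ^ 2 - 1 : ℝ[X]) ^ l = (X - C (-1)) ^ l * (X - 1) ^ l := by
    rw [← mul_pow]; congr 1; simp; ring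
  rw [legendreP, eval_mul, eval_C, h, eval_iterate_derivative_pow_mul]
  simp only [eval_pow, eval_sub, eval_X, eval_one]
  have : (l.factorial : ℝ) ≠ 0 := by positivity
  rw [show (-1 - 1 : ℝ) = (-1) * 2 by norm_num, mul_pow]
  field_simp

lemma derivative_legendreP_eval_one (l m : ℕ) :
    2 * ((m : ℝ) + 1) * (derivative^[m + 1] (legendreP l)).eval 1
      = ((l : ℝ) * (l + 1) - m * (m + 1)) * (derivative^[m] (legendreP l)).eval 1 := by
  have := legendreP_ode_eval l m 1
  linarith

/-- At `±1` the leading coefficient of the differential equation vanishes, which leaves a recursion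
between successive derivatives; the recursions at the two endpoints differ by a sign. -/
lemma derivative_legendreP_eval_neg_one (l m : ℕ) :
    (derivative^[m] (legendreP l)).eval (-1)
      = (-1) ^ (l + m) * (derivative^[m] (legendreP l)).eval 1 := by
  induction m with
  | zero => simp [legendreP_eval_one, legendreP_eval_neg_one]
  | succ m ih =>
    have h1 := derivative_legendreP_eval_one l m
    have h2 := legendreP_ode_eval l m (-1)
    rw [ih] at h2
    have h3 : (0 : ℝ) < 2 * (m + 1) := by positivity
    have : 2 * ((m : ℝ) + 1) * ((derivative^[m + 1] (legendreP l)).eval (-1)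
        - (-1) ^ (l + (m + 1)) * (derivative^[m + 1] (legendreP l)).eval 1) = 0 := by
      rw [← add_assoc, pow_succ]
      linear_combination h2 + (-1) ^ (l + m) * h1
    rcases mul_eq_zero.1 this with h | h
    · exact absurd h h3.ne'
    · exact sub_eq_zero.1 h

lemma integral_derivative_eval (g : ℝ[X]) :
    ∫ x in (-1 : ℝ)..1, (derivative g).eval x = g.eval 1 - g.eval (-1) :=
  intervalIntegral.integral_eq_sub_of_hasDerivAt (fun x _ => g.hasDerivAt x)
    ((derivative g).continuous.intervalIntegrable _ _)

/-- Integration over `[-1, 1]` as a linear functional on polynomials. -/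
def polyInt : ℝ[X] →ₗ[ℝ] ℝ where
  toFun g := ∫ x in (-1 : ℝ)..1, g.eval x
  map_add' f g := by
    simp only [eval_add]
    exact intervalIntegral.integral_add (f.continuous.intervalIntegrable _ _)
      (g.continuous.intervalIntegrable _ _)
  map_smul' a g := by
    simp only [eval_smul, smul_eq_mul, RingHom.id_apply, intervalIntegral.integral_const_mul]

lemma polyInt_apply (g : ℝ[X]) : polyInt g = ∫ x in (-1 : ℝ)..1, g.eval x := rfl

lemma polyInt_derivative (g : ℝ[X]) : polyInt (derivative g) = g.eval 1 - g.eval (-1) :=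
  integral_derivative_eval g

lemma derivative_one_sub_sq_pow (m : ℕ) :
    (1 - X ^ 2) * derivative ((1 - X ^ 2 : ℝ[X]) ^ m)
      = -(C (2 * (m : ℝ)) * X * (1 - X ^ 2 : ℝ[X]) ^ m) := by
  rcases m with _ | m
  · simp
  · rw [derivative_pow]
    simp only [derivative_sub, derivative_X_pow, derivative_one, Nat.add_sub_cancel]
    simp only [pow_succ]
    simp only [map_mul, map_natCast, C_ofNat]
    push_cast
    ring

/-- The differential equation in self-adjoint form, on which both the orthogonality and the norms
below rest. -/
lemma derivative_weighted_legendreP (l m : ℕ) :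
    derivative ((1 - X ^ 2) ^ (m + 1) * derivative^[m + 1] (legendreP l))
      = -(C ((l : ℝ) * (l + 1) - m * (m + 1)) *
        ((1 - X ^ 2) ^ m * derivative^[m] (legendreP l))) := by
  have h1 := derivative_one_sub_sq_pow m
  have h2 := legendreP_ode l m
  rw [pow_succ', derivative_mul, derivative_mul, ← Function.iterate_succ_apply' derivative]
  simp only [derivative_sub, derivative_X_pow, derivative_one]
  simp only [map_mul, map_sub, map_add, map_natCast, C_ofNat, map_one, Nat.cast_ofNat] at h1 h2 ⊢
  linear_combination (derivative^[m + 1] (legendreP l)) * h1 + (1 - X ^ 2) ^ m * h2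

/-- Sturm-Liouville: the weighted Wronskian vanishes at `±1`, and its derivative is the integrand
times `k(k+1) - l(l+1)`, which is nonzero. -/
lemma polyInt_legendreP_orthogonal {l k : ℕ} (hlk : l ≠ k) (m : ℕ) :
    polyInt ((1 - X ^ 2) ^ m * (derivative^[m] (legendreP l) * derivative^[m] (legendreP k))) = 0 := by
  have h := polyInt_derivative ((1 - X ^ 2) ^ (m + 1) * derivative^[m + 1] (legendreP l)
      * derivative^[m] (legendreP k) - (1 - X ^ 2) ^ (m + 1) * derivative^[m + 1] (legendreP k)
      * derivative^[m] (legendreP l))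
  have e : derivative ((1 - X ^ 2) ^ (m + 1) * derivative^[m + 1] (legendreP l)
      * derivative^[m] (legendreP k) - (1 - X ^ 2) ^ (m + 1) * derivative^[m + 1] (legendreP k)
      * derivative^[m] (legendreP l)) = ((k : ℝ) * (k + 1) - l * (l + 1)) • ((1 - X ^ 2) ^ m *
        (derivative^[m] (legendreP l) * derivative^[m] (legendreP k))) := by
    rw [derivative_sub, derivative_mul (g := derivative^[m] (legendreP k)),
      derivative_mul (g := derivative^[m] (legendreP l)), derivative_weighted_legendreP,
      derivative_weighted_legendreP, ← Function.iterate_succ_apply' derivative,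
      ← Function.iterate_succ_apply' derivative, smul_eq_C_mul]
    simp only [map_mul, map_sub, map_add, map_natCast, map_one]
    ring
  rw [e, map_smul] at h
  simp only [eval_sub, eval_mul, eval_pow, eval_one, eval_X] at h
  norm_num at h
  refine h.resolve_left fun h0 => hlk ?_
  have h1 : ((k : ℝ) - l) * (k + l + 1) = 0 := by linear_combination h0
  have h2 : ((k : ℝ) + l + 1) ≠ 0 := by positivity
  have h3 : (k : ℝ) = l := sub_eq_zero.1 ((mul_eq_zero.1 h1).resolve_right h2)
  exact_mod_cast h3.symm

lemma polyInt_legendreP_mul_of_degree_lt {l : ℕ} {g : ℝ[X]} (hg : g.degree < l) :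
    polyInt (legendreP l * g) = 0 := by
  refine linearMap_eq_zero_of_degree (p := legendreP)
    (polyInt ∘ₗ LinearMap.mulLeft ℝ (legendreP l)) l natDegree_legendreP coeff_legendreP ?_ hg
  intro k hk
  have := polyInt_legendreP_orthogonal (l := l) (k := k) (by omega) 0
  simpa using this

/-- Integrate `(x P_l²)' = (2l+1) P_l² + 2 P_l (x P_l' - l P_l)`. Leading terms cancel in the last
bracket, so it has degree below `l` and is orthogonal to `P_l`; the boundary values add up to `2`.
-/
lemma polyInt_legendreP_sq (l : ℕ) : polyInt (legendreP l * legendreP l) = 2 / (2 * l + 1) := by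
  have h := polyInt_derivative (X * (legendreP l * legendreP l))
  have e : derivative (X * (legendreP l * legendreP l))
      = (2 * (l : ℝ) + 1) • (legendreP l * legendreP l)
        + (2 : ℝ) • (legendreP l * (X * derivative (legendreP l) - C (l : ℝ) * legendreP l)) := by
    rw [derivative_mul, derivative_mul, derivative_X, smul_eq_C_mul, smul_eq_C_mul]
    simp only [map_mul, map_add, map_natCast, map_one, C_ofNat]
    ring
  have hdeg : (X * derivative (legendreP l) - C (l : ℝ) * legendreP l).degree < (l : WithBot ℕ) := by
    rw [degree_lt_iff_coeff_zero]
    intro m hm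
    rw [coeff_sub, coeff_C_mul]
    rcases m with _ | m
    · have : l = 0 := by omega
      subst this
      simp
    · rw [coeff_X_mul, coeff_derivative]
      rcases hm.eq_or_lt with h | h
      · rw [h]; push_cast; ring
      · rw [coeff_eq_zero_of_natDegree_lt ((natDegree_legendreP l).trans_lt h)]; ring
  rw [e, map_add, map_smul, map_smul, polyInt_legendreP_mul_of_degree_lt hdeg] at h
  simp only [eval_mul, eval_X, legendreP_eval_one, legendreP_eval_neg_one, smul_eq_mul] at h
  have h1 : ((-1 : ℝ) ^ l) * (-1) ^ l = 1 := by rw [← mul_pow]; norm_num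
  rw [h1] at h
  have : (2 * (l : ℝ) + 1) ≠ 0 := by positivity
  field_simp
  linarith

/-- Integration by parts multiplies the integral by `l(l+1) - m(m+1) = (l-m)(l+m+1)` when `m`
increases by one, which is the change of the factorial quotient. -/
lemma polyInt_weighted_sq {l m : ℕ} (hm : m ≤ l) :
    polyInt ((1 - X ^ 2) ^ m * (derivative^[m] (legendreP l) * derivative^[m] (legendreP l)))
      = 2 / (2 * l + 1) * ((l + m).factorial / (l - m).factorial) := by
  induction m with
  | zero =>
    have := polyInt_legendreP_sq l
    simp only [pow_zero, one_mul, Function.iterate_zero, id, this, Nat.sub_zero, add_zero]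
    have : (l.factorial : ℝ) ≠ 0 := by positivity
    field_simp
  | succ m ih =>
    have ih := ih (by omega)
    have h := polyInt_derivative ((1 - X ^ 2) ^ (m + 1) * derivative^[m + 1] (legendreP l)
      * derivative^[m] (legendreP l))
    rw [derivative_mul, derivative_weighted_legendreP, ← Function.iterate_succ_apply' derivative] at h
    have e : -(C ((l : ℝ) * (l + 1) - m * (m + 1)) * ((1 - X ^ 2) ^ m *
        derivative^[m] (legendreP l))) * derivative^[m] (legendreP l) + (1 - X ^ 2) ^ (m + 1) *
        derivative^[m + 1] (legendreP l) * derivative^[m.succ] (legendreP l)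
        = (1 - X ^ 2) ^ (m + 1) * (derivative^[m + 1] (legendreP l) *
          derivative^[m + 1] (legendreP l)) - ((l : ℝ) * (l + 1) - m * (m + 1)) •
          ((1 - X ^ 2) ^ m * (derivative^[m] (legendreP l) * derivative^[m] (legendreP l))) := by
      rw [smul_eq_C_mul]; ring
    rw [e, map_sub, map_smul, ih] at h
    simp only [eval_sub, eval_mul, eval_pow, eval_one, eval_X] at h
    rw [show (1 : ℝ) - 1 ^ 2 = 0 by norm_num, show (1 : ℝ) - (-1) ^ 2 = 0 by norm_num,
      zero_pow (Nat.succ_ne_zero m)] at h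
    simp only [zero_mul, sub_zero] at h
    rw [sub_eq_zero.1 h, smul_eq_mul]
    have e1 : l - m = (l - (m + 1)) + 1 := by omega
    have e2 : ((l - (m + 1) : ℕ) : ℝ) = l - (m + 1) := by
      rw [Nat.cast_sub hm]; push_cast; ring
    rw [e1, ← add_assoc, Nat.factorial_succ, Nat.factorial_succ]
    push_cast
    rw [e2]
    have h3 : ((l - (m + 1)).factorial : ℝ) ≠ 0 := by positivity
    have h4 : (l : ℝ) - (m + 1) + 1 ≠ 0 := by
      rw [← e2]; positivity
    field_simp
    ring

end Legendre

/-! ### Real spherical harmonics -/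

section Harmonics
open Polynomial

/-- The azimuthal factor: `cos mφ` for `m ≥ 0` and `sin |m|φ` for `m < 0`. -/
def azimuth (m : ℤ) (φ : ℝ) : ℝ :=
  if 0 ≤ m then Real.cos (m.natAbs * φ) else Real.sin (m.natAbs * φ)

/-- The homogeneous polynomial `Re (x₁ + i x₂)^m` or `Im (x₁ + i x₂)^|m|`. -/
def azimuthPoly (m : ℤ) (x : E3) : ℝ :=
  if 0 ≤ m then (((x 1 : ℂ) + Complex.I * (x 2 : ℂ)) ^ m.natAbs).re
  else (((x 1 : ℂ) + Complex.I * (x 2 : ℂ)) ^ m.natAbs).im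

/-- A polynomial in the polar coordinate times `azimuthPoly`. -/
def harm (q : ℝ[X]) (m : ℤ) (x : E3) : ℝ := q.eval (x 0) * azimuthPoly m x

lemma coord_sph_pow (θ φ : ℝ) (n : ℕ) :
    (((sph θ φ : E3) 1 : ℂ) + Complex.I * ((sph θ φ : E3) 2 : ℂ)) ^ n
      = ((Real.sin θ ^ n * Real.cos (n * φ) : ℝ) : ℂ)
        + Complex.I * ((Real.sin θ ^ n * Real.sin (n * φ) : ℝ) : ℂ) := by
  rw [sph_apply_one, sph_apply_two]
  have h := Complex.cos_add_sin_mul_I_pow n (φ : ℂ)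
  push_cast
  have e : ((Real.sin θ : ℂ) * Complex.cos φ + Complex.I * (Complex.sin θ * Complex.sin φ))
      = Complex.sin θ * (Complex.cos φ + Complex.sin φ * Complex.I) := by push_cast; ring
  push_cast at e
  rw [e, mul_pow, h]
  ring

lemma azimuthPoly_sph (m : ℤ) (θ φ : ℝ) :
    azimuthPoly m (sph θ φ) = Real.sin θ ^ m.natAbs * azimuth m φ := by
  rw [azimuthPoly, azimuth, coord_sph_pow]
  split_ifs <;> simp [-Complex.ofReal_mul, -Complex.ofReal_pow, -Complex.ofReal_cos,
    -Complex.ofReal_sin]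

lemma harm_sph (q : ℝ[X]) (m : ℤ) (θ φ : ℝ) : harm q m (sph θ φ)
    = q.eval (Real.cos θ) * Real.sin θ ^ m.natAbs * azimuth m φ := by
  rw [harm, azimuthPoly_sph, sph_apply_zero]; ring

lemma contDiff_coord {n : WithTop ℕ∞} (i : Fin 3) : ContDiff ℝ n fun x : E3 => x i :=
  contDiff_piLp_apply 2

lemma contDiff_azimuthPoly {n : WithTop ℕ∞} (m : ℤ) : ContDiff ℝ n (azimuthPoly m) := by
  have h1 : ContDiff ℝ n fun x : E3 => ((x 1 : ℂ) + Complex.I * (x 2 : ℂ)) ^ m.natAbs := by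
    have h2 : ∀ i : Fin 3, ContDiff ℝ n fun x : E3 => ((x i : ℝ) : ℂ) := fun i =>
      Complex.ofRealCLM.contDiff.comp (contDiff_coord i)
    exact ((h2 1).add (contDiff_const.mul (h2 2))).pow _
  unfold azimuthPoly
  split_ifs
  · exact Complex.reCLM.contDiff.comp h1
  · exact Complex.imCLM.contDiff.comp h1

lemma contDiff_harm {n : WithTop ℕ∞} (q : ℝ[X]) (m : ℤ) : ContDiff ℝ n (harm q m) := by
  have h1 : ContDiff ℝ n fun x : E3 => q.eval (x 0) := by
    have h2 : ContDiff ℝ n fun t : ℝ => q.eval t := by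
      have := q.contDiff_aeval (𝕜 := ℝ) n
      simp only [Polynomial.coe_aeval_eq_eval] at this
      exact this
    exact h2.comp (contDiff_coord 0)
  exact h1.mul (contDiff_azimuthPoly m)

lemma contMDiff_harm {n : WithTop ℕ∞} (q : ℝ[X]) (m : ℤ) :
    ContMDiff (𝓡 2) 𝓘(ℝ, ℝ) n fun x : S2 => harm q m x :=
  contMDiff_of_contDiffAt fun _ => (contDiff_harm q m).contDiffAt

lemma hasDerivAt_azimuth (m : ℤ) (φ : ℝ) :
    deriv (deriv (azimuth m)) φ = -(m.natAbs : ℝ) ^ 2 * azimuth m φ := by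
  have hl : ∀ φ, HasDerivAt (fun φ : ℝ => (m.natAbs : ℝ) * φ) m.natAbs φ := fun φ => by
    simpa using (hasDerivAt_id φ).const_mul (m.natAbs : ℝ)
  by_cases hm : 0 ≤ m
  · have e : azimuth m = fun φ => Real.cos (m.natAbs * φ) := by
      funext φ; rw [azimuth, if_pos hm]
    rw [e, funext fun φ => ((hl φ).cos).deriv]
    refine ((hl φ).sin.neg.mul_const (m.natAbs : ℝ)).deriv.trans ?_
    ring
  · have e : azimuth m = fun φ => Real.sin (m.natAbs * φ) := by
      funext φ; rw [azimuth, if_neg hm]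
    rw [e, funext fun φ => ((hl φ).sin).deriv]
    refine ((hl φ).cos.mul_const (m.natAbs : ℝ)).deriv.trans ?_
    ring

/-- With `k = |m|` the function is `q(cos θ) sin^k θ` times an azimuthal factor, where `q` is the
`k`-th derivative of `P_l`. After expansion the claim is the `k` times differentiated Legendre
equation for `q` at `cos θ`. -/
lemma sphLap_harm_legendre (l : ℕ) (m : ℤ) {θ : ℝ} (hθ : θ ∈ Ioo 0 Real.pi) (φ : ℝ) :
    sphLap (fun x => harm (derivative^[m.natAbs] (legendreP l)) m x) θ φ
      = -((l : ℝ) * (l + 1)) * harm (derivative^[m.natAbs] (legendreP l)) m (sph θ φ) := by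
  set k := m.natAbs with hk
  set q := derivative^[k] (legendreP l) with hq
  have hpow : ∀ t ∈ Ioo 0 Real.pi, HasDerivAt (fun t => Real.sin t ^ k)
      (k * Real.sin t ^ k * (Real.cos t / Real.sin t)) t := by
    intro t ht
    have hs : Real.sin t ≠ 0 := (Real.sin_pos_of_mem_Ioo ht).ne'
    refine ((Real.hasDerivAt_sin t).pow k).congr_deriv ?_
    rcases k with _ | k
    · simp
    · simp only [Nat.add_sub_cancel, pow_succ]; field_simp
  have hqd : ∀ (p : ℝ[X]) t, HasDerivAt (fun t => p.eval (Real.cos t))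
      (-((derivative p).eval (Real.cos t) * Real.sin t)) t := fun p t => by
    refine ((p.hasDerivAt (Real.cos t)).comp t (Real.hasDerivAt_cos t)).congr_deriv (by ring)
  have hcot : ∀ t ∈ Ioo 0 Real.pi, HasDerivAt (fun t => Real.cos t / Real.sin t)
      (-(1 / Real.sin t ^ 2)) t := by
    intro t ht
    have hs : Real.sin t ≠ 0 := (Real.sin_pos_of_mem_Ioo ht).ne'
    refine ((Real.hasDerivAt_cos t).div (Real.hasDerivAt_sin t) hs).congr_deriv ?_
    have := Real.sin_sq_add_cos_sq t
    field_simp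
    linarith
  have h1 : ∀ t ∈ Ioo 0 Real.pi, HasDerivAt (fun t => harm q m (sph t φ))
      ((-((derivative q).eval (Real.cos t) * Real.sin t) * Real.sin t ^ k
        + q.eval (Real.cos t) * (k * Real.sin t ^ k * (Real.cos t / Real.sin t)))
          * azimuth m φ) t := by
    intro t ht
    simp_rw [harm_sph]
    exact ((hqd q t).mul (hpow t ht)).mul_const _
  have h2' := (((((hqd (derivative q) θ).mul (Real.hasDerivAt_sin θ)).neg.mul (hpow θ hθ)).add
    ((hqd q θ).mul (((hpow θ hθ).const_mul (k : ℝ)).mul (hcot θ hθ)))).mul_const (azimuth m φ))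
  have h2 : HasDerivAt (deriv fun t => harm q m (sph t φ)) _ θ :=
    h2'.congr_of_eventuallyEq (by
      filter_upwards [isOpen_Ioo.mem_nhds hθ] with t ht
      exact (h1 t ht).deriv)
  have hs : Real.sin θ ≠ 0 := (Real.sin_pos_of_mem_Ioo hθ).ne'
  have h3 : deriv (deriv fun s => harm q m (sph θ s)) φ
      = q.eval (Real.cos θ) * Real.sin θ ^ k * (-(k : ℝ) ^ 2 * azimuth m φ) := by
    simp_rw [harm_sph]
    have e : ∀ a : ℝ, deriv (fun s => a * azimuth m s) = fun s => a * deriv (azimuth m) s :=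
      fun a => funext fun s => deriv_const_mul_field a
    rw [e, deriv_const_mul_field, hasDerivAt_azimuth]
  rw [sphLap, h2.deriv, (h1 θ hθ).deriv, h3, harm_sph]
  have hode := legendreP_ode_eval l k (Real.cos θ)
  rw [Function.iterate_succ_apply', Function.iterate_succ_apply', ← hq] at hode
  have hc : Real.cos θ ^ 2 = 1 - Real.sin θ ^ 2 := by
    have := Real.sin_sq_add_cos_sq θ; linarith
  rw [hc] at hode
  simp only [Pi.mul_apply, Pi.neg_apply]
  field_simp
  have hode' : (derivative (derivative q)).eval (Real.cos θ) * Real.sin θ ^ 2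
      = 2 * (k + 1) * Real.cos θ * (derivative q).eval (Real.cos θ)
      - ((l : ℝ) * (l + 1) - k * (k + 1)) * q.eval (Real.cos θ) := by linarith
  rw [← hk]
  linear_combination (Real.sin θ ^ k * azimuth m φ * Real.sin θ ^ 2) * hode'
    + (Real.sin θ ^ k * azimuth m φ * (k ^ 2 + k) * q.eval (Real.cos θ)) * hc

lemma eq_of_eq_on_sph {f g : S2 → ℝ} (hf : Continuous f) (hg : Continuous g)
    (h : ∀ θ ∈ Ioo 0 Real.pi, ∀ φ, f (sph θ φ) = g (sph θ φ)) : f = g := by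
  funext x
  obtain ⟨θ, hθ, φ, -, rfl⟩ := sph_surj x
  have hc : Continuous fun t => sph t φ :=
    continuous_sph.comp (continuous_id.prodMk continuous_const)
  have hE : EqOn (fun t => f (sph t φ)) (fun t => g (sph t φ)) (closure (Ioo 0 Real.pi)) :=
    EqOn.closure (fun t ht => h t ht φ) (hf.comp hc) (hg.comp hc)
  rw [closure_Ioo Real.pi_pos.ne] at hE
  exact hE hθ

lemma lap_eq_of_sphLap {f g : S2 → ℝ} (hf : IsC2 f) (hg : Continuous g)
    (h : ∀ θ ∈ Ioo 0 Real.pi, ∀ φ, sphLap f θ φ = g (sph θ φ)) : lap f = g :=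
  eq_of_eq_on_sph (continuous_lap hf) hg fun θ hθ φ => by
    rw [← h θ hθ φ, sphLap_eq_lap hf (Real.sin_pos_of_mem_Ioo hθ).ne']

lemma lap_const_mul {f : S2 → ℝ} (hf : IsC2 f) (a : ℝ) :
    lap (fun x => a * f x) = fun x => a * lap f x := by
  funext x
  have h := InnerProductSpace.laplacian_smul (𝕜 := ℝ) a
    (contDiffAt_homExt two_le_top hf (S2_ne_zero x))
  exact h

/-- The normalizing constant of the real spherical harmonics. -/
def realConst (l k : ℕ) : ℝ :=
  Real.sqrt ((2 * l + 1) / (4 * Real.pi) * ((l - k).factorial / (l + k).factorial))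
    * (if k = 0 then 1 else Real.sqrt 2)

/-- The real spherical harmonics. -/
def realY (l : ℕ) (m : ℤ) (x : S2) : ℝ :=
  realConst l m.natAbs * harm (derivative^[m.natAbs] (legendreP l)) m x

lemma contMDiff_realY {n : WithTop ℕ∞} (l : ℕ) (m : ℤ) :
    ContMDiff (𝓡 2) 𝓘(ℝ, ℝ) n (realY l m) :=
  (contDiff_const.mul contDiff_id).contMDiff.comp (contMDiff_harm _ m)

lemma continuous_realY (l : ℕ) (m : ℤ) : Continuous (realY l m) :=
  (contMDiff_realY (n := 0) l m).continuous

lemma lap_realY (l : ℕ) (m : ℤ) :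
    lap (realY l m) = fun x => -((l : ℝ) * (l + 1)) * realY l m x := by
  have h := lap_eq_of_sphLap (g := fun x => -((l : ℝ) * (l + 1)) *
    harm (derivative^[m.natAbs] (legendreP l)) m x) (contMDiff_harm _ m)
    (continuous_const.mul (contMDiff_harm (n := 0) _ m).continuous)
    (fun θ hθ φ => sphLap_harm_legendre l m hθ φ)
  have := lap_const_mul (f := fun x => harm (derivative^[m.natAbs] (legendreP l)) m x)
    (contMDiff_harm _ m) (realConst l m.natAbs)
  rw [show realY l m = fun x : S2 => realConst l m.natAbs *
    harm (derivative^[m.natAbs] (legendreP l)) m x from rfl, this, h]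
  funext x
  ring

/-! ### Orthonormality -/

lemma integral_cos_nat_mul (n : ℤ) :
    ∫ φ in (0 : ℝ)..2 * Real.pi, Real.cos (n * φ) = if n = 0 then 2 * Real.pi else 0 := by
  split_ifs with h
  · subst h; simp
  · have hn : (n : ℝ) ≠ 0 := by exact_mod_cast h
    rw [intervalIntegral.integral_comp_mul_left (fun x => Real.cos x) hn, integral_cos]
    have : Real.sin ((n : ℝ) * (2 * Real.pi)) = 0 := by
      rw [show (n : ℝ) * (2 * Real.pi) = ((n * 2 : ℤ) : ℝ) * Real.pi by push_cast; ring]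
      exact Real.sin_int_mul_pi _
    simp [this]

lemma integral_sin_nat_mul (n : ℤ) : ∫ φ in (0 : ℝ)..2 * Real.pi, Real.sin (n * φ) = 0 := by
  by_cases h : n = 0
  · subst h; simp
  · have hn : (n : ℝ) ≠ 0 := by exact_mod_cast h
    rw [intervalIntegral.integral_comp_mul_left (fun x => Real.sin x) hn, integral_sin]
    have : Real.cos ((n : ℝ) * (2 * Real.pi)) = 1 := Real.cos_int_mul_two_pi n
    simp [this]

lemma integral_azimuth_mul (m n : ℤ) :
    ∫ φ in (0 : ℝ)..2 * Real.pi, azimuth m φ * azimuth n φ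
      = if m = n then (if m.natAbs = 0 then 2 * Real.pi else Real.pi) else 0 := by
  have hcc : ∀ a b : ℤ, ∫ φ in (0 : ℝ)..2 * Real.pi, Real.cos (a * φ) * Real.cos (b * φ)
      = ((if a - b = 0 then 2 * Real.pi else 0) + (if a + b = 0 then 2 * Real.pi else 0)) / 2 := by
    intro a b
    rw [← integral_cos_nat_mul, ← integral_cos_nat_mul, ← intervalIntegral.integral_add
      ((by fun_prop : Continuous _).intervalIntegrable _ _)
      ((by fun_prop : Continuous _).intervalIntegrable _ _), ← intervalIntegral.integral_div]
    refine intervalIntegral.integral_congr fun φ _ => ?_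
    push_cast
    rw [sub_mul, add_mul, Real.cos_sub, Real.cos_add]
    ring
  have hss : ∀ a b : ℤ, ∫ φ in (0 : ℝ)..2 * Real.pi, Real.sin (a * φ) * Real.sin (b * φ)
      = ((if a - b = 0 then 2 * Real.pi else 0) - (if a + b = 0 then 2 * Real.pi else 0)) / 2 := by
    intro a b
    rw [← integral_cos_nat_mul, ← integral_cos_nat_mul, ← intervalIntegral.integral_sub
      ((by fun_prop : Continuous _).intervalIntegrable _ _)
      ((by fun_prop : Continuous _).intervalIntegrable _ _), ← intervalIntegral.integral_div]
    refine intervalIntegral.integral_congr fun φ _ => ?_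
    push_cast
    rw [sub_mul, add_mul, Real.cos_sub, Real.cos_add]
    ring
  have hsc : ∀ a b : ℤ, ∫ φ in (0 : ℝ)..2 * Real.pi, Real.sin (a * φ) * Real.cos (b * φ) = 0 := by
    intro a b
    have h := intervalIntegral.integral_add
      ((by fun_prop : Continuous fun φ : ℝ => Real.sin ((a - b : ℤ) * φ)).intervalIntegrable
        (μ := volume) 0 (2 * Real.pi))
      ((by fun_prop : Continuous fun φ : ℝ => Real.sin ((a + b : ℤ) * φ)).intervalIntegrable
        (μ := volume) 0 (2 * Real.pi))
    rw [integral_sin_nat_mul, integral_sin_nat_mul, add_zero] at h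
    have h' := congrArg (· / 2) h
    simp only [zero_div, ← intervalIntegral.integral_div] at h'
    refine Eq.trans (intervalIntegral.integral_congr fun φ _ => ?_) h'
    push_cast
    rw [sub_mul, add_mul, Real.sin_sub, Real.sin_add]
    ring
  have hcs : ∀ a b : ℤ, ∫ φ in (0 : ℝ)..2 * Real.pi, Real.cos (a * φ) * Real.sin (b * φ) = 0 :=
    fun a b => by simp_rw [mul_comm (Real.cos _)]; exact hsc b a
  have e : ∀ m : ℤ, ((m.natAbs : ℕ) : ℝ) = ((m.natAbs : ℤ) : ℝ) := fun m => (Int.cast_natCast _).symm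
  simp only [azimuth, e]
  by_cases hm : 0 ≤ m <;> by_cases hn : 0 ≤ n <;> simp only [hm, hn, if_true, if_false]
  · rw [hcc]
    by_cases h : m = n
    · subst h
      by_cases h0 : m.natAbs = 0
      · simp [h0]
      · have : m ≠ 0 := by omega
        simp [this]
    · have h1 : (m.natAbs : ℤ) - n.natAbs ≠ 0 := by omega
      have h2 : (m.natAbs : ℤ) + n.natAbs ≠ 0 := by omega
      simp only [h, h1, h2, if_false]; norm_num
  · rw [hcs, if_neg (by omega)]
  · rw [hsc, if_neg (by omega)]
  · rw [hss]
    have h2 : (m.natAbs : ℤ) + n.natAbs ≠ 0 := by omega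
    by_cases h : m = n
    · subst h
      have h0 : m ≠ 0 := by omega
      simp [h0]
    · have h1 : (m.natAbs : ℤ) - n.natAbs ≠ 0 := by omega
      simp only [h, h1, h2, if_false]; norm_num

lemma integral_sin_mul_eval_cos (k : ℕ) (g : ℝ[X]) :
    ∫ θ in (0 : ℝ)..Real.pi, Real.sin θ * (Real.sin θ ^ (2 * k) * g.eval (Real.cos θ))
      = polyInt ((1 - X ^ 2) ^ k * g) := by
  have h := intervalIntegral.integral_comp_mul_deriv (a := 0) (b := Real.pi)
    (f := Real.cos) (f' := fun θ => -Real.sin θ) (g := fun x => ((1 - X ^ 2) ^ k * g).eval x)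
    (fun θ _ => Real.hasDerivAt_cos θ) (by fun_prop)
    (((1 - X ^ 2) ^ k * g : ℝ[X]).continuous)
  rw [Real.cos_zero, Real.cos_pi, intervalIntegral.integral_symm (-1) 1] at h
  rw [polyInt_apply, ← neg_neg (∫ x in (-1 : ℝ)..1, _), ← h, ← intervalIntegral.integral_neg]
  refine intervalIntegral.integral_congr fun θ _ => ?_
  simp only [Function.comp, eval_mul, eval_pow, eval_sub, eval_one, eval_X]
  rw [pow_mul, Real.sin_sq]
  ring

lemma integral_harm_mul (q p : ℝ[X]) (m n : ℤ) :
    ∫ x : S2, harm q m x * harm p n x ∂sphMeasure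
      = if m = n then (if m.natAbs = 0 then 2 * Real.pi else Real.pi)
          * polyInt ((1 - X ^ 2) ^ m.natAbs * (q * p)) else 0 := by
  rw [integral_sphMeasure_eq (h := fun x : S2 => harm q m x * harm p n x)
    ((contMDiff_harm (n := 0) q m).continuous.mul (contMDiff_harm (n := 0) p n).continuous)]
  have e : ∀ θ φ : ℝ, Real.sin θ • (harm q m (sph θ φ) * harm p n (sph θ φ))
      = (Real.sin θ * (Real.sin θ ^ (m.natAbs + n.natAbs) * (q * p).eval (Real.cos θ)))
        * (azimuth m φ * azimuth n φ) := by
    intro θ φ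
    rw [harm_sph, harm_sph, eval_mul, smul_eq_mul, pow_add]; ring
  simp_rw [e, intervalIntegral.integral_const_mul, integral_azimuth_mul]
  rw [intervalIntegral.integral_mul_const]
  split_ifs with h h0
  · subst h
    rw [← two_mul, integral_sin_mul_eval_cos]; ring
  · subst h
    rw [← two_mul, integral_sin_mul_eval_cos]; ring
  · simp

theorem realY_orthonormal {l k : ℕ} {m n : ℤ} (hm : m.natAbs ≤ l) :
    ∫ x, realY l m x * realY k n x ∂sphMeasure = if l = k ∧ m = n then 1 else 0 := by
  have e : ∀ x : S2, realY l m x * realY k n x = realConst l m.natAbs * realConst k n.natAbs *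
      (harm (derivative^[m.natAbs] (legendreP l)) m x *
        harm (derivative^[n.natAbs] (legendreP k)) n x) := fun x => by
    rw [realY, realY]; ring
  simp_rw [e]
  rw [integral_const_mul, integral_harm_mul]
  by_cases hmn : m = n
  · subst hmn
    by_cases hlk : l = k
    · subst hlk
      rw [polyInt_weighted_sq hm]
      simp only [and_self, if_true]
      rw [realConst]
      set a := (2 * (l : ℝ) + 1) / (4 * Real.pi) *
        ((l - m.natAbs).factorial / (l + m.natAbs).factorial) with ha
      have ha0 : 0 ≤ a := by positivity
      have h1 : Real.sqrt a * Real.sqrt a = a := Real.mul_self_sqrt ha0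
      have h2 : Real.sqrt 2 * Real.sqrt 2 = 2 := Real.mul_self_sqrt (by norm_num)
      have f1 : ((l - m.natAbs).factorial : ℝ) ≠ 0 := by positivity
      have f2 : ((l + m.natAbs).factorial : ℝ) ≠ 0 := by positivity
      have f3 : (2 * (l : ℝ) + 1) ≠ 0 := by positivity
      have hπ := Real.pi_ne_zero
      split_ifs
      · rw [mul_one, h1, ha]; field_simp; norm_num
      · rw [mul_mul_mul_comm (Real.sqrt a), h1, h2, ha]; field_simp; norm_num
    · rw [polyInt_legendreP_orthogonal hlk]; simp [hlk]
  · simp [hmn]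

end Harmonics

/-! ### Completeness of the real spherical harmonics -/

section Density
open Polynomial

lemma continuous_harm (q : ℝ[X]) (m : ℤ) : Continuous fun x : S2 => harm q m x :=
  (contMDiff_harm (n := 0) q m).continuous

/-- `harm q m` as an element of `C(S², ℝ)`, linearly in `q`. -/
def harmC (m : ℤ) : ℝ[X] →ₗ[ℝ] C(S2, ℝ) where
  toFun q := ⟨fun x => harm q m x, continuous_harm q m⟩
  map_add' p q := by ext x; simp [harm, add_mul]
  map_smul' a q := by ext x; simp [harm, mul_assoc]

lemma harmC_apply (m : ℤ) (q : ℝ[X]) (x : S2) : harmC m q x = q.eval ((x : E3) 0) * azimuthPoly m x :=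
  rfl

/-- `realY l m` as an element of `C(S², ℝ)`. -/
def realYC (l : ℕ) (m : ℤ) : C(S2, ℝ) := ⟨realY l m, continuous_realY l m⟩

/-- The linear span of the real spherical harmonics. -/
def harmonicSpan : Submodule ℝ C(S2, ℝ) :=
  Submodule.span ℝ {f | ∃ (l : ℕ) (m : ℤ), m.natAbs ≤ l ∧ f = realYC l m}

lemma realConst_ne_zero (l k : ℕ) : realConst l k ≠ 0 := by
  rw [realConst]
  have : (0 : ℝ) < (2 * l + 1) / (4 * Real.pi) * ((l - k).factorial / (l + k).factorial) := by
    have := Real.pi_pos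
    positivity
  refine mul_ne_zero (Real.sqrt_pos.2 this).ne' ?_
  split_ifs <;> simp

lemma realYC_eq (l : ℕ) (m : ℤ) :
    realYC l m = realConst l m.natAbs • harmC m (derivative^[m.natAbs] (legendreP l)) := rfl

/-- Membership means vanishing in the quotient by the span. For a fixed order the derivatives of the
Legendre polynomials have every exact degree `k`, attained at `l = k + |m|`, and their images are
nonzero multiples of harmonics. -/
lemma harmC_mem (m : ℤ) (q : ℝ[X]) : harmC m q ∈ harmonicSpan := by
  rw [← Submodule.Quotient.mk_eq_zero, ← Submodule.mkQ_apply, ← LinearMap.comp_apply]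
  refine linearMap_eq_zero_of_degree
    (p := fun k => derivative^[m.natAbs] (legendreP (k + m.natAbs))) _ (q.natDegree + 1)
    (fun k => ?_) (fun k => ?_) (fun k _ => ?_) ?_
  · simpa using natDegree_derivative_legendreP (k + m.natAbs) m.natAbs
  · simpa using coeff_derivative_legendreP (l := k + m.natAbs) (m := m.natAbs) (by omega)
  · rw [LinearMap.comp_apply, Submodule.mkQ_apply, Submodule.Quotient.mk_eq_zero]
    have h : realYC (k + m.natAbs) m ∈ harmonicSpan :=
      Submodule.subset_span ⟨_, m, by omega, rfl⟩
    rw [realYC_eq] at h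
    exact (Submodule.smul_mem_iff _ (realConst_ne_zero _ _)).1 h
  · exact degree_le_natDegree.trans_lt (by exact_mod_cast Nat.lt_succ_self _)

/-- The functions `q(x₀) Re (x₁ + i x₂)^n` and `q(x₀) Im (x₁ + i x₂)^n`. -/
def coordC (q : ℝ[X]) (n : ℕ) (z : ℂ) : C(S2, ℝ) :=
  ⟨fun x => q.eval ((x : E3) 0) *
    (z * (((x : E3) 1 : ℂ) + Complex.I * ((x : E3) 2 : ℂ)) ^ n).re, by
      have h : ∀ i : Fin 3, Continuous fun x : S2 => (x : E3) i := fun i =>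
        (contDiff_coord (n := 0) i).continuous.comp continuous_subtype_val
      have h0 := h 0
      have h1 := h 1
      have h2 := h 2
      exact (q.continuous.comp h0).mul (by fun_prop)⟩

lemma coordC_mem (q : ℝ[X]) (n : ℕ) (z : ℂ) : coordC q n z ∈ harmonicSpan := by
  have e : coordC q n z = z.re • harmC n q - z.im •
      (if n = 0 then 0 else harmC (-n) q) := by
    ext x
    rcases n with _ | n
    · simp [coordC, harmC_apply, azimuthPoly]; ring
    · have hn : ¬ (0 : ℤ) ≤ -((n + 1 : ℕ) : ℤ) := by omega
      have hp : (0 : ℤ) ≤ ((n + 1 : ℕ) : ℤ) := by omega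
      simp only [coordC, ContinuousMap.coe_mk, Complex.mul_re, ContinuousMap.sub_apply,
        ContinuousMap.smul_apply, harmC_apply, azimuthPoly, hn, hp, if_true, if_false,
        Int.natAbs_neg, Int.natAbs_natCast, smul_eq_mul, Nat.succ_ne_zero]
      ring
  rw [e]
  refine Submodule.sub_mem _ (Submodule.smul_mem _ _ (harmC_mem _ _))
    (Submodule.smul_mem _ _ ?_)
  split_ifs
  · exact Submodule.zero_mem _
  · exact harmC_mem _ _

/-- The coordinate functions on the sphere. -/
def coordFun (i : Fin 3) : C(S2, ℝ) :=
  ⟨fun x => (x : E3) i, (contDiff_coord (n := 0) i).continuous.comp continuous_subtype_val⟩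

lemma S2_sq_add (x : S2) : (x : E3) 0 ^ 2 + (x : E3) 1 ^ 2 + (x : E3) 2 ^ 2 = 1 := by
  have h := S2_norm x
  rw [EuclideanSpace.norm_eq, Real.sqrt_eq_one] at h
  simpa [Fin.sum_univ_three] using h

/-- Put `w = x₁ + i x₂`. The coordinate `x₀` multiplies `q`, while `x₁` and `x₂` are linear
combinations of `w` and its conjugate. The former raises the power of `w`; the latter lowers it, as
`w` times its conjugate is `1 - x₀²` on the sphere. -/
lemma coordFun_mul_coordC (i : Fin 3) (q : ℝ[X]) (n : ℕ) (z : ℂ) :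
    coordFun i * coordC q n z ∈ harmonicSpan := by
  have key : ∀ b : ℂ, ∃ g ∈ harmonicSpan, ∀ x : S2, g x = q.eval ((x : E3) 0) *
      ((b * ((x : E3) 1 - Complex.I * ((x : E3) 2 : ℂ))) *
        (z * (((x : E3) 1 : ℂ) + Complex.I * ((x : E3) 2 : ℂ)) ^ n)).re := by
    intro b
    rcases n with _ | n
    -- For `n = 0` there is no power to lower; the conjugate of `w` is traded for `w` by conjugating
    -- under the real part.
    · refine ⟨coordC q 1 (conj (b * z)), coordC_mem _ _ _, fun x => ?_⟩
      simp [coordC]; left; ring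
    · refine ⟨coordC ((1 - X ^ 2) * q) n (b * z), coordC_mem _ _ _, fun x => ?_⟩
      have h := S2_sq_add x
      simp only [coordC, ContinuousMap.coe_mk, eval_mul, eval_sub, eval_one, eval_pow, eval_X]
      have e : (b * (((x : E3) 1 : ℂ) - Complex.I * ((x : E3) 2 : ℂ)) *
          (z * (((x : E3) 1 : ℂ) + Complex.I * ((x : E3) 2 : ℂ)) ^ (n + 1)))
          = ((1 - (x : E3) 0 ^ 2 : ℝ) : ℂ) *
            (b * z * (((x : E3) 1 : ℂ) + Complex.I * ((x : E3) 2 : ℂ)) ^ n) := by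
        rw [show (1 : ℝ) - (x : E3) 0 ^ 2 = (x : E3) 1 ^ 2 + (x : E3) 2 ^ 2 by linarith]
        push_cast
        linear_combination (-b * z * (((x : E3) 1 : ℂ) + Complex.I * ((x : E3) 2 : ℂ)) ^ n *
          ((x : E3) 2 : ℂ) ^ 2) * Complex.I_sq
      rw [e, Complex.re_ofReal_mul]
      ring
  have hhalf : ∀ x : S2, ∀ w : ℂ, (x : E3) 1 * w.re
      = ((1 / 2 * (((x : E3) 1 : ℂ) - Complex.I * ((x : E3) 2 : ℂ))) * w).re
        + (w / 2 * (((x : E3) 1 : ℂ) + Complex.I * ((x : E3) 2 : ℂ))).re := by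
    intro x w
    rw [← Complex.add_re, ← Complex.re_ofReal_mul]
    congr 1; ring
  have hhalf2 : ∀ x : S2, ∀ w : ℂ, (x : E3) 2 * w.re
      = ((Complex.I / 2 * (((x : E3) 1 : ℂ) - Complex.I * ((x : E3) 2 : ℂ))) * w).re
        + (-Complex.I * w / 2 * (((x : E3) 1 : ℂ) + Complex.I * ((x : E3) 2 : ℂ))).re := by
    intro x w
    rw [← Complex.add_re, ← Complex.re_ofReal_mul]
    congr 1
    linear_combination (w * ((x : E3) 2 : ℂ)) * Complex.I_sq
  fin_cases i
  · have e : coordFun 0 * coordC q n z = coordC (X * q) n z := by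
      ext x; simp [coordFun, coordC]; ring
    exact e ▸ coordC_mem _ _ _
  · obtain ⟨g, hg, hgx⟩ := key (1 / 2)
    have e : coordFun 1 * coordC q n z = g + coordC q (n + 1) (z / 2) := by
      ext x
      rw [ContinuousMap.add_apply, hgx, ContinuousMap.mul_apply]
      simp only [coordFun, coordC, ContinuousMap.coe_mk]
      rw [mul_left_comm, hhalf, mul_add]
      congr 3
      ring
    exact e ▸ Submodule.add_mem _ hg (coordC_mem _ _ _)
  · obtain ⟨g, hg, hgx⟩ := key (Complex.I / 2)
    have e : coordFun 2 * coordC q n z = g + coordC q (n + 1) (-Complex.I * z / 2) := by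
      ext x
      rw [ContinuousMap.add_apply, hgx, ContinuousMap.mul_apply]
      simp only [coordFun, coordC, ContinuousMap.coe_mk]
      rw [mul_left_comm, hhalf2, mul_add]
      congr 3
      ring
    exact e ▸ Submodule.add_mem _ hg (coordC_mem _ _ _)

lemma coordFun_mul_mem (i : Fin 3) {f : C(S2, ℝ)} (hf : f ∈ harmonicSpan) :
    coordFun i * f ∈ harmonicSpan := by
  induction hf using Submodule.span_induction with
  | mem f h =>
    obtain ⟨l, m, -, rfl⟩ := h
    have : ∃ z : ℂ, harmC m (derivative^[m.natAbs] (legendreP l))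
        = coordC (derivative^[m.natAbs] (legendreP l)) m.natAbs z := by
      by_cases hm : 0 ≤ m
      · refine ⟨1, ?_⟩
        ext x; simp [harmC_apply, coordC, azimuthPoly, hm]
      · refine ⟨-Complex.I, ?_⟩
        ext x; simp [harmC_apply, coordC, azimuthPoly, hm]
    obtain ⟨z, hz⟩ := this
    rw [realYC_eq, hz, mul_smul_comm]
    exact Submodule.smul_mem _ _ (coordFun_mul_coordC _ _ _ _)
  | zero => rw [mul_zero]; exact Submodule.zero_mem _
  | add f g _ _ h1 h2 => rw [mul_add]; exact Submodule.add_mem _ h1 h2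
  | smul a f _ h => rw [mul_smul_comm]; exact Submodule.smul_mem _ _ h

lemma adjoin_coord_le : (Algebra.adjoin ℝ (range coordFun)).toSubmodule ≤ harmonicSpan := by
  intro a ha
  -- Stability under multiplication by `a` passes to products in the induction, which mere
  -- membership would not. The case `u = 1` gives the claim.
  have h : ∀ u ∈ harmonicSpan, a * u ∈ harmonicSpan := by
    rw [Subalgebra.mem_toSubmodule] at ha
    induction ha using Algebra.adjoin_induction with
    | mem a h =>
      obtain ⟨i, rfl⟩ := h
      exact fun u hu => coordFun_mul_mem i hu
    | algebraMap r =>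
      intro u hu
      rw [← Algebra.smul_def]
      exact Submodule.smul_mem _ _ hu
    | add a b _ _ h1 h2 =>
      intro u hu
      rw [add_mul]
      exact Submodule.add_mem _ (h1 u hu) (h2 u hu)
    | mul a b _ _ h1 h2 =>
      intro u hu
      rw [mul_assoc]
      exact h1 _ (h2 u hu)
  have h1 := h (coordC 1 0 1) (coordC_mem _ _ _)
  have e : coordC 1 0 1 = 1 := by ext x; simp [coordC]
  rwa [e, mul_one] at h1

/-- Stone-Weierstrass: the coordinates separate points, and the algebra they generate lies in the
span. -/
theorem harmonicSpan_dense : harmonicSpan.topologicalClosure = ⊤ := by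
  have h := ContinuousMap.subalgebra_topologicalClosure_eq_top_of_separatesPoints
    (Algebra.adjoin ℝ (range coordFun)) (by
      intro x y hxy
      have : ∃ i, (x : E3) i ≠ (y : E3) i := by
        by_contra! hc
        exact hxy (Subtype.ext (by ext i; exact hc i))
      obtain ⟨i, hi⟩ := this
      exact ⟨coordFun i, ⟨coordFun i, Algebra.subset_adjoin ⟨i, rfl⟩, rfl⟩, hi⟩)
  rw [eq_top_iff]
  intro f _
  have hf : f ∈ (Algebra.adjoin ℝ (range coordFun)).topologicalClosure := by rw [h]; trivial
  exact closure_mono (adjoin_coord_le : _) hf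

/-- Density in the form in which it is applied: to the pairing with a fixed function, for
completeness, and to the defect of rotation invariance of the integral. -/
lemma clm_eq_zero_of_realY {E : Type*} [NormedAddCommGroup E] [NormedSpace ℝ E]
    (Λ : C(S2, ℝ) →L[ℝ] E)
    (h : ∀ (l : ℕ) (m : ℤ), m.natAbs ≤ l → Λ (realYC l m) = 0) : Λ = 0 := by
  ext f
  have hf : f ∈ harmonicSpan.topologicalClosure := by rw [harmonicSpan_dense]; trivial
  have h1 : harmonicSpan ≤ Λ.ker := by
    refine Submodule.span_le.2 ?_
    rintro _ ⟨l, m, hm, rfl⟩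
    exact h l m hm
  exact harmonicSpan.topologicalClosure_minimal h1 Λ.isClosed_ker hf

/-- Integration of continuous functions against a continuous weight. -/
def integralC (f : C(S2, ℝ)) : C(S2, ℝ) →L[ℝ] ℝ :=
  LinearMap.mkContinuous
    { toFun := fun g => ∫ x, f x * g x ∂sphMeasure
      map_add' := fun g h => by
        simp_rw [ContinuousMap.add_apply, mul_add]
        exact integral_add (integrable_sphMeasure (f.continuous.mul g.continuous))
          (integrable_sphMeasure (f.continuous.mul h.continuous))
      map_smul' := fun a g => by
        simp_rw [ContinuousMap.smul_apply, smul_eq_mul, RingHom.id_apply, mul_left_comm _ a]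
        exact integral_const_mul _ _ }
    (‖f‖ * sphMeasure.real univ) fun g => by
      refine (norm_integral_le_of_norm_le_const (C := ‖f‖ * ‖g‖)
        (Eventually.of_forall fun x => ?_)).trans (le_of_eq (by ring))
      rw [norm_mul]
      exact mul_le_mul (f.norm_coe_le_norm x) (g.norm_coe_le_norm x) (norm_nonneg _) (norm_nonneg _)

lemma integralC_apply (f g : C(S2, ℝ)) : integralC f g = ∫ x, f x * g x ∂sphMeasure := rfl

theorem eq_zero_of_integral_realY {f : S2 → ℝ} (hf : Continuous f)
    (h : ∀ (l : ℕ) (m : ℤ), m.natAbs ≤ l → ∫ x, f x * realY l m x ∂sphMeasure = 0) : f = 0 := by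
  have h0 := clm_eq_zero_of_realY (integralC ⟨f, hf⟩) h
  exact eq_zero_of_integral_sq_eq_zero hf (DFunLike.congr_fun h0 (⟨f, hf⟩ : C(S2, ℝ)))

/-! ### Rotation invariance of the surface measure -/

lemma lap_const (a : ℝ) : lap (fun _ => a) = 0 := by
  refine lap_eq_of_sphLap contMDiff_const continuous_const fun θ _ φ => ?_
  simp [sphLap]

lemma realY_zero_zero (x : S2) : realY 0 0 x = realConst 0 0 := by
  simp [realY, harm, azimuthPoly, legendreP]

/-- No change of variables is needed. It suffices to test on harmonics: for `l ≥ 1` a harmonic and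
its rotation are both eigenfunctions with nonzero eigenvalue, hence have integral zero by Green's
identity against `1`; for `l = 0` the harmonic is constant. -/
theorem integral_rot (R : E3 ≃ₗᵢ[ℝ] E3) {f : S2 → ℝ} (hf : Continuous f) :
    ∫ x, f (rot R x) ∂sphMeasure = ∫ x, f x ∂sphMeasure := by
  have h0 : (integralC 1).comp (ContinuousMap.compCLM ℝ ℝ ⟨rot R, continuous_rot R⟩)
      - integralC 1 = 0 := by
    refine clm_eq_zero_of_realY _ fun l m hm => ?_
    have e : ((integralC 1).comp (ContinuousMap.compCLM ℝ ℝ ⟨rot R, continuous_rot R⟩)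
        - integralC 1) (realYC l m)
        = (∫ x, realY l m (rot R x) ∂sphMeasure) - ∫ x, realY l m x ∂sphMeasure := by
      simp [integralC_apply, realYC]
    rw [e, sub_eq_zero]
    rcases Nat.eq_zero_or_pos l with rfl | hl
    · have : m = 0 := by omega
      subst this
      simp_rw [realY_zero_zero]
    · have hz : ∀ f : S2 → ℝ, IsC2 f → lap f = (fun x => -((l : ℝ) * (l + 1)) * f x) →
          ∫ x, f x ∂sphMeasure = 0 := by
        intro f hf hl2
        have h := green (f := fun _ => 1) contMDiff_const hf
        rw [hl2, lap_const] at h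
        simp only [one_mul, Pi.zero_apply, mul_zero, integral_zero] at h
        rw [integral_const_mul] at h
        have hl0 : (0 : ℝ) < l := by exact_mod_cast hl
        rcases mul_eq_zero.1 h with h | h
        · nlinarith
        · exact h
      rw [hz _ (contMDiff_realY l m) (lap_realY l m),
        hz (fun x => realY l m (rot R x)) (contMDiff_rot R two_le_top (contMDiff_realY l m))]
      funext x
      rw [lap_rot, lap_realY]
  have h1 := DFunLike.congr_fun h0 (⟨f, hf⟩ : C(S2, ℝ))
  simpa [integralC_apply, sub_eq_zero] using h1

end Density

/-! ### Rotations -/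

section Rotations
open Submodule

lemma det_reflection_eq (v : E3) :
    LinearMap.det ((ℝ ∙ v)ᗮ.reflection.toLinearEquiv : E3 →ₗ[ℝ] E3) = 1 ∨
      LinearMap.det ((ℝ ∙ v)ᗮ.reflection.toLinearEquiv : E3 →ₗ[ℝ] E3) = -1 := by
  rw [det_reflection]; exact neg_one_pow_eq_or ℝ _

lemma det_reflection_of_ne_zero {v : E3} (hv : v ≠ 0) :
    LinearMap.det ((ℝ ∙ v)ᗮ.reflection.toLinearEquiv : E3 →ₗ[ℝ] E3) = -1 := by
  rw [det_reflection, orthogonal_orthogonal, finrank_span_singleton hv, pow_one]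

lemma reflection_eq_self_of_inner {v x : E3} (h : inner ℝ v x = 0) :
    (ℝ ∙ v)ᗮ.reflection x = x :=
  reflection_mem_subspace_eq_self (mem_orthogonal_singleton_iff_inner_right.2 h)

lemma exists_ne_zero_inner_eq_zero (x y : E3) :
    ∃ u : E3, u ≠ 0 ∧ inner ℝ u x = 0 ∧ inner ℝ u y = 0 := by
  let L : E3 →ₗ[ℝ] (ℝ × ℝ) := (innerₛₗ ℝ x).prod (innerₛₗ ℝ y)
  have h : LinearMap.ker L ≠ ⊥ := LinearMap.ker_ne_bot_of_finrank_lt (by simp)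
  obtain ⟨u, hu, hu0⟩ := (Submodule.ne_bot_iff _).1 h
  have h1 : (inner ℝ x u, inner ℝ y u) = ((0 : ℝ), (0 : ℝ)) := hu
  rw [Prod.mk.injEq] at h1
  exact ⟨u, hu0, by rw [real_inner_comm]; exact h1.1, by rw [real_inner_comm]; exact h1.2⟩

lemma det_trans (R Q : E3 ≃ₗᵢ[ℝ] E3) :
    LinearMap.det ((R.trans Q).toLinearEquiv : E3 →ₗ[ℝ] E3)
      = LinearMap.det (Q.toLinearEquiv : E3 →ₗ[ℝ] E3)
        * LinearMap.det (R.toLinearEquiv : E3 →ₗ[ℝ] E3) := by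
  rw [← LinearMap.det_comp]; rfl

/-- One reflection takes `x` to `x'`, a second one takes the image of `y` to `y'`; equality of the
inner products puts `x'` into the second mirror. A further reflection corrects the determinant if
necessary. -/
lemma exists_rotation_pair {x y x' y' : S2}
    (h : inner ℝ (x : E3) (y : E3) = inner ℝ (x' : E3) (y' : E3)) :
    ∃ R : E3 ≃ₗᵢ[ℝ] E3, LinearMap.det (R.toLinearEquiv : E3 →ₗ[ℝ] E3) = 1 ∧
      rot R x = x' ∧ rot R y = y' := by
  set R1 := (ℝ ∙ ((x : E3) - x'))ᗮ.reflection with hR1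
  have h1 : R1 x = x' := reflection_sub (by rw [S2_norm, S2_norm])
  set R2 := (ℝ ∙ (R1 y - (y' : E3)))ᗮ.reflection with hR2
  have h2 : R2 (R1 y) = y' := reflection_sub (by rw [R1.norm_map, S2_norm, S2_norm])
  have h3 : R2 x' = x' := by
    refine reflection_eq_self_of_inner ?_
    rw [inner_sub_left, ← h1, R1.inner_map_map, h1, real_inner_comm, h, real_inner_comm, sub_self]
  -- The mirror orthogonal to `u` contains `x'` and `y'`. Either sign of the determinant can occur
  -- so far, since the reflection belonging to a zero difference vector is the identity.
  obtain ⟨u, hu0, hux, huy⟩ := exists_ne_zero_inner_eq_zero (x' : E3) y'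
  set R3 := (ℝ ∙ u)ᗮ.reflection with hR3
  have hd : LinearMap.det ((R1.trans R2).toLinearEquiv : E3 →ₗ[ℝ] E3) = 1 ∨
      LinearMap.det ((R1.trans R2).toLinearEquiv : E3 →ₗ[ℝ] E3) = -1 := by
    rw [det_trans]
    rcases det_reflection_eq ((x : E3) - x') with h | h <;>
      rcases det_reflection_eq (R1 y - (y' : E3)) with h' | h' <;>
      rw [hR1, hR2, h, h'] <;> norm_num
  rcases hd with hd | hd
  · refine ⟨R1.trans R2, hd, Subtype.ext ?_, Subtype.ext ?_⟩
    · change R2 (R1 x) = _; rw [h1, h3]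
    · change R2 (R1 y) = _; rw [h2]
  · refine ⟨(R1.trans R2).trans R3, ?_, Subtype.ext ?_, Subtype.ext ?_⟩
    · rw [det_trans, hd, hR3, det_reflection_of_ne_zero hu0]; norm_num
    · change R3 (R2 (R1 x)) = _
      rw [h1, h3]; exact reflection_eq_self_of_inner hux
    · change R3 (R2 (R1 y)) = _
      rw [h2]; exact reflection_eq_self_of_inner huy

lemma exists_rotation (x y : S2) : ∃ R : E3 ≃ₗᵢ[ℝ] E3,
    LinearMap.det (R.toLinearEquiv : E3 →ₗ[ℝ] E3) = 1 ∧ rot R x = y := by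
  obtain ⟨R, h1, h2, -⟩ := exists_rotation_pair (x := x) (y := x) (x' := y) (y' := y)
    (by rw [real_inner_self_eq_norm_sq, real_inner_self_eq_norm_sq, S2_norm, S2_norm])
  exact ⟨R, h1, h2⟩

end Rotations

/-! ### The eigenspaces of the Laplace-Beltrami operator -/

section Eigenspaces
open Polynomial

/-- `f` is a twice continuously differentiable eigenfunction of degree `l`. -/
structure IsEigen (l : ℕ) (f : S2 → ℝ) : Prop where
  isC2 : IsC2 f
  lap_eq : lap f = fun x => -((l : ℝ) * (l + 1)) * f x

lemma isEigen_realY (l : ℕ) (m : ℤ) : IsEigen l (realY l m) := ⟨contMDiff_realY l m, lap_realY l m⟩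

lemma IsEigen.continuous {l : ℕ} {f : S2 → ℝ} (hf : IsEigen l f) : Continuous f := hf.isC2.continuous

lemma IsEigen.comp_rot {l : ℕ} {f : S2 → ℝ} (hf : IsEigen l f) (R : E3 ≃ₗᵢ[ℝ] E3) :
    IsEigen l fun x => f (rot R x) :=
  ⟨contMDiff_rot R two_le_top hf.isC2, by funext x; rw [lap_rot, hf.lap_eq]⟩

lemma IsEigen.const_mul {l : ℕ} {f : S2 → ℝ} (hf : IsEigen l f) (a : ℝ) :
    IsEigen l fun x => a * f x :=
  ⟨(contDiff_const.mul contDiff_id).contMDiff.comp hf.isC2, by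
    funext x; rw [lap_const_mul hf.isC2, hf.lap_eq]; ring⟩

lemma mul_succ_injective {k l : ℕ} (h : (k : ℝ) * (k + 1) = l * (l + 1)) : k = l := by
  have : ((k : ℝ) - l) * (k + l + 1) = 0 := by linear_combination h
  rcases mul_eq_zero.1 this with h | h
  · exact_mod_cast sub_eq_zero.1 h
  · exact absurd h (by positivity)
  
lemma integral_mul_lap {l : ℕ} {f g : S2 → ℝ} (hf : IsEigen l f) (hg : IsC2 g) :
    ∫ x, lap g x * f x ∂sphMeasure = -((l : ℝ) * (l + 1)) * ∫ x, g x * f x ∂sphMeasure := by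
  have h := green hf.isC2 hg
  rw [hf.lap_eq] at h
  rw [← integral_const_mul]
  calc _ = ∫ x, f x * lap g x ∂sphMeasure := by simp_rw [mul_comm]
    _ = _ := by rw [h]; congr 1; funext x; ring

lemma IsEigen.orthogonal {k l : ℕ} {f g : S2 → ℝ} (hf : IsEigen k f) (hg : IsEigen l g)
    (hkl : k ≠ l) : ∫ x, f x * g x ∂sphMeasure = 0 := by
  have h := integral_mul_lap hg hf.isC2
  rw [hf.lap_eq] at h
  simp_rw [mul_assoc] at h
  rw [integral_const_mul] at h
  by_contra h0
  refine hkl (mul_succ_injective ?_)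
  have := mul_right_cancel₀ h0 h
  linarith

/-- An eigenfunction is the sum of its components along the real spherical harmonics. -/
lemma IsEigen.eq_sum {l : ℕ} {f : S2 → ℝ} (hf : IsEigen l f) (x : S2) :
    f x = ∑ m ∈ Finset.Icc (-(l : ℤ)) l, (∫ y, f y * realY l m y ∂sphMeasure) * realY l m x := by
  set g : S2 → ℝ := fun x => ∑ m ∈ Finset.Icc (-(l : ℤ)) l,
    (∫ y, f y * realY l m y ∂sphMeasure) * realY l m x with hg
  have hgc : Continuous g := continuous_finsetSum _ fun m _ =>
    continuous_const.mul (continuous_realY l m)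
  -- The difference is orthogonal to all harmonics: in degree `l` by orthonormality, in other
  -- degrees because eigenfunctions with different eigenvalues are orthogonal.
  have h0 := eq_zero_of_integral_realY (hf.continuous.sub hgc) (fun k n hn => by
    simp only [Pi.sub_apply, sub_mul]
    rw [integral_sub
      (integrable_sphMeasure (h := fun x => f x * realY k n x)
        (hf.continuous.mul (continuous_realY k n)))
      (integrable_sphMeasure (h := fun x => g x * realY k n x)
        (hgc.mul (continuous_realY k n))), sub_eq_zero]
    simp_rw [hg, Finset.sum_mul, mul_assoc]
    rw [integral_finsetSum _ fun m _ => integrable_sphMeasure (h := fun x =>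
      (∫ y, f y * realY l m y ∂sphMeasure) * (realY l m x * realY k n x))
      (continuous_const.mul ((continuous_realY l m).mul (continuous_realY k n)))]
    simp_rw [integral_const_mul]
    by_cases hlk : l = k
    · subst hlk
      rw [Finset.sum_eq_single n]
      · rw [realY_orthonormal hn]; simp
      · intro m hm hmn
        rw [Finset.mem_Icc] at hm
        rw [realY_orthonormal (by omega)]; simp [hmn]
      · intro h
        exact absurd (Finset.mem_Icc.2 (by omega)) h
    · rw [hf.orthogonal (isEigen_realY k n) hlk]
      refine (Finset.sum_eq_zero fun m hm => ?_).symm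
      rw [(isEigen_realY l m).orthogonal (isEigen_realY k n) hlk, mul_zero])
  exact sub_eq_zero.1 (congrFun h0 x)

/-- The constant `(2l + 1) / (4π)`. -/
def kerConst (l : ℕ) : ℝ := (2 * l + 1) / (4 * Real.pi)

lemma kerConst_pos (l : ℕ) : 0 < kerConst l := by
  have := Real.pi_pos
  rw [kerConst]; positivity

/-- The zonal kernel `P_l(⟨x, y⟩)`. -/
def zonal (l : ℕ) (x y : S2) : ℝ := (legendreP l).eval (inner ℝ (x : E3) (y : E3))

lemma zonal_comm (l : ℕ) (x y : S2) : zonal l x y = zonal l y x := by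
  rw [zonal, zonal, real_inner_comm]

lemma zonal_self (l : ℕ) (x : S2) : zonal l x x = 1 := by
  rw [zonal, real_inner_self_eq_norm_sq, S2_norm, one_pow, legendreP_eval_one]

lemma zonal_rot (l : ℕ) (R : E3 ≃ₗᵢ[ℝ] E3) (x y : S2) : zonal l (rot R x) (rot R y) = zonal l x y := by
  rw [zonal, zonal, coe_rot, coe_rot, R.inner_map_map]

lemma zonal_northPole (l : ℕ) (y : S2) : zonal l northPole y = (legendreP l).eval ((y : E3) 0) := by
  rw [zonal, coe_northPole, ePole, EuclideanSpace.inner_single_left]; simp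

lemma realConst_zero (l : ℕ) : realConst l 0 * realConst l 0 = kerConst l := by
  have := Real.mul_self_sqrt (kerConst_pos l).le
  rw [kerConst] at this ⊢
  simpa [realConst, div_self (Nat.cast_ne_zero.2 (Nat.factorial_ne_zero l) : (l.factorial : ℝ) ≠ 0)]
    using this

lemma realY_zero_order (l : ℕ) (y : S2) : realY l 0 y = realConst l 0 * zonal l northPole y := by
  rw [zonal_northPole]
  simp [realY, harm, azimuthPoly]

lemma realY_northPole (l : ℕ) {m : ℤ} (hm : m ≠ 0) : realY l m northPole = 0 := by
  have h0 : m.natAbs ≠ 0 := by omega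
  rw [realY, northPole, harm_sph]
  simp [h0]

lemma continuous_zonal (l : ℕ) : Continuous fun p : S2 × S2 => zonal l p.1 p.2 := by
  unfold zonal
  exact (legendreP l).continuous.comp (by fun_prop)

lemma continuous_zonal_right (l : ℕ) (x : S2) : Continuous (zonal l x) :=
  (continuous_zonal l).comp (continuous_const.prodMk continuous_id)

/-- At the pole it is a multiple of the harmonic of order `0`; a rotation moves the pole to `x`. -/
lemma isEigen_zonal (l : ℕ) (x : S2) : IsEigen l (zonal l x) := by
  obtain ⟨R, -, hR⟩ := exists_rotation x northPole
  have e : zonal l x = fun y => (realConst l 0)⁻¹ * realY l 0 (rot R y) := by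
    funext y
    rw [realY_zero_order, ← mul_assoc, inv_mul_cancel₀ (realConst_ne_zero _ _), one_mul, ← hR,
      zonal_rot]
  rw [e]
  exact ((isEigen_realY l 0).comp_rot R).const_mul _

lemma contMDiff_zonal {n : WithTop ℕ∞} (l : ℕ) (x : S2) : ContMDiff (𝓡 2) 𝓘(ℝ, ℝ) n (zonal l x) := by
  refine contMDiff_of_contDiffAt
    (g := fun y : E3 => (legendreP l).eval (inner ℝ (x : E3) y)) fun y => ContDiff.contDiffAt ?_
  have h2 : ContDiff ℝ n fun t : ℝ => (legendreP l).eval t := by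
    have := (legendreP l).contDiff_aeval (𝕜 := ℝ) n
    simp only [Polynomial.coe_aeval_eq_eval] at this
    exact this
  exact h2.comp (contDiff_const.inner ℝ contDiff_id)

/-- The zonal kernel reproduces the eigenfunctions. -/
theorem IsEigen.reproducing {l : ℕ} {f : S2 → ℝ} (hf : IsEigen l f) (x : S2) :
    f x = kerConst l * ∫ y, f y * zonal l x y ∂sphMeasure := by
  -- At the pole all harmonics of nonzero order vanish, so the expansion of `f` reduces to its zonal
  -- term. The general point follows by rotation.
  have hpole : ∀ f : S2 → ℝ, IsEigen l f →
      f northPole = kerConst l * ∫ y, f y * zonal l northPole y ∂sphMeasure := by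
    intro f hf
    rw [hf.eq_sum northPole, Finset.sum_eq_single 0]
    · simp_rw [realY_zero_order, mul_left_comm _ (realConst l 0)]
      rw [integral_const_mul, zonal_self, ← realConst_zero]
      ring
    · intro m _ hm
      rw [realY_northPole l hm, mul_zero]
    · intro h
      exact absurd (Finset.mem_Icc.2 (by omega)) h
  obtain ⟨R, -, hR⟩ := exists_rotation northPole x
  have h1 := hpole _ (hf.comp_rot R)
  rw [hR] at h1
  rw [h1, ← integral_rot R (f := fun y => f y * zonal l x y)
    (hf.continuous.mul (continuous_zonal_right l x))]
  simp_rw [← hR, zonal_rot]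

/-- The addition theorem for the real spherical harmonics. -/
theorem sum_realY_mul (l : ℕ) (x y : S2) :
    ∑ m ∈ Finset.Icc (-(l : ℤ)) l, realY l m x * realY l m y = kerConst l * zonal l x y := by
  rw [(isEigen_zonal l x).eq_sum y, Finset.mul_sum]
  refine Finset.sum_congr rfl fun m _ => ?_
  -- By the reproducing property, `kerConst l` times the coefficient of the zonal function along a
  -- harmonic is the value of that harmonic at `x`.
  conv_lhs => rw [(isEigen_realY l m).reproducing x]
  simp_rw [mul_comm (realY l m _) (zonal l x _)]
  ring

lemma integral_zonal_mul_zonal (l k : ℕ) (x z : S2) :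
    ∫ y, zonal l x y * zonal k z y ∂sphMeasure
      = if l = k then (kerConst l)⁻¹ * zonal l x z else 0 := by
  split_ifs with h
  · subst h
    rw [zonal_comm l x z, (isEigen_zonal l z).reproducing x, ← mul_assoc,
      inv_mul_cancel₀ (kerConst_pos l).ne', one_mul]
    simp_rw [mul_comm]
  · exact (isEigen_zonal l x).orthogonal (isEigen_zonal k z) h

/-- An eigenfunction which depends only on `⟨x, z⟩` is a multiple of the zonal kernel. -/
lemma IsEigen.eq_zonal {l : ℕ} {f : S2 → ℝ} (hf : IsEigen l f) (z : S2)
    (h : ∀ x y : S2, inner ℝ (z : E3) (x : E3) = inner ℝ (z : E3) (y : E3) → f x = f y) (x : S2) :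
    f x = f z * zonal l z x := by
  have hpole : ∀ f : S2 → ℝ, IsEigen l f →
      (∀ x y : S2, inner ℝ (northPole : E3) (x : E3) = inner ℝ (northPole : E3) (y : E3) → f x = f y) →
      ∀ x, f x = f northPole * zonal l northPole x := by
    intro f hf h
    -- Here `f` depends on the colatitude only, and azimuthal factors of nonzero order have mean
    -- zero over a period.
    have hz : ∀ m : ℤ, m ≠ 0 → ∫ y, f y * realY l m y ∂sphMeasure = 0 := by
      intro m hm
      rw [integral_sphMeasure_eq (h := fun y => f y * realY l m y)
        (hf.continuous.mul (continuous_realY l m))]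
      have hc : ∀ θ φ : ℝ, f (sph θ φ) = f (sph θ 0) := fun θ φ => h _ _ (by
        rw [coe_northPole, ePole, EuclideanSpace.inner_single_left,
          EuclideanSpace.inner_single_left, sph_apply_zero, sph_apply_zero])
      have hint : ∫ φ in (0 : ℝ)..2 * Real.pi, azimuth m φ = 0 := by
        have := integral_azimuth_mul m 0
        rw [if_neg hm] at this
        simpa [azimuth] using this
      have e : ∀ θ φ : ℝ, Real.sin θ • (f (sph θ φ) * realY l m (sph θ φ))
          = (Real.sin θ * f (sph θ 0) * realConst l m.natAbs *
            ((derivative^[m.natAbs] (legendreP l)).eval (Real.cos θ) * Real.sin θ ^ m.natAbs))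
            * azimuth m φ := by
        intro θ φ
        rw [hc, realY, harm_sph, smul_eq_mul]; ring
      simp_rw [e, intervalIntegral.integral_const_mul, hint, mul_zero]
      simp
    have key : ∀ x, f x = (∫ y, f y * realY l 0 y ∂sphMeasure) * realY l 0 x := by
      intro x
      rw [hf.eq_sum x, Finset.sum_eq_single 0]
      · intro m _ hm
        rw [hz m hm, zero_mul]
      · intro h
        exact absurd (Finset.mem_Icc.2 (by omega)) h
    intro x
    rw [key x, key northPole, realY_zero_order, realY_zero_order, zonal_self]
    ring
  obtain ⟨R, -, hR⟩ := exists_rotation northPole z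
  obtain ⟨y, rfl⟩ : ∃ y, rot R y = x := ⟨rot R.symm x, Subtype.ext (R.apply_symm_apply _)⟩
  have h1 := hpole _ (hf.comp_rot R) (fun x y hxy => h _ _ (by
    rw [← hR, coe_rot, coe_rot, coe_rot, R.inner_map_map, R.inner_map_map, hxy])) y
  rw [hR] at h1
  rw [h1, ← hR, zonal_rot]

end Eigenspaces

/-! ### Projections onto the eigenspaces -/

/-- The projection of `f` onto the eigenfunctions of degree `l`. -/
def proj (l : ℕ) (f : S2 → ℝ) (x : S2) : ℝ := kerConst l * ∫ y, f y * zonal l x y ∂sphMeasure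

/-- The square of the `L²` norm of the projection. -/
def projSq (l : ℕ) (f : S2 → ℝ) : ℝ := ∫ x, proj l f x * proj l f x ∂sphMeasure

lemma integral_mul_sum {ι : Type*} (s : Finset ι) {f : S2 → ℝ} (hf : Continuous f) (a : ι → ℝ)
    {g : ι → S2 → ℝ} (hg : ∀ i ∈ s, Continuous (g i)) :
    ∫ x, f x * ∑ i ∈ s, a i * g i x ∂sphMeasure = ∑ i ∈ s, a i * ∫ x, f x * g i x ∂sphMeasure := by
  simp_rw [Finset.mul_sum, mul_left_comm (f _)]
  rw [integral_finsetSum _ fun i hi => integrable_sphMeasure (h := fun x => a i * (f x * g i x))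
    (continuous_const.mul (hf.mul (hg i hi)))]
  simp_rw [integral_const_mul]

/-- The Cauchy-Schwarz inequality for continuous functions on the sphere. -/
lemma sq_integral_mul_le {f g : S2 → ℝ} (hf : Continuous f) (hg : Continuous g) :
    (∫ x, f x * g x ∂sphMeasure) ^ 2
      ≤ (∫ x, f x * f x ∂sphMeasure) * ∫ x, g x * g x ∂sphMeasure := by
  have key : ∀ w : ℝ, 0 ≤ (∫ x, f x * f x ∂sphMeasure) * (w * w)
      + (2 * ∫ x, f x * g x ∂sphMeasure) * w + ∫ x, g x * g x ∂sphMeasure := by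
    intro w
    have h0 : 0 ≤ ∫ x, (w * f x + g x) * (w * f x + g x) ∂sphMeasure :=
      integral_nonneg fun _ => mul_self_nonneg _
    have e : ∀ x, (w * f x + g x) * (w * f x + g x)
        = w * w * (f x * f x) + 2 * w * (f x * g x) + g x * g x := fun x => by ring
    have i1 := integrable_sphMeasure (h := fun x => w * w * (f x * f x))
      (continuous_const.mul (hf.mul hf))
    have i2 := integrable_sphMeasure (h := fun x => 2 * w * (f x * g x))
      (continuous_const.mul (hf.mul hg))
    have i3 := integrable_sphMeasure (h := fun x => g x * g x) (hg.mul hg)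
    simp_rw [e] at h0
    rw [integral_add (f := fun x => w * w * (f x * f x) + 2 * w * (f x * g x)) (i1.add i2) i3,
      integral_add i1 i2, integral_const_mul, integral_const_mul] at h0
    linarith
  have := discrim_le_zero key
  rw [discrim] at this
  nlinarith

lemma proj_eq_sum (l : ℕ) {f : S2 → ℝ} (hf : Continuous f) (x : S2) :
    proj l f x = ∑ m ∈ Finset.Icc (-(l : ℤ)) l, (∫ y, f y * realY l m y ∂sphMeasure) * realY l m x := by
  have h := integral_mul_sum (Finset.Icc (-(l : ℤ)) l) hf (fun m => realY l m x)
    (g := realY l) fun m _ => continuous_realY l m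
  simp_rw [sum_realY_mul] at h
  simp_rw [proj, ← integral_const_mul, mul_comm _ (realY l _ x), ← h]
  congr 1; funext y; ring

lemma proj_eq_self {l : ℕ} {f : S2 → ℝ} (hf : IsEigen l f) : proj l f = f :=
  funext fun x => (hf.reproducing x).symm

lemma lap_add {f g : S2 → ℝ} (hf : IsC2 f) (hg : IsC2 g) :
    lap (fun x => f x + g x) = fun x => lap f x + lap g x := by
  funext x
  exact (contDiffAt_homExt two_le_top hf (S2_ne_zero x)).laplacian_add
    (contDiffAt_homExt two_le_top hg (S2_ne_zero x))

lemma IsEigen.add {l : ℕ} {f g : S2 → ℝ} (hf : IsEigen l f) (hg : IsEigen l g) :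
    IsEigen l fun x => f x + g x :=
  ⟨hf.isC2.add hg.isC2, by
    funext x; rw [lap_add hf.isC2 hg.isC2, hf.lap_eq, hg.lap_eq]; ring⟩

lemma isEigen_sum {ι : Type*} (l : ℕ) (s : Finset ι) (a : ι → ℝ) {g : ι → S2 → ℝ}
    (hg : ∀ i, IsEigen l (g i)) : IsEigen l fun x => ∑ i ∈ s, a i * g i x := by
  classical
  induction s using Finset.induction_on with
  | empty =>
    simp only [Finset.sum_empty]
    exact ⟨contMDiff_const, by rw [lap_const]; funext x; simp⟩
  | insert i s hi ih =>
    simp_rw [Finset.sum_insert hi]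
    exact ((hg i).const_mul (a i)).add ih

lemma isEigen_proj (l : ℕ) {f : S2 → ℝ} (hf : Continuous f) : IsEigen l (proj l f) := by
  rw [show proj l f = _ from funext (proj_eq_sum l hf)]
  exact isEigen_sum l _ _ (isEigen_realY l)

lemma continuous_proj (l : ℕ) {f : S2 → ℝ} (hf : Continuous f) : Continuous (proj l f) :=
  (isEigen_proj l hf).continuous

lemma integral_mul_proj (l : ℕ) {f g : S2 → ℝ} (hf : Continuous f) (hg : Continuous g) :
    ∫ x, f x * proj l g x ∂sphMeasure = ∑ m ∈ Finset.Icc (-(l : ℤ)) l,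
      (∫ y, g y * realY l m y ∂sphMeasure) * ∫ y, f y * realY l m y ∂sphMeasure := by
  simp_rw [proj_eq_sum l hg]
  exact integral_mul_sum _ hf _ fun m _ => continuous_realY l m

lemma integral_proj_mul (l : ℕ) {f g : S2 → ℝ} (hf : Continuous f) (hg : Continuous g) :
    ∫ x, proj l f x * g x ∂sphMeasure = ∫ x, f x * proj l g x ∂sphMeasure := by
  rw [integral_mul_proj l hf hg]
  simp_rw [mul_comm (proj l f _)]
  rw [integral_mul_proj l hg hf]
  simp_rw [mul_comm]

lemma integral_proj_mul_proj (l : ℕ) {f g : S2 → ℝ} (hf : Continuous f) (hg : Continuous g) :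
    ∫ x, proj l f x * proj l g x ∂sphMeasure = ∫ x, f x * proj l g x ∂sphMeasure := by
  rw [integral_proj_mul l hf (continuous_proj l hg), proj_eq_self (isEigen_proj l hg)]

lemma projSq_nonneg (l : ℕ) (f : S2 → ℝ) : 0 ≤ projSq l f :=
  integral_nonneg fun _ => mul_self_nonneg _

lemma projSq_eq_sum (l : ℕ) {f : S2 → ℝ} (hf : Continuous f) :
    projSq l f = ∑ m ∈ Finset.Icc (-(l : ℤ)) l, (∫ y, f y * realY l m y ∂sphMeasure) ^ 2 := by
  rw [projSq, integral_proj_mul_proj l hf hf, integral_mul_proj l hf hf]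
  simp_rw [sq]

/-- Bessel's inequality. -/
lemma sum_projSq_le (s : Finset ℕ) {f : S2 → ℝ} (hf : Continuous f) :
    ∑ l ∈ s, projSq l f ≤ ∫ x, f x * f x ∂sphMeasure := by
  have hgc : Continuous fun x => ∑ l ∈ s, 1 * proj l f x :=
    continuous_finsetSum _ fun l _ => continuous_const.mul (continuous_proj l hf)
  have h1 : ∫ x, f x * ∑ l ∈ s, 1 * proj l f x ∂sphMeasure = ∑ l ∈ s, projSq l f := by
    rw [integral_mul_sum s hf _ fun l _ => continuous_proj l hf]
    refine Finset.sum_congr rfl fun l _ => ?_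
    rw [one_mul, projSq, integral_proj_mul_proj l hf hf]
  have h2 : ∫ x, (∑ l ∈ s, 1 * proj l f x) * ∑ l ∈ s, 1 * proj l f x ∂sphMeasure
      = ∑ l ∈ s, projSq l f := by
    rw [integral_mul_sum s hgc _ fun l _ => continuous_proj l hf]
    refine Finset.sum_congr rfl fun l hl => ?_
    simp_rw [mul_comm _ (proj l f _)]
    rw [integral_mul_sum s (continuous_proj l hf) _ fun l _ => continuous_proj l hf,
      Finset.sum_eq_single l]
    · rw [one_mul, one_mul, projSq]
    · intro k _ hk
      rw [(isEigen_proj l hf).orthogonal (isEigen_proj k hf) hk.symm, mul_zero]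
    · exact fun h => absurd hl h
  have h3 : 0 ≤ ∫ x, (f x - ∑ l ∈ s, 1 * proj l f x) * (f x - ∑ l ∈ s, 1 * proj l f x) ∂sphMeasure :=
    integral_nonneg fun _ => mul_self_nonneg _
  have e : ∀ x, (f x - ∑ l ∈ s, 1 * proj l f x) * (f x - ∑ l ∈ s, 1 * proj l f x)
      = f x * f x - 2 * (f x * ∑ l ∈ s, 1 * proj l f x)
        + (∑ l ∈ s, 1 * proj l f x) * ∑ l ∈ s, 1 * proj l f x := fun x => by ring
  simp_rw [e] at h3
  have hi1 := integrable_sphMeasure (h := fun x => f x * f x) (hf.mul hf)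
  have hi2 := integrable_sphMeasure (h := fun x => 2 * (f x * ∑ l ∈ s, 1 * proj l f x))
    (continuous_const.mul (hf.mul hgc))
  have hi3 := integrable_sphMeasure (h := fun x =>
    (∑ l ∈ s, 1 * proj l f x) * ∑ l ∈ s, 1 * proj l f x) (hgc.mul hgc)
  rw [integral_add (f := fun x => f x * f x - 2 * (f x * ∑ l ∈ s, 1 * proj l f x))
    (hi1.sub hi2) hi3, integral_sub hi1 hi2, integral_const_mul, h1, h2] at h3
  linarith

lemma summable_projSq {f : S2 → ℝ} (hf : Continuous f) : Summable fun l => projSq l f :=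
  summable_of_sum_le (fun l => projSq_nonneg l f) fun s => sum_projSq_le s hf

lemma proj_lap (l : ℕ) {f : S2 → ℝ} (hf : IsC2 f) :
    proj l (lap f) = fun x => -((l : ℝ) * (l + 1)) * proj l f x := by
  funext x
  rw [proj, integral_mul_lap (isEigen_zonal l x) hf, proj]
  ring

lemma projSq_lap (l : ℕ) {f : S2 → ℝ} (hf : IsC2 f) :
    projSq l (lap f) = ((l : ℝ) * (l + 1)) ^ 2 * projSq l f := by
  rw [projSq, proj_lap l hf, projSq, ← integral_const_mul]
  congr 1; funext x; ring

/-- Bessel's inequality for the Laplacian of `f`, which is continuous and has the projections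
`-l(l+1) f_l`. For `l ≥ 1` one has `(l+1)⁴ ≤ 4 (l(l+1))²`; the inequality for `f` itself covers `l =
0`. -/
lemma summable_pow_mul_projSq {f : S2 → ℝ} (hf : IsC2 f) :
    Summable fun l : ℕ => ((l : ℝ) + 1) ^ 4 * projSq l f := by
  have h1 := summable_projSq (continuous_lap hf)
  have h2 := summable_projSq hf.continuous
  simp_rw [projSq_lap _ hf] at h1
  refine Summable.of_nonneg_of_le (fun l => mul_nonneg (by positivity) (projSq_nonneg l f))
    (fun l => ?_) ((h1.mul_left 4).add h2)
  rw [← mul_assoc, ← add_one_mul]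
  refine mul_le_mul_of_nonneg_right ?_ (projSq_nonneg l f)
  rcases Nat.eq_zero_or_pos l with rfl | hl
  · norm_num
  · have : (1 : ℝ) ≤ l := by exact_mod_cast hl
    have h : ((l : ℝ) + 1) ^ 2 ≤ 2 * (l * (l + 1)) := by nlinarith
    have h' := mul_self_le_mul_self (by positivity) h
    nlinarith

/-- The pointwise bound for eigenfunctions. -/
lemma IsEigen.sq_le {l : ℕ} {f : S2 → ℝ} (hf : IsEigen l f) (x : S2) :
    f x ^ 2 ≤ kerConst l * ∫ y, f y * f y ∂sphMeasure := by
  have h1 := projSq_eq_sum l hf.continuous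
  have h2 := proj_eq_sum l hf.continuous x
  have h3 := sum_realY_mul l x x
  rw [projSq, proj_eq_self hf] at h1
  rw [proj_eq_self hf] at h2
  rw [zonal_self, mul_one] at h3
  -- Cauchy-Schwarz for the expansion in harmonics; by the addition theorem on the diagonal their
  -- squares at `x` sum to `kerConst l`.
  rw [h1, h2, ← h3, mul_comm]
  simp_rw [← sq]
  exact Finset.sum_mul_sq_le_sq_mul_sq _ _ _

lemma abs_proj_le (l : ℕ) {f : S2 → ℝ} (hf : Continuous f) (x : S2) :
    |proj l f x| ≤ Real.sqrt (kerConst l * projSq l f) :=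
  Real.abs_le_sqrt ((isEigen_proj l hf).sq_le x)

lemma kerConst_le (l : ℕ) : kerConst l ≤ l + 1 := by
  rw [kerConst, div_le_iff₀ (by positivity)]
  have := Real.pi_gt_three
  have hl : (0 : ℝ) ≤ l := Nat.cast_nonneg l
  nlinarith

/-- A weighted Cauchy-Schwarz bound. -/
lemma sqrt_le_of_weight {a b w : ℝ} (ha : 0 ≤ a) (hb : 0 ≤ b) (hw : 0 < w) :
    Real.sqrt (a * b) ≤ a * w⁻¹ + w * b := by
  rw [Real.sqrt_le_left (by positivity)]
  have h : a * w⁻¹ * (w * b) = a * b := by field_simp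
  have h1 : 0 ≤ a * w⁻¹ := by positivity
  have h2 : 0 ≤ w * b := by positivity
  nlinarith [mul_nonneg h1 h2]

lemma summable_inv_sq : Summable fun l : ℕ => (((l : ℝ) + 1) ^ 2)⁻¹ := by
  have h := (summable_nat_add_iff 1).2 (Real.summable_nat_pow_inv.2 (by norm_num : 1 < 2))
  simpa using h

/-- Gain of summability: if `∑ (l+1)^(2k+3) ‖f_l‖² < ∞` then `∑ (l+1)^k sup |f_l| < ∞`. -/
lemma summable_pow_mul_sqrt (k : ℕ) {s : ℕ → ℝ} (hs0 : ∀ l, 0 ≤ s l)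
    (hs : Summable fun l : ℕ => ((l : ℝ) + 1) ^ (2 * k + 3) * s l) :
    Summable fun l : ℕ => ((l : ℝ) + 1) ^ k * Real.sqrt (kerConst l * s l) := by
  refine Summable.of_nonneg_of_le (fun l => by positivity) (fun l => ?_) (summable_inv_sq.add hs)
  have hl : (0 : ℝ) < (l : ℝ) + 1 := by positivity
  have h1 : Real.sqrt (kerConst l * s l) ≤ Real.sqrt ((l + 1) * s l) :=
    Real.sqrt_le_sqrt (mul_le_mul_of_nonneg_right (kerConst_le l) (hs0 l))
  -- This weight leaves `(l+1)^(-2)` and `(l+1)^(2k+3) s l` after multiplication by `(l+1)^k`.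
  have h2 := sqrt_le_of_weight hl.le (hs0 l) (w := ((l : ℝ) + 1) ^ (k + 3)) (by positivity)
  calc ((l : ℝ) + 1) ^ k * Real.sqrt (kerConst l * s l)
      ≤ ((l : ℝ) + 1) ^ k * ((l + 1) * (((l : ℝ) + 1) ^ (k + 3))⁻¹ + ((l : ℝ) + 1) ^ (k + 3) * s l) :=
        mul_le_mul_of_nonneg_left (h1.trans h2) (by positivity)
    _ = _ := by
        have : ((l : ℝ) + 1) ≠ 0 := hl.ne'
        field_simp
        ring

/-- The terms dominate the sup norms of the projections, so every `C²` function has a uniformly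
convergent expansion. This is why the random series converges at all points simultaneously; the
exponent `3` needed is below the `4` available. -/
lemma summable_sqrt_projSq {f : S2 → ℝ} (hf : IsC2 f) :
    Summable fun l : ℕ => Real.sqrt (kerConst l * projSq l f) := by
  have h := summable_pow_mul_sqrt 0 (s := fun l => projSq l f) (fun l => projSq_nonneg l f) (by
    refine Summable.of_nonneg_of_le (fun l => mul_nonneg (by positivity) (projSq_nonneg l f))
      (fun l => mul_le_mul_of_nonneg_right ?_ (projSq_nonneg l f)) (summable_pow_mul_projSq hf)
    exact pow_le_pow_right₀ (by linarith [(Nat.cast_nonneg l : (0 : ℝ) ≤ l)]) (by norm_num))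
  simpa using h

/-! ### Series of eigenfunctions -/

section Series
variable {h : ℕ → S2 → ℝ} {b : ℕ → ℝ}

lemma continuous_tsum_eigen (hc : ∀ l, Continuous (h l)) (hb : Summable b)
    (hle : ∀ l x, |h l x| ≤ b l) : Continuous fun x => ∑' l, h l x :=
  continuous_tsum hc hb hle

lemma hasSum_integral_eigen (hc : ∀ l, Continuous (h l)) (hb : Summable b)
    (hle : ∀ l x, |h l x| ≤ b l) {ψ : S2 → ℝ} (hψ : Continuous ψ) :
    HasSum (fun l => ∫ x, h l x * ψ x ∂sphMeasure) (∫ x, (∑' l, h l x) * ψ x ∂sphMeasure) := by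
  have hs : ∀ x, Summable fun l => h l x := fun x => Summable.of_norm_bounded hb fun l => hle l x
  have := hasSum_integral_of_dominated_convergence (μ := sphMeasure)
    (F := fun l x => h l x * ψ x) (f := fun x => (∑' l, h l x) * ψ x)
    (fun l x => b l * |ψ x|) (fun l => (integrable_sphMeasure ((hc l).mul hψ)).1)
    (fun l => Eventually.of_forall fun x => by
      rw [norm_mul]; exact mul_le_mul_of_nonneg_right (hle l x) (abs_nonneg _))
    (Eventually.of_forall fun x => hb.mul_right _)
    (by
      simp_rw [tsum_mul_right]
      exact integrable_sphMeasure (continuous_const.mul hψ.abs))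
    (Eventually.of_forall fun x => (hs x).hasSum.mul_right _)
  exact this

/-- Uniform convergence lets the projection be taken termwise, and orthogonality of degrees leaves
one term. -/
lemma proj_tsum_eigen (he : ∀ l, IsEigen l (h l)) (hb : Summable b)
    (hle : ∀ l x, |h l x| ≤ b l) (l : ℕ) : proj l (fun x => ∑' k, h k x) = h l := by
  funext x
  have h1 := hasSum_integral_eigen (fun l => (he l).continuous) hb hle (continuous_zonal_right l x)
  have h2 : HasSum (fun k => ∫ y, h k y * zonal l x y ∂sphMeasure)
      (∫ y, h l y * zonal l x y ∂sphMeasure) :=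
    hasSum_single l fun k hk => (he k).orthogonal (isEigen_zonal l x) hk
  rw [proj, h1.unique h2, ← (he l).reproducing x]

/-- A continuous function is determined by its projections. -/
lemma eq_of_proj_eq {f g : S2 → ℝ} (hf : Continuous f) (hg : Continuous g)
    (h : ∀ l, proj l f = proj l g) : f = g := by
  have h0 := eq_zero_of_integral_realY (hf.sub hg) (fun l m _ => by
    have e : ∀ f, Continuous f → ∫ x, f x * realY l m x ∂sphMeasure
        = ∫ x, proj l f x * realY l m x ∂sphMeasure := fun f hf => by
      rw [integral_proj_mul l hf (continuous_realY l m), proj_eq_self (isEigen_realY l m)]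
    simp only [Pi.sub_apply, sub_mul]
    rw [integral_sub
      (integrable_sphMeasure (h := fun x => f x * realY l m x) (hf.mul (continuous_realY l m)))
      (integrable_sphMeasure (h := fun x => g x * realY l m x) (hg.mul (continuous_realY l m))),
      e f hf, e g hg, h, sub_self])
  exact sub_eq_zero.1 h0

/-- The device that identifies a continuous function with a series: it is applied to the initial
field, to a time slice of a weak solution, and to the Laplacian of such a slice. -/
lemma eq_tsum_of_proj {f : S2 → ℝ} (hf : Continuous f) (he : ∀ l, IsEigen l (h l))
    (hb : Summable b) (hle : ∀ l x, |h l x| ≤ b l) (hp : ∀ l, proj l f = h l) :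
    f = fun x => ∑' l, h l x :=
  eq_of_proj_eq hf (continuous_tsum_eigen (fun l => (he l).continuous) hb hle) fun l => by
    rw [hp, proj_tsum_eigen he hb hle]

end Series

/-! ### The complex spherical harmonics -/

section Complex
open Polynomial

lemma sqrt_one_sub_cos_sq {θ : ℝ} (hθ : θ ∈ Icc 0 Real.pi) :
    Real.sqrt (1 - Real.cos θ ^ 2) = Real.sin θ := by
  rw [← Real.sin_sq, Real.sqrt_sq (Real.sin_nonneg_of_mem_Icc hθ)]

/-- The modulus `√(c_l (l-k)!/(l+k)!) P_l^{(k)}(cos θ) sin^k θ` of the complex harmonics, with sign. -/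
def harmMod (l k : ℕ) (θ : ℝ) : ℝ :=
  Real.sqrt (kerConst l * ((l - k).factorial / (l + k).factorial)) *
    (derivative^[k] (legendreP l)).eval (Real.cos θ) * Real.sin θ ^ k

/-- For `m ≥ 0` the sign in the normalizing constant cancels that of the Legendre function. For `m <
0` one sign `(-1)^|m|` survives, and the factorial quotient in front inverts the one under the root.
Products with conjugates see only `ε² = 1`. On `[0, π]` the root `√(1 - cos² θ)` is `sin θ`. -/
lemma sphY_eq {l : ℕ} {m : ℤ} (hm : m ∈ Finset.Icc (-(l : ℤ)) l) :
    ∃ ε : ℝ, ε * ε = 1 ∧ (m = 0 → ε = 1) ∧ ∀ θ ∈ Icc 0 Real.pi, ∀ φ, sphY l m θ φ = ε *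
      (harmMod l m.natAbs θ : ℝ) * Complex.exp (Complex.I * m * φ) := by
  rw [Finset.mem_Icc] at hm
  rcases m with m | k
  · simp only [Int.ofNat_eq_natCast] at hm
    have hml : m ≤ l := by omega
    refine ⟨1, by norm_num, fun _ => rfl, fun θ hθ φ => ?_⟩
    rw [sphY, assocLegendre, assocLegendreNat, sqrt_one_sub_cos_sq hθ, harmonicConst, harmMod]
    simp only [Int.ofNat_eq_natCast, Int.natAbs_natCast]
    rw [show ((l : ℤ) - m).toNat = l - m by omega, show ((l : ℤ) + m).toNat = l + m by omega,
      zpow_natCast, ← kerConst]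
    have h1 : ((-1 : ℂ) ^ m) * (-1) ^ m = 1 := by rw [← mul_pow]; norm_num
    generalize Complex.exp (Complex.I * ((m : ℤ) : ℂ) * φ) = E
    push_cast
    linear_combination ((Real.sqrt (kerConst l * ((l - m).factorial / (l + m).factorial)) : ℂ) *
      E * Complex.sin θ ^ m * ((derivative^[m] (legendreP l)).eval (Real.cos θ) : ℝ)) * h1
  · obtain ⟨m, hmk⟩ : ∃ m, m = k + 1 := ⟨_, rfl⟩
    have hml : m ≤ l := by omega
    refine ⟨(-1) ^ m, by rw [← mul_pow]; norm_num, fun h => by omega, fun θ hθ φ => ?_⟩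
    rw [sphY, assocLegendre, ← hmk, assocLegendreNat, sqrt_one_sub_cos_sq hθ, harmonicConst, harmMod]
    simp only [Int.natAbs_negSucc, Nat.succ_eq_add_one, ← hmk]
    rw [show ((l : ℤ) - Int.negSucc k).toNat = l + m by omega,
      show ((l : ℤ) + Int.negSucc k).toNat = l - m by omega, ← kerConst]
    have h0 : ((-1 : ℝ) ^ Int.negSucc k) = (-1) ^ m := by
      rw [zpow_negSucc, ← hmk, ← inv_pow]; norm_num
    have f1 : (0 : ℝ) < (l - m).factorial := by positivity
    have f2 : (0 : ℝ) < (l + m).factorial := by positivity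
    have h2 : Real.sqrt (kerConst l * ((l + m).factorial / (l - m).factorial)) *
        (((l - m).factorial : ℝ) / (l + m).factorial)
        = Real.sqrt (kerConst l * ((l - m).factorial / (l + m).factorial)) := by
      have hk := (kerConst_pos l).le
      have hmul : ∀ a r : ℝ, 0 ≤ a → 0 ≤ r → Real.sqrt a * r = Real.sqrt (a * r ^ 2) :=
        fun a r ha hr => by rw [Real.sqrt_mul ha, Real.sqrt_sq hr]
      rw [hmul _ _ (by positivity) (by positivity)]
      congr 1
      field_simp
    rw [h0, ← h2]
    have h1 : ((-1 : ℂ) ^ m) * (-1) ^ m = 1 := by rw [← mul_pow]; norm_num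
    generalize Complex.exp (Complex.I * ((Int.negSucc k : ℤ) : ℂ) * φ) = E
    push_cast
    linear_combination ((Real.sqrt (kerConst l * ((l + m).factorial / (l - m).factorial)) : ℂ) *
      (((l - m).factorial : ℂ) / (l + m).factorial) * (-1) ^ m *
      E * Complex.sin θ ^ m * ((derivative^[m] (legendreP l)).eval (Real.cos θ) : ℝ)) * h1

lemma realConst_sq (l k : ℕ) : realConst l k ^ 2
    = kerConst l * ((l - k).factorial / (l + k).factorial) * (if k = 0 then 1 else 2) := by
  rw [realConst, ← kerConst, mul_pow, Real.sq_sqrt]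
  · split_ifs <;> simp
  · have := (kerConst_pos l).le
    positivity

/-- Real and complex harmonics give the same products only after the orders `m` and `-m` are added,
so both sums are symmetrized before being compared term by term. -/
lemma sum_Icc_eq_half (l : ℕ) (f : ℤ → ℂ) :
    ∑ m ∈ Finset.Icc (-(l : ℤ)) l, f m = ∑ m ∈ Finset.Icc (-(l : ℤ)) l, (f m + f (-m)) / 2 := by
  have h : ∑ m ∈ Finset.Icc (-(l : ℤ)) l, f m = ∑ m ∈ Finset.Icc (-(l : ℤ)) l, f (-m) :=
    Finset.sum_equiv (Equiv.neg ℤ) (fun i => by simp only [Finset.mem_Icc, Equiv.neg_apply]; omega)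
      (fun i _ => by simp)
  simp_rw [← Finset.sum_div, Finset.sum_add_distrib]
  rw [← h]; ring

lemma azimuth_add_neg {m : ℤ} (hm : m ≠ 0) (φ φ' : ℝ) :
    azimuth m φ * azimuth m φ' + azimuth (-m) φ * azimuth (-m) φ' = Real.cos (m * (φ - φ')) := by
  rcases lt_or_gt_of_ne hm with h | h
  · have h1 : ¬ 0 ≤ m := by omega
    have h2 : 0 ≤ -m := by omega
    have e : ((m.natAbs : ℕ) : ℝ) = -m := by
      rw [← Int.cast_natCast, Int.natCast_natAbs, abs_of_neg h]; push_cast; ring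
    simp only [azimuth, h1, h2, if_true, if_false, Int.natAbs_neg, e]
    rw [show (m : ℝ) * (φ - φ') = -(-m * φ - -m * φ') by ring, Real.cos_neg, Real.cos_sub]
    ring
  · have h1 : 0 ≤ m := by omega
    have h2 : ¬ 0 ≤ -m := by omega
    have e : ((m.natAbs : ℕ) : ℝ) = m := by
      rw [← Int.cast_natCast, Int.natCast_natAbs, abs_of_pos h]
    simp only [azimuth, h1, h2, if_true, if_false, Int.natAbs_neg, e]
    rw [mul_sub, Real.cos_sub]

lemma exp_mul_conj_add (m : ℤ) (φ φ' : ℝ) :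
    conj (Complex.exp (Complex.I * m * φ')) * Complex.exp (Complex.I * m * φ)
      + conj (Complex.exp (Complex.I * (-m : ℤ) * φ')) * Complex.exp (Complex.I * (-m : ℤ) * φ)
      = ((2 * Real.cos (m * (φ - φ')) : ℝ) : ℂ) := by
  rw [← Complex.exp_conj, ← Complex.exp_conj, ← Complex.exp_add, ← Complex.exp_add]
  push_cast
  rw [Complex.two_cos]
  simp only [map_mul, Complex.conj_I, Complex.conj_ofReal, map_neg, map_intCast]
  congr 1 <;> congr 1 <;> ring

/-- The addition theorem for the complex spherical harmonics. -/
theorem sum_sphY_mul_conj (l : ℕ) {θ θ' : ℝ} (hθ : θ ∈ Icc 0 Real.pi) (hθ' : θ' ∈ Icc 0 Real.pi)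
    (φ φ' : ℝ) : ∑ m ∈ Finset.Icc (-(l : ℤ)) l, conj (sphY l m θ' φ') * sphY l m θ φ
      = ((kerConst l * zonal l (sph θ φ) (sph θ' φ') : ℝ) : ℂ) := by
  rw [← sum_realY_mul, Complex.ofReal_sum, sum_Icc_eq_half l fun m => conj _ * _,
    sum_Icc_eq_half l fun m => (_ : ℝ)]
  refine Finset.sum_congr rfl fun m hm => ?_
  congr 1
  have hm' : -m ∈ Finset.Icc (-(l : ℤ)) l := by
    rw [Finset.mem_Icc] at hm ⊢; omega
  obtain ⟨ε, hε, -, h1⟩ := sphY_eq hm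
  obtain ⟨δ, hδ, -, h2⟩ := sphY_eq hm'
  rw [h1 θ hθ, h1 θ' hθ', h2 θ hθ, h2 θ' hθ', Int.natAbs_neg]
  have hε' : (ε : ℂ) * ε = 1 := by exact_mod_cast hε
  have hδ' : (δ : ℂ) * δ = 1 := by exact_mod_cast hδ
  have e1 := exp_mul_conj_add m φ φ'
  have e2 : realY l m (sph θ φ) * realY l m (sph θ' φ')
      + realY l (-m) (sph θ φ) * realY l (-m) (sph θ' φ')
      = harmMod l m.natAbs θ * harmMod l m.natAbs θ' * (2 * Real.cos (m * (φ - φ'))) := by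
    have h3 : ∀ m : ℤ, realY l m (sph θ φ) * realY l m (sph θ' φ')
        = harmMod l m.natAbs θ * harmMod l m.natAbs θ' * ((if m.natAbs = 0 then 1 else 2) *
          (azimuth m φ * azimuth m φ')) := by
      intro m
      have h4 := realConst_sq l m.natAbs
      have h5 : 0 ≤ kerConst l * (((l - m.natAbs).factorial : ℝ) / (l + m.natAbs).factorial) := by
        have := (kerConst_pos l).le
        positivity
      have h6 := Real.mul_self_sqrt h5
      rw [realY, realY, harm_sph, harm_sph, harmMod, harmMod]
      linear_combination ((derivative^[m.natAbs] (legendreP l)).eval (Real.cos θ) *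
        Real.sin θ ^ m.natAbs * azimuth m φ *
        (derivative^[m.natAbs] (legendreP l)).eval (Real.cos θ') *
        Real.sin θ' ^ m.natAbs * azimuth m φ') * h4
        - ((derivative^[m.natAbs] (legendreP l)).eval (Real.cos θ) *
        Real.sin θ ^ m.natAbs * azimuth m φ *
        (derivative^[m.natAbs] (legendreP l)).eval (Real.cos θ') *
        Real.sin θ' ^ m.natAbs * azimuth m φ' * (if m.natAbs = 0 then 1 else 2)) * h6
    rw [h3, h3, Int.natAbs_neg, ← mul_add, ← mul_add]
    by_cases h0 : m = 0
    · subst h0; simp [azimuth]; norm_num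
    · rw [azimuth_add_neg h0, if_neg (by omega)]
  rw [← Complex.ofReal_add, e2]
  simp only [map_mul, Complex.conj_ofReal]
  rw [Complex.ofReal_mul, ← e1]
  push_cast
  linear_combination ((harmMod l m.natAbs θ : ℂ) * harmMod l m.natAbs θ' *
    (conj (Complex.exp (Complex.I * m * φ')) * Complex.exp (Complex.I * m * φ))) * hε'
    + ((harmMod l m.natAbs θ : ℂ) * harmMod l m.natAbs θ' *
    (conj (Complex.exp (Complex.I * (-m) * φ')) * Complex.exp (Complex.I * (-m) * φ))) * hδ'

lemma continuous_sphY (l : ℕ) (m : ℤ) : Continuous fun p : ℝ × ℝ => sphY l m p.1 p.2 := by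
  have h : Continuous (assocLegendre l m) := by
    have h0 : ∀ k, Continuous (assocLegendreNat l k) := fun k => by
      have := (derivative^[k] (legendreP l)).continuous
      unfold assocLegendreNat
      fun_prop
    rcases m with m | k
    · exact h0 m
    · exact continuous_const.mul (h0 (k + 1))
  unfold sphY
  fun_prop

lemma integrable_angMeasure {E : Type*} [NormedAddCommGroup E] {h : ℝ × ℝ → E} (hh : Continuous h) :
    Integrable h angMeasure := by
  obtain ⟨C, hC⟩ := (isCompact_Icc (a := (0 : ℝ)) (b := Real.pi)).prod
    (isCompact_Icc (a := (0 : ℝ)) (b := 2 * Real.pi)) |>.exists_bound_of_continuousOn hh.continuousOn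
  refine Integrable.mono' (integrable_const C) hh.aestronglyMeasurable ?_
  filter_upwards [ae_angMeasure] with p hp
  exact hC p ⟨⟨hp.1.1.le, hp.1.2.le⟩, ⟨hp.2.1, hp.2.2.le⟩⟩

/-- By the addition theorem the inner sum over `m` of the asserted series is the integral against
the zonal kernel. From here on only the real projections matter. -/
lemma sum_coeff_mul_sphY {f : S2 → ℝ} (hf : Continuous f) (l : ℕ) {θ : ℝ} (hθ : θ ∈ Icc 0 Real.pi)
    (φ : ℝ) : ∑ m ∈ Finset.Icc (-(l : ℤ)) l,
      (∫ p, (f (sph p.1 p.2) : ℂ) * conj (sphY l m p.1 p.2) ∂angMeasure) * sphY l m θ φ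
      = (proj l f (sph θ φ) : ℂ) := by
  have hint : ∀ m, Integrable (fun p : ℝ × ℝ => (f (sph p.1 p.2) : ℂ) * conj (sphY l m p.1 p.2)
      * sphY l m θ φ) angMeasure := by
    intro m
    have hfc : Continuous fun p : ℝ × ℝ => f (sph p.1 p.2) := hf.comp continuous_sph
    have hY := continuous_sphY l m
    exact integrable_angMeasure (((Complex.continuous_ofReal.comp hfc).mul
      (Complex.continuous_conj.comp hY)).mul continuous_const)
  simp_rw [← integral_mul_const]
  rw [← integral_finsetSum _ fun m _ => hint m, proj, integral_sphMeasure
    (h := fun y => f y * zonal l (sph θ φ) y) (hf.mul (continuous_zonal_right l _)).aestronglyMeasurable, ← integral_const_mul,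
    ← integral_complex_ofReal]
  refine integral_congr_ae ?_
  filter_upwards [ae_angMeasure] with p hp
  have := sum_sphY_mul_conj l hθ ⟨hp.1.1.le, hp.1.2.le⟩ φ p.2
  simp_rw [mul_assoc]
  rw [← Finset.mul_sum, this]
  push_cast
  ring

end Complex

section Weak
variable {c r D ηinf : ℝ}

/-! ### Series of time factors -/

/-- The second derivative of the time factor. -/
def timeFDD (c r D ηinf : ℝ) (l : ℕ) (η : ℝ) : ℝ :=
  -((2 * nuIndex c D ηinf - 1) / (ηinf - η)) * timeFD c r D ηinf l η
    - zfreq c r l ^ 2 * timeF c r D ηinf l η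

lemma mem_Ioo_of_mem_Ico {η : ℝ} (h : η ∈ Ico 0 ηinf) : η ∈ Ioo (-1) ηinf :=
  ⟨by linarith [h.1], h.2⟩

lemma summable_of_sq_weight {p : ℕ → ℝ} (hp : Summable fun l : ℕ => ((l : ℝ) + 1) ^ 2 * |p l|)
    {k : ℕ} (hk : k ≤ 2) : Summable fun l : ℕ => ((l : ℝ) + 1) ^ k * |p l| :=
  Summable.of_nonneg_of_le (fun l => by positivity) (fun l =>
    mul_le_mul_of_nonneg_right (pow_le_pow_right₀ (by linarith [(Nat.cast_nonneg l : (0 : ℝ) ≤ l)])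
      hk) (abs_nonneg _)) hp

/-- Each time derivative of `F_l` costs a factor of order `l+1`, so the weight `(l+1)²` allows two
termwise derivatives; the equation for the sum follows from that of the terms. -/
lemma timeSeries (hc : 0 < c) (hr : 0 < r) (hD : 0 < D) (hη : 0 < ηinf)
    {p : ℕ → ℝ} (hp : Summable fun l : ℕ => ((l : ℝ) + 1) ^ 2 * |p l|) {η : ℝ}
    (h : η ∈ Ioo (-1) ηinf) :
    HasDerivAt (fun s => ∑' l, timeF c r D ηinf l s * p l) (∑' l, timeFD c r D ηinf l η * p l) η ∧
    HasDerivAt (fun s => ∑' l, timeFD c r D ηinf l s * p l)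
      (∑' l, timeFDD c r D ηinf l η * p l) η ∧
    ContinuousAt (fun s => ∑' l, timeFDD c r D ηinf l s * p l) η ∧
    ∑' l, timeFDD c r D ηinf l η * p l
      = -((2 * nuIndex c D ηinf - 1) / (ηinf - η)) * ∑' l, timeFD c r D ηinf l η * p l
        - c ^ 2 / r ^ 2 * ∑' l, timeF c r D ηinf l η * ((l : ℝ) * (l + 1) * p l) := by
  -- The coefficient `1/(η∞-η)` is unbounded near `η∞`, so bounds uniform in `l` are available only
  -- up to some `b < η∞`.
  obtain ⟨b, hb1, hb2⟩ := exists_between h.2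
  obtain ⟨M, hM, hMb⟩ := exists_timeF_bound hc hr hD hη hb2
  have hηb : η ∈ Ioo (-1) b := ⟨h.1, hb1⟩
  have hd := fun l s (hs : s ∈ Ioo (-1) b) =>
    hasDerivAt_timeF (D := D) hc hr l (hs.2.trans hb2)
  have s0 : Summable fun l : ℕ => M * |p l| := by
    simpa using (summable_of_sq_weight hp (k := 0) (by norm_num)).mul_left M
  have s1 : Summable fun l : ℕ => M * ((l + 1) * |p l|) := by
    simpa using (summable_of_sq_weight hp (k := 1) (by norm_num)).mul_left M
  have s2 : Summable fun l : ℕ => M * ((l + 1) ^ 2 * |p l|) := hp.mul_left M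
  have b0 : ∀ l, ∀ s ∈ Ioo (-1) b, ‖timeF c r D ηinf l s * p l‖ ≤ M * |p l| := fun l s hs => by
    rw [Real.norm_eq_abs, abs_mul]
    exact mul_le_mul_of_nonneg_right (hMb l s hs).1 (abs_nonneg _)
  have b1 : ∀ l, ∀ s ∈ Ioo (-1) b, ‖timeFD c r D ηinf l s * p l‖ ≤ M * ((l + 1) * |p l|) :=
    fun l s hs => by
      rw [Real.norm_eq_abs, abs_mul, ← mul_assoc]
      exact mul_le_mul_of_nonneg_right (hMb l s hs).2.1 (abs_nonneg _)
  have b2 : ∀ l, ∀ s ∈ Ioo (-1) b, ‖timeFDD c r D ηinf l s * p l‖ ≤ M * ((l + 1) ^ 2 * |p l|) :=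
    fun l s hs => by
      rw [Real.norm_eq_abs, abs_mul, ← mul_assoc]
      exact mul_le_mul_of_nonneg_right (hMb l s hs).2.2 (abs_nonneg _)
  have S0 : Summable fun l => timeF c r D ηinf l η * p l := s0.of_norm_bounded fun l => b0 l η hηb
  have S1 : Summable fun l => timeFD c r D ηinf l η * p l := s1.of_norm_bounded fun l => b1 l η hηb
  refine ⟨?_, ?_, ?_, ?_⟩
  · exact hasDerivAt_tsum_of_isPreconnected s1 isOpen_Ioo isPreconnected_Ioo
      (fun l s hs => ((hd l s hs).1).mul_const _) b1 hηb S0 hηb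
  · exact hasDerivAt_tsum_of_isPreconnected s2 isOpen_Ioo isPreconnected_Ioo
      (fun l s hs => ((hd l s hs).2).mul_const _) b2 hηb S1 hηb
  · have hcont : ContinuousOn (fun s => ∑' l, timeFDD c r D ηinf l s * p l) (Ioo (-1) b) := by
      refine continuousOn_tsum (fun l s hs => ContinuousAt.continuousWithinAt ?_) s2 b2
      have hne : ηinf - s ≠ 0 := (sub_pos.2 (hs.2.trans hb2)).ne'
      have h1 := (hd l s hs).1.continuousAt
      have h2 := (hd l s hs).2.continuousAt
      unfold timeFDD
      exact ((((continuousAt_const.div (continuousAt_const.sub continuousAt_id) hne).neg).mul h2).sub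
        (continuousAt_const.mul h1)).mul continuousAt_const
    exact hcont.continuousAt (isOpen_Ioo.mem_nhds hηb)
  · have S2 : Summable fun l : ℕ => timeF c r D ηinf l η * ((l : ℝ) * (l + 1) * p l) := by
      refine s2.of_norm_bounded fun l => ?_
      rw [Real.norm_eq_abs, abs_mul, abs_mul, abs_of_nonneg (by positivity : (0 : ℝ) ≤ l * (l + 1))]
      refine mul_le_mul (hMb l η hηb).1 (mul_le_mul_of_nonneg_right ?_ (abs_nonneg _))
        (by positivity) hM
      nlinarith [(Nat.cast_nonneg l : (0 : ℝ) ≤ l)]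
    rw [← tsum_mul_left, ← tsum_mul_left, ← (S1.mul_left _).tsum_sub (S2.mul_left _)]
    refine tsum_congr fun l => ?_
    rw [timeFDD, zfreq_sq]
    ring

lemma contDiffOn_two_of_hasDerivWithinAt {g g1 g2 : ℝ → ℝ}
    (h1 : ∀ η ∈ Ico 0 ηinf, HasDerivWithinAt g (g1 η) (Ico 0 ηinf) η)
    (h2 : ∀ η ∈ Ico 0 ηinf, HasDerivWithinAt g1 (g2 η) (Ico 0 ηinf) η)
    (h3 : ContinuousOn g2 (Ico 0 ηinf)) :
    ContDiffOn ℝ 2 g (Ico 0 ηinf) ∧ ∀ η ∈ Ico 0 ηinf,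
      derivWithin g (Ico 0 ηinf) η = g1 η ∧
      derivWithin (derivWithin g (Ico 0 ηinf)) (Ico 0 ηinf) η = g2 η := by
  have hu : UniqueDiffOn ℝ (Ico 0 ηinf) := uniqueDiffOn_Ico 0 ηinf
  have e1 : ∀ η ∈ Ico 0 ηinf, derivWithin g (Ico 0 ηinf) η = g1 η :=
    fun η h => (h1 η h).derivWithin (hu η h)
  have h2' : ∀ η ∈ Ico 0 ηinf,
      HasDerivWithinAt (derivWithin g (Ico 0 ηinf)) (g2 η) (Ico 0 ηinf) η :=
    fun η h => (h2 η h).congr e1 (e1 η h)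
  have e2 : ∀ η ∈ Ico 0 ηinf, derivWithin (derivWithin g (Ico 0 ηinf)) (Ico 0 ηinf) η = g2 η :=
    fun η h => (h2' η h).derivWithin (hu η h)
  refine ⟨?_, fun η h => ⟨e1 η h, e2 η h⟩⟩
  rw [show (2 : WithTop ℕ∞) = 1 + 1 by norm_num, contDiffOn_succ_iff_derivWithin hu]
  refine ⟨fun η h => (h1 η h).differentiableWithinAt, by simp, ?_⟩
  rw [show (1 : WithTop ℕ∞) = 0 + 1 by norm_num, contDiffOn_succ_iff_derivWithin hu]
  refine ⟨fun η h => (h2' η h).differentiableWithinAt, by simp, ?_⟩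
  rw [contDiffOn_zero]
  exact h3.congr e2

/-- The initial value problem for a series of time factors. -/
lemma timeSeries_ivp (hc : 0 < c) (hr : 0 < r) (hD : 0 < D) (hη : 0 < ηinf)
    {p : ℕ → ℝ} (hp : Summable fun l : ℕ => ((l : ℝ) + 1) ^ 2 * |p l|)
    {g : ℝ → ℝ} (hg : ∀ η ∈ Ico 0 ηinf, g η = ∑' l, timeF c r D ηinf l η * p l) :
    ContDiffOn ℝ 2 g (Ico 0 ηinf) ∧
    (∀ η ∈ Ico 0 ηinf, damping c D ηinf η * derivWithin g (Ico 0 ηinf) η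
      + 1 / c ^ 2 * derivWithin (derivWithin g (Ico 0 ηinf)) (Ico 0 ηinf) η
      - 1 / r ^ 2 * ∑' l, timeF c r D ηinf l η * (-((l : ℝ) * (l + 1)) * p l) = 0) ∧
    derivWithin g (Ico 0 ηinf) 0 = 0 := by
  have hts := fun η (h : η ∈ Ico 0 ηinf) =>
    timeSeries hc hr hD hη hp (mem_Ioo_of_mem_Ico h)
  obtain ⟨h1, h2⟩ := contDiffOn_two_of_hasDerivWithinAt (g := g)
    (fun η h => ((hts η h).1.hasDerivWithinAt).congr hg (hg η h))
    (fun η h => (hts η h).2.1.hasDerivWithinAt)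
    (fun η h => (hts η h).2.2.1.continuousWithinAt)
  refine ⟨h1, fun η h => ?_, ?_⟩
  · have e : ∑' l, timeF c r D ηinf l η * (-((l : ℝ) * (l + 1)) * p l)
        = -∑' l, timeF c r D ηinf l η * ((l : ℝ) * (l + 1) * p l) := by
      rw [← tsum_neg]; exact tsum_congr fun l => by ring
    rw [(h2 η h).1, (h2 η h).2, (hts η h).2.2.2, damping_eq hη h.2 hc hD, e]
    field_simp
    ring
  · rw [(h2 0 ⟨le_rfl, hη⟩).1]
    simp [timeFD_zero]

/-! ### Weak solutions -/

lemma integral_sphLap {f g : S2 → ℝ} (hf : Continuous f) (hg : IsC2 g) :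
    ∫ p, f (sph p.1 p.2) * sphLap g p.1 p.2 ∂angMeasure = ∫ x, f x * lap g x ∂sphMeasure := by
  rw [integral_sphMeasure (h := fun x => f x * lap g x)
    (hf.mul (continuous_lap hg)).aestronglyMeasurable]
  refine integral_congr_ae ?_
  filter_upwards [ae_angMeasure] with p hp
  rw [sphLap_eq_lap hg (Real.sin_pos_of_mem_Ioo hp.1).ne']

lemma pairing_eq {v : ℝ → S2 → ℝ} {ψ : S2 → ℝ} {η : ℝ} (hv : Continuous (v η)) (hψ : Continuous ψ) :
    pairing v ψ η = ∫ x, v η x * ψ x ∂sphMeasure :=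
  (integral_sphMeasure (h := fun x => v η x * ψ x) (hv.mul hψ).aestronglyMeasurable).symm

lemma IsWeakSolution.continuous {f : S2 → ℝ} {v : ℝ → S2 → ℝ}
    (hv : IsWeakSolution c r D ηinf f v) {η : ℝ} (h : η ∈ Ico 0 ηinf) : Continuous (v η) :=
  hv.continuousOn.comp_continuous (f := fun x => (η, x)) (by fun_prop) fun _ => ⟨h, mem_univ _⟩

/-- The projections of a weak solution. -/
theorem IsWeakSolution.proj_eq (hc : 0 < c) (hr : 0 < r) (hD : 0 < D) (hη : 0 < ηinf)
    {f : S2 → ℝ} {v : ℝ → S2 → ℝ}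
    (hv : IsWeakSolution c r D ηinf f v) (l : ℕ) {η : ℝ} (h : η ∈ Ico 0 ηinf) (x : S2) :
    proj l (v η) x = timeF c r D ηinf l η * proj l f x := by
  set I := Ico 0 ηinf with hI
  -- The zonal function is a smooth test function, and the pairing with it is the projection at `x`
  -- up to `kerConst l`. Being an eigenfunction, it turns the weak equation into the time equation
  -- of degree `l`.
  have hψ := contMDiff_zonal (n := ((⊤ : ℕ∞) : WithTop ℕ∞)) l x
  have hψ2 := contMDiff_zonal (n := 2) l x
  have h2 := hv.contDiffOn _ hψ
  have hu : UniqueDiffOn ℝ I := uniqueDiffOn_Ico 0 ηinf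
  have hg : ∀ s ∈ I, pairing v (zonal l x) s = ∫ y, v s y * zonal l x y ∂sphMeasure :=
    fun s hs => pairing_eq (hv.continuous hs) (continuous_zonal_right l x)
  rw [show (2 : WithTop ℕ∞) = 1 + 1 by norm_num, contDiffOn_succ_iff_derivWithin hu] at h2
  obtain ⟨hd1, -, h3⟩ := h2
  have hd2 : DifferentiableOn ℝ (derivWithin (pairing v (zonal l x)) I) I :=
    h3.differentiableOn (by norm_num)
  have hnhds : ∀ s ∈ Ioo 0 ηinf, I ∈ 𝓝 s := fun s hs => Ico_mem_nhds hs.1 hs.2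
  have key := eq_timeF_mul_of_ode hc hr hD hη l (g := pairing v (zonal l x))
    (g' := derivWithin (pairing v (zonal l x)) I) (a := pairing v (zonal l x) 0)
    hd1.continuousOn hd2.continuousOn
    (fun s hs => (hd1 s (Ioo_subset_Ico_self hs)).hasDerivWithinAt.hasDerivAt (hnhds s hs))
    (fun s hs => by
      have hs' := Ioo_subset_Ico_self hs
      refine ((hd2 s hs').hasDerivWithinAt.hasDerivAt (hnhds s hs)).congr_deriv ?_
      have e := hv.equation _ hψ s hs'
      rw [integral_sphLap (hv.continuous hs') hψ2, (isEigen_zonal l x).lap_eq,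
        damping_eq hη hs.2 hc hD] at e
      simp_rw [mul_left_comm (v s _)] at e
      rw [integral_const_mul, ← hg s hs', ← hI] at e
      rw [zfreq_sq]
      generalize derivWithin (derivWithin (pairing v (zonal l x)) I) I s = a2 at e ⊢
      generalize derivWithin (pairing v (zonal l x)) I s = a1 at e ⊢
      generalize pairing v (zonal l x) s = a0 at e ⊢
      generalize (2 * nuIndex c D ηinf - 1) / (ηinf - s) = κ at e ⊢
      have hc' : c ^ 2 * (1 / c ^ 2) = 1 := by field_simp
      have e' := congrArg (c ^ 2 * ·) e
      simp only [mul_zero] at e'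
      linear_combination e' - (κ * a1 + a2) * hc')
    rfl (hv.initial_deriv _ hψ) h
  have h0 : (0 : ℝ) ∈ I := ⟨le_rfl, hη⟩
  rw [hg η h, hg 0 h0] at key
  rw [proj, proj, key]
  simp_rw [hv.initial]
  ring

/-- The integral is at most `‖f_l‖ ‖ψ_l‖`, and `(l+1)² ‖f_l‖ ‖ψ_l‖ ≤ (l+1)⁴ ‖f_l‖² + ‖ψ_l‖²`. Both
terms are summable, so continuity of `ψ` suffices. -/
lemma summable_sq_mul_integral_proj {f ψ : S2 → ℝ} (hf : IsC2 f) (hψ : Continuous ψ) :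
    Summable fun l : ℕ => ((l : ℝ) + 1) ^ 2 * |∫ x, proj l f x * ψ x ∂sphMeasure| := by
  have hfc := hf.continuous
  refine Summable.of_nonneg_of_le (fun l => by positivity) (fun l => ?_)
    ((summable_pow_mul_projSq hf).add (summable_projSq hψ))
  have e1 : ∫ x, proj l f x * ψ x ∂sphMeasure = ∫ x, proj l f x * proj l ψ x ∂sphMeasure := by
    rw [integral_proj_mul_proj l hfc hψ, integral_proj_mul l hfc hψ]
  have hCS := sq_integral_mul_le (continuous_proj l hfc) (continuous_proj l hψ)
  rw [e1]
  set I := ∫ x, proj l f x * proj l ψ x ∂sphMeasure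
  have p1 := projSq_nonneg l ψ
  have p2 : 0 ≤ ((l : ℝ) + 1) ^ 4 * projSq l f := mul_nonneg (by positivity) (projSq_nonneg l f)
  refine (sq_le_sq₀ (by positivity) (add_nonneg p2 p1)).1 ?_
  rw [mul_pow, sq_abs]
  calc (((l : ℝ) + 1) ^ 2) ^ 2 * I ^ 2 ≤ (((l : ℝ) + 1) ^ 2) ^ 2 * (projSq l f * projSq l ψ) :=
        mul_le_mul_of_nonneg_left hCS (by positivity)
    _ ≤ _ := by nlinarith [mul_nonneg p2 p1]

lemma hasSum_proj {f : S2 → ℝ} (hf : IsC2 f) (x : S2) : HasSum (fun l => proj l f x) (f x) := by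
  have hb := summable_sqrt_projSq hf
  have hle := fun l x => abs_proj_le l hf.continuous x
  have := eq_tsum_of_proj hf.continuous (fun l => isEigen_proj l hf.continuous) hb hle fun _ => rfl
  have hs : Summable fun l => proj l f x := hb.of_norm_bounded fun l => hle l x
  have h := hs.hasSum
  rwa [← congrFun this x] at h

lemma abs_timeF_mul_proj_le (hc : 0 < c) (hr : 0 < r) (hD : 0 < D) (hη : 0 < ηinf)
    {f : S2 → ℝ} (hf : Continuous f) (l : ℕ) {η : ℝ} (h : η ∈ Ico 0 ηinf)
    (x : S2) : |timeF c r D ηinf l η * proj l f x| ≤ Real.sqrt (kerConst l * projSq l f) := by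
  rw [abs_mul, ← one_mul (Real.sqrt _)]
  exact mul_le_mul (abs_timeF_le_one hc hr hD hη l h) (abs_proj_le l hf x) (abs_nonneg _) zero_le_one

/-- Every weak solution is the sum of its series. -/
theorem IsWeakSolution.hasSum (hc : 0 < c) (hr : 0 < r) (hD : 0 < D) (hη : 0 < ηinf)
    {f : S2 → ℝ} (hf : IsC2 f) {v : ℝ → S2 → ℝ}
    (hv : IsWeakSolution c r D ηinf f v) {η : ℝ} (h : η ∈ Ico 0 ηinf) (x : S2) :
    HasSum (fun l => timeF c r D ηinf l η * proj l f x) (v η x) := by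
  have hb := summable_sqrt_projSq hf
  have hle := fun l x => abs_timeF_mul_proj_le hc hr hD hη hf.continuous l h x
  have := eq_tsum_of_proj (hv.continuous h)
    (h := fun l x => timeF c r D ηinf l η * proj l f x)
    (fun l => (isEigen_proj l hf.continuous).const_mul _) hb hle
    (fun l => funext fun x => hv.proj_eq hc hr hD hη l h x)
  have hs : Summable fun l => timeF c r D ηinf l η * proj l f x := hb.of_norm_bounded fun l => hle l x
  have h := hs.hasSum
  rwa [← congrFun this x] at h

/-- A function on `[0, η∞) × S²` given by the series is a weak solution. -/
theorem isWeakSolution_of_hasSum (hc : 0 < c) (hr : 0 < r) (hD : 0 < D) (hη : 0 < ηinf)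
    {f : S2 → ℝ} (hf : IsC2 f) {v : ℝ → S2 → ℝ}
    (hv : ∀ η ∈ Ico 0 ηinf, ∀ x, v η x = ∑' l, timeF c r D ηinf l η * proj l f x) :
    IsWeakSolution c r D ηinf f v := by
  have hfc := hf.continuous
  have hb := summable_sqrt_projSq hf
  have hle := fun l η (h : η ∈ Ico 0 ηinf) x => abs_timeF_mul_proj_le hc hr hD hη hfc l h x
  have hcF : ∀ l, ContinuousOn (timeF c r D ηinf l) (Ico 0 ηinf) := fun l η h =>
    (hasDerivAt_timeF hc hr l h.2).1.continuousAt.continuousWithinAt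
  have hcont : ContinuousOn (fun p : ℝ × S2 => v p.1 p.2) (Ico 0 ηinf ×ˢ univ) := by
    have : ContinuousOn (fun p : ℝ × S2 => ∑' l, timeF c r D ηinf l p.1 * proj l f p.2)
        (Ico 0 ηinf ×ˢ univ) :=
      continuousOn_tsum (fun l => ((hcF l).comp continuousOn_fst fun p hp => hp.1).mul
        ((continuous_proj l hfc).comp_continuousOn continuousOn_snd)) hb
        fun l p hp => hle l p.1 hp.1 p.2
    exact this.congr fun p hp => hv p.1 hp.1 p.2
  have hvc : ∀ η ∈ Ico 0 ηinf, Continuous (v η) := fun η h =>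
    hcont.comp_continuous (f := fun x => (η, x)) (by fun_prop) fun _ => ⟨h, mem_univ _⟩
  -- Stated for continuous `ψ` so that it applies to a test function and to its Laplacian.
  have hint : ∀ ψ, Continuous ψ → ∀ η ∈ Ico 0 ηinf, ∫ x, v η x * ψ x ∂sphMeasure
      = ∑' l, timeF c r D ηinf l η * ∫ x, proj l f x * ψ x ∂sphMeasure := by
    intro ψ hψ η h
    have := hasSum_integral_eigen (h := fun l x => timeF c r D ηinf l η * proj l f x)
      (fun l => continuous_const.mul (continuous_proj l hfc)) hb (fun l x => hle l η h x) hψ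
    simp_rw [mul_assoc, integral_const_mul] at this
    rw [this.tsum_eq]
    simp_rw [hv η h]
  have hpair : ∀ ψ, Continuous ψ → ∀ η ∈ Ico 0 ηinf, pairing v ψ η
      = ∑' l, timeF c r D ηinf l η * ∫ x, proj l f x * ψ x ∂sphMeasure := fun ψ hψ η h => by
    rw [pairing_eq (hvc η h) hψ, hint ψ hψ η h]
  refine ⟨hcont, fun ψ hψ => ?_, fun ψ hψ η h => ?_, fun x => ?_, fun ψ hψ => ?_⟩
  · exact (timeSeries_ivp hc hr hD hη (summable_sq_mul_integral_proj hf hψ.continuous)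
      (hpair ψ hψ.continuous)).1
  · have hψ2 : IsC2 ψ := hψ.of_le two_le_top
    have h1 := (timeSeries_ivp hc hr hD hη (summable_sq_mul_integral_proj hf hψ.continuous)
      (hpair ψ hψ.continuous)).2.1 η h
    -- Pairing with the Laplacian of `ψ` multiplies the `l`-th coefficient by `-l(l+1)`, which
    -- matches the series in the time equation.
    rw [integral_sphLap (hvc η h) hψ2, hint _ (continuous_lap hψ2) η h]
    refine Eq.trans ?_ h1
    congr 2
    refine tsum_congr fun l => ?_
    have := integral_mul_lap (isEigen_proj l hfc) hψ2
    simp_rw [mul_comm _ (proj l f _)] at this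
    rw [this]
  · rw [hv 0 ⟨le_rfl, hη⟩ x]
    simp_rw [timeF_zero hc hr hη, one_mul]
    exact (hasSum_proj hf x).tsum_eq
  · exact (timeSeries_ivp hc hr hD hη (summable_sq_mul_integral_proj hf hψ.continuous)
      (hpair ψ hψ.continuous)).2.2

end Weak

/-! ### Polynomial kernels -/

section Kernels
open Polynomial
variable {F : Type*} [NormedAddCommGroup F] [NormedSpace ℝ F]

/-- The integral operator with kernel `q(⟨x, y⟩)`. -/
def polyKernel (q : ℝ[X]) (g : S2 → F) (x : E3) : F :=
  ∫ y : S2, q.eval (inner ℝ x (y : E3)) • g y ∂sphMeasure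

/-- The integrand of the derivative of `polyKernel`. -/
def kernelDeriv (g : S2 → F) (y : S2) : E3 →L[ℝ] F := (innerSL ℝ (y : E3)).smulRight (g y)

lemma continuous_kernelDeriv {g : S2 → F} (hg : Continuous g) : Continuous (kernelDeriv g) := by
  have h1 : Continuous fun y : S2 => innerSL ℝ (y : E3) :=
    (innerSL ℝ (E := E3)).continuous.comp continuous_subtype_val
  have h2 := (ContinuousLinearMap.smulRightL ℝ E3 F).continuous₂.comp (h1.prodMk hg)
  exact h2

lemma norm_kernelDeriv (g : S2 → F) (y : S2) : ‖kernelDeriv g y‖ = ‖g y‖ := by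
  rw [kernelDeriv, ContinuousLinearMap.norm_smulRight_apply, innerSL_apply_norm, S2_norm, one_mul]

/-- The derivative has the same form, with `q'` and the density `y ↦ ⟨y, ·⟩ g(y)`, of the same norm
as `g` because `‖y‖ = 1`. Vector-valued densities are allowed so that this can be iterated. -/
lemma hasFDerivAt_polyKernel (q : ℝ[X]) {g : S2 → F} (hg : Continuous g) (x : E3) :
    HasFDerivAt (polyKernel q g) (polyKernel (derivative q) (kernelDeriv g) x) x := by
  have hin : Continuous fun p : E3 × S2 => inner ℝ p.1 (p.2 : E3) := by fun_prop
  have hF : ∀ x : E3, Continuous fun y : S2 => q.eval (inner ℝ x (y : E3)) • g y := fun x =>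
    (q.continuous.comp (hin.comp (continuous_const.prodMk continuous_id))).smul hg
  have hF' : Continuous fun p : E3 × S2 =>
      (derivative q).eval (inner ℝ p.1 (p.2 : E3)) • kernelDeriv g p.2 :=
    ((derivative q).continuous.comp hin).smul ((continuous_kernelDeriv hg).comp continuous_snd)
  obtain ⟨C, hC⟩ := ((isCompact_closedBall x 1).prod (isCompact_univ (X := S2))).exists_bound_of_continuousOn
    hF'.continuousOn
  exact hasFDerivAt_integral_of_dominated_of_fderiv_le (μ := sphMeasure)
    (F := fun x y => q.eval (inner ℝ x (y : E3)) • g y)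
    (F' := fun x y => (derivative q).eval (inner ℝ x (y : E3)) • kernelDeriv g y)
    (bound := fun _ => C) (Metric.ball_mem_nhds x one_pos)
    (Eventually.of_forall fun x => (integrable_sphMeasure (hF x)).1) (integrable_sphMeasure (hF x))
    (integrable_sphMeasure (hF'.comp (continuous_const.prodMk continuous_id))).1
    (Eventually.of_forall fun y z hz => hC (z, y) ⟨Metric.ball_subset_closedBall hz, mem_univ _⟩)
    (integrable_const C)
    (Eventually.of_forall fun y z _ => by
      have h1 : HasFDerivAt (fun z : E3 => inner ℝ z (y : E3)) (innerSL ℝ (y : E3)) z := by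
        rw [show (fun z : E3 => inner ℝ z (y : E3)) = innerSL ℝ (y : E3) from
          funext fun z => real_inner_comm _ _]
        exact (innerSL ℝ (y : E3)).hasFDerivAt
      have h2 := (((q.hasDerivAt (inner ℝ z (y : E3))).comp_hasFDerivAt z h1)).smul_const (g y)
      refine h2.congr_fderiv ?_
      ext v
      simp [kernelDeriv, mul_smul])

/-- Cauchy-Schwarz. The integral of `q(⟨x, y⟩)²` over the sphere does not depend on `x`; at the pole
it is `2π` times an integral over `[-1, 1]`. -/
lemma norm_polyKernel_sq_le (q : ℝ[X]) {g : S2 → F} (hg : Continuous g) (x : S2) :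
    ‖polyKernel q g x‖ ^ 2
      ≤ 2 * Real.pi * polyInt (q * q) * ∫ y, ‖g y‖ * ‖g y‖ ∂sphMeasure := by
  have hin : Continuous fun y : S2 => inner ℝ (x : E3) (y : E3) := by fun_prop
  have hq : Continuous fun y : S2 => |q.eval (inner ℝ (x : E3) (y : E3))| :=
    (q.continuous.comp hin).abs
  have h1 : ‖polyKernel q g x‖
      ≤ ∫ y, |q.eval (inner ℝ (x : E3) (y : E3))| * ‖g y‖ ∂sphMeasure := by
    refine (norm_integral_le_integral_norm _).trans (le_of_eq ?_)
    simp_rw [norm_smul, Real.norm_eq_abs]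
  have h2 := sq_integral_mul_le hq hg.norm
  have h3 : ∫ y : S2, |q.eval (inner ℝ (x : E3) (y : E3))| * |q.eval (inner ℝ (x : E3) (y : E3))|
      ∂sphMeasure = 2 * Real.pi * polyInt (q * q) := by
    simp_rw [abs_mul_abs_self]
    obtain ⟨R, -, hR⟩ := exists_rotation northPole x
    have hc : Continuous fun y : S2 => q.eval (inner ℝ (x : E3) (y : E3))
        * q.eval (inner ℝ (x : E3) (y : E3)) := (q.continuous.comp hin).mul (q.continuous.comp hin)
    rw [← integral_rot R hc]
    have e : ∀ y : S2, q.eval (inner ℝ (x : E3) (rot R y : E3)) * q.eval (inner ℝ (x : E3) (rot R y : E3))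
        = harm (q * q) 0 y * harm 1 0 y := by
      intro y
      rw [← hR, coe_rot, coe_rot, R.inner_map_map, coe_northPole, ePole,
        EuclideanSpace.inner_single_left]
      simp [harm, azimuthPoly]
    simp_rw [e]
    rw [integral_harm_mul]
    simp
  rw [← h3]
  exact (pow_le_pow_left₀ (norm_nonneg _) h1 2).trans h2

lemma degree_derivative_legendreP_lt (l m : ℕ) :
    (derivative^[m + 1] (legendreP l)).degree < l := by
  induction m with
  | zero =>
    have h0 : legendreP l ≠ 0 := fun h => coeff_legendreP l (by rw [h, coeff_zero])
    exact (degree_derivative_lt h0).trans_le (natDegree_le_iff_degree_le.1 (natDegree_legendreP l))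
  | succ m ih =>
    rw [Function.iterate_succ_apply']
    exact (degree_derivative_le).trans_lt ih

lemma derivative_legendreP_eval_one_nonneg (l m : ℕ) :
    0 ≤ (derivative^[m] (legendreP l)).eval 1 := by
  induction m with
  | zero => simp [legendreP_eval_one]
  | succ m ih =>
    rcases le_or_gt m l with h | h
    · have h1 := derivative_legendreP_eval_one l m
      have h2 : (m : ℝ) ≤ l := by exact_mod_cast h
      have h3 : 0 ≤ (l : ℝ) * (l + 1) - m * (m + 1) := by
        nlinarith [(Nat.cast_nonneg m : (0 : ℝ) ≤ m)]
      have h4 := mul_nonneg h3 ih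
      rw [← h1] at h4
      exact nonneg_of_mul_nonneg_right h4 (by positivity)
    · rw [iterate_derivative_eq_zero ((natDegree_legendreP l).trans_lt (h.trans (Nat.lt_succ_self m))),
        eval_zero]

lemma derivative_legendreP_mul_eval_sub (l m : ℕ) :
    (derivative^[m] (legendreP l) * derivative^[m + 1] (legendreP l)).eval 1
      - (derivative^[m] (legendreP l) * derivative^[m + 1] (legendreP l)).eval (-1)
      = 2 * ((derivative^[m] (legendreP l)).eval 1 * (derivative^[m + 1] (legendreP l)).eval 1) := by
  rw [eval_mul, eval_mul, derivative_legendreP_eval_neg_one, derivative_legendreP_eval_neg_one]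
  have h : ((-1 : ℝ) ^ (l + m)) * (-1) ^ (l + (m + 1)) = -1 := by
    rw [← pow_add, show l + m + (l + (m + 1)) = 2 * (l + m) + 1 by ring, pow_succ, pow_mul]
    norm_num
  linear_combination (-((derivative^[m] (legendreP l)).eval 1 *
    (derivative^[m + 1] (legendreP l)).eval 1)) * h

lemma derivative_legendreP_eval (l : ℕ) : (derivative (legendreP l)).eval 1 = l * (l + 1) / 2 := by
  have := derivative_legendreP_eval_one l 0
  simp [legendreP_eval_one] at this
  linarith

/-- Integrate `(P_l P_l')'`: the term `P_l P_l''` vanishes by orthogonality to lower degrees, and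
the boundary term is `2 P_l'(1) = l(l+1)`. -/
lemma polyInt_derivative_legendreP_sq (l : ℕ) :
    polyInt (derivative (legendreP l) * derivative (legendreP l)) = l * (l + 1) := by
  have h1 := derivative_legendreP_mul_eval_sub l 0
  have h2 := polyInt_legendreP_mul_of_degree_lt (degree_derivative_legendreP_lt l 1)
  have h3 := polyInt_derivative (legendreP l * derivative (legendreP l))
  rw [derivative_mul, map_add] at h3
  simp only [Function.iterate_zero, Function.iterate_succ, Function.comp, id, zero_add] at h1 h2
  rw [h1, h2, legendreP_eval_one, derivative_legendreP_eval] at h3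
  linarith

/-- Two integrations by parts give `∫ (P_l'')² = 2 P_l'(1) P_l''(1) - 2 P_l'''(1)`. The last term is
not positive and is dropped; with `L = l(l+1)` the rest is bounded by `P_l'(1) = L/2` and `P_l''(1)
= L(L-2)/8`. -/
lemma polyInt_derivative_derivative_legendreP_sq_le (l : ℕ) :
    polyInt (derivative (derivative (legendreP l)) * derivative (derivative (legendreP l)))
      ≤ ((l : ℝ) * (l + 1)) ^ 3 / 8 := by
  have h1 := derivative_legendreP_mul_eval_sub l 1
  have h2 := polyInt_legendreP_mul_of_degree_lt (degree_derivative_legendreP_lt l 3)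
  have h3 := polyInt_derivative (derivative (legendreP l) * derivative (derivative (legendreP l)))
  have h4 := polyInt_derivative (legendreP l * derivative (derivative (derivative (legendreP l))))
  have h5 := derivative_legendreP_eval_one_nonneg l 3
  have h6 := derivative_legendreP_eval_one l 1
  have h7 := derivative_legendreP_eval_neg_one l 3
  have h8 := legendreP_eval_neg_one l
  rw [derivative_mul, map_add] at h3 h4
  simp only [Function.iterate_zero, Function.iterate_succ, Function.comp, id] at h1 h2 h5 h6 h7
  rw [eval_mul, eval_mul, h7, h8, legendreP_eval_one, h2] at h4
  rw [h1] at h3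
  rw [derivative_legendreP_eval] at h3 h6
  have h9 : ((-1 : ℝ) ^ l) * (-1) ^ (l + 3) = -1 := by
    rw [← pow_add, show l + (l + 3) = 2 * (l + 1) + 1 by ring, pow_succ, pow_mul]
    norm_num
  set a := (derivative (derivative (legendreP l))).eval 1
  set b := (derivative (derivative (derivative (legendreP l)))).eval 1
  have h10 : polyInt (derivative (legendreP l) * derivative (derivative (derivative (legendreP l))))
      = 2 * b := by
    linear_combination h4 - b * h9
  have hL : 0 ≤ (l : ℝ) * (l + 1) := by positivity
  have h11 : a ≤ ((l : ℝ) * (l + 1)) ^ 2 / 8 := by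
    push_cast at h6
    nlinarith
  have h12 := mul_le_mul_of_nonneg_left h11 hL
  nlinarith

end Kernels

/-! ### Series of twice continuously differentiable functions -/

section CTwoSeries
variable {E F : Type*} [NormedAddCommGroup E] [NormedSpace ℝ E] [NormedAddCommGroup F]
  [NormedSpace ℝ F]

lemma norm_iteratedFDerivWithin_one_eq {s : Set E} (hs : IsOpen s) {f : E → F} {f1 : E → E →L[ℝ] F}
    (h1 : ∀ x ∈ s, HasFDerivAt f (f1 x) x) {x : E} (hx : x ∈ s) :
    ‖iteratedFDerivWithin ℝ 1 f s x‖ = ‖f1 x‖ := by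
  rw [norm_iteratedFDerivWithin_one f (hs.uniqueDiffWithinAt hx), fderivWithin_of_isOpen hs hx,
    (h1 x hx).fderiv]

lemma norm_iteratedFDerivWithin_two_eq {s : Set E} (hs : IsOpen s) {f : E → F} {f1 : E → E →L[ℝ] F}
    {f2 : E → E →L[ℝ] E →L[ℝ] F} (h1 : ∀ x ∈ s, HasFDerivAt f (f1 x) x)
    (h2 : ∀ x ∈ s, HasFDerivAt f1 (f2 x) x) {x : E} (hx : x ∈ s) :
    ‖iteratedFDerivWithin ℝ 2 f s x‖ = ‖f2 x‖ := by
  have e : EqOn (fderivWithin ℝ f s) f1 s := fun y hy => by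
    rw [fderivWithin_of_isOpen hs hy, (h1 y hy).fderiv]
  rw [← norm_iteratedFDerivWithin_fderivWithin hs.uniqueDiffOn hx,
    iteratedFDerivWithin_congr e hx, norm_iteratedFDerivWithin_one_eq hs h2 hx]

/-- Termwise differentiation on an open set only, since the derivative bounds for the series below
are local in time and space. -/
lemma contDiffOn_two_tsum [CompleteSpace F] {s : Set E} (hs : IsOpen s) (hp : IsPreconnected s)
    {f : ℕ → E → F} {v : ℕ → ℝ} (hv : Summable v) (hf : ∀ n, ContDiffOn ℝ 2 (f n) s)
    (hb : ∀ k ≤ 2, ∀ n, ∀ x ∈ s, ‖iteratedFDerivWithin ℝ k (f n) s x‖ ≤ v n) :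
    ContDiffOn ℝ 2 (fun x => ∑' n, f n x) s := by
  have d1 : ∀ n, ∀ x ∈ s, HasFDerivAt (f n) (fderiv ℝ (f n) x) x := fun n x hx =>
    (((hf n).contDiffAt (hs.mem_nhds hx)).differentiableAt (by norm_num)).hasFDerivAt
  have d2 : ∀ n, ∀ x ∈ s, HasFDerivAt (fderiv ℝ (f n)) (fderiv ℝ (fderiv ℝ (f n)) x) x :=
    fun n x hx => ((((hf n).contDiffAt (hs.mem_nhds hx)).fderiv_right (m := 1)
      (by norm_num)).differentiableAt (by norm_num)).hasFDerivAt
  have b1 : ∀ n, ∀ x ∈ s, ‖fderiv ℝ (f n) x‖ ≤ v n := fun n x hx => by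
    rw [← norm_iteratedFDerivWithin_one_eq hs (d1 n) hx]; exact hb 1 (by norm_num) n x hx
  have b2 : ∀ n, ∀ x ∈ s, ‖fderiv ℝ (fderiv ℝ (f n)) x‖ ≤ v n := fun n x hx => by
    rw [← norm_iteratedFDerivWithin_two_eq hs (d1 n) (d2 n) hx]; exact hb 2 le_rfl n x hx
  have s0 : ∀ x ∈ s, Summable fun n => f n x := fun x hx => hv.of_norm_bounded fun n => by
    have := hb 0 (by norm_num) n x hx
    rwa [norm_iteratedFDerivWithin_zero] at this
  have D1 : ∀ x ∈ s, HasFDerivAt (fun y => ∑' n, f n y) (∑' n, fderiv ℝ (f n) x) x := fun x hx =>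
    hasFDerivAt_tsum_of_isPreconnected hv hs hp d1 b1 hx (s0 x hx) hx
  have D2 : ∀ x ∈ s, HasFDerivAt (fun y => ∑' n, fderiv ℝ (f n) y)
      (∑' n, fderiv ℝ (fderiv ℝ (f n)) x) x := fun x hx =>
    hasFDerivAt_tsum_of_isPreconnected hv hs hp d2 b2 hx
      (hv.of_norm_bounded fun n => b1 n x hx) hx
  have C2 : ContinuousOn (fun x => ∑' n, fderiv ℝ (fderiv ℝ (f n)) x) s := by
    refine continuousOn_tsum (f := fun n x => fderiv ℝ (fderiv ℝ (f n)) x) (fun n x hx => ContinuousAt.continuousWithinAt ?_) hv b2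
    exact ((((hf n).contDiffAt (hs.mem_nhds hx)).fderiv_right (m := 1) (by norm_num)).fderiv_right
      (m := 0) (by norm_num)).continuousAt
  rw [show (2 : WithTop ℕ∞) = 1 + 1 by norm_num, contDiffOn_succ_iff_fderiv_of_isOpen hs]
  refine ⟨fun x hx => (D1 x hx).differentiableAt.differentiableWithinAt, by simp, ?_⟩
  refine ContDiffOn.congr (f := fun x => ∑' n, fderiv ℝ (f n) x) ?_ fun x hx => (D1 x hx).fderiv
  rw [show (1 : WithTop ℕ∞) = 0 + 1 by norm_num, contDiffOn_succ_iff_fderiv_of_isOpen hs]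
  refine ⟨fun x hx => (D2 x hx).differentiableAt.differentiableWithinAt, by simp, ?_⟩
  rw [contDiffOn_zero]
  exact C2.congr fun x hx => (D2 x hx).fderiv

end CTwoSeries

section Regularity
open Polynomial

/-! ### Derivative bounds for eigenfunctions -/

/-- The polynomial extension of `proj l f` to the whole space. -/
def polyExt (l : ℕ) (f : S2 → ℝ) : E3 → ℝ := polyKernel (legendreP l) fun y => kerConst l * proj l f y

lemma polyExt_coe (l : ℕ) {f : S2 → ℝ} (hf : Continuous f) (x : S2) : polyExt l f x = proj l f x := by
  rw [(isEigen_proj l hf).reproducing x, polyExt, polyKernel, ← integral_const_mul]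
  congr 1; funext y
  rw [smul_eq_mul, zonal]; ring

/-- The exponents of the derivative bounds. -/
def growth (k : ℕ) : ℕ := if k ≤ 1 then 2 else 4

lemma contDiff_two_of_hasFDerivAt {E : Type*} [NormedAddCommGroup E] [NormedSpace ℝ E] {f : E → ℝ}
    {f1 : E → E →L[ℝ] ℝ} {f2 : E → E →L[ℝ] E →L[ℝ] ℝ} (h1 : ∀ x, HasFDerivAt f (f1 x) x)
    (h2 : ∀ x, HasFDerivAt f1 (f2 x) x) (h3 : Continuous f2) : ContDiff ℝ 2 f := by
  rw [show (2 : WithTop ℕ∞) = ((1 : ℕ) : WithTop ℕ∞) + 1 by norm_num, contDiff_succ_iff_hasFDerivAt]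
  refine ⟨f1, by simpa using contDiff_one_iff_hasFDerivAt.2 ⟨f2, h3, h2⟩, h1⟩

lemma two_pi_mul_kerConst_sq_le (l : ℕ) : 2 * Real.pi * kerConst l ^ 2 ≤ ((l : ℝ) + 1) ^ 2 := by
  have hπ := Real.pi_gt_three
  have hl : (0 : ℝ) ≤ l := Nat.cast_nonneg l
  have e : 2 * Real.pi * kerConst l ^ 2 = (2 * l + 1) ^ 2 / (8 * Real.pi) := by
    rw [kerConst]; field_simp; ring
  rw [e, div_le_iff₀ (by positivity)]
  nlinarith [mul_nonneg hl hl]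

/-- Differentiating the reproducing formula replaces `P_l` by `P_l'` and `P_l''`, whose square
integrals are at most `(l+1)²` and `(l+1)⁶`. The factor `2π ((2l+1)/(4π))²` contributes at most
another `(l+1)²`. -/
lemma polyExt_bound (l : ℕ) {f : S2 → ℝ} (hf : Continuous f) :
    ContDiff ℝ 2 (polyExt l f) ∧ ∀ k ≤ 2, ∀ x : S2, ‖iteratedFDeriv ℝ k (polyExt l f) x‖
      ≤ ((l : ℝ) + 1) ^ growth k * Real.sqrt (projSq l f) := by
  set g : S2 → ℝ := fun y => kerConst l * proj l f y with hg
  have hgc : Continuous g := continuous_const.mul (continuous_proj l hf)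
  have hk1 := continuous_kernelDeriv hgc
  have hk2 := continuous_kernelDeriv hk1
  have h1 : ∀ x, HasFDerivAt (polyExt l f) (polyKernel (derivative (legendreP l)) (kernelDeriv g) x) x :=
    fun x => hasFDerivAt_polyKernel (legendreP l) hgc x
  have h2 := fun x => hasFDerivAt_polyKernel (derivative (legendreP l)) hk1 x
  have h3 := fun x => hasFDerivAt_polyKernel (derivative (derivative (legendreP l))) hk2 x
  have hl : (0 : ℝ) ≤ l := Nat.cast_nonneg l
  have hL : (0 : ℝ) ≤ l * (l + 1) := by positivity
  have hL' : (l : ℝ) * (l + 1) ≤ (l + 1) ^ 2 := by nlinarith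
  have hp := projSq_nonneg l f
  have hc := two_pi_mul_kerConst_sq_le l
  have hgg : ∫ y, ‖g y‖ * ‖g y‖ ∂sphMeasure = kerConst l ^ 2 * projSq l f := by
    rw [projSq, ← integral_const_mul]
    congr 1; funext y
    rw [Real.norm_eq_abs, abs_mul_abs_self, hg]; ring
  -- Used with `e = 1` for the first and `e = 3` for the second derivative, which gives the
  -- exponents `2` and `4` of `growth`.
  have hb : ∀ (q : ℝ[X]) (e : ℕ), polyInt (q * q) ≤ ((l : ℝ) + 1) ^ (2 * e) → ∀ a : ℝ,
      a ^ 2 ≤ 2 * Real.pi * polyInt (q * q) * (kerConst l ^ 2 * projSq l f) →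
      a ≤ ((l : ℝ) + 1) ^ (e + 1) * Real.sqrt (projSq l f) := by
    intro q e hq a ha
    refine le_of_sq_le_sq (ha.trans ?_) (by positivity)
    rw [mul_pow, Real.sq_sqrt hp, ← pow_mul]
    calc _ = polyInt (q * q) * (2 * Real.pi * kerConst l ^ 2) * projSq l f := by ring
      _ ≤ ((l : ℝ) + 1) ^ (2 * e) * ((l : ℝ) + 1) ^ 2 * projSq l f :=
        mul_le_mul_of_nonneg_right (mul_le_mul hq hc (by positivity) (by positivity)) hp
      _ = _ := by ring
  refine ⟨contDiff_two_of_hasFDerivAt h1 h2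
    (continuous_iff_continuousAt.2 fun x => (h3 x).continuousAt), fun k hk x => ?_⟩
  rw [← iteratedFDerivWithin_univ]
  interval_cases k
  · rw [norm_iteratedFDerivWithin_zero, polyExt_coe l hf, Real.norm_eq_abs]
    refine (abs_proj_le l hf x).trans ?_
    rw [Real.sqrt_mul (kerConst_pos l).le]
    refine mul_le_mul_of_nonneg_right ?_ (Real.sqrt_nonneg _)
    rw [growth, if_pos (by norm_num), Real.sqrt_le_left (by positivity)]
    have := kerConst_le l
    have h1 : (1 : ℝ) ≤ l + 1 := by linarith
    calc kerConst l ≤ (l + 1) ^ 1 := by rw [pow_one]; exact this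
      _ ≤ (l + 1) ^ 4 := pow_le_pow_right₀ h1 (by norm_num)
      _ = _ := by ring
  · rw [norm_iteratedFDerivWithin_one_eq isOpen_univ (fun x _ => h1 x) (mem_univ _)]
    refine hb (derivative (legendreP l)) 1 ?_ _ ?_
    · rw [polyInt_derivative_legendreP_sq]; simpa using hL'
    · refine (norm_polyKernel_sq_le _ hk1 x).trans (le_of_eq ?_)
      simp_rw [norm_kernelDeriv]; rw [hgg]
  · rw [norm_iteratedFDerivWithin_two_eq isOpen_univ (fun x _ => h1 x) (fun x _ => h2 x) (mem_univ _)]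
    refine hb (derivative (derivative (legendreP l))) 3 ?_ _ ?_
    · refine (polyInt_derivative_derivative_legendreP_sq_le l).trans ?_
      have := pow_le_pow_left₀ hL hL' 3
      rw [← pow_mul] at this
      have h0 : (0 : ℝ) ≤ (l * (l + 1)) ^ 3 := by positivity
      simp only [Nat.reduceMul] at this ⊢
      linarith
    · refine (norm_polyKernel_sq_le _ hk2 x).trans (le_of_eq ?_)
      simp_rw [norm_kernelDeriv]; rw [hgg]

/-! ### Regularity of the series -/

variable {c r D ηinf : ℝ}

lemma timeF_fst_bound (hc : 0 < c) (hr : 0 < r) (hD : 0 < D) (hη : 0 < ηinf) {b : ℝ} (hb : b < ηinf) :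
    ∃ M : ℝ, 0 ≤ M ∧ ∀ (s : Set E3), IsOpen s → ∀ l : ℕ,
      ContDiffOn ℝ 2 (fun q : ℝ × E3 => timeF c r D ηinf l q.1) (Ioo (-1) b ×ˢ s) ∧
      ∀ k ≤ 2, ∀ q ∈ Ioo (-1) b ×ˢ s,
        ‖iteratedFDerivWithin ℝ k (fun q : ℝ × E3 => timeF c r D ηinf l q.1) (Ioo (-1) b ×ˢ s) q‖
          ≤ M * ((l : ℝ) + 1) ^ k := by
  obtain ⟨M, hM, hMb⟩ := exists_timeF_bound hc hr hD hη hb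
  refine ⟨M, hM, fun s hs l => ?_⟩
  have ho : IsOpen (Ioo (-1) b ×ˢ s) := isOpen_Ioo.prod hs
  have hd := fun η (h : η < ηinf) => hasDerivAt_timeF (D := D) hc hr l h
  set L : ℝ × E3 →L[ℝ] ℝ := ContinuousLinearMap.fst ℝ ℝ E3 with hL
  have hLn : ‖L‖ ≤ 1 := ContinuousLinearMap.norm_fst_le ℝ ℝ E3
  have h1 : ∀ q ∈ Ioo (-1) b ×ˢ s, HasFDerivAt (fun q : ℝ × E3 => timeF c r D ηinf l q.1)
      (timeFD c r D ηinf l q.1 • L) q := fun q hq =>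
    (hd q.1 (hq.1.2.trans hb)).1.comp_hasFDerivAt q L.hasFDerivAt
  have h2 : ∀ q ∈ Ioo (-1) b ×ˢ s, HasFDerivAt (fun q : ℝ × E3 => timeFD c r D ηinf l q.1 • L)
      ((timeFDD c r D ηinf l q.1 • L).smulRight L) q := fun q hq =>
    ((hd q.1 (hq.1.2.trans hb)).2.comp_hasFDerivAt q L.hasFDerivAt).smul_const L
  refine ⟨?_, fun k hk q hq => ?_⟩
  · have hF : ContDiffOn ℝ 2 (timeF c r D ηinf l) (Iio ηinf) := by
      rw [show (2 : WithTop ℕ∞) = 1 + 1 by norm_num, contDiffOn_succ_iff_deriv_of_isOpen isOpen_Iio]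
      refine ⟨fun η h => (hd η h).1.differentiableAt.differentiableWithinAt, by simp, ?_⟩
      refine ContDiffOn.congr (f := timeFD c r D ηinf l) ?_ fun η h => (hd η h).1.deriv
      rw [show (1 : WithTop ℕ∞) = 0 + 1 by norm_num, contDiffOn_succ_iff_deriv_of_isOpen isOpen_Iio]
      refine ⟨fun η h => (hd η h).2.differentiableAt.differentiableWithinAt, by simp, ?_⟩
      rw [contDiffOn_zero]
      refine ContinuousOn.congr (f := timeFDD c r D ηinf l) (fun η h => ?_) fun η h => (hd η h).2.deriv
      have hne : ηinf - η ≠ 0 := (sub_pos.2 h).ne'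
      unfold timeFDD
      exact (((((continuousAt_const.div (continuousAt_const.sub continuousAt_id) hne).neg).mul
        (hd η h).2.continuousAt).sub
        (continuousAt_const.mul (hd η h).1.continuousAt))).continuousWithinAt
    exact hF.comp contDiff_fst.contDiffOn fun q hq => hq.1.2.trans hb
  · interval_cases k
    · rw [norm_iteratedFDerivWithin_zero, pow_zero, mul_one]
      exact (hMb l q.1 hq.1).1
    · rw [norm_iteratedFDerivWithin_one_eq ho h1 hq, norm_smul, pow_one, Real.norm_eq_abs]
      exact (mul_le_of_le_one_right (abs_nonneg _) hLn).trans (hMb l q.1 hq.1).2.1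
    · rw [norm_iteratedFDerivWithin_two_eq ho h1 h2 hq, ContinuousLinearMap.norm_smulRight_apply,
        norm_smul, Real.norm_eq_abs]
      refine (mul_le_of_le_one_right (by positivity) hLn).trans ?_
      exact (mul_le_of_le_one_right (abs_nonneg _) hLn).trans (hMb l q.1 hq.1).2.2

/-- The normalization map on the second factor. -/
def normalizeSnd (q : ℝ × E3) : E3 := ‖q.2‖⁻¹ • q.2

lemma contDiffOn_normalizeSnd : ContDiffOn ℝ 2 normalizeSnd {q : ℝ × E3 | q.2 ≠ 0} := by
  intro q hq
  have h1 : ContDiffAt ℝ 2 (fun q : ℝ × E3 => ‖q.2‖) q := contDiffAt_snd.norm ℝ hq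
  exact ((h1.inv (norm_ne_zero_iff.2 hq)).smul contDiffAt_snd).contDiffWithinAt

/-- The ball of radius `1/2` about a unit vector stays away from the origin, and on its compact
closure the derivatives of the normalization are bounded. The form `B ^ k` is the one required by
the estimate for compositions. -/
lemma normalizeSnd_bound (b : ℝ) (x : S2) : ∃ B : ℝ, 1 ≤ B ∧
    ContDiffOn ℝ 2 normalizeSnd (Ioo (-1) b ×ˢ Metric.ball (x : E3) (1 / 2)) ∧
    (∀ q ∈ Ioo (-1) b ×ˢ Metric.ball (x : E3) (1 / 2), ∃ y : S2, normalizeSnd q = y) ∧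
    ∀ k, 1 ≤ k → k ≤ 2 → ∀ q ∈ Ioo (-1) b ×ˢ Metric.ball (x : E3) (1 / 2),
      ‖iteratedFDerivWithin ℝ k normalizeSnd (Ioo (-1) b ×ˢ Metric.ball (x : E3) (1 / 2)) q‖
        ≤ B ^ k := by
  set s := Ioo (-1) b ×ˢ Metric.ball (x : E3) (1 / 2) with hs
  set U := {q : ℝ × E3 | q.2 ≠ 0} with hU
  have hso : IsOpen s := isOpen_Ioo.prod Metric.isOpen_ball
  have hUo : IsOpen U := isOpen_ne.preimage continuous_snd
  have hK : IsCompact (Icc (-1) b ×ˢ Metric.closedBall (x : E3) (1 / 2)) :=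
    isCompact_Icc.prod (isCompact_closedBall _ _)
  have hKU : Icc (-1) b ×ˢ Metric.closedBall (x : E3) (1 / 2) ⊆ U := by
    intro q hq h0
    have := hq.2
    rw [Metric.mem_closedBall, dist_eq_norm, h0, zero_sub, norm_neg, S2_norm] at this
    norm_num at this
  have hsK : s ⊆ Icc (-1) b ×ˢ Metric.closedBall (x : E3) (1 / 2) :=
    prod_mono Ioo_subset_Icc_self Metric.ball_subset_closedBall
  have hbd : ∀ k : ℕ, k ≤ 2 → ∃ C, ∀ q ∈ s, ‖iteratedFDerivWithin ℝ k normalizeSnd s q‖ ≤ C := by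
    intro k hk
    have hcont := contDiffOn_normalizeSnd.continuousOn_iteratedFDerivWithin
      (m := k) (by exact_mod_cast hk) hUo.uniqueDiffOn
    obtain ⟨C, hC⟩ := hK.exists_bound_of_continuousOn (hcont.mono hKU)
    refine ⟨C, fun q hq => ?_⟩
    have h1 := hC q (hsK hq)
    rw [iteratedFDerivWithin_of_isOpen k hUo (hKU (hsK hq))] at h1
    rwa [iteratedFDerivWithin_of_isOpen k hso hq]
  obtain ⟨C1, hC1⟩ := hbd 1 (by norm_num)
  obtain ⟨C2, hC2⟩ := hbd 2 le_rfl
  refine ⟨max 1 (max C1 C2), le_max_left _ _, contDiffOn_normalizeSnd.mono (hsK.trans hKU),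
    fun q hq => ⟨radial q.2, (coe_radial (hKU (hsK hq))).symm⟩, fun k hk1 hk2 q hq => ?_⟩
  have h1 : max C1 C2 ≤ max 1 (max C1 C2) := le_max_right _ _
  interval_cases k
  · rw [pow_one]
    exact (hC1 q hq).trans ((le_max_left _ _).trans h1)
  · refine (hC2 q hq).trans (((le_max_right _ _).trans h1).trans ?_)
    exact le_self_pow₀ (le_max_left _ _) (by norm_num)

/-- The series solution is twice continuously differentiable if the field is smooth enough. -/
theorem contMDiffAt_series (hc : 0 < c) (hr : 0 < r) (hD : 0 < D) (hη : 0 < ηinf)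
    {f : S2 → ℝ} (hf : Continuous f)
    (hs : Summable fun l : ℕ => ((l : ℝ) + 1) ^ 4 * Real.sqrt (projSq l f)) {p : ℝ × S2}
    (hp : p.1 ∈ Ioo (-1) ηinf) : ContMDiffAt (𝓘(ℝ, ℝ).prod (𝓡 2)) 𝓘(ℝ, ℝ) 2
      (fun p : ℝ × S2 => ∑' l, timeF c r D ηinf l p.1 * proj l f p.2) p := by
  obtain ⟨b, hb1, hb2⟩ := exists_between hp.2
  obtain ⟨M, hM, hMb⟩ := timeF_fst_bound hc hr hD hη hb2
  obtain ⟨B, hB1, hNc, hNS, hNb⟩ := normalizeSnd_bound b p.2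
  set s := Ioo (-1) b ×ˢ Metric.ball (p.2 : E3) (1 / 2) with hsdef
  have hso : IsOpen s := isOpen_Ioo.prod Metric.isOpen_ball
  have hspre : IsPreconnected s := isPreconnected_Ioo.prod
    (convex_ball (p.2 : E3) (1 / 2)).isPreconnected
  have hps : (p.1, (p.2 : E3)) ∈ s := ⟨⟨hp.1, hb1⟩, Metric.mem_ball_self (by norm_num)⟩
  have hFb := hMb _ (Metric.isOpen_ball (x := (p.2 : E3)) (ε := 1 / 2))
  have hE := fun l => polyExt_bound l hf
  have hEc : ∀ l, ContDiffOn ℝ 2 (polyExt l f ∘ normalizeSnd) s := fun l =>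
    (hE l).1.comp_contDiffOn hNc
  -- Composition with the normalization lands on the sphere, where the bounds for `polyExt` hold; it
  -- costs the factor `k! B^k ≤ 2 B²`.
  have hEb : ∀ l, ∀ k ≤ 2, ∀ q ∈ s, ‖iteratedFDerivWithin ℝ k (polyExt l f ∘ normalizeSnd) s q‖
      ≤ 2 * B ^ 2 * (((l : ℝ) + 1) ^ growth k * Real.sqrt (projSq l f)) := by
    intro l k hk q hq
    obtain ⟨y, hy⟩ := hNS q hq
    have h := norm_iteratedFDerivWithin_comp_le (n := k) (N := 2) (t := univ) (hE l).1.contDiffOn hNc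
      (by exact_mod_cast hk) uniqueDiffOn_univ hso.uniqueDiffOn (mapsTo_univ _ _) hq
      (C := ((l : ℝ) + 1) ^ growth k * Real.sqrt (projSq l f)) (D := B) (fun i hi => by
        rw [iteratedFDerivWithin_univ, hy]
        refine ((hE l).2 i (hi.trans hk) y).trans
          (mul_le_mul_of_nonneg_right ?_ (Real.sqrt_nonneg _))
        refine pow_le_pow_right₀ (by linarith [(Nat.cast_nonneg l : (0 : ℝ) ≤ l)]) ?_
        unfold growth
        split_ifs <;> omega) (fun i hi1 hi2 => hNb i hi1 (hi2.trans hk) q hq)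
    refine h.trans ?_
    have h1 : (k.factorial : ℝ) ≤ 2 := by exact_mod_cast Nat.factorial_le hk
    have h2 : B ^ k ≤ B ^ 2 := pow_le_pow_right₀ hB1 hk
    have h3 : 0 ≤ ((l : ℝ) + 1) ^ growth k * Real.sqrt (projSq l f) := by positivity
    calc _ = (k.factorial : ℝ) * B ^ k * (((l : ℝ) + 1) ^ growth k * Real.sqrt (projSq l f)) := by ring
      _ ≤ _ := mul_le_mul_of_nonneg_right (mul_le_mul h1 h2 (by positivity) (by norm_num)) h3
  have hV : ContDiffOn ℝ 2 (fun q : ℝ × E3 =>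
      ∑' l, timeF c r D ηinf l q.1 * (polyExt l f ∘ normalizeSnd) q) s := by
    -- The constant is `12 = 3 · 2 · 2`: at most three terms in Leibniz' formula, binomial
    -- coefficients at most `2`, and the `2` from the composition.
    refine contDiffOn_two_tsum hso hspre
      (hs.mul_left (12 * M * B ^ 2)) (fun l => (hFb l).1.mul (hEc l)) fun k hk l q hq => ?_
    refine (norm_iteratedFDerivWithin_mul_le (hFb l).1 (hEc l) hso.uniqueDiffOn hq (n := k)
      (by exact_mod_cast hk)).trans ?_
    have hterm : ∀ i ∈ Finset.range (k + 1), (k.choose i : ℝ) *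
        ‖iteratedFDerivWithin ℝ i (fun q : ℝ × E3 => timeF c r D ηinf l q.1) s q‖ *
        ‖iteratedFDerivWithin ℝ (k - i) (polyExt l f ∘ normalizeSnd) s q‖
        ≤ 4 * M * B ^ 2 * (((l : ℝ) + 1) ^ 4 * Real.sqrt (projSq l f)) := by
      intro i hi
      have hik : i ≤ k := Nat.lt_succ_iff.1 (Finset.mem_range.1 hi)
      have h1 : (k.choose i : ℝ) ≤ 2 := by
        have : k.choose i ≤ 2 := by
          interval_cases k <;> interval_cases i <;> decide
        exact_mod_cast this
      have h2 := (hFb l).2 i (hik.trans hk) q hq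
      have h3 := hEb l (k - i) (by omega) q hq
      -- With `i` time derivatives and `k - i` space derivatives the exponent is `i + growth (k -
      -- i)`, at most `4` for `k ≤ 2`.
      have h4 : ((l : ℝ) + 1) ^ i * ((l : ℝ) + 1) ^ growth (k - i) ≤ ((l : ℝ) + 1) ^ 4 := by
        rw [← pow_add]
        refine pow_le_pow_right₀ (by linarith [(Nat.cast_nonneg l : (0 : ℝ) ≤ l)]) ?_
        unfold growth
        split_ifs <;> omega
      calc _ ≤ 2 * (M * ((l : ℝ) + 1) ^ i) *
            (2 * B ^ 2 * (((l : ℝ) + 1) ^ growth (k - i) * Real.sqrt (projSq l f))) :=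
            mul_le_mul (mul_le_mul h1 h2 (norm_nonneg _) (by norm_num)) h3 (norm_nonneg _)
              (by positivity)
        _ = 4 * M * B ^ 2 * ((((l : ℝ) + 1) ^ i * ((l : ℝ) + 1) ^ growth (k - i)) *
            Real.sqrt (projSq l f)) := by ring
        _ ≤ _ := mul_le_mul_of_nonneg_left (mul_le_mul_of_nonneg_right h4 (Real.sqrt_nonneg _))
            (by positivity)
    refine (Finset.sum_le_sum hterm).trans ?_
    rw [Finset.sum_const, Finset.card_range, nsmul_eq_mul]
    have h5 : ((k + 1 : ℕ) : ℝ) ≤ 3 := by exact_mod_cast Nat.succ_le_succ hk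
    calc _ ≤ 3 * (4 * M * B ^ 2 * (((l : ℝ) + 1) ^ 4 * Real.sqrt (projSq l f))) :=
          mul_le_mul_of_nonneg_right h5 (by positivity)
      _ = _ := by ring
  have hcoe : ContMDiff (𝓘(ℝ, ℝ).prod (𝓡 2)) 𝓘(ℝ, ℝ × E3) 2 fun p : ℝ × S2 => (p.1, (p.2 : E3)) :=
    contMDiff_fst.prodMk_space (contMDiff_coe_S2.comp contMDiff_snd)
  have h1 := (hV.contDiffAt (hso.mem_nhds hps)).contMDiffAt.comp p (hcoe p)
  refine h1.congr_of_eventuallyEq (Eventually.of_forall fun q => ?_)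
  refine tsum_congr fun l => ?_
  simp only [Function.comp]
  rw [normalizeSnd, S2_norm, inv_one, one_smul, polyExt_coe l hf]

end Regularity

section Classical
variable {c r D ηinf : ℝ}

/-! ### Derivatives of pairings -/

lemma exists_bound_slab {w : ℝ × (ℝ × ℝ) → ℝ} (hw : ContinuousOn w (Ico 0 ηinf ×ˢ univ)) {b : ℝ}
    (hb : b < ηinf) : ∃ C : ℝ, ∀ᵐ p ∂angMeasure, ∀ s ∈ Icc 0 b, ‖w (s, p)‖ ≤ C := by
  have hK : IsCompact (Icc 0 b ×ˢ (Icc (0 : ℝ) Real.pi ×ˢ Icc (0 : ℝ) (2 * Real.pi))) :=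
    isCompact_Icc.prod (isCompact_Icc.prod isCompact_Icc)
  obtain ⟨C, hC⟩ := hK.exists_bound_of_continuousOn
    (hw.mono (prod_mono (fun s hs => ⟨hs.1, hs.2.trans_lt hb⟩) (subset_univ _)))
  refine ⟨C, ?_⟩
  filter_upwards [ae_angMeasure] with p hp s hs
  exact hC (s, p) ⟨hs, ⟨hp.1.1.le, hp.1.2.le⟩, ⟨hp.2.1, hp.2.2.le⟩⟩

lemma continuous_slice {w : ℝ × (ℝ × ℝ) → ℝ} (hw : ContinuousOn w (Ico 0 ηinf ×ˢ univ)) {s : ℝ}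
    (hs : s ∈ Ico 0 ηinf) : Continuous fun p => w (s, p) :=
  hw.comp_continuous (f := fun p => (s, p)) (by fun_prop) fun _ => ⟨hs, mem_univ _⟩

lemma continuousOn_slice {w : ℝ × (ℝ × ℝ) → ℝ} (hw : ContinuousOn w (Ico 0 ηinf ×ˢ univ))
    (p : ℝ × ℝ) : ContinuousOn (fun s => w (s, p)) (Ico 0 ηinf) :=
  ContinuousOn.comp (g := w) (f := fun s => (s, p)) hw (by fun_prop) fun s hs => ⟨hs, mem_univ _⟩

lemma continuousOn_integral_slab {w : ℝ × (ℝ × ℝ) → ℝ} (hw : ContinuousOn w (Ico 0 ηinf ×ˢ univ)) :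
    ContinuousOn (fun s => ∫ p, w (s, p) ∂angMeasure) (Ico 0 ηinf) := by
  intro s0 hs0
  obtain ⟨b, hb1, hb2⟩ := exists_between hs0.2
  obtain ⟨C, hC⟩ := exists_bound_slab hw hb2
  have hev : ∀ᶠ s in 𝓝[Ico 0 ηinf] s0, s ∈ Ico 0 ηinf ∧ s ≤ b := by
    filter_upwards [self_mem_nhdsWithin, mem_nhdsWithin_of_mem_nhds (Iio_mem_nhds hb1)] with s h1 h2
    exact ⟨h1, le_of_lt h2⟩
  refine continuousWithinAt_of_dominated (F := fun s p => w (s, p)) (bound := fun _ => C)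
    ?_ ?_ (integrable_const C) (Eventually.of_forall fun p => ?_)
  · filter_upwards [hev] with s hs
    exact (continuous_slice hw hs.1).aestronglyMeasurable
  · filter_upwards [hev] with s hs
    filter_upwards [hC] with p hp
    exact hp s ⟨hs.1.1, hs.2⟩
  · exact continuousOn_slice hw p s0 hs0

/-- At interior times this is dominated differentiation under the integral. At the endpoint `0` the
one-sided derivative is obtained as the limit of the derivatives at positive times. -/
lemma hasDerivWithinAt_integral_slab {w w1 : ℝ × (ℝ × ℝ) → ℝ}
    (hw : ContinuousOn w (Ico 0 ηinf ×ˢ univ)) (hw1 : ContinuousOn w1 (Ico 0 ηinf ×ˢ univ))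
    (h : ∀ s ∈ Ico 0 ηinf, ∀ p, HasDerivWithinAt (fun s => w (s, p)) (w1 (s, p)) (Ico 0 ηinf) s)
    {s : ℝ} (hs : s ∈ Ico 0 ηinf) :
    HasDerivWithinAt (fun s => ∫ p, w (s, p) ∂angMeasure) (∫ p, w1 (s, p) ∂angMeasure)
      (Ico 0 ηinf) s := by
  have hint : ∀ s ∈ Ioo 0 ηinf, HasDerivAt (fun s => ∫ p, w (s, p) ∂angMeasure)
      (∫ p, w1 (s, p) ∂angMeasure) s := by
    intro s hs
    obtain ⟨b, hb1, hb2⟩ := exists_between hs.2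
    obtain ⟨C, hC⟩ := exists_bound_slab hw1 hb2
    have hsub : ∀ t ∈ Ioo 0 b, t ∈ Ico 0 ηinf := fun t ht => ⟨ht.1.le, ht.2.trans hb2⟩
    refine (hasDerivAt_integral_of_dominated_loc_of_deriv_le (μ := angMeasure)
      (F := fun s p => w (s, p)) (F' := fun s p => w1 (s, p)) (bound := fun _ => C)
      (Ioo_mem_nhds hs.1 hb1) ?_ ?_ ?_ ?_ (integrable_const C) ?_).2
    · filter_upwards [Ioo_mem_nhds hs.1 hb1] with t ht
      exact (continuous_slice hw (hsub t ht)).aestronglyMeasurable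
    · exact integrable_angMeasure (continuous_slice hw (Ioo_subset_Ico_self hs))
    · exact (continuous_slice hw1 (Ioo_subset_Ico_self hs)).aestronglyMeasurable
    · filter_upwards [hC] with p hp t ht
      exact hp t (Ioo_subset_Icc_self ht)
    · exact Eventually.of_forall fun p t ht =>
        (h t (hsub t ht) p).hasDerivAt (Ico_mem_nhds ht.1 (ht.2.trans hb2))
  rcases hs.1.eq_or_lt with h0 | h0
  · subst h0
    have hc0 := continuousOn_integral_slab hw
    have hc1 := continuousOn_integral_slab hw1
    have hle : 𝓝[>] (0 : ℝ) ≤ 𝓝[Ico 0 ηinf] 0 := by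
      rw [← nhdsWithin_Ioo_eq_nhdsGT hs.2]
      exact nhdsWithin_mono _ Ioo_subset_Ico_self
    refine (hasDerivWithinAt_Ici_of_tendsto_deriv (s := Ioo 0 ηinf)
      (fun t ht => (hint t ht).differentiableAt.differentiableWithinAt)
      ((hc0 0 hs).mono Ioo_subset_Ico_self) (Ioo_mem_nhdsGT hs.2) ?_).mono Ico_subset_Ici_self
    refine ((hc1 0 hs).tendsto.mono_left hle).congr' ?_
    filter_upwards [Ioo_mem_nhdsGT hs.2] with t ht
    exact (hint t ht).deriv.symm
  · exact (hint s ⟨h0, hs.2⟩).hasDerivWithinAt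

/-! ### Classical solutions -/

lemma isC2_slice {v : ℝ → S2 → ℝ} (hv : ContMDiffOn (𝓘(ℝ, ℝ).prod (𝓡 2)) 𝓘(ℝ, ℝ) 2
    (fun p : ℝ × S2 => v p.1 p.2) (Ico 0 ηinf ×ˢ univ)) {η : ℝ} (h : η ∈ Ico 0 ηinf) : IsC2 (v η) :=
  hv.comp_contMDiff (f := fun x : S2 => (η, x)) (contMDiff_const.prodMk contMDiff_id)
    fun _ => ⟨h, mem_univ _⟩

/-- Every classical solution is a weak solution. -/
theorem IsClassicalSolution.isWeakSolution (hη : 0 < ηinf) {f : S2 → ℝ} {v : ℝ → S2 → ℝ}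
    (hv : IsClassicalSolution c r D ηinf f v) : IsWeakSolution c r D ηinf f v := by
  set I := Ico 0 ηinf with hI
  set J : Set (ℝ × (ℝ × ℝ)) := I ×ˢ univ with hJ
  set w : ℝ × (ℝ × ℝ) → ℝ := fun q => v q.1 (sph q.2.1 q.2.2) with hw
  have hcomp : ContMDiff 𝓘(ℝ, ℝ × (ℝ × ℝ)) (𝓘(ℝ, ℝ).prod (𝓡 2)) 2
      fun q : ℝ × (ℝ × ℝ) => (q.1, sph q.2.1 q.2.2) :=
    (contDiff_fst.contMDiff).prodMk (contMDiff_sph.comp contDiff_snd.contMDiff)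
  have hwC : ContDiffOn ℝ 2 w J :=
    (hv.contMDiffOn.comp hcomp.contMDiffOn fun q hq => ⟨hq.1, mem_univ _⟩).contDiffOn
  have hu : UniqueDiffOn ℝ J := (uniqueDiffOn_Ico 0 ηinf).prod uniqueDiffOn_univ
  set e : ℝ × (ℝ × ℝ) := (1, 0) with he
  set w1 : ℝ × (ℝ × ℝ) → ℝ := fun q => fderivWithin ℝ w J q e with hw1
  set w2 : ℝ × (ℝ × ℝ) → ℝ := fun q => fderivWithin ℝ w1 J q e with hw2
  have hw1C : ContDiffOn ℝ 1 w1 J :=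
    (hwC.fderivWithin hu (m := 1) (by norm_num)).clm_apply contDiffOn_const
  have hw2C : ContinuousOn w2 J :=
    ((hw1C.fderivWithin hu (m := 0) (by norm_num)).clm_apply contDiffOn_const).continuousOn
  have hslice : ∀ (u : ℝ × (ℝ × ℝ) → ℝ), ContDiffOn ℝ 1 u J → ∀ s ∈ I, ∀ p,
      HasDerivWithinAt (fun s => u (s, p)) (fderivWithin ℝ u J (s, p) e) I s := by
    intro u hu1 s hs p
    have h1 := (hu1.differentiableOn (by norm_num) (s, p) ⟨hs, mem_univ _⟩).hasFDerivWithinAt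
    have h2 : HasDerivWithinAt (fun s : ℝ => (s, p)) e I s :=
      (hasDerivAt_id s).hasDerivWithinAt.prodMk (hasDerivWithinAt_const s I p)
    exact h1.comp_hasDerivWithinAt s h2 (show MapsTo (fun s : ℝ => (s, p)) I J from fun t ht => ⟨ht, mem_univ _⟩)
  have hd1 := hslice w (hwC.of_le (by norm_num))
  have hd2 := hslice w1 hw1C
  have hpt : ∀ η ∈ I, ∀ p : ℝ × ℝ, derivWithin (fun s => v s (sph p.1 p.2)) I η = w1 (η, p) ∧
      derivWithin (derivWithin (fun s => v s (sph p.1 p.2)) I) I η = w2 (η, p) := fun η h p =>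
    (contDiffOn_two_of_hasDerivWithinAt (g := fun s => v s (sph p.1 p.2))
      (g1 := fun s => w1 (s, p)) (g2 := fun s => w2 (s, p)) (fun s hs => hd1 s hs p)
      (fun s hs => hd2 s hs p) (continuousOn_slice hw2C p)).2 η h
  have hψc : ∀ ψ : S2 → ℝ, Continuous ψ → Continuous fun q : ℝ × (ℝ × ℝ) => ψ (sph q.2.1 q.2.2) :=
    fun ψ hψ => hψ.comp (continuous_sph.comp continuous_snd)
  have hpair : ∀ ψ : S2 → ℝ, Continuous ψ → ContDiffOn ℝ 2 (pairing v ψ) I ∧ ∀ η ∈ I,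
      derivWithin (pairing v ψ) I η = ∫ p, w1 (η, p) * ψ (sph p.1 p.2) ∂angMeasure ∧
      derivWithin (derivWithin (pairing v ψ) I) I η
        = ∫ p, w2 (η, p) * ψ (sph p.1 p.2) ∂angMeasure := by
    intro ψ hψ
    have c0 : ContinuousOn (fun q : ℝ × (ℝ × ℝ) => w q * ψ (sph q.2.1 q.2.2)) J :=
      hwC.continuousOn.mul (hψc ψ hψ).continuousOn
    have c1 : ContinuousOn (fun q : ℝ × (ℝ × ℝ) => w1 q * ψ (sph q.2.1 q.2.2)) J :=
      hw1C.continuousOn.mul (hψc ψ hψ).continuousOn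
    have c2 : ContinuousOn (fun q : ℝ × (ℝ × ℝ) => w2 q * ψ (sph q.2.1 q.2.2)) J :=
      hw2C.mul (hψc ψ hψ).continuousOn
    exact contDiffOn_two_of_hasDerivWithinAt (g := pairing v ψ)
      (fun s hs => hasDerivWithinAt_integral_slab c0 c1
        (fun s hs p => (hd1 s hs p).mul_const (ψ (sph p.1 p.2))) hs)
      (fun s hs => hasDerivWithinAt_integral_slab c1 c2
        (fun s hs p => (hd2 s hs p).mul_const (ψ (sph p.1 p.2))) hs)
      (continuousOn_integral_slab c2)
  refine ⟨hv.contMDiffOn.continuousOn, fun ψ hψ => (hpair ψ hψ.continuous).1, fun ψ hψ η h => ?_,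
    hv.initial, fun ψ hψ => ?_⟩
  · have hψ2 : IsC2 ψ := hψ.of_le two_le_top
    have hvη := isC2_slice hv.contMDiffOn h
    obtain ⟨e1, e2⟩ := (hpair ψ hψ.continuous).2 η h
    have hψs : Continuous fun p : ℝ × ℝ => ψ (sph p.1 p.2) := hψ.continuous.comp continuous_sph
    have i1 : Integrable (fun p => damping c D ηinf η * (w1 (η, p) * ψ (sph p.1 p.2))) angMeasure :=
      integrable_angMeasure (continuous_const.mul ((continuous_slice hw1C.continuousOn h).mul hψs))
    have i2 : Integrable (fun p => 1 / c ^ 2 * (w2 (η, p) * ψ (sph p.1 p.2))) angMeasure :=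
      integrable_angMeasure (continuous_const.mul ((continuous_slice hw2C h).mul hψs))
    have i3 : Integrable (fun p : ℝ × ℝ => 1 / r ^ 2 * (ψ (sph p.1 p.2) * lap (v η) (sph p.1 p.2)))
        angMeasure :=
      integrable_angMeasure (continuous_const.mul (hψs.mul ((continuous_lap hvη).comp continuous_sph)))
    -- Green's identity moves the Laplacian from `ψ` to the solution, so the weak expression becomes
    -- the integral of `ψ` times the pointwise equation.
    rw [e1, e2, integral_sphLap hvη.continuous hψ2, green hvη hψ2,
      integral_sphMeasure (h := fun x => ψ x * lap (v η) x)
        (hψ.continuous.mul (continuous_lap hvη)).aestronglyMeasurable,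
      ← integral_const_mul, ← integral_const_mul, ← integral_const_mul, ← integral_add i1 i2]
    refine (integral_sub (i1.add i2) i3).symm.trans ?_
    refine integral_eq_zero_of_ae ?_
    filter_upwards [ae_angMeasure] with p hp
    have h1 := hv.equation η h p.1 hp.1 p.2
    rw [(hpt η h p).1, (hpt η h p).2,
      sphLap_eq_lap hvη (Real.sin_pos_of_mem_Ioo hp.1).ne'] at h1
    simp only [Pi.add_apply, Pi.zero_apply]
    linear_combination ψ (sph p.1 p.2) * h1
  · have h0 : (0 : ℝ) ∈ I := ⟨le_rfl, hη⟩
    rw [((hpair ψ hψ.continuous).2 0 h0).1]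
    refine integral_eq_zero_of_ae (Eventually.of_forall fun p => ?_)
    have := hv.initial_deriv (sph p.1 p.2)
    rw [(hpt 0 h0 p).1] at this
    simp [this]

/-- A weak solution is classical if the initial field is smooth enough. -/
theorem IsWeakSolution.isClassicalSolution (hc : 0 < c) (hr : 0 < r) (hD : 0 < D) (hη : 0 < ηinf)
    {f : S2 → ℝ} {v : ℝ → S2 → ℝ} (hf : IsC2 f)
    (hs : Summable fun l : ℕ => ((l : ℝ) + 1) ^ 4 * Real.sqrt (projSq l f))
    (hv : IsWeakSolution c r D ηinf f v) : IsClassicalSolution c r D ηinf f v := by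
  have hfc := hf.continuous
  have hsum : ∀ η ∈ Ico 0 ηinf, ∀ x, v η x = ∑' l, timeF c r D ηinf l η * proj l f x :=
    fun η h x => ((hv.hasSum hc hr hD hη hf h x).tsum_eq).symm
  have hle : ∀ (l : ℕ) (x : S2), ((l : ℝ) + 1) ^ 2 * |proj l f x| ≤ ((l : ℝ) + 1) ^ 4 * Real.sqrt (projSq l f) := by
    intro l x
    have h1 := (polyExt_bound l hfc).2 0 (by norm_num) x
    rw [norm_iteratedFDeriv_zero, polyExt_coe l hfc, Real.norm_eq_abs, growth, if_pos (by norm_num)] at h1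
    calc _ ≤ ((l : ℝ) + 1) ^ 2 * (((l : ℝ) + 1) ^ 2 * Real.sqrt (projSq l f)) :=
          mul_le_mul_of_nonneg_left h1 (by positivity)
      _ = _ := by ring
  have hp : ∀ x, Summable fun l : ℕ => ((l : ℝ) + 1) ^ 2 * |proj l f x| := fun x =>
    Summable.of_nonneg_of_le (fun l => by positivity) (fun l => hle l x) hs
  have hivp := fun x => timeSeries_ivp hc hr hD hη (hp x) (g := fun s => v s x)
    fun η h => hsum η h x
  have hC2 : ContMDiffOn (𝓘(ℝ, ℝ).prod (𝓡 2)) 𝓘(ℝ, ℝ) 2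
      (fun p : ℝ × S2 => v p.1 p.2) (Ico 0 ηinf ×ˢ univ) := fun p hp =>
    ((contMDiffAt_series hc hr hD hη hfc hs (mem_Ioo_of_mem_Ico hp.1)).contMDiffWithinAt).congr
      (fun q hq => hsum q.1 hq.1 q.2) (hsum p.1 hp.1 p.2)
  refine ⟨hC2, fun η h θ hθ φ => ?_, hv.initial, fun x => (hivp x).2.2⟩
  have hvη := isC2_slice hC2 h
  -- Both sides are continuous and have the same projections, so no termwise application of the
  -- Laplacian is required.
  have hlap : lap (v η) = fun x => ∑' l, timeF c r D ηinf l η * (-((l : ℝ) * (l + 1)) * proj l f x) := by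
    refine eq_tsum_of_proj (b := fun l => ((l : ℝ) + 1) ^ 4 * Real.sqrt (projSq l f))
      (h := fun l x => timeF c r D ηinf l η * (-((l : ℝ) * (l + 1)) * proj l f x))
      (continuous_lap hvη)
      (fun l => ((isEigen_proj l hfc).const_mul _).const_mul _) hs (fun l x => ?_) fun l => ?_
    · refine le_trans ?_ (hle l x)
      rw [abs_mul, abs_mul, abs_neg, abs_of_nonneg (by positivity : (0 : ℝ) ≤ l * (l + 1))]
      have h1 := abs_timeF_le_one hc hr hD hη l h
      have h2 : (l : ℝ) * (l + 1) ≤ (l + 1) ^ 2 := by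
        nlinarith [(Nat.cast_nonneg l : (0 : ℝ) ≤ l)]
      calc _ ≤ 1 * (((l : ℝ) + 1) ^ 2 * |proj l f x|) :=
            mul_le_mul h1 (mul_le_mul_of_nonneg_right h2 (abs_nonneg _)) (by positivity) zero_le_one
        _ = _ := one_mul _
    · rw [proj_lap l hvη]
      funext x
      rw [hv.proj_eq hc hr hD hη l h x]
      ring
  rw [sphLap_eq_lap hvη (Real.sin_pos_of_mem_Ioo hθ).ne', hlap]
  exact (hivp (sph θ φ)).2.1 η h

end Classical

/-! ### Orthogonal series in `L²` -/

section OrthogonalSeries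

variable {α : Type*} [MeasurableSpace α] {μ : Measure α}

lemma eLpNorm_two_le {f : α → ℝ} (hf : MemLp f 2 μ) {C : ℝ} (h : ∫ a, f a * f a ∂μ ≤ C) :
    eLpNorm f 2 μ ≤ ENNReal.ofReal (Real.sqrt C) := by
  rw [hf.eLpNorm_eq_integral_rpow_norm (by norm_num) (by norm_num)]
  refine ENNReal.ofReal_le_ofReal ?_
  have h1 : ∫ a, ‖f a‖ ^ (2 : ENNReal).toReal ∂μ = ∫ a, f a * f a ∂μ := by
    refine integral_congr_ae (Eventually.of_forall fun a => ?_)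
    simp [← sq]
  rw [h1, ENNReal.toReal_ofNat, ← one_div, ← Real.sqrt_eq_rpow]
  exact Real.sqrt_le_sqrt h

lemma integral_sum_mul_self_le {X : ℕ → α → ℝ} {b : ℕ → ℝ} (hX : ∀ l, MemLp (X l) 2 μ)
    (horth : ∀ l k, l ≠ k → ∫ a, X l a * X k a ∂μ = 0) (hb : ∀ l, ∫ a, X l a * X l a ∂μ ≤ b l)
    (s : Finset ℕ) :
    ∫ a, (∑ l ∈ s, X l a) * ∑ l ∈ s, X l a ∂μ ≤ ∑ l ∈ s, b l := by
  have hint : ∀ l k, Integrable (fun a => X l a * X k a) μ := fun l k => (hX l).integrable_mul (hX k)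
  simp_rw [Finset.sum_mul_sum]
  rw [integral_finsetSum _ fun l _ => integrable_finsetSum _ fun k _ => hint l k]
  refine Finset.sum_le_sum fun l hl => ?_
  rw [integral_finsetSum _ fun k _ => hint l k, Finset.sum_eq_single_of_mem l hl
    fun k _ hk => horth l k hk.symm]
  exact hb l

/-- An almost surely convergent series of orthogonal functions with summable squared norms
converges in `L²`. -/
theorem memLp_and_tendsto_of_orthogonal {X : ℕ → α → ℝ} {Y : α → ℝ} {b : ℕ → ℝ}
    (hX : ∀ l, MemLp (X l) 2 μ)
    (horth : ∀ l k, l ≠ k → ∫ a, X l a * X k a ∂μ = 0) (hb : ∀ l, ∫ a, X l a * X l a ∂μ ≤ b l)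
    (hs : Summable b)
    (hY : ∀ᵐ a ∂μ, Tendsto (fun N => ∑ l ∈ Finset.range N, X l a) atTop (𝓝 (Y a))) :
    MemLp Y 2 μ ∧
      Tendsto (fun N => eLpNorm (fun a => Y a - ∑ l ∈ Finset.range N, X l a) 2 μ) atTop (𝓝 0) := by
  have hb0 : ∀ l, 0 ≤ b l := fun l =>
    (integral_nonneg fun a => mul_self_nonneg (X l a)).trans (hb l)
  have hS : ∀ s : Finset ℕ, MemLp (fun a => ∑ l ∈ s, X l a) 2 μ := fun s =>
    memLp_finsetSum s fun l _ => hX l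
  -- Fatou's lemma as the upper index tends to infinity: the tail is the almost sure limit of finite
  -- blocks, whose norms are controlled by orthogonality.
  have hle : ∀ M, eLpNorm (fun a => Y a - ∑ l ∈ Finset.range M, X l a) 2 μ
      ≤ ENNReal.ofReal (Real.sqrt (∑' l, b l - ∑ l ∈ Finset.range M, b l)) := by
    intro M
    refine (Lp.eLpNorm_lim_le_liminf_eLpNorm
      (f := fun N a => ∑ l ∈ Finset.range N, X l a - ∑ l ∈ Finset.range M, X l a)
      (fun N => ((hS _).sub (hS _)).1) _ ?_).trans ?_
    · filter_upwards [hY] with a ha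
      exact ha.sub_const _
    · refine liminf_le_of_frequently_le' (Eventually.frequently ?_)
      filter_upwards [eventually_ge_atTop M] with N hN
      have e : (fun a => ∑ l ∈ Finset.range N, X l a - ∑ l ∈ Finset.range M, X l a)
          = fun a => ∑ l ∈ Finset.Ico M N, X l a := by
        funext a
        rw [Finset.sum_Ico_eq_sub _ hN]
      rw [e]
      refine eLpNorm_two_le (hS _) ((integral_sum_mul_self_le hX horth hb _).trans ?_)
      rw [Finset.sum_Ico_eq_sub _ hN]
      exact sub_le_sub_right (hs.sum_le_tsum _ fun l _ => hb0 l) _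
  refine ⟨⟨aestronglyMeasurable_of_tendsto_ae _ (fun N => (hS (Finset.range N)).1) hY, ?_⟩, ?_⟩
  · have := hle 0
    simp only [Finset.range_zero, Finset.sum_empty, sub_zero] at this
    exact this.trans_lt ENNReal.ofReal_lt_top
  · refine tendsto_of_tendsto_of_tendsto_of_le_of_le tendsto_const_nhds ?_
      (fun _ => bot_le) hle
    have h1 : Tendsto (fun M => ∑' l, b l - ∑ l ∈ Finset.range M, b l) atTop (𝓝 0) := by
      have := hs.hasSum.tendsto_sum_nat.const_sub (∑' l, b l)
      rwa [sub_self] at this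
    have h2 := ENNReal.tendsto_ofReal (h1.sqrt)
    rwa [Real.sqrt_zero, ENNReal.ofReal_zero] at h2

/-- Convergence in `L²` implies convergence of the integrals against square integrable functions. -/
lemma tendsto_integral_mul_of_eLpNorm {S : ℕ → α → ℝ} {Y g : α → ℝ} (hS : ∀ N, MemLp (S N) 2 μ)
    (hY : MemLp Y 2 μ) (hg : MemLp g 2 μ)
    (h : Tendsto (fun N => eLpNorm (fun a => Y a - S N a) 2 μ) atTop (𝓝 0)) :
    Tendsto (fun N => ∫ a, S N a * g a ∂μ) atTop (𝓝 (∫ a, Y a * g a ∂μ)) := by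
  refine tendsto_integral_of_L1' _ (hY.integrable_mul hg).1
    (Eventually.of_forall fun N => (hS N).integrable_mul hg) ?_
  have hle : ∀ N, eLpNorm ((fun a => S N a * g a) - fun a => Y a * g a) 1 μ
      ≤ eLpNorm (fun a => Y a - S N a) 2 μ * eLpNorm g 2 μ := by
    intro N
    have e : ((fun a => S N a * g a) - fun a => Y a * g a) = -((fun a => Y a - S N a) • g) := by
      funext a
      change S N a * g a - Y a * g a = -((Y a - S N a) * g a)
      ring
    rw [e, eLpNorm_neg]
    exact eLpNorm_smul_le_mul_eLpNorm hg.1 (hY.sub (hS N)).1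
  refine tendsto_of_tendsto_of_tendsto_of_le_of_le tendsto_const_nhds ?_ (fun _ => bot_le) hle
  have := ENNReal.Tendsto.mul_const h (Or.inr hg.2.ne)
  rwa [zero_mul] at this

end OrthogonalSeries

/-! ### Measurable modifications -/

section Modification

variable {Ω : Type*} [MeasurableSpace Ω] {P : Measure Ω}

/-- Measurability is arranged at a countable dense set of points on a measurable set of full measure
and spreads to all points by continuity of the realizations. Off that set the field is put equal to
zero. -/
lemma exists_measurable_modification {T : S2 → Ω → ℝ} (hm : ∀ x, AEMeasurable (T x) P)
    (hC2 : ∀ᵐ ω ∂P, IsC2 fun x => T x ω) :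
    ∃ U : S2 → Ω → ℝ, Measurable (Function.uncurry U) ∧ (∀ ω, IsC2 fun x => U x ω) ∧
      ∀ᵐ ω ∂P, ∀ x, T x ω = U x ω := by
  have : Nonempty S2 := ⟨northPole⟩
  set d := TopologicalSpace.denseSeq S2 with hd
  have hae : ∀ᵐ ω ∂P, IsC2 (fun x => T x ω) ∧ ∀ k, T (d k) ω = (hm (d k)).mk _ ω :=
    hC2.and (ae_all_iff.2 fun k => (hm (d k)).ae_eq_mk)
  obtain ⟨G, hG, hGm, hGP⟩ := hae.exists_measurable_mem
  refine ⟨fun x => G.indicator (T x), ?_, fun ω => ?_, ?_⟩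
  · have hdm : ∀ k, Measurable (G.indicator (T (d k))) := by
      intro k
      have : G.indicator (T (d k)) = G.indicator ((hm (d k)).mk _) := by
        refine indicator_congr fun ω hω => (hGP ω hω).2 k
      rw [this]
      exact (hm (d k)).measurable_mk.indicator hGm
    have hcont : ∀ ω, Continuous fun x => G.indicator (T x) ω := by
      intro ω
      by_cases hω : ω ∈ G
      · simp only [indicator_of_mem hω]
        exact (hGP ω hω).1.continuous
      · simp only [indicator_of_notMem hω]
        exact continuous_const
    refine measurable_uncurry_of_continuous_of_measurable hcont fun x => ?_
    obtain ⟨z, hz, hzx⟩ := mem_closure_iff_seq_limit.1 (TopologicalSpace.denseRange_denseSeq S2 x)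
    refine measurable_of_tendsto_metrizable (f := fun n => G.indicator (T (z n))) (fun n => ?_)
      (tendsto_pi_nhds.2 fun ω => ((hcont ω).tendsto x).comp hzx)
    obtain ⟨k, hk⟩ := hz n
    rw [← hk]
    exact hdm k
  · by_cases hω : ω ∈ G
    · simp only [indicator_of_mem hω]
      exact (hGP ω hω).1
    · simp only [indicator_of_notMem hω]
      exact contMDiff_const
  · filter_upwards [hG] with ω hω x
    rw [indicator_of_mem hω]

end Modification

/-! ### Isotropic fields -/

lemma measurePreserving_rot (R : E3 ≃ₗᵢ[ℝ] E3) : MeasurePreserving (rot R) sphMeasure sphMeasure := by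
  refine ⟨(continuous_rot R).measurable, ?_⟩
  have : IsFiniteMeasure (sphMeasure.map (rot R)) :=
    Measure.isFiniteMeasure_map _ _
  refine ext_of_forall_integral_eq_of_IsFiniteMeasure fun f => ?_
  rw [integral_map (continuous_rot R).measurable.aemeasurable f.continuous.aestronglyMeasurable]
  exact integral_rot R f.continuous

variable {Ω : Type*} [MeasurableSpace Ω]

/-- A jointly measurable, centered, square integrable random field on the sphere with twice
continuously differentiable realizations and rotation invariant covariances. -/
structure IsSmoothIsotropic (T : S2 → Ω → ℝ) (P : Measure Ω) : Prop where
  measurable : Measurable (Function.uncurry T)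
  isC2 : ∀ ω, IsC2 fun x => T x ω
  memLp : ∀ x, MemLp (T x) 2 P
  integral_eq : ∀ x, ∫ ω, T x ω ∂P = 0
  integral_mul : ∀ R : E3 ≃ₗᵢ[ℝ] E3, LinearMap.det (R.toLinearEquiv : E3 →ₗ[ℝ] E3) = 1 →
    ∀ x y, ∫ ω, T (rot R x) ω * T (rot R y) ω ∂P = ∫ ω, T x ω * T y ω ∂P

/-- Everything probabilistic is reduced here to second order: the Gaussian law supplies
measurability and second moments, and isotropy is used for pairs of points only. -/
lemma exists_isSmoothIsotropic {P : Measure Ω} {T : S2 → Ω → ℝ} (hGauss : IsGaussianProcess T P)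
    (hCentered : ∀ x, ∫ ω, T x ω ∂P = 0) (hIso : IsIsotropic T P)
    (hC2 : ∀ᵐ ω ∂P, IsC2 fun x => T x ω) :
    ∃ U : S2 → Ω → ℝ, IsSmoothIsotropic U P ∧ ∀ᵐ ω ∂P, ∀ x, T x ω = U x ω := by
  obtain ⟨U, hU, hUC, hTU⟩ := exists_measurable_modification (fun x => hGauss.aemeasurable x) hC2
  have hx : ∀ x, T x =ᵐ[P] U x := fun x => hTU.mono fun ω h => h x
  refine ⟨U, ⟨hU, hUC, fun x => ?_, fun x => ?_, fun R hR x y => ?_⟩, hTU⟩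
  · exact (memLp_congr_ae (hx x)).1 (hGauss.hasGaussianLaw_eval x).memLp_two
  · rw [← hCentered x]
    exact integral_congr_ae (hx x).symm
  · have hI := hIso R hR 2 ![x, y] ![rot R x, rot R y] (by
      intro i
      fin_cases i
      · exact coe_rot R x
      · exact coe_rot R y)
    have h2 := (hI.comp (u := fun v : Fin 2 → ℝ => v 0 * v 1)
      ((measurable_pi_apply 0).mul (measurable_pi_apply 1))).integral_eq
    simp only [Function.comp_def, Matrix.cons_val_zero, Matrix.cons_val_one] at h2
    have e : ∀ x y, ∫ ω, T x ω * T y ω ∂P = ∫ ω, U x ω * U y ω ∂P := fun x y =>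
      integral_congr_ae ((hx x).mul (hx y))
    rw [← e, ← e]
    exact h2.symm

/-! ### Second order structure of the projections of an isotropic field -/

lemma proj_eq (l : ℕ) (f : S2 → ℝ) (x : S2) :
    proj l f x = kerConst l * ∫ y, f y * zonal l x y ∂sphMeasure := rfl

/-- The harmonic of order `0` is `√(kerConst l)` times the zonal function at the pole. Thus `C_l` is
read off from the variance of the projection at the pole. -/
lemma norm_coeff_zero_sq {Ω : Type*} {T : S2 → Ω → ℝ} (l : ℕ) {ω : Ω} (hT : Continuous fun x => T x ω) :
    kerConst l * ‖coeff T l 0 ω‖ ^ 2 = proj l (fun y => T y ω) northPole ^ 2 := by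
  have e : ∀ p : ℝ × ℝ, (T (sph p.1 p.2) ω : ℂ) * conj (sphY l 0 p.1 p.2)
      = ((Real.sqrt (kerConst l) * (T (sph p.1 p.2) ω * zonal l northPole (sph p.1 p.2)) : ℝ) : ℂ) := by
    intro p
    have h1 : sphY l 0 p.1 p.2
        = ((Real.sqrt (kerConst l) * zonal l northPole (sph p.1 p.2) : ℝ) : ℂ) := by
      have h2 : assocLegendre l 0 (Real.cos p.1) = (legendreP l).eval (Real.cos p.1) := by
        change assocLegendreNat l 0 _ = _
        simp [assocLegendreNat]
      have h3 : harmonicConst l 0 = Real.sqrt (kerConst l) := by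
        have : ((l.factorial : ℝ)) ≠ 0 := by positivity
        simp [harmonicConst, kerConst, this]
      rw [sphY, h2, h3, zonal_northPole]
      simp [sph]
    rw [h1, Complex.conj_ofReal]
    push_cast
    ring
  have e2 : coeff T l 0 ω = ((Real.sqrt (kerConst l)
      * ∫ y, T y ω * zonal l northPole y ∂sphMeasure : ℝ) : ℂ) := by
    rw [coeff]
    simp_rw [e]
    rw [integral_complex_ofReal, integral_const_mul,
      integral_sphMeasure (h := fun y => T y ω * zonal l northPole y)
        (hT.mul (continuous_zonal_right l _)).aestronglyMeasurable]
  rw [e2, Complex.norm_real, Real.norm_eq_abs, sq_abs, proj_eq, mul_pow, mul_pow,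
    Real.sq_sqrt (kerConst_pos l).le]
  ring

section SecondOrder

variable {Ω : Type*} [MeasurableSpace Ω] {P : Measure Ω} {T : S2 → Ω → ℝ}

namespace IsSmoothIsotropic

lemma powerSpectrum_nonneg : ∀ l, 0 ≤ powerSpectrum T P l := fun _ =>
  integral_nonneg fun _ => sq_nonneg _

lemma continuous (hT : IsSmoothIsotropic T P) (ω : Ω) : Continuous fun x => T x ω :=
  (hT.isC2 ω).continuous

lemma measurable_swap (hT : IsSmoothIsotropic T P) : Measurable fun q : Ω × S2 => T q.2 q.1 :=
  hT.measurable.comp _root_.measurable_swap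

lemma integral_self_mul_self (hT : IsSmoothIsotropic T P) (x y : S2) :
    ∫ ω, T x ω * T x ω ∂P = ∫ ω, T y ω * T y ω ∂P := by
  obtain ⟨R, hR, rfl⟩ := exists_rotation x y
  exact (hT.integral_mul R hR x x).symm

lemma integrable_mul (hT : IsSmoothIsotropic T P) (x y : S2) :
    Integrable (fun ω => T x ω * T y ω) P := (hT.memLp x).integrable_mul (hT.memLp y)

/-- The arithmetic-geometric inequality, with equal variances at all points by isotropy. The uniform
bound justifies the applications of Fubini's theorem. -/
lemma integral_abs_mul_le (hT : IsSmoothIsotropic T P) (x y : S2) :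
    ∫ ω, |T x ω * T y ω| ∂P ≤ ∫ ω, T northPole ω * T northPole ω ∂P := by
  calc ∫ ω, |T x ω * T y ω| ∂P ≤ ∫ ω, (T x ω * T x ω + T y ω * T y ω) / 2 ∂P := by
        refine integral_mono (hT.integrable_mul x y).abs
          (((hT.integrable_mul x x).add (hT.integrable_mul y y)).div_const 2) fun ω => ?_
        simp only [abs_mul]
        nlinarith [sq_nonneg (|T x ω| - |T y ω|), abs_mul_abs_self (T x ω), abs_mul_abs_self (T y ω)]
    _ = _ := by
        rw [integral_div, integral_add (hT.integrable_mul x x) (hT.integrable_mul y y),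
          hT.integral_self_mul_self x northPole, hT.integral_self_mul_self y northPole]
        ring

lemma measurable_integral_mul (hT : IsSmoothIsotropic T P) {g : S2 → ℝ} (hg : Continuous g) :
    Measurable fun ω => ∫ y, T y ω * g y ∂sphMeasure :=
  (StronglyMeasurable.integral_prod_right' (f := fun q : Ω × S2 => T q.2 q.1 * g q.2)
    (hT.measurable_swap.mul (hg.measurable.comp measurable_snd)).stronglyMeasurable).measurable

lemma measurable_proj_eval (hT : IsSmoothIsotropic T P) (l : ℕ) (x : S2) :
    Measurable fun ω => proj l (fun y => T y ω) x :=
  (hT.measurable_integral_mul (continuous_zonal_right l x)).const_mul (kerConst l)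

lemma measurable_proj (hT : IsSmoothIsotropic T P) (l : ℕ) :
    Measurable fun q : Ω × S2 => proj l (fun y => T y q.1) q.2 :=
  (measurable_uncurry_of_continuous_of_measurable (u := fun x ω => proj l (fun y => T y ω) x)
    (fun ω => continuous_proj l (hT.continuous ω)) fun x => hT.measurable_proj_eval l x).comp
    _root_.measurable_swap

variable [IsProbabilityMeasure P]

lemma integrable_prod_mul_self (hT : IsSmoothIsotropic T P) :
    Integrable (fun q : Ω × S2 => T q.2 q.1 * T q.2 q.1) (P.prod sphMeasure) := by
  rw [integrable_prod_iff' (f := fun q : Ω × S2 => T q.2 q.1 * T q.2 q.1)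
    (hT.measurable_swap.mul hT.measurable_swap).aestronglyMeasurable]
  refine ⟨Eventually.of_forall fun x => hT.integrable_mul x x, ?_⟩
  have : ∀ x, ∫ ω, ‖T x ω * T x ω‖ ∂P = ∫ ω, T northPole ω * T northPole ω ∂P := fun x => by
    rw [← hT.integral_self_mul_self x]
    exact integral_congr_ae (Eventually.of_forall fun ω => Real.norm_of_nonneg (mul_self_nonneg _))
  simp only [this]
  exact integrable_const _

lemma integrable_energy (hT : IsSmoothIsotropic T P) :
    Integrable (fun ω => ∫ x, T x ω * T x ω ∂sphMeasure) P :=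
  hT.integrable_prod_mul_self.integral_prod_left

lemma memLp_integral_mul (hT : IsSmoothIsotropic T P) {g : S2 → ℝ} (hg : Continuous g) :
    MemLp (fun ω => ∫ y, T y ω * g y ∂sphMeasure) 2 P := by
  rw [memLp_two_iff_integrable_sq (hT.measurable_integral_mul hg).aestronglyMeasurable]
  refine (hT.integrable_energy.mul_const (∫ x, g x * g x ∂sphMeasure)).mono'
    ((hT.measurable_integral_mul hg).pow_const 2).aestronglyMeasurable
    (Eventually.of_forall fun ω => ?_)
  rw [Real.norm_of_nonneg (sq_nonneg _)]
  exact sq_integral_mul_le (hT.continuous ω) hg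

lemma integral_integral_mul (hT : IsSmoothIsotropic T P) {g : S2 → ℝ} (hg : Continuous g) :
    ∫ ω, ∫ y, T y ω * g y ∂sphMeasure ∂P = 0 := by
  have h1 : MemLp (fun q : Ω × S2 => T q.2 q.1) 2 (P.prod sphMeasure) := by
    rw [memLp_two_iff_integrable_sq hT.measurable_swap.aestronglyMeasurable]
    simpa only [sq] using hT.integrable_prod_mul_self
  have h2 : MemLp (fun q : Ω × S2 => g q.2) 2 (P.prod sphMeasure) := by
    rw [memLp_two_iff_integrable_sq (f := fun q : Ω × S2 => g q.2)
      (hg.measurable.comp measurable_snd).aestronglyMeasurable]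
    exact (integrable_sphMeasure (hg.pow 2)).comp_snd P
  rw [integral_integral_swap (f := fun ω y => T y ω * g y) (h1.integrable_mul h2)]
  simp_rw [integral_mul_const, hT.integral_eq, zero_mul, integral_zero]

lemma integrable_prod_mul_mul (hT : IsSmoothIsotropic T P) {g h : S2 → ℝ} (hg : Continuous g)
    (hh : Continuous h) :
    Integrable (fun q : Ω × (S2 × S2) => T q.2.1 q.1 * T q.2.2 q.1 * (g q.2.1 * h q.2.2))
      (P.prod (sphMeasure.prod sphMeasure)) := by
  have hgh : Continuous fun z : S2 × S2 => g z.1 * h z.2 :=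
    (hg.comp continuous_fst).mul (hh.comp continuous_snd)
  have hm : Measurable fun q : Ω × (S2 × S2) => T q.2.1 q.1 * T q.2.2 q.1 * (g q.2.1 * h q.2.2) :=
    ((hT.measurable.comp ((measurable_fst.comp measurable_snd).prodMk measurable_fst)).mul
      (hT.measurable.comp ((measurable_snd.comp measurable_snd).prodMk measurable_fst))).mul
      (hgh.measurable.comp measurable_snd)
  rw [integrable_prod_iff' hm.aestronglyMeasurable]
  refine ⟨Eventually.of_forall fun z => (hT.integrable_mul z.1 z.2).mul_const (g z.1 * h z.2), ?_⟩
  obtain ⟨C, hC⟩ := isCompact_univ.exists_bound_of_continuousOn hgh.continuousOn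
  refine Integrable.mono' (integrable_const ((∫ ω, T northPole ω * T northPole ω ∂P) * C))
    (hm.norm.stronglyMeasurable.integral_prod_left').aestronglyMeasurable
    (Eventually.of_forall fun z => ?_)
  rw [Real.norm_of_nonneg (integral_nonneg fun _ => norm_nonneg _)]
  simp_rw [norm_mul (T _ _ * T _ _), integral_mul_const]
  exact mul_le_mul (hT.integral_abs_mul_le _ _) (hC z (mem_univ _)) (norm_nonneg _)
    (integral_nonneg fun _ => mul_self_nonneg _)

lemma integral_pair_eq (hT : IsSmoothIsotropic T P) {g h : S2 → ℝ} (hg : Continuous g)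
    (hh : Continuous h) :
    ∫ ω, (∫ y, T y ω * g y ∂sphMeasure) * (∫ y, T y ω * h y ∂sphMeasure) ∂P
      = ∫ z, (∫ ω, T z.1 ω * T z.2 ω ∂P) * (g z.1 * h z.2) ∂(sphMeasure.prod sphMeasure) := by
  have h1 := integral_integral_swap
    (f := fun ω (z : S2 × S2) => T z.1 ω * T z.2 ω * (g z.1 * h z.2))
    (hT.integrable_prod_mul_mul hg hh)
  simp_rw [integral_mul_const] at h1
  rw [← h1]
  congr 1
  funext ω
  rw [← integral_prod_mul]
  congr 1
  funext z
  ring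

/-- Rotation invariance of the covariances of linear functionals of the field. -/
lemma integral_pair_rot (hT : IsSmoothIsotropic T P) {g h : S2 → ℝ} (hg : Continuous g)
    (hh : Continuous h) {R : E3 ≃ₗᵢ[ℝ] E3}
    (hR : LinearMap.det (R.toLinearEquiv : E3 →ₗ[ℝ] E3) = 1) :
    ∫ ω, (∫ y, T y ω * g (rot R y) ∂sphMeasure) * (∫ y, T y ω * h (rot R y) ∂sphMeasure) ∂P
      = ∫ ω, (∫ y, T y ω * g y ∂sphMeasure) * (∫ y, T y ω * h y ∂sphMeasure) ∂P := by
  rw [hT.integral_pair_eq (g := fun y => g (rot R y)) (h := fun y => h (rot R y))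
    (hg.comp (continuous_rot R)) (hh.comp (continuous_rot R)), hT.integral_pair_eq hg hh]
  -- Rotating both variables preserves the product measure and the two-point covariances.
  have hmp := (measurePreserving_rot R).prod (measurePreserving_rot R)
  have hint := (hT.integrable_prod_mul_mul hg hh).integral_prod_right
  simp_rw [integral_mul_const] at hint
  conv_rhs => rw [← hmp.map_eq]
  rw [integral_map hmp.measurable.aemeasurable (by rw [hmp.map_eq]; exact hint.1)]
  congr 1
  funext z
  simp only [Prod.map_fst, Prod.map_snd]
  rw [hT.integral_mul R hR]

/-! #### The projections of the field -/

lemma memLp_proj (hT : IsSmoothIsotropic T P) (l : ℕ) (x : S2) :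
    MemLp (fun ω => proj l (fun y => T y ω) x) 2 P :=
  (hT.memLp_integral_mul (continuous_zonal_right l x)).const_mul (kerConst l)

lemma integral_proj (hT : IsSmoothIsotropic T P) (l : ℕ) (x : S2) :
    ∫ ω, proj l (fun y => T y ω) x ∂P = 0 := by
  simp_rw [proj_eq, integral_const_mul, hT.integral_integral_mul (continuous_zonal_right l x),
    mul_zero]

/-- The expectation is a finite combination of the harmonics of degree `l`, so nothing has to be
differentiated under it. -/
lemma isEigen_integral_proj_mul (hT : IsSmoothIsotropic T P) (l : ℕ) {Z : Ω → ℝ} (hZ : MemLp Z 2 P) :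
    IsEigen l fun x => ∫ ω, proj l (fun y => T y ω) x * Z ω ∂P := by
  have e : (fun x => ∫ ω, proj l (fun y => T y ω) x * Z ω ∂P) = fun x =>
      ∑ m ∈ Finset.Icc (-(l : ℤ)) l,
        (∫ ω, (∫ y, T y ω * realY l m y ∂sphMeasure) * Z ω ∂P) * realY l m x := by
    funext x
    have hint : ∀ m, Integrable (fun ω => (∫ y, T y ω * realY l m y ∂sphMeasure) * Z ω * realY l m x) P :=
      fun m => ((hT.memLp_integral_mul (continuous_realY l m)).integrable_mul hZ).mul_const _
    rw [Finset.sum_congr rfl fun m _ => (integral_mul_const (realY l m x) fun ω =>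
      (∫ y, T y ω * realY l m y ∂sphMeasure) * Z ω).symm, ← integral_finsetSum _ fun m _ => hint m]
    congr 1
    funext ω
    rw [proj_eq_sum l (hT.continuous ω), Finset.sum_mul]
    exact Finset.sum_congr rfl fun m _ => by ring
  rw [e]
  exact isEigen_sum l _ _ (isEigen_realY l)

lemma integral_proj_mul_rot (hT : IsSmoothIsotropic T P) (l k : ℕ) (x z : S2) {R : E3 ≃ₗᵢ[ℝ] E3}
    (hR : LinearMap.det (R.toLinearEquiv : E3 →ₗ[ℝ] E3) = 1) :
    ∫ ω, proj l (fun y => T y ω) (rot R x) * proj k (fun y => T y ω) (rot R z) ∂P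
      = ∫ ω, proj l (fun y => T y ω) x * proj k (fun y => T y ω) z ∂P := by
  have e : ∀ x z, ∫ ω, proj l (fun y => T y ω) x * proj k (fun y => T y ω) z ∂P
      = kerConst l * kerConst k * ∫ ω, (∫ y, T y ω * zonal l x y ∂sphMeasure)
        * (∫ y, T y ω * zonal k z y ∂sphMeasure) ∂P := by
    intro x z
    rw [← integral_const_mul]
    congr 1
    funext ω
    rw [proj_eq, proj_eq]
    ring
  rw [e, e, ← hT.integral_pair_rot (continuous_zonal_right l _) (continuous_zonal_right k _) hR]
  simp_rw [zonal_rot]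

lemma integral_proj_mul_eq_of_inner (hT : IsSmoothIsotropic T P) (l k : ℕ) {x z x' z' : S2}
    (h : inner ℝ (x : E3) (z : E3) = inner ℝ (x' : E3) (z' : E3)) :
    ∫ ω, proj l (fun y => T y ω) x * proj k (fun y => T y ω) z ∂P
      = ∫ ω, proj l (fun y => T y ω) x' * proj k (fun y => T y ω) z' ∂P := by
  obtain ⟨R, hR, rfl, rfl⟩ := exists_rotation_pair h
  exact (hT.integral_proj_mul_rot l k x z hR).symm

/-- In `x` the covariance is an eigenfunction of degree `l`, and by isotropy it depends on `⟨x, z⟩`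
only. -/
lemma integral_proj_mul_eq_zonal_left (hT : IsSmoothIsotropic T P) (l k : ℕ) (x z : S2) :
    ∫ ω, proj l (fun y => T y ω) x * proj k (fun y => T y ω) z ∂P
      = (∫ ω, proj l (fun y => T y ω) z * proj k (fun y => T y ω) z ∂P) * zonal l z x :=
  (hT.isEigen_integral_proj_mul l (hT.memLp_proj k z)).eq_zonal z (fun x y h =>
    hT.integral_proj_mul_eq_of_inner l k (by rw [real_inner_comm, h, real_inner_comm])) x

/-- Exchanging the two points shows that the covariance is the same multiple `a` of `P_l` and of
`P_k`. These are orthogonal for `l ≠ k`, so `a = 0`. -/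
lemma integral_proj_mul_of_ne (hT : IsSmoothIsotropic T P) {l k : ℕ} (h : l ≠ k) (x z : S2) :
    ∫ ω, proj l (fun y => T y ω) x * proj k (fun y => T y ω) z ∂P = 0 := by
  have hd : ∫ ω, proj l (fun y => T y ω) z * proj k (fun y => T y ω) z ∂P = 0 := by
    set a := ∫ ω, proj l (fun y => T y ω) z * proj k (fun y => T y ω) z ∂P with ha
    have h1 : ∀ x, a * zonal l z x = a * zonal k z x := by
      intro x
      rw [ha, ← hT.integral_proj_mul_eq_zonal_left l k x z]
      have h2 := hT.integral_proj_mul_eq_zonal_left k l z x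
      simp_rw [mul_comm (proj k _ _)] at h2
      rw [hT.integral_proj_mul_eq_of_inner l k (x' := z) (z' := x) (real_inner_comm _ _),
        hT.integral_proj_mul_eq_of_inner l k (x := z) (z := z) (x' := x) (z' := x)
          (by simp), zonal_comm]
      have h3 := hT.integral_proj_mul_eq_of_inner l k (x := z) (z := x) (x' := x) (z' := z)
        (real_inner_comm _ _)
      rw [h3, h2]
    have h2 : a * (kerConst l)⁻¹ = 0 := by
      have e1 := integral_zonal_mul_zonal l l z z
      have e2 := integral_zonal_mul_zonal k l z z
      rw [if_pos rfl, zonal_self, mul_one] at e1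
      rw [if_neg h.symm] at e2
      rw [← e1, ← mul_zero a, ← e2, ← integral_const_mul, ← integral_const_mul]
      congr 1
      funext x
      rw [← mul_assoc, ← mul_assoc, h1]
    exact (mul_eq_zero.1 h2).resolve_right (inv_ne_zero (kerConst_pos l).ne')
  rw [hT.integral_proj_mul_eq_zonal_left, hd, zero_mul]

end IsSmoothIsotropic

variable [IsProbabilityMeasure P]

namespace IsSmoothIsotropic

/-- The covariances of the projections of the field. -/
theorem integral_proj_mul_proj (hT : IsSmoothIsotropic T P) (l : ℕ) (x z : S2) :
    ∫ ω, proj l (fun y => T y ω) x * proj l (fun y => T y ω) z ∂P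
      = kerConst l * powerSpectrum T P l * zonal l x z := by
  rw [hT.integral_proj_mul_eq_zonal_left, zonal_comm,
    hT.integral_proj_mul_eq_of_inner l l (x := z) (z := z) (x' := northPole) (z' := northPole)
      (by simp), powerSpectrum, ← integral_const_mul]
  simp_rw [norm_coeff_zero_sq l (hT.continuous _), sq]

lemma integrable_prod_proj_mul_self (hT : IsSmoothIsotropic T P) (l : ℕ) :
    Integrable (fun q : Ω × S2 => proj l (fun y => T y q.1) q.2 * proj l (fun y => T y q.1) q.2)
      (P.prod sphMeasure) := by
  rw [integrable_prod_iff' (f := fun q : Ω × S2 =>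
      proj l (fun y => T y q.1) q.2 * proj l (fun y => T y q.1) q.2)
    ((hT.measurable_proj l).mul (hT.measurable_proj l)).aestronglyMeasurable]
  refine ⟨Eventually.of_forall fun x => (hT.memLp_proj l x).integrable_mul (hT.memLp_proj l x), ?_⟩
  have : ∀ x, ∫ ω, ‖proj l (fun y => T y ω) x * proj l (fun y => T y ω) x‖ ∂P
      = kerConst l * powerSpectrum T P l := fun x => by
    rw [← mul_one (_ * _), ← zonal_self l x, ← hT.integral_proj_mul_proj l x x]
    exact integral_congr_ae (Eventually.of_forall fun ω => Real.norm_of_nonneg (mul_self_nonneg _))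
  simp only [this]
  exact integrable_const _

lemma memLp_prod_proj (hT : IsSmoothIsotropic T P) (l : ℕ) :
    MemLp (fun q : Ω × S2 => proj l (fun y => T y q.1) q.2) 2 (P.prod sphMeasure) := by
  rw [memLp_two_iff_integrable_sq (hT.measurable_proj l).aestronglyMeasurable]
  simpa only [sq] using hT.integrable_prod_proj_mul_self l

lemma integrable_projSq (hT : IsSmoothIsotropic T P) (l : ℕ) :
    Integrable (fun ω => projSq l fun y => T y ω) P :=
  (hT.integrable_prod_proj_mul_self l).integral_prod_left

lemma integral_projSq (hT : IsSmoothIsotropic T P) (l : ℕ) :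
    ∫ ω, projSq l (fun y => T y ω) ∂P = (2 * l + 1) * powerSpectrum T P l := by
  simp_rw [projSq]
  rw [integral_integral_swap (f := fun ω x => proj l (fun y => T y ω) x * proj l (fun y => T y ω) x)
    (hT.integrable_prod_proj_mul_self l)]
  simp_rw [hT.integral_proj_mul_proj, zonal_self, mul_one, integral_const, sphMeasure_real_univ,
    kerConst, smul_eq_mul]
  have := Real.pi_pos
  field_simp

/-- Bessel's inequality in expectation: the partial sums are bounded by the mean energy of the
field. -/
lemma summable_powerSpectrum (hT : IsSmoothIsotropic T P) :
    Summable fun l : ℕ => (2 * (l : ℝ) + 1) * powerSpectrum T P l := by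
  refine summable_of_sum_le (c := ∫ ω, ∫ x, T x ω * T x ω ∂sphMeasure ∂P)
    (fun l => mul_nonneg (by positivity) (powerSpectrum_nonneg l)) fun s => ?_
  simp_rw [← hT.integral_projSq]
  rw [← integral_finsetSum _ fun l _ => hT.integrable_projSq l]
  exact integral_mono (integrable_finsetSum _ fun l _ => hT.integrable_projSq l)
    hT.integrable_energy fun ω => sum_projSq_le s (hT.continuous ω)

lemma summable_kerConst_mul_powerSpectrum (hT : IsSmoothIsotropic T P) :
    Summable fun l : ℕ => kerConst l * powerSpectrum T P l := by
  refine (hT.summable_powerSpectrum.mul_left (4 * Real.pi)⁻¹).congr fun l => ?_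
  rw [kerConst]; ring

end IsSmoothIsotropic

end SecondOrder

/-! ### The random solution -/

/-- Translates the complex partial sums of the statement into the real series of projections. -/
lemma partialSum_eq {Ω : Type*} {T : S2 → Ω → ℝ} (c r D ηinf : ℝ) (L : ℕ) (η : ℝ) {θ : ℝ}
    (hθ : θ ∈ Icc 0 Real.pi) (φ : ℝ) {ω : Ω} (hT : Continuous fun x => T x ω) :
    partialSum c r D ηinf T L η θ φ ω = ((∑ l ∈ Finset.range (L + 1),
      timeF c r D ηinf l η * proj l (fun x => T x ω) (sph θ φ) : ℝ) : ℂ) := by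
  rw [partialSum]
  push_cast
  refine Finset.sum_congr rfl fun l _ => ?_
  rw [← sum_coeff_mul_sphY hT l hθ φ]
  rfl

lemma measurePreserving_sph : MeasurePreserving (fun p : ℝ × ℝ => sph p.1 p.2) angMeasure sphMeasure :=
  ⟨measurable_sph, rfl⟩

lemma angMeasure_real_univ : angMeasure.real univ = 4 * Real.pi := by
  rw [← sphMeasure_real_univ, ← measurePreserving_sph.measureReal_preimage
    MeasurableSet.univ.nullMeasurableSet, preimage_univ]

lemma powerSpectrum_congr {Ω : Type*} [MeasurableSpace Ω] {P : Measure Ω} {T U : S2 → Ω → ℝ}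
    (h : ∀ᵐ ω ∂P, ∀ x, T x ω = U x ω) (l : ℕ) : powerSpectrum T P l = powerSpectrum U P l := by
  refine integral_congr_ae (h.mono fun ω hω => ?_)
  simp only [coeff, hω]

lemma integral_sum_mul {α : Type*} [MeasurableSpace α] {μ : Measure α} (s : Finset ℕ) (a : ℕ → ℝ)
    {X : ℕ → α → ℝ} {g : α → ℝ} (hX : ∀ l, MemLp (X l) 2 μ) (hg : MemLp g 2 μ) :
    ∫ ω, (∑ l ∈ s, a l * X l ω) * g ω ∂μ = ∑ l ∈ s, a l * ∫ ω, X l ω * g ω ∂μ := by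
  have hint : ∀ l, Integrable (fun ω => a l * (X l ω * g ω)) μ := fun l =>
    ((hX l).integrable_mul hg).const_mul _
  simp_rw [Finset.sum_mul, mul_assoc]
  rw [integral_finsetSum _ fun l _ => hint l]
  simp_rw [integral_const_mul]

section RandomSolution

variable {Ω : Type*} [MeasurableSpace Ω] {P : Measure Ω} {T : S2 → Ω → ℝ}
  {c r D ηinf : ℝ}

/-- The random field defined by the series is a solution. -/
lemma IsSmoothIsotropic.isWeakRandomSolution (hT : IsSmoothIsotropic T P) (hc : 0 < c) (hr : 0 < r)
    (hD : 0 < D) (hη : 0 < ηinf) : IsWeakRandomSolution c r D ηinf P T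
      fun η x ω => ∑' l, timeF c r D ηinf l η * proj l (fun y => T y ω) x := by
  refine ⟨fun η h x => Measurable.aemeasurable ?_, Eventually.of_forall fun ω =>
    isWeakSolution_of_hasSum hc hr hD hη (hT.isC2 ω) fun η _ x => rfl⟩
  refine measurable_of_tendsto_metrizable (f := fun (N : ℕ) ω => ∑ l ∈ Finset.range N,
    timeF c r D ηinf l η * proj l (fun y => T y ω) x)
    (fun N => Finset.measurable_fun_sum _ fun l _ => (hT.measurable_proj_eval l x).const_mul _) ?_
  refine tendsto_pi_nhds.2 fun ω => Summable.tendsto_sum_tsum_nat ?_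
  exact (summable_sqrt_projSq (hT.isC2 ω)).of_norm_bounded fun l =>
    abs_timeF_mul_proj_le hc hr hD hη (hT.continuous ω) l h x

variable [IsProbabilityMeasure P]

/-- The orthogonal series of a time slice at a point converges in mean square. -/
lemma IsSmoothIsotropic.memLp_and_tendsto (hT : IsSmoothIsotropic T P) (hc : 0 < c) (hr : 0 < r)
    (hD : 0 < D) (hη : 0 < ηinf) {η : ℝ} (h : η ∈ Ico 0 ηinf) (x : S2) {Y : Ω → ℝ}
    (hY : ∀ᵐ ω ∂P, HasSum (fun l => timeF c r D ηinf l η * proj l (fun x => T x ω) x) (Y ω)) :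
    MemLp Y 2 P ∧ Tendsto (fun N => eLpNorm (fun ω => Y ω - ∑ l ∈ Finset.range N,
      timeF c r D ηinf l η * proj l (fun x => T x ω) x) 2 P) atTop (𝓝 0) := by
  refine memLp_and_tendsto_of_orthogonal
    (X := fun l ω => timeF c r D ηinf l η * proj l (fun x => T x ω) x)
    (fun l => (hT.memLp_proj l x).const_mul _) (fun l k hlk => ?_) (fun l => ?_)
    hT.summable_kerConst_mul_powerSpectrum (hY.mono fun ω hω => hω.tendsto_sum_nat)
  · simp_rw [mul_mul_mul_comm, integral_const_mul, hT.integral_proj_mul_of_ne hlk, mul_zero]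
  · simp_rw [mul_mul_mul_comm, integral_const_mul, hT.integral_proj_mul_proj, zonal_self, mul_one]
    refine mul_le_of_le_one_left (mul_nonneg (kerConst_pos l).le (powerSpectrum_nonneg l)) ?_
    rw [← abs_mul_abs_self]
    exact mul_le_one₀ (abs_timeF_le_one hc hr hD hη l h) (abs_nonneg _)
      (abs_timeF_le_one hc hr hD hη l h)

/-- The covariance function of the solution. -/
theorem IsSmoothIsotropic.hasSum_covariance (hT : IsSmoothIsotropic T P) (hc : 0 < c) (hr : 0 < r)
    (hD : 0 < D) (hη : 0 < ηinf) {η η' : ℝ} (h : η ∈ Ico 0 ηinf) (h' : η' ∈ Ico 0 ηinf)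
    (x x' : S2) {Y Y' : Ω → ℝ}
    (hY : ∀ᵐ ω ∂P, HasSum (fun l => timeF c r D ηinf l η * proj l (fun x => T x ω) x) (Y ω))
    (hY' : ∀ᵐ ω ∂P, HasSum (fun l => timeF c r D ηinf l η' * proj l (fun x => T x ω) x') (Y' ω)) :
    HasSum (fun l => timeF c r D ηinf l η * timeF c r D ηinf l η' *
      (kerConst l * powerSpectrum T P l * zonal l x x')) (covariance Y Y' P) := by
  obtain ⟨m1, t1⟩ := hT.memLp_and_tendsto hc hr hD hη h x hY
  obtain ⟨m2, t2⟩ := hT.memLp_and_tendsto hc hr hD hη h' x' hY'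
  have hS : ∀ (η : ℝ) (x : S2) (N : ℕ), MemLp (fun ω => ∑ l ∈ Finset.range N,
      timeF c r D ηinf l η * proj l (fun x => T x ω) x) 2 P := fun η x N =>
    memLp_finsetSum _ fun l _ => (hT.memLp_proj l x).const_mul _
  -- The series for `Y'` is tested against one projection; orthogonality of degrees leaves a single
  -- term once `N > l`.
  have hproj : ∀ l, ∫ ω, proj l (fun x => T x ω) x * Y' ω ∂P
      = timeF c r D ηinf l η' * (kerConst l * powerSpectrum T P l * zonal l x x') := by
    intro l
    have hl := tendsto_integral_mul_of_eLpNorm (hS η' x') m2 (hT.memLp_proj l x) t2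
    have he : ∀ᶠ N in atTop, ∫ ω, (∑ k ∈ Finset.range N, timeF c r D ηinf k η' *
        proj k (fun x => T x ω) x') * proj l (fun x => T x ω) x ∂P
        = timeF c r D ηinf l η' * (kerConst l * powerSpectrum T P l * zonal l x x') := by
      filter_upwards [eventually_gt_atTop l] with N hN
      rw [integral_sum_mul _ _ (fun k => hT.memLp_proj k x') (hT.memLp_proj l x),
        Finset.sum_eq_single_of_mem l (Finset.mem_range.2 hN) fun k _ hk => by
          rw [hT.integral_proj_mul_of_ne hk, mul_zero],
        hT.integral_proj_mul_proj, zonal_comm]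
    refine Eq.trans ?_ (tendsto_nhds_unique hl (tendsto_const_nhds.congr' (he.mono fun _ e => e.symm)))
    simp_rw [mul_comm]
  have hmean : ∫ ω, Y ω ∂P = 0 := by
    have hl := tendsto_integral_mul_of_eLpNorm (hS η x) m1 (memLp_const (1 : ℝ)) t1
    simp only [mul_one] at hl
    refine tendsto_nhds_unique (hl.congr fun N => ?_) tendsto_const_nhds
    rw [integral_finsetSum _ fun l _ =>
      ((hT.memLp_proj l x).integrable (by norm_num)).const_mul (timeF c r D ηinf l η)]
    exact Finset.sum_eq_zero fun l _ => by rw [integral_const_mul, hT.integral_proj, mul_zero]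
  have hcov : covariance Y Y' P = ∫ ω, Y ω * Y' ω ∂P := by
    rw [covariance_eq_sub m1 m2, hmean, zero_mul, sub_zero]
    rfl
  have hsum : Summable fun l => timeF c r D ηinf l η * timeF c r D ηinf l η' *
      (kerConst l * powerSpectrum T P l * zonal l x x') := by
    refine hT.summable_kerConst_mul_powerSpectrum.of_norm_bounded fun l => ?_
    -- This replaces the bound `|P_l| ≤ 1`: the left side is the modulus of a covariance and the
    -- right side the common variance.
    have hz : |kerConst l * powerSpectrum T P l * zonal l x x'| ≤ kerConst l * powerSpectrum T P l := by
      rw [← hT.integral_proj_mul_proj l x x']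
      refine (abs_integral_le_integral_abs).trans ?_
      have e : ∀ z, ∫ ω, proj l (fun y => T y ω) z * proj l (fun y => T y ω) z ∂P
          = kerConst l * powerSpectrum T P l := fun z => by
        rw [hT.integral_proj_mul_proj, zonal_self, mul_one]
      have hi : ∀ z w, Integrable (fun ω => proj l (fun y => T y ω) z * proj l (fun y => T y ω) w) P :=
        fun z w => (hT.memLp_proj l z).integrable_mul (hT.memLp_proj l w)
      calc _ ≤ ∫ ω, (proj l (fun y => T y ω) x * proj l (fun y => T y ω) x
            + proj l (fun y => T y ω) x' * proj l (fun y => T y ω) x') / 2 ∂P := by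
            refine integral_mono (hi x x').abs (((hi x x).add (hi x' x')).div_const 2) fun ω => ?_
            simp only [abs_mul]
            nlinarith [sq_nonneg (|proj l (fun y => T y ω) x| - |proj l (fun y => T y ω) x'|),
              abs_mul_abs_self (proj l (fun y => T y ω) x),
              abs_mul_abs_self (proj l (fun y => T y ω) x')]
        _ = _ := by
            rw [integral_div, integral_add (hi x x) (hi x' x'), e, e]
            ring
    rw [Real.norm_eq_abs, abs_mul, abs_mul]
    refine le_of_le_of_eq (mul_le_mul (mul_le_one₀ (abs_timeF_le_one hc hr hD hη l h) (abs_nonneg _)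
      (abs_timeF_le_one hc hr hD hη l h')) hz (abs_nonneg _) zero_le_one)
      (one_mul _)
  rw [hcov, hsum.hasSum_iff_tendsto_nat]
  refine (tendsto_integral_mul_of_eLpNorm (hS η x) m1 m2 t1).congr fun N => ?_
  rw [integral_sum_mul _ _ (fun l => hT.memLp_proj l x) m2]
  simp_rw [hproj, mul_assoc]

/-- The series of the solution converges in `L²(Ω × S²)`. -/
theorem IsSmoothIsotropic.memLp_prod_and_tendsto (hT : IsSmoothIsotropic T P) (hc : 0 < c)
    (hr : 0 < r) (hD : 0 < D) (hη : 0 < ηinf) {η : ℝ} (h : η ∈ Ico 0 ηinf) {Y : Ω × (ℝ × ℝ) → ℝ}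
    (hY : ∀ᵐ q ∂(P.prod angMeasure), HasSum (fun l => timeF c r D ηinf l η *
      proj l (fun x => T x q.1) (sph q.2.1 q.2.2)) (Y q)) :
    MemLp Y 2 (P.prod angMeasure) ∧ Tendsto (fun N => eLpNorm (fun q => Y q - ∑ l ∈ Finset.range N,
      timeF c r D ηinf l η * proj l (fun x => T x q.1) (sph q.2.1 q.2.2)) 2 (P.prod angMeasure))
      atTop (𝓝 0) := by
  have hmp := (MeasurePreserving.id P).prod measurePreserving_sph
  have hm : ∀ l, MemLp (fun q : Ω × (ℝ × ℝ) => proj l (fun x => T x q.1) (sph q.2.1 q.2.2)) 2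
      (P.prod angMeasure) := fun l => (hT.memLp_prod_proj l).comp_measurePreserving hmp
  have hint : ∀ l k, ∫ q : Ω × (ℝ × ℝ), proj l (fun x => T x q.1) (sph q.2.1 q.2.2) *
      proj k (fun x => T x q.1) (sph q.2.1 q.2.2) ∂(P.prod angMeasure)
      = ∫ p : ℝ × ℝ, ∫ ω, proj l (fun x => T x ω) (sph p.1 p.2) *
        proj k (fun x => T x ω) (sph p.1 p.2) ∂P ∂angMeasure := fun l k =>
    integral_prod_symm _ ((hm l).integrable_mul (hm k))
  refine memLp_and_tendsto_of_orthogonal (X := fun l (q : Ω × (ℝ × ℝ)) =>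
      timeF c r D ηinf l η * proj l (fun x => T x q.1) (sph q.2.1 q.2.2))
    (fun l => (hm l).const_mul _) (fun l k hlk => ?_) (fun l => ?_)
    hT.summable_powerSpectrum (hY.mono fun ω hω => hω.tendsto_sum_nat)
  · simp_rw [mul_mul_mul_comm, integral_const_mul, hint, hT.integral_proj_mul_of_ne hlk,
      integral_zero, mul_zero]
  · simp_rw [mul_mul_mul_comm, integral_const_mul, hint, hT.integral_proj_mul_proj, zonal_self,
      mul_one, integral_const, angMeasure_real_univ, smul_eq_mul]
    have e : 4 * Real.pi * (kerConst l * powerSpectrum T P l) = (2 * l + 1) * powerSpectrum T P l := by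
      have := Real.pi_pos
      rw [kerConst]
      field_simp
    rw [e]
    refine mul_le_of_le_one_left (mul_nonneg (by positivity) (powerSpectrum_nonneg l)) ?_
    rw [← abs_mul_abs_self]
    exact mul_le_one₀ (abs_timeF_le_one hc hr hD hη l h) (abs_nonneg _)
      (abs_timeF_le_one hc hr hD hη l h)

/-- A summability condition on the power spectrum makes almost every realization regular. -/
lemma IsSmoothIsotropic.ae_summable (hT : IsSmoothIsotropic T P)
    (hs : Summable fun l : ℕ => powerSpectrum T P l * (l : ℝ) ^ 10 * (2 * l + 1)) :
    ∀ᵐ ω ∂P, Summable fun l : ℕ => ((l : ℝ) + 1) ^ 4 * Real.sqrt (projSq l fun x => T x ω) := by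
  have h1 : Summable fun l : ℕ => ((l : ℝ) + 1) ^ 10 * ((2 * l + 1) * powerSpectrum T P l) := by
    refine Summable.of_nonneg_of_le (fun l => mul_nonneg (by positivity)
      (mul_nonneg (by positivity) (powerSpectrum_nonneg l))) (fun l => ?_)
      ((hs.mul_left (2 ^ 10)).add hT.summable_powerSpectrum)
    have h0 : 0 ≤ (2 * (l : ℝ) + 1) * powerSpectrum T P l :=
      mul_nonneg (by positivity) (powerSpectrum_nonneg l)
    have h2 : ((l : ℝ) + 1) ^ 10 ≤ 2 ^ 10 * (l : ℝ) ^ 10 + 1 := by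
      rcases Nat.eq_zero_or_pos l with rfl | hl
      · norm_num
      · have : (1 : ℝ) ≤ l := by exact_mod_cast hl
        rw [← mul_pow]
        have h3 := pow_le_pow_left₀ (by positivity : (0 : ℝ) ≤ (l : ℝ) + 1)
          (by linarith : (l : ℝ) + 1 ≤ 2 * l) 10
        linarith
    calc _ ≤ (2 ^ 10 * (l : ℝ) ^ 10 + 1) * ((2 * l + 1) * powerSpectrum T P l) :=
          mul_le_mul_of_nonneg_right h2 h0
      _ = _ := by ring
  have hi : ∀ l : ℕ, Integrable (fun ω => ((l : ℝ) + 1) ^ 10 * projSq l fun x => T x ω) P := fun l =>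
    (hT.integrable_projSq l).const_mul _
  have h0 : ∀ (l : ℕ) (ω : Ω), 0 ≤ ((l : ℝ) + 1) ^ 10 * projSq l fun x => T x ω := fun l ω =>
    mul_nonneg (by positivity) (projSq_nonneg _ _)
  -- By Tonelli the expectation of the series is finite, hence the series is finite almost surely.
  have hfin : ∫⁻ ω, ∑' l : ℕ, ENNReal.ofReal (((l : ℝ) + 1) ^ 10 * projSq l fun x => T x ω) ∂P ≠ ⊤ := by
    rw [lintegral_tsum fun l => (hi l).1.aemeasurable.ennreal_ofReal]
    have : ∀ l : ℕ, ∫⁻ ω, ENNReal.ofReal (((l : ℝ) + 1) ^ 10 * projSq l fun x => T x ω) ∂P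
        = ENNReal.ofReal (((l : ℝ) + 1) ^ 10 * ((2 * l + 1) * powerSpectrum T P l)) := fun l => by
      rw [← ofReal_integral_eq_lintegral_ofReal (hi l) (Eventually.of_forall (h0 l)),
        integral_const_mul, hT.integral_projSq]
    simp_rw [this]
    exact h1.tsum_ofReal_ne_top
  filter_upwards [ae_lt_top' (AEMeasurable.tsum fun l =>
    (hi l).1.aemeasurable.ennreal_ofReal) hfin] with ω hω
  have h2 : Summable fun l : ℕ => ((l : ℝ) + 1) ^ 10 * projSq l fun x => T x ω := by
    have := ENNReal.summable_toReal hω.ne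
    simpa only [ENNReal.toReal_ofReal (h0 _ ω)] using this
  refine Summable.of_nonneg_of_le (fun l => by positivity) (fun l => ?_) (summable_inv_sq.add h2)
  have hl : (0 : ℝ) < (l : ℝ) + 1 := by positivity
  -- The weight `(l+1)^6` splits `(l+1)^4 ‖T_l‖` into `(l+1)^(-2)` and `(l+1)^10 ‖T_l‖²`; the
  -- exponent `10` of the hypothesis comes from here.
  have h3 := sqrt_le_of_weight zero_le_one (projSq_nonneg l fun x => T x ω)
    (w := ((l : ℝ) + 1) ^ 6) (by positivity)
  rw [one_mul] at h3
  calc _ ≤ ((l : ℝ) + 1) ^ 4 * (1 * (((l : ℝ) + 1) ^ 6)⁻¹ + ((l : ℝ) + 1) ^ 6 * projSq l fun x => T x ω) :=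
        mul_le_mul_of_nonneg_left h3 (by positivity)
    _ = _ := by
        field_simp

end RandomSolution

end ExpandingSphere

end

/-! ### The main theorem -/

theorem theorem2 {Ω : Type*} [MeasurableSpace Ω] (P : Measure Ω) [IsProbabilityMeasure P]
    (c r D ηinf : ℝ) (hc : 0 < c) (hr : 0 < r) (hD : 0 < D) (hη : 0 < ηinf)
    (T : ExpandingSphere.S2 → Ω → ℝ)
    (hGauss : IsGaussianProcess T P)
    (hCentered : ∀ x, ∫ ω, T x ω ∂P = 0)
    (hIso : ExpandingSphere.IsIsotropic T P)
    (hC2 : ∀ᵐ ω ∂P, ContMDiff (𝓡 2) 𝓘(ℝ, ℝ) 2 (fun x => T x ω)) :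
    (∃ u : ℝ → ExpandingSphere.S2 → Ω → ℝ,
      ExpandingSphere.IsWeakRandomSolution c r D ηinf P T u) ∧
    (∀ u : ℝ → ExpandingSphere.S2 → Ω → ℝ,
      ExpandingSphere.IsWeakRandomSolution c r D ηinf P T u →
      -- the series converges to the solution in the space of square integrable fields
      (∀ η ∈ Ico 0 ηinf,
        MemLp (fun q : Ω × (ℝ × ℝ) => u η (ExpandingSphere.sph q.2.1 q.2.2) q.1) 2
          (P.prod ExpandingSphere.angMeasure) ∧
        Tendsto (fun L : ℕ =>
            eLpNorm (fun q : Ω × (ℝ × ℝ) =>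
              (u η (ExpandingSphere.sph q.2.1 q.2.2) q.1 : ℂ)
                - ExpandingSphere.partialSum c r D ηinf T L η q.2.1 q.2.2 q.1) 2
              (P.prod ExpandingSphere.angMeasure))
          atTop (𝓝 0)) ∧
      -- it also converges almost surely
      (∀ᵐ ω ∂P, ∀ η ∈ Ico 0 ηinf, ∀ θ ∈ Icc 0 Real.pi, ∀ φ : ℝ,
        Tendsto (fun L : ℕ => ExpandingSphere.partialSum c r D ηinf T L η θ φ ω)
          atTop (𝓝 (u η (ExpandingSphere.sph θ φ) ω : ℂ))) ∧
      -- the covariance function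
      (∀ η ∈ Ico 0 ηinf, ∀ x, MemLp (u η x) 2 P) ∧
      (∀ η ∈ Ico 0 ηinf, ∀ η' ∈ Ico 0 ηinf, ∀ x x' : ExpandingSphere.S2,
        HasSum (fun l : ℕ => (4 * Real.pi)⁻¹ *
            (ExpandingSphere.powerSpectrum T P l * (2 * l + 1)
              * ExpandingSphere.timeF c r D ηinf l η * ExpandingSphere.timeF c r D ηinf l η'
              * (ExpandingSphere.legendreP l).eval
                  (Real.cos (InnerProductGeometry.angle
                    (x : ExpandingSphere.E3) (x' : ExpandingSphere.E3)))))
          (covariance (u η x) (u η' x') P))) ∧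
    -- classical solutions are solutions, and conversely for a smooth enough initial field
    (∀ u : ℝ → ExpandingSphere.S2 → Ω → ℝ,
      (ExpandingSphere.IsClassicalRandomSolution c r D ηinf P T u →
        ExpandingSphere.IsWeakRandomSolution c r D ηinf P T u) ∧
      (Summable (fun l : ℕ =>
          ExpandingSphere.powerSpectrum T P l * (l : ℝ) ^ 10 * (2 * l + 1)) →
        ExpandingSphere.IsWeakRandomSolution c r D ηinf P T u →
        ExpandingSphere.IsClassicalRandomSolution c r D ηinf P T u)) := by
  -- Almost surely the realizations of `T` and `U` coincide at all points simultaneously, so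
  -- coefficients, power spectrum and solutions may be computed from `U`.
  obtain ⟨U, hU, hTU⟩ := ExpandingSphere.exists_isSmoothIsotropic hGauss hCentered hIso hC2
  have hpath : ∀ᵐ ω ∂P, (fun x => T x ω) = fun x => U x ω := hTU.mono fun ω h => funext h
  have hsum : ∀ u : ℝ → ExpandingSphere.S2 → Ω → ℝ,
      ExpandingSphere.IsWeakRandomSolution c r D ηinf P T u →
      ∀ᵐ ω ∂P, ∀ η ∈ Ico 0 ηinf, ∀ x, HasSum (fun l =>
        ExpandingSphere.timeF c r D ηinf l η * ExpandingSphere.proj l (fun x => U x ω) x) (u η x ω) := by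
    intro u hu
    filter_upwards [hu.2, hpath] with ω hω hp η h x
    rw [hp] at hω
    exact hω.hasSum hc hr hD hη (hU.isC2 ω) h x
  have hpart : ∀ᵐ ω ∂P, ∀ (L : ℕ) (η : ℝ), ∀ θ ∈ Icc 0 Real.pi, ∀ φ : ℝ,
      ExpandingSphere.partialSum c r D ηinf T L η θ φ ω = ((∑ l ∈ Finset.range (L + 1),
        ExpandingSphere.timeF c r D ηinf l η *
          ExpandingSphere.proj l (fun x => U x ω) (ExpandingSphere.sph θ φ) : ℝ) : ℂ) := by
    filter_upwards [hpath] with ω hp L η θ hθ φ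
    have h1 : Continuous fun x => T x ω := by
      rw [hp]
      exact hU.continuous ω
    rw [ExpandingSphere.partialSum_eq c r D ηinf L η hθ φ h1, hp]
  refine ⟨⟨_, (hU.isWeakRandomSolution hc hr hD hη).1, ?_⟩,
    fun u hu => ⟨fun η h => ?_, ?_, fun η h x => ?_, fun η h η' h' x x' => ?_⟩,
    fun u => ⟨fun hu => ⟨hu.1, ?_⟩, fun hs hu => ⟨hu.1, ?_⟩⟩⟩
  · filter_upwards [(hU.isWeakRandomSolution hc hr hD hη).2, hpath] with ω hω hp
    rwa [hp]
  · have hq : ∀ᵐ q ∂(P.prod ExpandingSphere.angMeasure), ∀ x, HasSum (fun l =>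
        ExpandingSphere.timeF c r D ηinf l η * ExpandingSphere.proj l (fun x => U x q.1) x)
        (u η x q.1) :=
      Measure.quasiMeasurePreserving_fst.ae ((hsum u hu).mono fun ω hω => hω η h)
    obtain ⟨h1, h2⟩ := hU.memLp_prod_and_tendsto hc hr hD hη h
      (Y := fun q => u η (ExpandingSphere.sph q.2.1 q.2.2) q.1)
      (hq.mono fun q hq => hq (ExpandingSphere.sph q.2.1 q.2.2))
    -- The partial sum with index `L` has the `L + 1` terms `l ≤ L`, hence the shift.
    refine ⟨h1, (h2.comp (tendsto_add_atTop_nat 1)).congr fun L => ?_⟩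
    refine eLpNorm_congr_norm_ae ?_
    -- The formula for the partial sums needs `θ ∈ [0, π]`, which holds almost everywhere for the
    -- angular measure.
    filter_upwards [Measure.quasiMeasurePreserving_fst.ae hpart,
      Measure.quasiMeasurePreserving_snd.ae ExpandingSphere.ae_angMeasure] with q hq1 hq2
    rw [hq1 L η q.2.1 (Ioo_subset_Icc_self hq2.1) q.2.2, ← Complex.ofReal_sub, Complex.norm_real]
  · filter_upwards [hsum u hu, hpart] with ω h1 h2 η h θ hθ φ
    simp_rw [h2 _ η θ hθ φ]
    exact (Complex.continuous_ofReal.tendsto _).comp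
      ((h1 η h (ExpandingSphere.sph θ φ)).tendsto_sum_nat.comp (tendsto_add_atTop_nat 1))
  · exact (hU.memLp_and_tendsto hc hr hD hη h x ((hsum u hu).mono fun ω hω => hω η h x)).1
  · refine (hU.hasSum_covariance hc hr hD hη h h' x x' ((hsum u hu).mono fun ω hω => hω η h x)
      ((hsum u hu).mono fun ω hω => hω η' h' x')).congr_fun fun l => ?_
    rw [InnerProductGeometry.cos_angle, ExpandingSphere.S2_norm, ExpandingSphere.S2_norm, mul_one,
      div_one, ExpandingSphere.powerSpectrum_congr hTU, ExpandingSphere.zonal,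
      ExpandingSphere.kerConst]
    ring
  · exact hu.2.mono fun ω hω => hω.isWeakSolution hη
  · have hs' : Summable fun l : ℕ =>
        ExpandingSphere.powerSpectrum U P l * (l : ℝ) ^ 10 * (2 * l + 1) :=
      hs.congr fun l => by rw [ExpandingSphere.powerSpectrum_congr hTU]
    filter_upwards [hu.2, hpath, hU.ae_summable hs'] with ω hω hp h1
    rw [hp] at hω ⊢
    exact hω.isClassicalSolution hc hr hD hη (hU.isC2 ω) h1
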